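/- Conventions. $\mathbb S^n\subset\mathbb R^{n+1}$ is the unit sphere, $V_{n-1}$ is $(n-1)$-dimensional volume ("area"). A set $X\subset\mathbb S^n$ is convex if for any two non-antipodal points of $X$ the minor great-circle arc joining them lies in $X$. A convex $k$-cell is a finite intersection of closed half-spheres that spans a great $k$-sphere and is not a great sphere itself. A nondegenerate convex $n$-dimensional polyhedral complex in $\mathbb S^n$ is a convex $n$-cell (the body) whose boundary is subdivided into convex cells of dimensions $0,\dots,n-1$: the relative boundary of each cell is the union of its proper faces, and distinct faces have disjoint relative interiors; adjacent cells may span the same great sphere. A convex $n$-dimensional polyhedral complex is such a complex, or a limiting position (all faces converging in the Hausdorff metric, with the same face poset) in which all proper faces are still convex cells, of unchanged dimensions, subdivided by their faces; the body may become flat, that is, a doubly covered convex $(n-1)$-cell. Facets are the $(n-1)$-faces. The dihedral angle of a face $G$ at a face $E$ of codimension two in $G$ is the interior angle between the two facets of $G$ that meet at $E$; for a flat $G$ it is $0$ if these facets lie on the same side of $E$, and $\pi$ if they lie on opposite sides. A nondegenerate simplex in $\mathbb S^n$ is the set of points with nonnegative coordinates with respect to some basis of $\mathbb R^{n+1}$,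 with its usual faces; a (combinatorial) simplex is a nondegenerate simplex or a limiting position of nondegenerate simplices, together with its faces. Proposition. (i) Let $n\ge 2$ and $m\ge 3$ be integers, and let $S_m\ge\dots\ge S_1>0$ satisfy $S_m\le S_1+\dots+S_{m-1}$ and $S_1+\dots+S_m\le V_{n-1}(\mathbb S^{n-1})$. Then there exists a convex $n$-dimensional polyhedral complex in $\mathbb S^n$ that lies in a closed half-sphere and has exactly $m$ facets, with areas $S_1,\dots,S_m$. Each of its facets has exactly two $(n-2)$-faces. If $S_m<S_1+\dots+S_{m-1}$, the complex is nondegenerate. If both $S_m<S_1+\dots+S_{m-1}$ and $S_1+\dots+S_m<V_{n-1}(\mathbb S^{n-1})$, then all its dihedral angles are less than $\pi$. (ii) Let $n\ge 2$ and let $S_{n+1}\ge\dots\ge S_1>0$ satisfy $S_{n+1}\le S_1+\dots+S_n$ and $S_1+\dots+S_{n+1}\le V_{n-1}(\mathbb S^{n-1})$. Then there exists a convex polyhedral complex in $\mathbb S^n$, lying in a closed half-sphere, that is a combinatorial $n$-simplex with facet areas $S_1,\dots,S_{n+1}$. All its faces of every dimension, including the complex itself, are convex and have all their dihedral angles at most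 $\pi$. If $n\ge 3$, some of these dihedral angles are equal to $\pi$. -/

import Mathlib

open Set Filter Topology MeasureTheory

noncomputable section

namespace SphericalComplex

/-- Euclidean space `ℝⁿ⁺¹`, whose unit sphere is `𝕊ⁿ`. -/
abbrev Space (n : ℕ) : Type := EuclideanSpace ℝ (Fin (n + 1))

/-- The sphere `𝕊ⁿ`. -/
def unitSphere (n : ℕ) : Set (Space n) := Metric.sphere 0 1

/-- `V_{n-1}(𝕊ⁿ⁻¹)`: the surface measure of the unit sphere of `ℝⁿ`. -/
def sphereVolume (n : ℕ) : ℝ :=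
  (volume : Measure (EuclideanSpace ℝ (Fin n))).toSphere.real univ

/-- The intrinsic volume of a subset `C` of the sphere, in the dimension of `C`: its surface measure
in the unit sphere of the linear span of `C`. The measure on the span is Lebesgue measure,
normalised so that the unit cube of an orthonormal basis has measure one. -/
def area {n : ℕ} (C : Set (Space n)) : ℝ :=
  ((stdOrthonormalBasis ℝ (Submodule.span ℝ C)).toBasis.addHaar).toSphere.real
    {x | ((x : Submodule.span ℝ C) : Space n) ∈ C}

/-- Spherical convexity: with any two non-antipodal points, the minor great-circle arc between
them belongs to the set. -/
def SphConvex {n : ℕ} (X : Set (Space n)) : Prop :=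
  ∀ x ∈ X, ∀ y ∈ X, y ≠ -x → ∀ a b : ℝ, 0 ≤ a → 0 ≤ b →
    a • x + b • y ∈ unitSphere n → a • x + b • y ∈ X

/-- `X` lies in some closed half-sphere. -/
def InClosedHemisphere {n : ℕ} (X : Set (Space n)) : Prop :=
  ∃ e ∈ unitSphere n, ∀ x ∈ X, 0 ≤ inner ℝ e x

/-- A convex polyhedral `k`-cell of `𝕊ⁿ`: a finite intersection of closed half-spheres (and
possibly great hyperspheres, as intersections of two opposite half-spheres) that spans a great
`k`-sphere and is not a whole great sphere. Equivalently, a convex spherical polytope that is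
homeomorphic to a closed `k`-ball. -/
def IsCell {n : ℕ} (k : ℕ) (C : Set (Space n)) : Prop :=
  (∃ A : Finset (Space n), C = {x | x ∈ unitSphere n ∧ ∀ a ∈ A, 0 ≤ inner ℝ a x}) ∧
  Module.finrank ℝ (Submodule.span ℝ C) = k + 1 ∧
  ∃ x ∈ C, -x ∉ C

/-- The interior of `C` relative to the great sphere spanned by `C`. -/
def relInt {n : ℕ} (C : Set (Space n)) : Set (Space n) :=
  {x ∈ C | ∀ᶠ z in 𝓝[unitSphere n ∩ (Submodule.span ℝ C : Set (Space n))] x, z ∈ C}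

/-- The boundary of the closed set `C` relative to the great sphere spanned by `C`. -/
def relBdry {n : ℕ} (C : Set (Space n)) : Set (Space n) := C \ relInt C

/-- The combinatorial data of an `n`-dimensional complex: the finite partially ordered set of its
(nonempty) faces with their dimensions. The greatest face, `body`, is the complex itself. -/
structure FacePoset (n : ℕ) where
  Face : Type
  [finite : Finite Face]
  [order : PartialOrder Face]
  body : Face
  le_body : ∀ F, F ≤ body
  dim : Face → ℕ
  dim_strictMono : StrictMono dim
  dim_body : dim body = n

attribute [instance] FacePoset.finite FacePoset.order

/-- The face `G` is realised as a convex polyhedral cell of the correct dimension, whose boundary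
is subdivided by the proper faces of `G`. -/
structure IsSubdividedCell {n : ℕ} (P : FacePoset n) (c : P.Face → Set (Space n))
    (G : P.Face) : Prop where
  cell : IsCell (P.dim G) (c G)
  bdry : relBdry (c G) = ⋃ F ∈ {F : P.Face | F < G}, c F
  disj : ∀ F F' : P.Face, F ≤ G → F' ≤ G → F ≠ F' → Disjoint (relInt (c F)) (relInt (c F'))

/-- A nondegenerate convex `n`-dimensional polyhedral complex in `𝕊ⁿ`: a convex polyhedral `n`-cell
whose boundary is subdivided into convex polyhedral cells. (Adjacent cells may span
the same great sphere.) -/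
def IsNondegenerateComplex {n : ℕ} (P : FacePoset n) (c : P.Face → Set (Space n)) : Prop :=
  ∀ G : P.Face, IsSubdividedCell P c G

/-- Convergence of all faces in the Hausdorff metric. -/
def FacesTendsto {ι : Type} {n : ℕ} (u : ℕ → ι → Set (Space n)) (c : ι → Set (Space n)) : Prop :=
  ∀ F : ι, Tendsto (fun k => Metric.hausdorffEDist (u k F) (c F)) atTop (𝓝 0)

/-- A convex `n`-dimensional polyhedral complex in `𝕊ⁿ`: a nondegenerate one, or a limiting position
of nondegenerate ones with the same face poset. All proper faces keep their dimensions;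
only the `n`-dimensional body itself may become flat, in which case its boundary covers an
`(n-1)`-cell twice. -/
structure IsConvexComplex {n : ℕ} (P : FacePoset n) (c : P.Face → Set (Space n)) : Prop where
  proper : ∀ G : P.Face, G ≠ P.body → IsSubdividedCell P c G
  body : ∃ d : ℕ, (d = n ∨ d + 1 = n) ∧ IsCell d (c P.body)
  limit : ∃ u : ℕ → P.Face → Set (Space n),
    (∀ k, IsNondegenerateComplex P (u k)) ∧ FacesTendsto u c

/-- The facets are the `(n-1)`-faces; `S` lists their areas. -/
def HasFacetAreas {n m : ℕ} (P : FacePoset n) (c : P.Face → Set (Space n))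
    (S : Fin m → ℝ) : Prop :=
  ∃ e : Fin m ≃ {F : P.Face // P.dim F + 1 = n}, ∀ i, area (c (e i)) = S i

/-- Near every relative interior point of `E`, the set `X` coincides with the join of the great
sphere spanned by `E` with the circular arc of the directions `cos φ • u + sin φ • w`,
`α ≤ φ ≤ β`. -/
def LocallyWedge {n : ℕ} (X E : Set (Space n)) (u w : Space n) (α β : ℝ) : Prop :=
  ∀ x ∈ relInt E, ∀ᶠ z in 𝓝[unitSphere n] x,
    z ∈ X ↔ ∃ y ∈ Submodule.span ℝ E, ∃ r φ : ℝ, 0 ≤ r ∧ α ≤ φ ∧ φ ≤ β ∧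
      z = y + r • (Real.cos φ • u + Real.sin φ • w)

/-- `θ` is the interior dihedral angle of `G` at its codimension-two face `E`, between the facets
`F` and `F'` of `G` that meet at `E`: in the normal directions of `E`, the set `G` sweeps the arc
of length `θ` from `F` to `F'`. A flat (doubly covered) `G`, spanning the same
great sphere as `F`, has by this description the angle `0` where `F` and `F'` lie on
the same side of `E`; where they lie on opposite sides of `E`, its angle is `π`. -/
def IsDihedralAngle {n : ℕ} (G E F F' : Set (Space n)) (θ : ℝ) : Prop :=
  0 ≤ θ ∧ θ ≤ 2 * Real.pi ∧ ∃ u w : Space n,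
    ‖u‖ = 1 ∧ ‖w‖ = 1 ∧ inner ℝ u w = 0 ∧
    (∀ y ∈ E, inner ℝ u y = 0 ∧ inner ℝ w y = 0) ∧
    LocallyWedge F E u w 0 0 ∧ LocallyWedge F' E u w θ θ ∧
    (LocallyWedge G E u w 0 θ ∨
      (Submodule.span ℝ G = Submodule.span ℝ F ∧ θ = Real.pi))

/-- `F` and `F'` are the two distinct facets of `G` at its codimension-two face `E`. -/
def MeetAt {n : ℕ} (P : FacePoset n) (G E F F' : P.Face) : Prop :=
  P.dim E + 2 = P.dim G ∧ P.dim F + 1 = P.dim G ∧ P.dim F' + 1 = P.dim G ∧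
    F ≠ F' ∧ E < F ∧ E < F' ∧ F < G ∧ F' < G

/-- The face poset of the combinatorial `n`-simplex: the nonempty sets of its `n+1` vertices. -/
def simplexPoset (n : ℕ) : FacePoset n where
  Face := {A : Finset (Fin (n + 1)) // A.Nonempty}
  body := ⟨Finset.univ, Finset.univ_nonempty⟩
  le_body F := Finset.subset_univ F.1
  dim A := A.1.card - 1
  dim_strictMono A B h := by
    have h1 := Finset.card_lt_card (show A.1 ⊂ B.1 from h)
    have h2 := A.2.card_pos
    show A.1.card - 1 < B.1.card - 1
    omega
  dim_body := by simp

/-- The face with vertex set `A` of the simplex in `𝕊ⁿ` with vertex directions `v`: the points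
that have nonnegative coordinates with respect to `v`, and zero coordinates outside `A`. -/
def simplexFace {n : ℕ} (v : Fin (n + 1) → Space n) (A : Finset (Fin (n + 1))) : Set (Space n) :=
  {x | x ∈ unitSphere n ∧ ∃ t : Fin (n + 1) → ℝ,
    (∀ i, 0 ≤ t i) ∧ (∀ i ∉ A, t i = 0) ∧ x = ∑ i, t i • v i}

/-- A simplex in `𝕊ⁿ`, with its faces: a limiting position (possibly constant) of nondegenerate
simplices. -/
def IsSimplex {n : ℕ} (c : (simplexPoset n).Face → Set (Space n)) : Prop :=
  ∃ v : ℕ → Fin (n + 1) → Space n, (∀ k, LinearIndependent ℝ (v k)) ∧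
    FacesTendsto (fun k (A : (simplexPoset n).Face) => simplexFace (v k) A.1) c

end SphericalComplex

end

/-! All the geometry is done with polyhedral cones in `ℝⁿ⁺¹`: `trace` cuts them with the unit
sphere, `rint` is the interior relative to the linear span, and the relative distance `ConeClose`
stands in for Hausdorff convergence. Suspending a cell means passing from its cone `K` to `K × ℝ`.
This multiplies the areas of all facets by the same factor, the ratio of the sphere volumes
(`area_lift_univ`). Since the conditions on the areas are homogeneous, both parts of the theorem
descend by induction to `n = 2`.

On `𝕊²` the task is to find a polygon with prescribed edge lengths (`exists_polygon`). If both
inequalities are strict, the polygon can be inscribed in a small circle whose radius is found by the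
intermediate value theorem (`exists_inscribed_angles`). If the lengths add up to `2π`, it is a
hemisphere with subdivided boundary. If the longest edge equals the sum of the others, it is a
doubly covered arc. The two extreme shapes are limits of strictly convex polygons whose vertex rays
are tilted slightly out of the horizontal plane.

For part (i) the polygon is suspended repeatedly (`ComplexModel.suspend`). The `(n-2)`-faces of a
facet are the suspensions of the two ends of an edge, and facets spanning different great spheres
continue to do so.

For part (ii) the suspension of a simplex is turned into a simplex again by cutting the suspended
facet opposite to the vertex `0` along the graph of a linear functional. The poles become two new
vertices, joined by the semicircle over the old vertex `0`, and the other old vertices move onto the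
graph (`isSimplexFanAt_splitCone`). The areas of the two pieces are arbitrary positive numbers with
the right sum (`exists_lift_area`). Hence the two smallest areas may be merged, the induction
hypothesis applied, and the merged facet split. With at least four areas, merging the two smallest
preserves the inequality for the largest. Moving the poles slightly towards the old vertex `0`
exhibits the result as a limit of nondegenerate simplices (`coneClose_splitVertices`). The edges
from the two poles to a common vertex lie on one great circle, which gives a plane angle `π` as soon
as `n ≥ 3`.

Dihedral angles are read off from tangent cones. Modulo the span of the ridge, the tangent cone of a
nondegenerate cell is a convex planar sector, so its angle is at most `π`, with equality exactly if
the two facets have the same span (`IsRidge.exists_isDihedralAngle`). For a flat simplex the angles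
are `0` or `π`, according to a record `χ` of the side on which each facet lies. -/

set_option linter.unusedSectionVars false

noncomputable section

namespace SphericalComplex

/-! ### Polyhedral cones, relative interiors, fans and closeness of cones -/

section Cones

variable {V W : Type*} [NormedAddCommGroup V] [NormedSpace ℝ V]
  [NormedAddCommGroup W] [NormedSpace ℝ W]

/-- The interior of `K` relative to its linear span. -/
def rint (K : Set V) : Set V := {x ∈ K | K ∈ 𝓝[(Submodule.span ℝ K : Set V)] x}

/-- A polyhedral cone: a finite intersection of closed half-spaces through the origin. -/
def IsPolyCone (K : Set V) : Prop :=
  ∃ A : Finset (V →L[ℝ] ℝ), K = {x | ∀ a ∈ A, 0 ≤ a x}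

theorem rint_subset (K : Set V) : rint K ⊆ K := fun _ h => h.1

namespace IsPolyCone

variable {K : Set V} {J : Set W}

theorem zero_mem (h : IsPolyCone K) : (0 : V) ∈ K := by
  obtain ⟨A, rfl⟩ := h
  simp

theorem add_mem (h : IsPolyCone K) {x y : V} (hx : x ∈ K) (hy : y ∈ K) : x + y ∈ K := by
  obtain ⟨A, rfl⟩ := h
  intro a ha
  rw [map_add]
  exact add_nonneg (hx a ha) (hy a ha)

theorem smul_mem (h : IsPolyCone K) {x : V} (hx : x ∈ K) {r : ℝ} (hr : 0 ≤ r) : r • x ∈ K := by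
  obtain ⟨A, rfl⟩ := h
  intro a ha
  rw [map_smul]
  exact mul_nonneg hr (hx a ha)

theorem inter {K' : Set V} (h : IsPolyCone K) (h' : IsPolyCone K') : IsPolyCone (K ∩ K') := by
  classical
  obtain ⟨A, rfl⟩ := h
  obtain ⟨B, rfl⟩ := h'
  refine ⟨A ∪ B, ?_⟩
  ext x
  simp only [mem_inter_iff, mem_ofPred_eq, Finset.mem_union]
  constructor
  · rintro ⟨h1, h2⟩ a (ha | ha)
    exacts [h1 a ha, h2 a ha]
  · exact fun h => ⟨fun a ha => h a (Or.inl ha), fun a ha => h a (Or.inr ha)⟩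

theorem preimage (h : IsPolyCone J) (f : V →L[ℝ] W) : IsPolyCone (f ⁻¹' J) := by
  classical
  obtain ⟨A, rfl⟩ := h
  refine ⟨A.image fun a => a.comp f, ?_⟩
  ext x
  simp

theorem prod (h : IsPolyCone K) (h' : IsPolyCone J) : IsPolyCone (K ×ˢ J) := by
  have := (h.preimage (ContinuousLinearMap.fst ℝ V W)).inter
    (h'.preimage (ContinuousLinearMap.snd ℝ V W))
  exact this

theorem halfspace (a : V →L[ℝ] ℝ) : IsPolyCone {x | 0 ≤ a x} := ⟨{a}, by simp⟩

theorem ker (a : V →L[ℝ] ℝ) : IsPolyCone {x | a x = 0} := by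
  have := (halfspace a).inter (halfspace (-a))
  convert this using 1
  ext x
  simp only [mem_ofPred_eq, mem_inter_iff, _root_.neg_apply]
  constructor
  · intro h; simp [h]
  · rintro ⟨h1, h2⟩; linarith

theorem univ : IsPolyCone (Set.univ : Set V) := ⟨∅, by simp⟩

theorem iInter {ι : Type*} [Finite ι] {K : ι → Set V} (h : ∀ i, IsPolyCone (K i)) :
    IsPolyCone (⋂ i, K i) := by
  classical
  have := Fintype.ofFinite ι
  choose A hA using h
  refine ⟨Finset.univ.biUnion A, ?_⟩
  ext x
  simp only [mem_iInter, mem_ofPred_eq, Finset.mem_biUnion, Finset.mem_univ, true_and]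
  constructor
  · rintro h a ⟨i, hi⟩
    have := h i
    rw [hA i] at this
    exact this a hi
  · intro h i
    rw [hA i]
    exact fun a ha => h a ⟨i, ha⟩

theorem singleton_zero [FiniteDimensional ℝ V] : IsPolyCone ({0} : Set V) := by
  let b := Module.finBasis ℝ V
  have := iInter fun i => ker (LinearMap.toContinuousLinearMap (b.coord i))
  convert this using 1
  ext x
  simp only [mem_singleton_iff, mem_iInter, mem_ofPred_eq, LinearMap.coe_toContinuousLinearMap',
    Module.Basis.coord_apply]
  constructor
  · rintro rfl; simp
  · intro h
    exact b.ext_elem fun i => by simp [h i]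

end IsPolyCone

theorem isPolyCone_Ici : IsPolyCone (Ici (0 : ℝ)) :=
  IsPolyCone.halfspace (ContinuousLinearMap.id ℝ ℝ)

theorem isPolyCone_Iic : IsPolyCone (Iic (0 : ℝ)) := by
  convert IsPolyCone.halfspace (-ContinuousLinearMap.id ℝ ℝ) using 1
  ext x
  simp

/-- The line through `x` in direction `y` stays in the span, so a neighbourhood relative to the span
catches a segment of it. That `t` may be negative is what the applications use. -/
theorem rint_sub_smul_mem {K : Set V} {x y : V} (hx : x ∈ rint K)
    (hy : y ∈ Submodule.span ℝ K) : ∃ ε > (0 : ℝ), ∀ t : ℝ, |t| ≤ ε → x + t • y ∈ K := by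
  have hc : Tendsto (fun t : ℝ => x + t • y) (𝓝 0) (𝓝[(Submodule.span ℝ K : Set V)] x) := by
    refine tendsto_nhdsWithin_iff.2 ⟨?_, Eventually.of_forall fun t => ?_⟩
    · have : Continuous fun t : ℝ => x + t • y := by fun_prop
      simpa using this.tendsto 0
    · exact Submodule.add_mem _ (Submodule.subset_span hx.1) (Submodule.smul_mem _ _ hy)
  obtain ⟨ε, hε, h⟩ := Metric.eventually_nhds_iff.1 (hc.eventually hx.2)
  refine ⟨ε / 2, by positivity, fun t ht => h ?_⟩
  rw [Real.dist_eq, sub_zero]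
  linarith

/-- From `x` one can step a little in the direction `-y` without leaving `K`. If `a x` were zero,
`a` would become negative there. -/
theorem pos_of_mem_rint {K : Set V} (a : V →L[ℝ] ℝ) (ha : ∀ x ∈ K, 0 ≤ a x) {y : V} (hy : y ∈ K)
    (hay : 0 < a y) {x : V} (hx : x ∈ rint K) : 0 < a x := by
  obtain ⟨ε, hε, h⟩ := rint_sub_smul_mem hx (Submodule.subset_span hy)
  have := ha _ (h (-ε) (by rw [abs_neg, abs_of_pos hε]))
  rw [map_add, map_smul, smul_eq_mul] at this
  nlinarith [mul_pos hε hay]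

theorem mem_rint_of_isOpen {K U : Set V} {x : V} (hx : x ∈ K) (hU : IsOpen U) (hxU : x ∈ U)
    (h : ∀ z ∈ U, z ∈ Submodule.span ℝ K → z ∈ K) : x ∈ rint K := by
  refine ⟨hx, ?_⟩
  filter_upwards [mem_nhdsWithin_of_mem_nhds (hU.mem_nhds hxU), self_mem_nhdsWithin] with z h1 h2
  exact h z h1 h2

/-- One point satisfying all inequalities strictly suffices: a neighbourhood of it in `L` lies in
`K`, so `K` spans `L`, and by `pos_of_mem_rint` the relative interior is cut out by the strict
inequalities. Most explicit relative interiors below are computed this way. -/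
theorem span_and_rint_poly {ι : Type*} [Finite ι] (L : Submodule ℝ V) (a : ι → V →L[ℝ] ℝ)
    {y : V} (hyL : y ∈ L) (hy : ∀ i, 0 < a i y) {K : Set V}
    (hK : K = {x | x ∈ L ∧ ∀ i, 0 ≤ a i x}) :
    Submodule.span ℝ K = L ∧ rint K = {x | x ∈ L ∧ ∀ i, 0 < a i x} := by
  have hopen : IsOpen {x | ∀ i, 0 < a i x} := by
    have : {x | ∀ i, 0 < a i x} = ⋂ i, {x | 0 < a i x} := by ext; simp
    rw [this]
    exact isOpen_iInter_of_finite fun i => isOpen_lt continuous_const (a i).continuous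
  have hyK : y ∈ K := by rw [hK]; exact ⟨hyL, fun i => (hy i).le⟩
  have hspan : Submodule.span ℝ K = L := by
    refine le_antisymm (Submodule.span_le.2 fun x hx => ?_) fun x hx => ?_
    · rw [hK] at hx; exact hx.1
    · have hc : Tendsto (fun t : ℝ => y + t • x) (𝓝[>] 0) (𝓝 y) := by
        have : Continuous fun t : ℝ => y + t • x := by fun_prop
        simpa using (this.tendsto 0).mono_left nhdsWithin_le_nhds
      obtain ⟨t, ht, ht0⟩ := ((hc.eventually (hopen.mem_nhds hy)).and self_mem_nhdsWithin).exists
      have ht0 : (0 : ℝ) < t := ht0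
      have h1 : y + t • x ∈ K := by
        rw [hK]
        exact ⟨L.add_mem hyL (L.smul_mem _ hx), fun i => (ht i).le⟩
      have h2 := Submodule.sub_mem _ (Submodule.subset_span (R := ℝ) h1)
        (Submodule.subset_span (R := ℝ) hyK)
      rw [add_sub_cancel_left] at h2
      exact (Submodule.smul_mem_iff _ ht0.ne').1 h2
  refine ⟨hspan, ?_⟩
  ext x
  constructor
  · intro hx
    have hxK := hx.1
    rw [hK] at hxK
    refine ⟨hxK.1, fun i => pos_of_mem_rint (a i) (fun z hz => ?_) hyK (hy i) hx⟩
    rw [hK] at hz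
    exact hz.2 i
  · rintro ⟨hxL, hx⟩
    refine mem_rint_of_isOpen (by rw [hK]; exact ⟨hxL, fun i => (hx i).le⟩) hopen hx ?_
    intro z hz hzs
    rw [hspan] at hzs
    rw [hK]
    exact ⟨hzs, fun i => (hz i).le⟩

theorem span_prod {K : Set V} {J : Set W} (hK : (0 : V) ∈ K) (hJ : (0 : W) ∈ J) :
    Submodule.span ℝ (K ×ˢ J) = (Submodule.span ℝ K).prod (Submodule.span ℝ J) := by
  refine le_antisymm (Submodule.span_le.2 ?_) ?_
  · rintro ⟨x, y⟩ ⟨hx, hy⟩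
    exact ⟨Submodule.subset_span hx, Submodule.subset_span hy⟩
  · rintro ⟨x, y⟩ ⟨hx, hy⟩
    have h1 : (x, (0 : W)) ∈ Submodule.span ℝ (K ×ˢ J) := by
      have : Submodule.span ℝ K ≤ (Submodule.span ℝ (K ×ˢ J)).comap (LinearMap.inl ℝ V W) :=
        Submodule.span_le.2 fun z hz => Submodule.subset_span ⟨hz, hJ⟩
      exact this hx
    have h2 : ((0 : V), y) ∈ Submodule.span ℝ (K ×ˢ J) := by
      have : Submodule.span ℝ J ≤ (Submodule.span ℝ (K ×ˢ J)).comap (LinearMap.inr ℝ V W) :=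
        Submodule.span_le.2 fun z hz => Submodule.subset_span ⟨hK, hz⟩
      exact this hy
    simpa using Submodule.add_mem _ h1 h2

theorem rint_prod {K : Set V} {J : Set W} (hK : (0 : V) ∈ K) (hJ : (0 : W) ∈ J) :
    rint (K ×ˢ J) = rint K ×ˢ rint J := by
  ext ⟨x, y⟩
  have key : 𝓝[(Submodule.span ℝ (K ×ˢ J) : Set (V × W))] (x, y) =
      𝓝[(Submodule.span ℝ K : Set V)] x ×ˢ 𝓝[(Submodule.span ℝ J : Set W)] y := by
    rw [span_prod hK hJ, Submodule.prod_coe, nhdsWithin_prod_eq]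
  constructor
  · rintro ⟨⟨h1, h2⟩, h3⟩
    rw [key] at h3
    -- A product set can be split along a product filter only if both factors are nontrivial.
    have : NeBot (𝓝[(Submodule.span ℝ K : Set V)] x) :=
      mem_closure_iff_nhdsWithin_neBot.1 (subset_closure (Submodule.subset_span h1))
    have : NeBot (𝓝[(Submodule.span ℝ J : Set W)] y) :=
      mem_closure_iff_nhdsWithin_neBot.1 (subset_closure (Submodule.subset_span h2))
    rw [prod_mem_prod_iff] at h3
    exact ⟨⟨h1, h3.1⟩, h2, h3.2⟩
  · rintro ⟨⟨h1, h3⟩, h2, h4⟩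
    refine ⟨⟨h1, h2⟩, ?_⟩
    rw [key]
    exact prod_mem_prod h3 h4

theorem span_preimage (Φ : V ≃L[ℝ] W) (K : Set W) :
    (Submodule.span ℝ (Φ ⁻¹' K)) = (Submodule.span ℝ K).comap (Φ : V →ₗ[ℝ] W) := by
  have h1 : Φ ⁻¹' K = Φ.symm '' K := (Φ.symm.image_eq_preimage_symm K).symm
  rw [h1]
  ext x
  have h2 : (Φ.symm '' K) = ((Φ.symm : W →ₗ[ℝ] V) '' K) := rfl
  rw [h2, Submodule.span_image, Submodule.mem_map, Submodule.mem_comap]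
  constructor
  · rintro ⟨y, hy, rfl⟩
    simpa using hy
  · intro h
    exact ⟨Φ x, h, by simp⟩

theorem rint_preimage (Φ : V ≃L[ℝ] W) (K : Set W) : rint (Φ ⁻¹' K) = Φ ⁻¹' rint K := by
  ext x
  have : (Submodule.span ℝ (Φ ⁻¹' K) : Set V) = Φ ⁻¹' (Submodule.span ℝ K : Set W) := by
    rw [span_preimage]; rfl
  have h2 : 𝓝[(Submodule.span ℝ (Φ ⁻¹' K) : Set V)] x =
      comap Φ (𝓝[(Submodule.span ℝ K : Set W)] (Φ x)) := by
    rw [this]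
    rw [nhdsWithin, nhdsWithin, comap_inf, comap_principal]
    congr 1
    exact Φ.toHomeomorph.nhds_eq_comap x
  simp only [rint, mem_ofPred_eq, mem_preimage, h2]
  refine and_congr_right fun _ => ?_
  rw [← mem_map.trans Iff.rfl, map_comap_of_surjective Φ.surjective]

/-- A polyhedral cone over a convex `k`-cell. -/
structure IsConeCell (k : ℕ) (K : Set V) : Prop where
  poly : IsPolyCone K
  finrank_span : Module.finrank ℝ (Submodule.span ℝ K) = k + 1
  pointed : ∃ x ∈ K, -x ∉ K

/-- The cone `K G` is a cell whose boundary is subdivided by the proper faces of `G`. -/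
structure IsFanAt {ι : Type*} [Preorder ι] (dim : ι → ℕ) (K : ι → Set V) (G : ι) : Prop where
  cell : IsConeCell (dim G) (K G)
  bdry : K G \ rint (K G) = {0} ∪ ⋃ F ∈ {F : ι | F < G}, K F
  disj : ∀ F F' : ι, F ≤ G → F' ≤ G → F ≠ F' → Disjoint (rint (K F)) (rint (K F'))

/-- Two cones are `ε`-close if every point of either has a point of the other at distance at most
`ε` times its norm. -/
def ConeClose (ε : ℝ) (K K' : Set V) : Prop :=
  (∀ x ∈ K, ∃ y ∈ K', ‖x - y‖ ≤ ε * ‖x‖) ∧ (∀ y ∈ K', ∃ x ∈ K, ‖y - x‖ ≤ ε * ‖y‖)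

namespace ConeClose

theorem refl {ε : ℝ} (hε : 0 ≤ ε) (K : Set V) : ConeClose ε K K :=
  ⟨fun x hx => ⟨x, hx, by simp; positivity⟩, fun x hx => ⟨x, hx, by simp; positivity⟩⟩

theorem mono {ε ε' : ℝ} (h : ε ≤ ε') {K K' : Set V} (hK : ConeClose ε K K') :
    ConeClose ε' K K' :=
  ⟨fun x hx => (hK.1 x hx).imp fun _ hy => ⟨hy.1, hy.2.trans (by gcongr)⟩,
   fun x hx => (hK.2 x hx).imp fun _ hy => ⟨hy.1, hy.2.trans (by gcongr)⟩⟩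

/-- The second error is relative to the norm of the intermediate point, which may exceed that of the
first by the factor `1 + ε`; hence the product term. -/
theorem trans {ε ε' : ℝ} (hε : 0 ≤ ε) (hε' : 0 ≤ ε') {K K' K'' : Set V}
    (h : ConeClose ε K K') (h' : ConeClose ε' K' K'') :
    ConeClose (ε + ε' + ε * ε') K K'' := by
  have aux : ∀ {a b : ℝ}, 0 ≤ b → ∀ x y z : V, ‖x - y‖ ≤ a * ‖x‖ →
      ‖y - z‖ ≤ b * ‖y‖ → ‖x - z‖ ≤ (a + b + a * b) * ‖x‖ := by
    intro a b hb x y z h1 h2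
    have h3 : ‖x - z‖ ≤ ‖x - y‖ + ‖y - z‖ := norm_sub_le_norm_sub_add_norm_sub x y z
    have h4 : ‖y‖ ≤ ‖x‖ + ‖x - y‖ := by
      have := norm_sub_le x (x - y); rwa [sub_sub_cancel] at this
    have h5 : b * ‖y‖ ≤ b * (‖x‖ + a * ‖x‖) := by gcongr; linarith
    linarith
  refine ⟨fun x hx => ?_, fun z hz => ?_⟩
  · obtain ⟨y, hy, hxy⟩ := h.1 x hx
    obtain ⟨z, hz, hyz⟩ := h'.1 y hy
    exact ⟨z, hz, aux hε' _ _ _ hxy hyz⟩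
  · obtain ⟨y, hy, hxy⟩ := h'.2 z hz
    obtain ⟨x, hx, hyz⟩ := h.2 y hy
    refine ⟨x, hx, ?_⟩
    have := aux hε _ _ _ hxy hyz
    convert this using 2
    ring

theorem preimage (Φ : V ≃L[ℝ] W) {ε : ℝ} (hε : 0 ≤ ε) {K K' : Set W} (h : ConeClose ε K K') :
    ConeClose (‖(Φ.symm : W →L[ℝ] V)‖ * ε * ‖(Φ : V →L[ℝ] W)‖) (Φ ⁻¹' K) (Φ ⁻¹' K') := by
  have aux : ∀ (x : V) (y : W), ‖Φ x - y‖ ≤ ε * ‖Φ x‖ →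
      ‖x - Φ.symm y‖ ≤ ‖(Φ.symm : W →L[ℝ] V)‖ * ε * ‖(Φ : V →L[ℝ] W)‖ * ‖x‖ := by
    intro x y hxy
    have h1 : x - Φ.symm y = (Φ.symm : W →L[ℝ] V) (Φ x - y) := by simp
    rw [h1]
    have h2 := (Φ : V →L[ℝ] W).le_opNorm x
    calc _ ≤ ‖(Φ.symm : W →L[ℝ] V)‖ * ‖Φ x - y‖ := ContinuousLinearMap.le_opNorm _ _
      _ ≤ ‖(Φ.symm : W →L[ℝ] V)‖ * (ε * (‖(Φ : V →L[ℝ] W)‖ * ‖x‖)) := by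
          gcongr
          exact hxy.trans (by gcongr; exact h2)
      _ = _ := by ring
  constructor
  · intro x hx
    obtain ⟨y, hy, hxy⟩ := h.1 (Φ x) hx
    exact ⟨Φ.symm y, by simpa using hy, aux x y hxy⟩
  · intro x hx
    obtain ⟨y, hy, hxy⟩ := h.2 (Φ x) hx
    exact ⟨Φ.symm y, by simpa using hy, aux x y hxy⟩

end ConeClose

end Cones

/-! ### From cones to cells on the sphere -/

section Sphere

variable {n : ℕ}

/-- The trace of a cone on the unit sphere. -/
def trace (K : Set (Space n)) : Set (Space n) := {x | x ∈ unitSphere n ∧ x ∈ K}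

theorem mem_unitSphere {x : Space n} : x ∈ unitSphere n ↔ ‖x‖ = 1 := by
  simp [unitSphere]

theorem normalize_mem_trace {K : Set (Space n)} (hK : IsPolyCone K) {x : Space n} (hx : x ∈ K)
    (h0 : x ≠ 0) : ‖x‖⁻¹ • x ∈ trace K :=
  ⟨mem_unitSphere.2 (by rw [norm_smul, norm_inv, norm_norm, inv_mul_cancel₀ (norm_ne_zero_iff.2 h0)]),
    hK.smul_mem hx (by positivity)⟩

theorem span_trace {K : Set (Space n)} (hK : IsPolyCone K) :
    Submodule.span ℝ (trace K) = Submodule.span ℝ K := by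
  refine le_antisymm (Submodule.span_mono fun x hx => hx.2) (Submodule.span_le.2 fun x hx => ?_)
  by_cases h0 : x = 0
  · rw [h0]; exact Submodule.zero_mem _
  · have h := Submodule.subset_span (R := ℝ) (normalize_mem_trace hK hx h0)
    exact (Submodule.smul_mem_iff _ (inv_ne_zero (norm_ne_zero_iff.2 h0))).1 h

/-- Radial projection is continuous away from the origin and preserves the span, so it pulls
neighbourhoods on the sphere back to neighbourhoods in the span; homogeneity of `K` undoes the
projection. -/
theorem relInt_trace {K : Set (Space n)} (hK : IsPolyCone K) : relInt (trace K) = trace (rint K) := by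
  ext x
  constructor
  · rintro ⟨⟨h1, h2⟩, h3⟩
    rw [span_trace hK] at h3
    have hx0 : x ≠ 0 := by
      rintro rfl; simp [mem_unitSphere] at h1
    refine ⟨h1, h2, ?_⟩
    have hc : Tendsto (fun z : Space n => ‖z‖⁻¹ • z) (𝓝[(Submodule.span ℝ K : Set (Space n))] x)
        (𝓝[unitSphere n ∩ (Submodule.span ℝ K : Set (Space n))] x) := by
      refine tendsto_nhdsWithin_iff.2 ⟨?_, ?_⟩
      · have : ContinuousAt (fun z : Space n => ‖z‖⁻¹ • z) x :=
          (continuousAt_id.norm.inv₀ (norm_ne_zero_iff.2 hx0)).smul continuousAt_id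
        have h4 : ‖x‖⁻¹ • x = x := by rw [mem_unitSphere.1 h1]; simp
        rw [ContinuousAt, h4] at this
        exact this.mono_left nhdsWithin_le_nhds
      · filter_upwards [self_mem_nhdsWithin, nhdsWithin_le_nhds (isOpen_ne.mem_nhds hx0)] with z hz hz0
        refine ⟨?_, Submodule.smul_mem _ _ hz⟩
        rw [mem_unitSphere, norm_smul, norm_inv, norm_norm, inv_mul_cancel₀ (norm_ne_zero_iff.2 hz0)]
    filter_upwards [hc.eventually h3, nhdsWithin_le_nhds (isOpen_ne.mem_nhds hx0)] with z hz hz0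
    have := hK.smul_mem hz.2 (norm_nonneg z)
    rwa [smul_smul, mul_inv_cancel₀ (norm_ne_zero_iff.2 hz0), one_smul] at this
  · rintro ⟨h1, h2, h3⟩
    refine ⟨⟨h1, h2⟩, ?_⟩
    rw [span_trace hK]
    filter_upwards [nhdsWithin_mono x inter_subset_right h3, self_mem_nhdsWithin] with z hz hz2
    exact ⟨hz2.1, hz⟩

theorem IsConeCell.isCell {k : ℕ} {K : Set (Space n)} (h : IsConeCell k K) : IsCell k (trace K) := by
  classical
  refine ⟨?_, by rw [span_trace h.poly, h.finrank_span], ?_⟩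
  · obtain ⟨A, rfl⟩ := h.poly
    refine ⟨A.image (InnerProductSpace.toDual ℝ (Space n)).symm, ?_⟩
    ext x
    simp [trace]
  · obtain ⟨x, hx, hx'⟩ := h.pointed
    have h0 : x ≠ 0 := by
      rintro rfl
      rw [neg_zero] at hx'
      exact hx' hx
    refine ⟨_, normalize_mem_trace h.poly hx h0, fun h' => hx' ?_⟩
    have := h.poly.smul_mem h'.2 (norm_nonneg x)
    rwa [smul_neg, smul_smul, mul_inv_cancel₀ (norm_ne_zero_iff.2 h0), one_smul] at this

theorem IsPolyCone.sphConvex {K : Set (Space n)} (h : IsPolyCone K) : SphConvex (trace K) :=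
  fun _ hx _ hy _ _ _ ha hb hs => ⟨hs, h.add_mem (h.smul_mem hx.2 ha) (h.smul_mem hy.2 hb)⟩

/-- Since `-x ∉ K`, some defining functional is negative at `-x`. It is nonzero, and its normalised
Riesz vector is the pole of the half-sphere. -/
theorem IsConeCell.inClosedHemisphere {k : ℕ} {K : Set (Space n)} (h : IsConeCell k K) :
    InClosedHemisphere (trace K) := by
  obtain ⟨⟨A, hA⟩, -, x, hx, hx'⟩ := h
  rw [hA] at hx hx'
  simp only [mem_ofPred_eq, not_forall] at hx hx'
  obtain ⟨a, ha, hax⟩ := hx'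
  set v := (InnerProductSpace.toDual ℝ (Space n)).symm a with hv
  have hin : ∀ z, inner ℝ v z = a z := fun z => by simp [hv]
  have hv0 : v ≠ 0 := by
    intro h0
    have := hin x
    rw [h0, inner_zero_left] at this
    rw [map_neg, ← this] at hax
    simp at hax
  refine ⟨‖v‖⁻¹ • v, mem_unitSphere.2 ?_, ?_⟩
  · rw [norm_smul, norm_inv, norm_norm, inv_mul_cancel₀ (norm_ne_zero_iff.2 hv0)]
  · rintro z ⟨-, hz⟩
    rw [hA] at hz
    rw [real_inner_smul_left, hin]
    exact mul_nonneg (by positivity) (hz a ha)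

/-- The only discrepancy between the two boundary formulas is the apex `{0}`, which stands for the
empty face and misses the sphere. -/
theorem IsFanAt.isSubdividedCell {P : FacePoset n} {K : P.Face → Set (Space n)} {G : P.Face}
    (hpoly : ∀ F ≤ G, IsPolyCone (K F)) (h : IsFanAt P.dim K G) :
    IsSubdividedCell P (fun F => trace (K F)) G where
  cell := h.cell.isCell
  bdry := by
    rw [relBdry, relInt_trace h.cell.poly]
    ext x
    have hb : x ∈ K G \ rint (K G) ↔ x ∈ {0} ∪ ⋃ F ∈ {F : P.Face | F < G}, K F := by rw [h.bdry]
    simp only [Set.mem_sdiff, mem_union, mem_singleton_iff, mem_iUnion, mem_ofPred_eq, exists_prop] at hb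
    simp only [Set.mem_sdiff, mem_iUnion, mem_ofPred_eq, exists_prop, trace]
    constructor
    · rintro ⟨⟨h1, h2⟩, h3⟩
      rcases hb.1 ⟨h2, fun h4 => h3 ⟨h1, h4⟩⟩ with rfl | ⟨F, hF, hx⟩
      · simp [mem_unitSphere] at h1
      · exact ⟨F, hF, h1, hx⟩
    · rintro ⟨F, hF, h1, hx⟩
      have := hb.2 (Or.inr ⟨F, hF, hx⟩)
      exact ⟨⟨h1, this.1⟩, fun h4 => this.2 h4.2⟩
  disj F F' hF hF' hne := by
    rw [relInt_trace (hpoly F hF), relInt_trace (hpoly F' hF')]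
    exact (h.disj F F' hF hF' hne).mono (fun x hx => hx.2) (fun x hx => hx.2)

/-- One `ε` is the distance from `x` to `y`, the other that from `y` to its radial projection. The
bound `ε < 1` keeps `y` away from the origin. -/
theorem ConeClose.exists_mem_trace {ε : ℝ} (hε : ε < 1) {K : Set (Space n)}
    (hK : IsPolyCone K) {x y : Space n} (hx : ‖x‖ = 1) (hy : y ∈ K) (hxy : ‖x - y‖ ≤ ε * ‖x‖) :
    ∃ z ∈ trace K, dist x z ≤ 2 * ε := by
  rw [hx, mul_one] at hxy
  have h1 : |1 - ‖y‖| ≤ ε := by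
    rw [← hx]; exact (abs_norm_sub_norm_le x y).trans hxy
  have hy0 : y ≠ 0 := by
    rintro rfl
    rw [norm_zero] at h1
    norm_num at h1
    linarith
  refine ⟨_, normalize_mem_trace hK hy hy0, ?_⟩
  have h2 : ‖y - ‖y‖⁻¹ • y‖ = |1 - ‖y‖| := by
    have : y - ‖y‖⁻¹ • y = (1 - ‖y‖⁻¹) • y := by rw [sub_smul, one_smul]
    rw [this, norm_smul, Real.norm_eq_abs]
    have hp : 0 < ‖y‖ := norm_pos_iff.2 hy0
    rw [← abs_of_pos hp, ← abs_mul, abs_of_pos hp, sub_mul, inv_mul_cancel₀ hp.ne', one_mul, abs_sub_comm]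
  rw [dist_eq_norm]
  have := norm_sub_le_norm_sub_add_norm_sub x y (‖y‖⁻¹ • y)
  linarith

theorem ConeClose.hausdorffEDist_le {ε : ℝ} (hε : ε < 1) {K K' : Set (Space n)}
    (hK : IsPolyCone K) (hK' : IsPolyCone K') (h : ConeClose ε K K') :
    Metric.hausdorffEDist (trace K) (trace K') ≤ ENNReal.ofReal (2 * ε) := by
  refine Metric.hausdorffEDist_le_of_mem_edist ?_ ?_
  · rintro x ⟨hx, hxK⟩
    obtain ⟨y, hy, hxy⟩ := h.1 x hxK
    obtain ⟨z, hz, hxz⟩ := exists_mem_trace hε hK' (mem_unitSphere.1 hx) hy hxy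
    exact ⟨z, hz, by rw [edist_dist]; exact ENNReal.ofReal_le_ofReal hxz⟩
  · rintro x ⟨hx, hxK⟩
    obtain ⟨y, hy, hxy⟩ := h.2 x hxK
    obtain ⟨z, hz, hxz⟩ := exists_mem_trace hε hK (mem_unitSphere.1 hx) hy hxy
    exact ⟨z, hz, by rw [edist_dist]; exact ENNReal.ofReal_le_ofReal hxz⟩

/-- The rate `1 / (k + 2)` is below one already for `k = 0`, as the projection to the sphere
requires. -/
theorem facesTendsto_of_coneClose {ι : Type} {u : ℕ → ι → Set (Space n)} {K : ι → Set (Space n)}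
    (hu : ∀ k F, IsPolyCone (u k F)) (hK : ∀ F, IsPolyCone (K F))
    (h : ∀ (k : ℕ) F, ConeClose (1 / ((k : ℝ) + 2)) (u k F) (K F)) :
    FacesTendsto (fun k F => trace (u k F)) fun F => trace (K F) := by
  intro F
  have hlim : Tendsto (fun k : ℕ => ENNReal.ofReal (2 * (1 / ((k : ℝ) + 2)))) atTop (𝓝 0) := by
    rw [← ENNReal.ofReal_zero]
    refine (ENNReal.continuous_ofReal.tendsto 0).comp ?_
    have h1 : Tendsto (fun k : ℕ => (k : ℝ) + 2) atTop atTop :=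
      tendsto_atTop_add_const_right _ _ tendsto_natCast_atTop_atTop
    simpa using (h1.inv_tendsto_atTop).const_mul 2
  refine tendsto_of_tendsto_of_tendsto_of_le_of_le tendsto_const_nhds hlim (fun _ => zero_le)
    fun k => ?_
  refine (h k F).hausdorffEDist_le ?_ (hu k F) (hK F)
  rw [div_lt_one (by positivity)]
  have : (0 : ℝ) ≤ k := Nat.cast_nonneg k
  linarith

end Sphere

/-! ### Planar sectors in polar coordinates -/

theorem exists_polar {a b : ℝ} (hb : 0 ≤ b) :
    ∃ r φ : ℝ, 0 ≤ r ∧ 0 ≤ φ ∧ φ ≤ Real.pi ∧ a = r * Real.cos φ ∧ b = r * Real.sin φ := by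
  refine ⟨‖(⟨a, b⟩ : ℂ)‖, Complex.arg ⟨a, b⟩, norm_nonneg _, Complex.arg_nonneg_iff.2 hb,
    Complex.arg_le_pi _, ?_, ?_⟩
  · rw [Complex.norm_mul_cos_arg]
  · rw [Complex.norm_mul_sin_arg]

section Wedge

variable {V : Type*} [AddCommGroup V] [Module ℝ V]

/-- The join of a linear subspace with a circular arc of directions. -/
def wedge (L : Submodule ℝ V) (u w : V) (α β : ℝ) : Set V :=
  {z | ∃ y ∈ L, ∃ r φ : ℝ, 0 ≤ r ∧ α ≤ φ ∧ φ ≤ β ∧ z = y + r • (Real.cos φ • u + Real.sin φ • w)}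

theorem wedge_self (L : Submodule ℝ V) (u w : V) (θ : ℝ) :
    wedge L u w θ θ =
      {z | ∃ y ∈ L, ∃ r : ℝ, 0 ≤ r ∧ z = y + r • (Real.cos θ • u + Real.sin θ • w)} := by
  ext z
  constructor
  · rintro ⟨y, hy, r, φ, hr, h1, h2, rfl⟩
    obtain rfl := le_antisymm h1 h2
    exact ⟨y, hy, r, hr, rfl⟩
  · rintro ⟨y, hy, r, hr, rfl⟩
    exact ⟨y, hy, r, θ, hr, le_rfl, le_rfl, rfl⟩

theorem wedge_pi (L : Submodule ℝ V) (u w : V) :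
    wedge L u w 0 Real.pi = {z | ∃ y ∈ L, ∃ a b : ℝ, 0 ≤ b ∧ z = y + (a • u + b • w)} := by
  ext z
  constructor
  · rintro ⟨y, hy, r, φ, hr, h1, h2, rfl⟩
    exact ⟨y, hy, r * Real.cos φ, r * Real.sin φ,
      mul_nonneg hr (Real.sin_nonneg_of_nonneg_of_le_pi h1 h2), by simp [smul_smul]⟩
  · rintro ⟨y, hy, a, b, hb, rfl⟩
    obtain ⟨r, φ, hr, h0, hpi, rfl, rfl⟩ := exists_polar (a := a) hb
    exact ⟨y, hy, r, φ, hr, h0, hpi, by simp [smul_smul]⟩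

/-- By the sine rule, the direction `φ` has the coefficients `sin (θ - φ) / sin θ` and `sin φ / sin
θ` with respect to the directions `0` and `θ`. Conversely, a polar angle beyond `θ` would make the
first coefficient negative unless `r = 0`. -/
theorem wedge_eq (L : Submodule ℝ V) (u w : V) {θ : ℝ} (h0 : 0 < θ) (hpi : θ < Real.pi) :
    wedge L u w 0 θ = {z | ∃ y ∈ L, ∃ a b : ℝ, 0 ≤ a ∧ 0 ≤ b ∧
      z = y + (a • u + b • (Real.cos θ • u + Real.sin θ • w))} := by
  have hs : 0 < Real.sin θ := Real.sin_pos_of_pos_of_lt_pi h0 hpi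
  ext z
  constructor
  · rintro ⟨y, hy, r, φ, hr, h1, h2, rfl⟩
    refine ⟨y, hy, r * Real.sin (θ - φ) / Real.sin θ, r * Real.sin φ / Real.sin θ, ?_, ?_, ?_⟩
    · have := Real.sin_nonneg_of_nonneg_of_le_pi (x := θ - φ) (by linarith) (by linarith)
      positivity
    · have := Real.sin_nonneg_of_nonneg_of_le_pi (x := φ) h1 (by linarith)
      positivity
    · congr 1
      rw [Real.sin_sub]
      match_scalars
      · field_simp
        ring
      · field_simp
  · rintro ⟨y, hy, a, b, ha, hb, rfl⟩
    obtain ⟨r, φ, hr, hφ0, hφpi, h1, h2⟩ := exists_polar (a := a + b * Real.cos θ)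
      (b := b * Real.sin θ) (by positivity)
    have hz : a • u + b • (Real.cos θ • u + Real.sin θ • w) =
        r • (Real.cos φ • u + Real.sin φ • w) := by
      rw [smul_add, smul_smul, smul_smul, smul_add, smul_smul, smul_smul, ← h1, ← h2]
      match_scalars <;> ring
    by_cases hφ : φ ≤ θ
    · exact ⟨y, hy, r, φ, hr, hφ0, hφ, by rw [hz]⟩
    · have h3 : r * Real.sin (θ - φ) = a * Real.sin θ := by
        rw [Real.sin_sub]
        linear_combination (-Real.sin θ) * h1 + (Real.cos θ) * h2
      have h4 : Real.sin (θ - φ) < 0 := by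
        rw [← neg_pos, ← Real.sin_neg]
        exact Real.sin_pos_of_pos_of_lt_pi (by linarith) (by linarith)
      have h5 : r = 0 := by
        by_contra hne
        have : 0 < r := lt_of_le_of_ne hr (Ne.symm hne)
        nlinarith [mul_nonneg ha hs.le]
      refine ⟨y, hy, 0, 0, le_rfl, le_rfl, h0.le, ?_⟩
      rw [hz, h5, zero_smul, zero_smul]

end Wedge

/-! ### Tangent cones of polyhedral cones along a face -/

section TangentCone

variable {V : Type*} [NormedAddCommGroup V] [NormedSpace ℝ V]

/-- For each defining functional that does not vanish on `E`, pick a point of `E` where it is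
positive; the sum of these points is interior. The remaining functionals vanish on the whole span
and impose nothing there. -/
theorem IsPolyCone.rint_nonempty {E : Set V} (h : IsPolyCone E) : (rint E).Nonempty := by
  classical
  obtain ⟨A, hA⟩ := id h
  let ι := {a : A // ∃ y ∈ E, a.1 y ≠ 0}
  have hch : ∀ a : ι, ∃ y ∈ E, 0 < a.1.1 y := by
    rintro ⟨a, y, hy, hay⟩
    refine ⟨y, hy, lt_of_le_of_ne ?_ hay.symm⟩
    rw [hA] at hy
    exact hy a.1 a.2
  choose y hyE hy using hch
  have hge : ∀ a ∈ A, ∀ z ∈ E, 0 ≤ a z := fun a ha z hz => by rw [hA] at hz; exact hz a ha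
  have hmem : ∑ i, y i ∈ E := by
    refine Finset.sum_induction y (· ∈ E) (fun _ _ => h.add_mem) h.zero_mem fun i _ => hyE i
  have := (span_and_rint_poly (Submodule.span ℝ E) (fun a : ι => a.1.1) (y := ∑ i, y i)
    (Submodule.subset_span hmem) (fun a => ?_) (K := E) ?_).2
  · refine ⟨∑ i, y i, ?_⟩
    rw [this]
    refine ⟨Submodule.subset_span hmem, fun a => ?_⟩
    rw [map_sum]
    exact Finset.sum_pos' (fun i _ => hge _ a.1.2 _ (hyE i)) ⟨a, Finset.mem_univ _, hy a⟩
  · rw [map_sum]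
    exact Finset.sum_pos' (fun i _ => hge _ a.1.2 _ (hyE i)) ⟨a, Finset.mem_univ _, hy a⟩
  · ext x
    refine ⟨fun hx => ⟨Submodule.subset_span hx, fun a => hge _ a.1.2 _ hx⟩, ?_⟩
    rintro ⟨hxs, hx⟩
    rw [hA]
    intro a ha
    by_cases hae : ∃ y ∈ E, a y ≠ 0
    · exact hx ⟨⟨a, ha⟩, hae⟩
    · push Not at hae
      have : Submodule.span ℝ E ≤ LinearMap.ker (a : V →ₗ[ℝ] ℝ) := Submodule.span_le.2 hae
      exact (this hxs : a x = 0).ge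

/-- `T` is a polyhedral cone with `L` in its lineality space. -/
def IsPolyConeOver (L : Submodule ℝ V) (T : Set V) : Prop :=
  ∃ B : Finset (V →L[ℝ] ℝ), (∀ a ∈ B, ∀ y ∈ L, a y = 0) ∧ T = {z | ∀ a ∈ B, 0 ≤ a z}

/-- `T` is the tangent cone of `K` along the relative interior of `E`. -/
structure IsTangentCone (E K T : Set V) : Prop where
  polyOver : IsPolyConeOver (Submodule.span ℝ E) T
  subset : K ⊆ T
  eventually : ∀ x ∈ rint E, ∀ᶠ z in 𝓝 x, z ∈ K ↔ z ∈ T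

/-- Only the defining functionals of `K` that vanish on `E` are kept. Each of the others is positive
on the relative interior of `E`, hence inactive near its points. -/
theorem exists_isTangentCone {E K : Set V} (hK : IsPolyCone K) (hEK : E ⊆ K) :
    ∃ T, IsTangentCone E K T := by
  classical
  obtain ⟨A, rfl⟩ := hK
  have hspan : ∀ a : V →L[ℝ] ℝ, (∀ y ∈ E, a y = 0) → ∀ y ∈ Submodule.span ℝ E, a y = 0 := by
    intro a ha
    have : Submodule.span ℝ E ≤ LinearMap.ker (a : V →ₗ[ℝ] ℝ) := Submodule.span_le.2 ha
    exact fun y hy => this hy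
  obtain ⟨B, hB⟩ : ∃ B : Finset (V →L[ℝ] ℝ), ∀ a, a ∈ B ↔ a ∈ A ∧ ∀ y ∈ E, a y = 0 :=
    ⟨A.filter (fun a => ∀ y ∈ E, a y = 0), fun a => Finset.mem_filter⟩
  refine ⟨{z | ∀ a ∈ B, 0 ≤ a z}, ⟨B, fun a ha => hspan a ((hB a).1 ha).2, rfl⟩,
    fun z hz a ha => hz a ((hB a).1 ha).1, fun x hx => ?_⟩
  have h1 : ∀ᶠ z in 𝓝 x, ∀ a ∈ A, a ∉ B → 0 < a z := by
    refine (eventually_all_finset A).2 fun a haA => ?_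
    by_cases haB : a ∈ B
    · exact Eventually.of_forall fun z h => absurd haB h
    have hae : ∃ y ∈ E, a y ≠ 0 := by
      by_contra! h
      exact haB ((hB a).2 ⟨haA, h⟩)
    obtain ⟨y, hy, hay⟩ := hae
    have hpos : 0 < a x := pos_of_mem_rint a (fun z hz => hEK hz a haA) hy
      (lt_of_le_of_ne (hEK hy a haA) hay.symm) hx
    have := a.continuous.continuousAt.eventually (lt_mem_nhds hpos)
    filter_upwards [this] with z hz _ using hz
  filter_upwards [h1] with z hz
  refine ⟨fun h a ha => h a ((hB a).1 ha).1, fun h a ha => ?_⟩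
  by_cases haB : a ∈ B
  · exact h a haB
  · exact (hz a ha haB).le

theorem IsPolyConeOver.add_mem_iff {L : Submodule ℝ V} {T : Set V} (h : IsPolyConeOver L T)
    {y z : V} (hy : y ∈ L) : y + z ∈ T ↔ z ∈ T := by
  obtain ⟨B, hB, rfl⟩ := h
  refine forall₂_congr fun a ha => ?_
  rw [map_add, hB a ha y hy, zero_add]

theorem IsPolyConeOver.isPolyCone {L : Submodule ℝ V} {T : Set V} (h : IsPolyConeOver L T) :
    IsPolyCone T := ⟨h.choose, h.choose_spec.2⟩

theorem tendsto_add_smul (x z : V) : Tendsto (fun t : ℝ => x + t • z) (𝓝[>] 0) (𝓝 x) := by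
  have : Continuous fun t : ℝ => x + t • z := by fun_prop
  simpa using (this.tendsto 0).mono_left nhdsWithin_le_nhds

namespace IsTangentCone

variable {E K T : Set V}

theorem exists_add_smul_mem (h : IsTangentCone E K T) {x z : V} (hx : x ∈ rint E) (hz : z ∈ T) :
    ∃ t > (0 : ℝ), x + t • z ∈ K := by
  obtain ⟨t, h1, ht⟩ := (((tendsto_add_smul x z).eventually (h.eventually x hx)).and
    self_mem_nhdsWithin).exists
  refine ⟨t, ht, h1.2 ?_⟩
  rw [h.polyOver.add_mem_iff (Submodule.subset_span hx.1)]
  exact h.polyOver.isPolyCone.smul_mem hz (le_of_lt ht)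

/-- Elements of `T` are directions along which one can start from a relative interior point of `E`
and stay in `K` for a while, and this description is monotone in `K`. -/
theorem mono (h : IsTangentCone E K T) {K' T' : Set V} (h' : IsTangentCone E K' T')
    (hE : IsPolyCone E) (hKK' : K ⊆ K') : T ⊆ T' := by
  intro z hz
  obtain ⟨x, hx⟩ := hE.rint_nonempty
  obtain ⟨t, ht, hm⟩ := h.exists_add_smul_mem hx hz
  have h1 := h'.subset (hKK' hm)
  rw [h'.polyOver.add_mem_iff (Submodule.subset_span hx.1)] at h1
  have := h'.polyOver.isPolyCone.smul_mem h1 (inv_nonneg.2 ht.le)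
  rwa [smul_smul, inv_mul_cancel₀ ht.ne', one_smul] at this

theorem span_eq (h : IsTangentCone E K T) (hE : IsPolyCone E) (hEK : E ⊆ K) :
    Submodule.span ℝ T = Submodule.span ℝ K := by
  refine le_antisymm (Submodule.span_le.2 fun z hz => ?_) (Submodule.span_mono h.subset)
  obtain ⟨x, hx⟩ := hE.rint_nonempty
  obtain ⟨t, ht, hm⟩ := h.exists_add_smul_mem hx hz
  have h2 := Submodule.sub_mem _ (Submodule.subset_span (R := ℝ) hm)
    (Submodule.subset_span (R := ℝ) (hEK hx.1))
  rw [add_sub_cancel_left] at h2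
  exact (Submodule.smul_mem_iff _ ht.ne').1 h2

theorem eventually_rint (h : IsTangentCone E K T) (hE : IsPolyCone E) (hEK : E ⊆ K) {x : V}
    (hx : x ∈ rint E) : ∀ᶠ z in 𝓝 x, z ∈ rint T → z ∈ rint K := by
  have h1 := h.eventually x hx
  filter_upwards [h1, eventually_eventually_nhds.2 h1] with z hz1 hz2 hz
  refine ⟨hz1.2 hz.1, ?_⟩
  have h3 := hz.2
  rw [h.span_eq hE hEK] at h3
  filter_upwards [h3, nhdsWithin_le_nhds hz2] with z' h4 h5
  exact h5.2 h4

/-- If `T` filled its span, then near a relative interior point of `E` the cone `K` would fill its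
span too, and that point would be interior to `K`. -/
theorem exists_not_mem (h : IsTangentCone E K T) (hE : IsPolyCone E) (hEK : E ⊆ K)
    (hd : Disjoint (rint E) (rint K)) : ∃ z ∈ Submodule.span ℝ T, z ∉ T := by
  by_contra! hall
  obtain ⟨x, hx⟩ := hE.rint_nonempty
  refine Set.disjoint_left.1 hd hx ⟨hEK hx.1, ?_⟩
  filter_upwards [nhdsWithin_le_nhds (h.eventually x hx), self_mem_nhdsWithin] with z h1 h2
  refine h1.2 (hall z ?_)
  rw [h.span_eq hE hEK]
  exact h2

end IsTangentCone

end TangentCone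

/-! ### Cones with one dimension more than their lineality space -/

section Ray

variable {V : Type*} [NormedAddCommGroup V] [InnerProductSpace ℝ V] [FiniteDimensional ℝ V]

theorem exists_unit_of_finrank {L M : Submodule ℝ V} (hLM : L ≤ M)
    (hr : Module.finrank ℝ M = Module.finrank ℝ L + 1) :
    ∃ u : V, ‖u‖ = 1 ∧ u ∈ M ∧ (∀ y ∈ L, inner ℝ u y = 0) ∧
      ∀ z ∈ M, ∃ y ∈ L, ∃ r : ℝ, z = y + r • u := by
  have h1 := Submodule.finrank_add_inf_finrank_orthogonal hLM
  have h2 : Module.finrank ℝ ↥(Lᗮ ⊓ M) = 1 := by omega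
  obtain ⟨⟨v, hv⟩, hv0, hall⟩ := finrank_eq_one_iff'.1 h2
  have hv0' : v ≠ 0 := fun h => hv0 (by ext; simpa using h)
  have hn : ‖v‖ ≠ 0 := norm_ne_zero_iff.2 hv0'
  refine ⟨‖v‖⁻¹ • v, by rw [norm_smul, norm_inv, norm_norm, inv_mul_cancel₀ hn],
    M.smul_mem _ hv.2, fun y hy => ?_, fun z hz => ?_⟩
  · rw [real_inner_smul_left, real_inner_comm, (Submodule.mem_orthogonal L v).1 hv.1 y hy, mul_zero]
  · have hp : (L.starProjection z) ∈ L := Submodule.starProjection_apply_mem L z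
    have hz' : z - L.starProjection z ∈ Lᗮ ⊓ M :=
      ⟨L.sub_starProjection_mem_orthogonal z, M.sub_mem hz (hLM hp)⟩
    obtain ⟨c, hc⟩ := hall ⟨_, hz'⟩
    have hc' : c • v = z - L.starProjection z := congrArg Subtype.val hc
    refine ⟨_, hp, c * ‖v‖, ?_⟩
    rw [smul_smul, mul_assoc, mul_inv_cancel₀ hn, mul_one, hc']
    abel

/-- Modulo `L` the cone `T` lives on a line. It is not the whole line by `hne`, and it is not zero
because it spans more than `L`; so it is a half-line, and `u` is its unit direction orthogonal to
`L`. -/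
theorem exists_ray {L : Submodule ℝ V} {T : Set V} (hT : IsPolyConeOver L T)
    (hLT : L ≤ Submodule.span ℝ T)
    (hr : Module.finrank ℝ (Submodule.span ℝ T) = Module.finrank ℝ L + 1)
    (hne : ∃ z ∈ Submodule.span ℝ T, z ∉ T) :
    ∃ u : V, ‖u‖ = 1 ∧ u ∈ Submodule.span ℝ T ∧ (∀ y ∈ L, inner ℝ u y = 0) ∧
      (∀ z ∈ Submodule.span ℝ T, ∃ y ∈ L, ∃ r : ℝ, z = y + r • u) ∧
      T = {z | ∃ y ∈ L, ∃ r : ℝ, 0 ≤ r ∧ z = y + r • u} := by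
  obtain ⟨u₀, hu1, huT, huL, hdec⟩ := exists_unit_of_finrank hLT hr
  obtain ⟨B, hB, rfl⟩ := hT
  obtain ⟨a₀, ha₀, hau⟩ : ∃ a ∈ B, a u₀ ≠ 0 := by
    by_contra! h
    obtain ⟨z, hz, hzT⟩ := hne
    obtain ⟨y, hy, r, rfl⟩ := hdec z hz
    refine hzT fun a ha => ?_
    rw [map_add, map_smul, h a ha, hB a ha y hy]
    simp
  obtain ⟨u, hu1, huT, huL, hdec, hau⟩ : ∃ u : V, ‖u‖ = 1 ∧
      u ∈ Submodule.span ℝ {z | ∀ a ∈ B, 0 ≤ a z} ∧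
      (∀ y ∈ L, inner ℝ u y = 0) ∧
      (∀ z ∈ Submodule.span ℝ {z | ∀ a ∈ B, 0 ≤ a z}, ∃ y ∈ L, ∃ r : ℝ, z = y + r • u) ∧
      0 < a₀ u := by
    rcases lt_or_gt_of_ne hau with h | h
    · refine ⟨-u₀, by rwa [norm_neg], Submodule.neg_mem _ huT, fun y hy => ?_, fun z hz => ?_, ?_⟩
      · rw [inner_neg_left, huL y hy, neg_zero]
      · obtain ⟨y, hy, r, rfl⟩ := hdec z hz
        exact ⟨y, hy, -r, by simp⟩
      · rw [map_neg]; linarith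
    · exact ⟨u₀, hu1, huT, huL, hdec, h⟩
  have hval : ∀ a ∈ B, ∀ y ∈ L, ∀ r : ℝ, a (y + r • u) = r * a u := fun a ha y hy r => by
    rw [map_add, map_smul, hB a ha y hy, zero_add, smul_eq_mul]
  have hpos : ∀ y ∈ L, ∀ r : ℝ, (∀ a ∈ B, 0 ≤ a (y + r • u)) → 0 ≤ r := by
    intro y hy r h
    have := h a₀ ha₀
    rw [hval _ ha₀ y hy] at this
    exact nonneg_of_mul_nonneg_left this hau
  obtain ⟨y₁, hy₁, r₁, hr₁, hm₁⟩ : ∃ y ∈ L, ∃ r : ℝ, 0 < r ∧ ∀ a ∈ B, 0 ≤ a (y + r • u) := by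
    by_contra! h
    have : Submodule.span ℝ {z | ∀ a ∈ B, 0 ≤ a z} ≤ L := by
      refine Submodule.span_le.2 fun z hz => ?_
      obtain ⟨y, hy, r, rfl⟩ := hdec z (Submodule.subset_span hz)
      have hr0 : r = 0 := by
        refine le_antisymm (le_of_not_gt fun hr => ?_) (hpos y hy r hz)
        obtain ⟨a, ha, hlt⟩ := h y hy r hr
        exact absurd (hz a ha) (not_le.2 hlt)
      simpa [hr0] using hy
    have := Submodule.finrank_mono this
    omega
  refine ⟨u, hu1, huT, huL, hdec, ?_⟩
  ext z
  constructor
  · intro hz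
    obtain ⟨y, hy, r, rfl⟩ := hdec z (Submodule.subset_span hz)
    exact ⟨y, hy, r, hpos y hy r hz, rfl⟩
  · rintro ⟨y, hy, r, hr, rfl⟩ a ha
    rw [hval a ha y hy]
    have := hm₁ a ha
    rw [hval a ha y₁ hy₁] at this
    exact mul_nonneg hr (nonneg_of_mul_nonneg_right this hr₁)

end Ray

/-! ### Existence and bounds of dihedral angles -/

section Dihedral

variable {n : ℕ}

theorem IsTangentCone.locallyWedge {E K T : Set (Space n)} (h : IsTangentCone E K T)
    (hE : IsPolyCone E) {u w : Space n} {α β : ℝ} (hT : T = wedge (Submodule.span ℝ E) u w α β) :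
    LocallyWedge (trace K) (trace E) u w α β := by
  intro x hx
  rw [relInt_trace hE] at hx
  rw [span_trace hE]
  filter_upwards [nhdsWithin_le_nhds (h.eventually x hx.2), self_mem_nhdsWithin] with z h1 h2
  have h3 : z ∈ trace K ↔ z ∈ K := ⟨fun h => h.2, fun h => ⟨h2, h⟩⟩
  rw [h3, h1, hT]
  rfl

theorem ray_eq_wedge_zero {V : Type*} [AddCommGroup V] [Module ℝ V] (L : Submodule ℝ V) (u w : V) :
    {z | ∃ y ∈ L, ∃ r : ℝ, 0 ≤ r ∧ z = y + r • u} = wedge L u w 0 0 := by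
  rw [wedge_self]
  simp

theorem ray_eq_wedge_pi {V : Type*} [AddCommGroup V] [Module ℝ V] (L : Submodule ℝ V) (u w : V) :
    {z | ∃ y ∈ L, ∃ r : ℝ, 0 ≤ r ∧ z = y + r • (-u)} = wedge L u w Real.pi Real.pi := by
  rw [wedge_self]
  simp

theorem exists_unit_orthogonal (M : Submodule ℝ (Space n)) (hM : Module.finrank ℝ M ≤ n) :
    ∃ w : Space n, ‖w‖ = 1 ∧ ∀ y ∈ M, inner ℝ w y = 0 := by
  have h1 := M.finrank_add_finrank_orthogonal
  rw [finrank_euclideanSpace_fin] at h1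
  have h2 : 0 < Module.finrank ℝ Mᗮ := by omega
  obtain ⟨v, hv⟩ := (Module.finrank_pos_iff_exists_ne_zero (R := ℝ) (M := Mᗮ)).1 h2
  have hv' : (v : Space n) ≠ 0 := by simpa using hv
  refine ⟨‖(v : Space n)‖⁻¹ • (v : Space n), ?_, fun y hy => ?_⟩
  · rw [norm_smul, norm_inv, norm_norm, inv_mul_cancel₀ (norm_ne_zero_iff.2 hv')]
  · rw [real_inner_smul_left, real_inner_comm, (Submodule.mem_orthogonal M _).1 v.2 y hy, mul_zero]

theorem eq_or_eq_neg_of_mem {L : Submodule ℝ (Space n)} {u u' : Space n} (hu : ‖u‖ = 1)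
    (hu' : ‖u'‖ = 1) (huL : ∀ y ∈ L, inner ℝ u y = 0) (huL' : ∀ y ∈ L, inner ℝ u' y = 0)
    (h : ∃ y ∈ L, ∃ r : ℝ, u' = y + r • u) : u' = u ∨ u' = -u := by
  obtain ⟨y, hy, r, h⟩ := h
  have hy0 : y = 0 := by
    have : inner ℝ y y = 0 := by
      have h1 : y = u' - r • u := by rw [h]; abel
      calc inner ℝ y y = inner ℝ (u' - r • u) y := by rw [← h1]
        _ = 0 := by rw [inner_sub_left, real_inner_smul_left, huL' y hy, huL y hy]; simp
    exact inner_self_eq_zero.1 this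
  rw [hy0, zero_add] at h
  have : |r| = 1 := by
    rw [h, norm_smul, hu, mul_one, Real.norm_eq_abs] at hu'
    exact hu'
  rcases (abs_eq zero_le_one).1 this with h1 | h1 <;> rw [h1] at h
  · left; simpa using h
  · right; simpa using h

/-- Tangent data of a facet `F` along its boundary ridge `E`: the unit vector `u` points from `E`
into `F`. -/
structure IsFacetDirection (E F : Set (Space n)) (u : Space n) : Prop where
  norm_eq : ‖u‖ = 1
  mem_span : u ∈ Submodule.span ℝ F
  orthogonal : ∀ y ∈ Submodule.span ℝ E, inner ℝ u y = 0
  decompose : ∀ z ∈ Submodule.span ℝ F, ∃ y ∈ Submodule.span ℝ E, ∃ r : ℝ, z = y + r • u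
  tangent : IsTangentCone E F {z | ∃ y ∈ Submodule.span ℝ E, ∃ r : ℝ, 0 ≤ r ∧ z = y + r • u}

theorem exists_isFacetDirection {E F : Set (Space n)} (hE : IsPolyCone E) (hF : IsPolyCone F)
    (hEF : E ⊆ F)
    (hr : Module.finrank ℝ (Submodule.span ℝ F) = Module.finrank ℝ (Submodule.span ℝ E) + 1)
    (hd : Disjoint (rint E) (rint F)) : ∃ u : Space n, IsFacetDirection E F u := by
  obtain ⟨T, hT⟩ := exists_isTangentCone hF hEF
  have hs := hT.span_eq hE hEF
  obtain ⟨u, hu1, huT, huL, hdec, hTe⟩ := exists_ray hT.polyOver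
    (by rw [hs]; exact Submodule.span_mono hEF) (by rw [hs, hr]) (hT.exists_not_mem hE hEF hd)
  rw [hs] at huT hdec
  exact ⟨u, hu1, huT, huL, hdec, by rwa [← hTe]⟩

/-- The points `x + t • u` are interior to the half-space that is tangent to `F`. This detects
overlaps: two facets at `E` with the same direction would have common relative interior points. -/
theorem IsFacetDirection.eventually_mem_rint {E F : Set (Space n)} (hE : IsPolyCone E)
    (hEF : E ⊆ F) {u : Space n} (hu : IsFacetDirection E F u)
    {x : Space n} (hx : x ∈ rint E) : ∀ᶠ t : ℝ in 𝓝[>] 0, x + t • u ∈ rint F := by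
  have h1 := (tendsto_add_smul x u).eventually (hu.tangent.eventually_rint hE hEF hx)
  filter_upwards [h1, self_mem_nhdsWithin] with t ht ht0
  have ht0 : 0 < t := ht0
  have hval : ∀ y ∈ Submodule.span ℝ E, ∀ r : ℝ, inner ℝ u (y + r • u) = r := by
    intro y hy r
    rw [inner_add_right, hu.orthogonal y hy, real_inner_smul_right, real_inner_self_eq_norm_sq,
      hu.norm_eq]
    ring
  refine ht (mem_rint_of_isOpen (U := {z | 0 < inner ℝ u z})
    ⟨x, Submodule.subset_span hx.1, t, ht0.le, rfl⟩
    (isOpen_lt continuous_const (by fun_prop)) ?_ ?_)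
  · change 0 < inner ℝ u (x + t • u)
    rw [hval x (Submodule.subset_span hx.1)]
    exact ht0
  · intro z hz hzs
    rw [hu.tangent.span_eq hE hEF] at hzs
    obtain ⟨y, hy, r, rfl⟩ := hu.decompose z hzs
    change 0 < inner ℝ u (y + r • u) at hz
    rw [hval y hy] at hz
    exact ⟨y, hy, r, hz.le, rfl⟩

/-- If the tangent cone `T` of `G` along `E` contains `v`, but `v` points into a set whose relative
interior misses that of `G`, some supporting functional of `T` vanishes at `v`. -/
theorem exists_supporting {E F G T : Set (Space n)} (hE : IsPolyCone E) (hEG : E ⊆ G)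
    (hTG : IsTangentCone E G T) {B : Finset (Space n →L[ℝ] ℝ)}
    (hB : ∀ a ∈ B, ∀ y ∈ Submodule.span ℝ E, a y = 0) (hTB : T = {z | ∀ a ∈ B, 0 ≤ a z})
    {x v v' : Space n} (hx : x ∈ rint E) (hv : ∀ a ∈ B, 0 ≤ a v)
    (hdec : ∀ z ∈ Submodule.span ℝ G, ∃ y ∈ Submodule.span ℝ E, ∃ b c : ℝ,
      z = y + (b • v + c • v'))
    (hra : ∀ᶠ t : ℝ in 𝓝[>] 0, x + t • v ∈ rint F) (hdF : Disjoint (rint F) (rint G)) :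
    ∃ a ∈ B, a v = 0 ∧ a v' ≠ 0 := by
  by_contra! hall
  -- If every functional that vanishes at `v` also vanished at `v'`, it would vanish on the whole
  -- span. Only functionals positive at `v` would then constrain `T`, making the ray along `v`
  -- interior to `T` and the set `F` overlap the interior of `G`.
  have hint : ∀ t : ℝ, 0 < t → x + t • v ∈ rint T := by
    intro t ht
    have hpos : ∀ a ∈ B, 0 < a v → 0 < a (x + t • v) := by
      intro a ha hav
      rw [map_add, map_smul, hB a ha x (Submodule.subset_span hx.1), zero_add, smul_eq_mul]
      exact mul_pos ht hav
    refine mem_rint_of_isOpen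
      (U := ⋂ a ∈ B.filter (fun a => 0 < a v), {z | 0 < a z}) ?_ ?_ ?_ ?_
    · rw [hTB]
      intro a ha
      rw [map_add, map_smul, hB a ha x (Submodule.subset_span hx.1), zero_add, smul_eq_mul]
      exact mul_nonneg ht.le (hv a ha)
    · exact isOpen_biInter_finset fun a _ => isOpen_lt continuous_const a.continuous
    · simp only [mem_iInter]
      intro a ha
      exact hpos a (Finset.mem_filter.1 ha).1 (Finset.mem_filter.1 ha).2
    · intro z hz hzs
      rw [hTG.span_eq hE hEG] at hzs
      simp only [mem_iInter] at hz
      rw [hTB]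
      intro a ha
      rcases (hv a ha).eq_or_lt with h0 | h0
      · obtain ⟨y, hy, b, c, rfl⟩ := hdec z hzs
        rw [map_add, map_add, map_smul, map_smul, hB a ha y hy, ← h0, hall a ha h0.symm]
        simp
      · exact le_of_lt (hz a (Finset.mem_filter.2 ⟨ha, h0⟩))
  obtain ⟨t, ⟨h1, h2⟩, ht⟩ := ((hra.and ((tendsto_add_smul x v).eventually
    (hTG.eventually_rint hE hEG hx))).and self_mem_nhdsWithin).exists
  exact Set.disjoint_left.1 hdF h1 (h2 (hint t ht))

/-- The unit vector completing `u` to an orthonormal basis of the plane of `u`, `u'`. -/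
theorem exists_angle {u u' : Space n} (hu : ‖u‖ = 1) (hu' : ‖u'‖ = 1) (hne : u' ≠ u)
    (hneg : u' ≠ -u) : ∃ θ : ℝ, ∃ w : Space n, 0 < θ ∧ θ < Real.pi ∧ Real.cos θ = inner ℝ u u' ∧
      ‖w‖ = 1 ∧ inner ℝ u w = 0 ∧ u' = Real.cos θ • u + Real.sin θ • w ∧
      w = (Real.sin θ)⁻¹ • (u' - Real.cos θ • u) := by
  have hle : |inner ℝ u u'| ≤ 1 := by
    have := abs_real_inner_le_norm u u'
    rwa [hu, hu', mul_one] at this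
  have hlt1 : inner ℝ u u' < 1 := lt_of_le_of_ne (abs_le.1 hle).2 fun h =>
    hne ((inner_eq_one_iff_of_norm_eq_one hu hu').1 h).symm
  have hgt1 : -1 < inner ℝ u u' := lt_of_le_of_ne (abs_le.1 hle).1 fun h => by
    have h1 : inner ℝ u (-u') = 1 := by rw [inner_neg_right, ← h, neg_neg]
    have := (inner_eq_one_iff_of_norm_eq_one hu (by rwa [norm_neg])).1 h1
    exact hneg (by rw [this, neg_neg])
  obtain ⟨θ, hθ⟩ : ∃ θ, θ = Real.arccos (inner ℝ u u') := ⟨_, rfl⟩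
  have hcos : Real.cos θ = inner ℝ u u' := by rw [hθ, Real.cos_arccos hgt1.le hlt1.le]
  have hθ0 : 0 < θ := by rw [hθ]; exact Real.arccos_pos.2 hlt1
  have hθpi : θ < Real.pi := lt_of_le_of_ne (by rw [hθ]; exact Real.arccos_le_pi _) fun h => by
    rw [h, Real.cos_pi] at hcos
    linarith
  have hsin : 0 < Real.sin θ := Real.sin_pos_of_pos_of_lt_pi hθ0 hθpi
  obtain ⟨w, hw⟩ : ∃ w, w = (Real.sin θ)⁻¹ • (u' - Real.cos θ • u) := ⟨_, rfl⟩
  have hu'w : u' = Real.cos θ • u + Real.sin θ • w := by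
    rw [hw, smul_smul, mul_inv_cancel₀ hsin.ne', one_smul]; abel
  have huw : inner ℝ u w = 0 := by
    rw [hw, real_inner_smul_right, inner_sub_right, real_inner_smul_right,
      real_inner_self_eq_norm_sq, hu, ← hcos]
    ring
  have hw1 : ‖w‖ = 1 := by
    have h1 : inner ℝ u' u' = 1 := by rw [real_inner_self_eq_norm_sq, hu']; norm_num
    rw [hu'w, inner_add_left, inner_add_right, inner_add_right] at h1
    simp only [real_inner_smul_left, real_inner_smul_right] at h1
    rw [real_inner_comm u w, huw, real_inner_self_eq_norm_sq, real_inner_self_eq_norm_sq, hu] at h1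
    have h2 : Real.sin θ ^ 2 * (‖w‖ ^ 2 - 1) = 0 := by
      linear_combination h1 - Real.sin_sq_add_cos_sq θ
    have h3 : ‖w‖ ^ 2 - 1 = 0 := by
      rcases mul_eq_zero.1 h2 with h | h
      · exact absurd h (by positivity)
      · exact h
    nlinarith [norm_nonneg w]
  exact ⟨θ, w, hθ0, hθpi, hcos, hw1, huw, hu'w, hw⟩

/-- The polyhedral cones `F`, `F'` are two facets of `G` meeting along the ridge `E`; the rank of
`G` exceeds that of `E` by `k`, so that `k = 1` if `G` is flat and `k = 2` otherwise. -/
structure IsRidge (k : ℕ) (E F F' G : Set (Space n)) : Prop where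
  polyE : IsPolyCone E
  polyF : IsPolyCone F
  polyF' : IsPolyCone F'
  polyG : IsPolyCone G
  EF : E ⊆ F
  EF' : E ⊆ F'
  FG : F ⊆ G
  FG' : F' ⊆ G
  rankF : Module.finrank ℝ (Submodule.span ℝ F) = Module.finrank ℝ (Submodule.span ℝ E) + 1
  rankF' : Module.finrank ℝ (Submodule.span ℝ F') = Module.finrank ℝ (Submodule.span ℝ E) + 1
  rankG : Module.finrank ℝ (Submodule.span ℝ G) = Module.finrank ℝ (Submodule.span ℝ E) + k
  disjEF : Disjoint (rint E) (rint F)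
  disjEF' : Disjoint (rint E) (rint F')

/-- Modulo the span of `E`, the tangent cone of `G` is a convex cone in a plane that contains the
directions `u`, `u'` of the two facets. They differ because the interiors of the facets are
disjoint. If they are opposite, the cone is a half-plane and the facets have the same span;
otherwise it is the sector between them, of angle less than `π`. -/
theorem IsRidge.exists_isDihedralAngle {E F F' G : Set (Space n)} (h : IsRidge 2 E F F' G)
    (hdEG : Disjoint (rint E) (rint G)) (hdFG : Disjoint (rint F) (rint G))
    (hdFG' : Disjoint (rint F') (rint G)) (hdFF' : Disjoint (rint F) (rint F')) :
    ∃ θ ≤ Real.pi, IsDihedralAngle (trace G) (trace E) (trace F) (trace F') θ ∧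
      (Submodule.span ℝ F ≠ Submodule.span ℝ F' → θ < Real.pi) ∧
      (Submodule.span ℝ F = Submodule.span ℝ F' → θ = Real.pi) := by
  have hpi := Real.pi_pos
  have hE := h.polyE
  have hEG : E ⊆ G := h.EF.trans h.FG
  obtain ⟨u, hu⟩ := exists_isFacetDirection hE h.polyF h.EF h.rankF h.disjEF
  obtain ⟨u', hu'⟩ := exists_isFacetDirection hE h.polyF' h.EF' h.rankF' h.disjEF'
  obtain ⟨T, hTG⟩ := exists_isTangentCone h.polyG hEG
  have hsT := hTG.span_eq hE hEG
  obtain ⟨x, hx⟩ := hE.rint_nonempty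
  have huT : u ∈ T := hu.tangent.mono hTG hE h.FG ⟨0, Submodule.zero_mem _, 1, zero_le_one, by simp⟩
  have huT' : u' ∈ T :=
    hu'.tangent.mono hTG hE h.FG' ⟨0, Submodule.zero_mem _, 1, zero_le_one, by simp⟩
  have hra := hu.eventually_mem_rint hE h.EF hx
  have hra' := hu'.eventually_mem_rint hE h.EF' hx
  have hne : u' ≠ u := by
    rintro rfl
    obtain ⟨t, h1, h2⟩ := (hra.and hra').exists
    exact Set.disjoint_left.1 hdFF' h1 h2
  have horth : ∀ y ∈ trace E, inner ℝ u y = 0 :=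
    fun y hy => hu.orthogonal y (Submodule.subset_span hy.2)
  by_cases hneg : u' = -u
  · have hspanFF' : Submodule.span ℝ F = Submodule.span ℝ F' := by
      refine Submodule.eq_of_le_of_finrank_eq (fun z hz => ?_) (by rw [h.rankF, h.rankF'])
      obtain ⟨y, hy, r, rfl⟩ := hu.decompose z hz
      refine Submodule.add_mem _ (Submodule.span_mono h.EF' hy) (Submodule.smul_mem _ _ ?_)
      have := hu'.mem_span
      rw [hneg] at this
      exact (Submodule.neg_mem_iff _).1 this
    -- A functional nonnegative at `u` and at `-u` vanishes at `u`. The lineality space therefore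
    -- contains the span of `F`, and `exists_ray` applies over it.
    have hover : IsPolyConeOver (Submodule.span ℝ F) T := by
      obtain ⟨B, hB, hTB⟩ := hTG.polyOver
      refine ⟨B, fun a ha z hz => ?_, hTB⟩
      obtain ⟨y, hy, r, rfl⟩ := hu.decompose z hz
      have h1 : 0 ≤ a u := by rw [hTB] at huT; exact huT a ha
      have h2 : 0 ≤ a u' := by rw [hTB] at huT'; exact huT' a ha
      rw [hneg, map_neg] at h2
      rw [map_add, map_smul, hB a ha y hy, le_antisymm (by linarith) h1]
      simp
    obtain ⟨w, hw, -, hwF, -, hTw⟩ := exists_ray hover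
      (by rw [hsT]; exact Submodule.span_mono h.FG) (by rw [hsT, h.rankG, h.rankF])
      (hTG.exists_not_mem hE hEG hdEG)
    refine ⟨Real.pi, le_rfl, ⟨hpi.le, by linarith, u, w, hu.norm_eq, hw, ?_, ?_, ?_, ?_,
      Or.inl ?_⟩, ?_, ?_⟩
    · rw [real_inner_comm]; exact hwF u hu.mem_span
    · exact fun y hy => ⟨horth y hy, hwF y (Submodule.subset_span (h.EF hy.2))⟩
    · exact hu.tangent.locallyWedge hE (ray_eq_wedge_zero _ u w)
    · have hT' := hu'.tangent
      rw [hneg] at hT'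
      exact hT'.locallyWedge hE (ray_eq_wedge_pi _ u w)
    · refine hTG.locallyWedge hE ?_
      rw [wedge_pi, hTw]
      ext z
      constructor
      · rintro ⟨m, hm, r, hr, rfl⟩
        obtain ⟨y, hy, a, rfl⟩ := hu.decompose m hm
        exact ⟨y, hy, a, r, hr, by abel⟩
      · rintro ⟨y, hy, a, b, hb, rfl⟩
        exact ⟨y + a • u, Submodule.add_mem _ (Submodule.span_mono h.EF hy)
          (Submodule.smul_mem _ _ hu.mem_span), b, hb, by abel⟩
    · exact fun h => absurd hspanFF' h
    · exact fun _ => rfl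
  · have hu'F : u' ∉ Submodule.span ℝ F := fun h' =>
      (eq_or_eq_neg_of_mem hu.norm_eq hu'.norm_eq hu.orthogonal hu'.orthogonal
        (hu.decompose u' h')).elim hne hneg
    have hsup : Submodule.span ℝ F ⊔ Submodule.span ℝ F' = Submodule.span ℝ G := by
      refine Submodule.eq_of_le_of_finrank_le
        (sup_le (Submodule.span_mono h.FG) (Submodule.span_mono h.FG')) ?_
      have : Submodule.span ℝ F < Submodule.span ℝ F ⊔ Submodule.span ℝ F' :=
        lt_of_le_of_ne le_sup_left fun h' =>
          hu'F (by rw [h']; exact Submodule.mem_sup_right hu'.mem_span)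
      have := Submodule.finrank_lt_finrank_of_lt this
      have h1 := h.rankF
      have h2 := h.rankG
      omega
    have hdecG : ∀ z ∈ Submodule.span ℝ G, ∃ y ∈ Submodule.span ℝ E, ∃ a b : ℝ,
        z = y + (a • u + b • u') := by
      intro z hz
      rw [← hsup] at hz
      obtain ⟨f, hf, f', hf', rfl⟩ := Submodule.mem_sup.1 hz
      obtain ⟨y, hy, a, rfl⟩ := hu.decompose f hf
      obtain ⟨y', hy', b, rfl⟩ := hu'.decompose f' hf'
      exact ⟨y + y', Submodule.add_mem _ hy hy', a, b, by abel⟩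
    obtain ⟨B, hB, hTB⟩ := hTG.polyOver
    have hval : ∀ a ∈ B, ∀ y ∈ Submodule.span ℝ E, ∀ b c : ℝ,
        a (y + (b • u + c • u')) = b * a u + c * a u' := fun a ha y hy b c => by
      rw [map_add, hB a ha y hy, map_add, map_smul, map_smul, zero_add, smul_eq_mul, smul_eq_mul]
    have hBu : ∀ a ∈ B, 0 ≤ a u := by rw [hTB] at huT; exact huT
    have hBu' : ∀ a ∈ B, 0 ≤ a u' := by rw [hTB] at huT'; exact huT'
    -- A functional vanishing at `u` but not at `u'` bounds the coefficient of `u'` from below by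
    -- zero, and vice versa; together the two confine `T` to the sector.
    obtain ⟨a₁, ha₁, h1u, h1u'⟩ := exists_supporting hE hEG hTG hB hTB hx hBu hdecG hra hdFG
    obtain ⟨a₂, ha₂, h2u', h2u⟩ := exists_supporting hE hEG hTG hB hTB hx hBu' (fun z hz => by
      obtain ⟨y, hy, b, c, rfl⟩ := hdecG z hz
      exact ⟨y, hy, c, b, by abel⟩) hra' hdFG'
    have hTe : T = {z | ∃ y ∈ Submodule.span ℝ E, ∃ a b : ℝ, 0 ≤ a ∧ 0 ≤ b ∧
        z = y + (a • u + b • u')} := by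
      ext z
      constructor
      · intro hz
        have hzs : z ∈ Submodule.span ℝ G := by rw [← hsT]; exact Submodule.subset_span hz
        obtain ⟨y, hy, b, c, rfl⟩ := hdecG z hzs
        rw [hTB] at hz
        have h3 := hz a₁ ha₁
        have h4 := hz a₂ ha₂
        rw [hval _ ha₁ y hy, h1u, mul_zero, zero_add] at h3
        rw [hval _ ha₂ y hy, h2u', mul_zero, add_zero] at h4
        exact ⟨y, hy, b, c,
          nonneg_of_mul_nonneg_left h4 (lt_of_le_of_ne (hBu _ ha₂) h2u.symm),
          nonneg_of_mul_nonneg_left h3 (lt_of_le_of_ne (hBu' _ ha₁) h1u'.symm), rfl⟩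
      · rintro ⟨y, hy, b, c, hb, hc, rfl⟩
        rw [hTB]
        intro a ha
        rw [hval a ha y hy]
        exact add_nonneg (mul_nonneg hb (hBu a ha)) (mul_nonneg hc (hBu' a ha))
    obtain ⟨θ, w, hθ0, hθpi, hcos, hw1, huw, hu'w, hw⟩ :=
      exists_angle hu.norm_eq hu'.norm_eq hne hneg
    refine ⟨θ, hθpi.le, ⟨hθ0.le, by linarith, u, w, hu.norm_eq, hw1, huw, ?_, ?_, ?_, Or.inl ?_⟩,
      fun _ => hθpi, fun h' => absurd hu'.mem_span (by rw [← h']; exact hu'F)⟩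
    · intro y hy
      refine ⟨horth y hy, ?_⟩
      rw [hw, real_inner_smul_left, inner_sub_left, real_inner_smul_left,
        hu'.orthogonal y (Submodule.subset_span hy.2), horth y hy]
      ring
    · exact hu.tangent.locallyWedge hE (ray_eq_wedge_zero _ u w)
    · refine hu'.tangent.locallyWedge hE ?_
      rw [wedge_self, ← hu'w]
    · refine hTG.locallyWedge hE ?_
      rw [wedge_eq _ _ _ hθ0 hθpi, ← hu'w, hTe]

/-- In the span of a flat `G` the only unit normals of `E` are `u` and `-u`, and disjoint interiors
exclude equal directions. The second frame vector is any unit normal of `G`; the rank bound `hn`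
provides one. -/
theorem IsRidge.isDihedralAngle_pi_of_flat {E F F' G : Set (Space n)} (h : IsRidge 1 E F F' G)
    (hn : Module.finrank ℝ (Submodule.span ℝ G) ≤ n) (hdFF' : Disjoint (rint F) (rint F')) :
    IsDihedralAngle (trace G) (trace E) (trace F) (trace F') Real.pi := by
  have hpi := Real.pi_pos
  have hE := h.polyE
  obtain ⟨u, hu⟩ := exists_isFacetDirection hE h.polyF h.EF h.rankF h.disjEF
  obtain ⟨u', hu'⟩ := exists_isFacetDirection hE h.polyF' h.EF' h.rankF' h.disjEF'
  obtain ⟨x, hx⟩ := hE.rint_nonempty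
  have hne : u' ≠ u := by
    rintro rfl
    obtain ⟨t, h1, h2⟩ := ((hu.eventually_mem_rint hE h.EF hx).and
      (hu'.eventually_mem_rint hE h.EF' hx)).exists
    exact Set.disjoint_left.1 hdFF' h1 h2
  have hGF : Submodule.span ℝ G = Submodule.span ℝ F :=
    (Submodule.eq_of_le_of_finrank_eq (Submodule.span_mono h.FG) (by rw [h.rankF, h.rankG])).symm
  have hneg : u' = -u := by
    refine (eq_or_eq_neg_of_mem hu.norm_eq hu'.norm_eq hu.orthogonal hu'.orthogonal
      (hu.decompose u' ?_)).resolve_left hne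
    rw [← hGF]
    exact Submodule.span_mono h.FG' hu'.mem_span
  obtain ⟨w, hw, hwG⟩ := exists_unit_orthogonal _ hn
  rw [hGF] at hwG
  refine ⟨hpi.le, by linarith, u, w, hu.norm_eq, hw, ?_, ?_, ?_, ?_, Or.inr ⟨?_, rfl⟩⟩
  · rw [real_inner_comm]; exact hwG u hu.mem_span
  · exact fun y hy => ⟨hu.orthogonal y (Submodule.subset_span hy.2),
      hwG y (Submodule.subset_span (h.EF hy.2))⟩
  · exact hu.tangent.locallyWedge hE (ray_eq_wedge_zero _ u w)
  · have hT' := hu'.tangent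
    rw [hneg] at hT'
    exact hT'.locallyWedge hE (ray_eq_wedge_pi _ u w)
  · rw [span_trace h.polyG, span_trace h.polyF, hGF]

/-- Here `E` lies on the boundary of `G`, so that modulo `E` the tangent cone of `G` is a single
half-line. By monotonicity of tangent cones both facets have its direction. -/
theorem IsRidge.isDihedralAngle_zero_of_flat {E F F' G : Set (Space n)} (h : IsRidge 1 E F F' G)
    (hn : Module.finrank ℝ (Submodule.span ℝ G) ≤ n) (hdEG : Disjoint (rint E) (rint G)) :
    IsDihedralAngle (trace G) (trace E) (trace F) (trace F') 0 := by
  have hpi := Real.pi_pos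
  have hE := h.polyE
  obtain ⟨u, hu⟩ := exists_isFacetDirection hE h.polyG (h.EF.trans h.FG) h.rankG hdEG
  have same : ∀ F₀ : Set (Space n), IsPolyCone F₀ → E ⊆ F₀ → F₀ ⊆ G →
      Module.finrank ℝ (Submodule.span ℝ F₀) = Module.finrank ℝ (Submodule.span ℝ E) + 1 →
      Disjoint (rint E) (rint F₀) →
      IsTangentCone E F₀ {z | ∃ y ∈ Submodule.span ℝ E, ∃ r : ℝ, 0 ≤ r ∧ z = y + r • u} := by
    intro F₀ hF₀ hEF₀ hFG₀ hr₀ hd₀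
    obtain ⟨u', hu'⟩ := exists_isFacetDirection hE hF₀ hEF₀ hr₀ hd₀
    have hmem : u' ∈ {z | ∃ y ∈ Submodule.span ℝ E, ∃ r : ℝ, 0 ≤ r ∧ z = y + r • u'} :=
      ⟨0, Submodule.zero_mem _, 1, zero_le_one, by simp⟩
    obtain ⟨y, hy, r, hr, h⟩ := hu'.tangent.mono hu.tangent hE hFG₀ hmem
    rcases eq_or_eq_neg_of_mem hu.norm_eq hu'.norm_eq hu.orthogonal hu'.orthogonal
      ⟨y, hy, r, h⟩ with h1 | h1
    · rw [← h1]
      exact hu'.tangent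
    · exfalso
      have h2 : inner ℝ u u' = r := by
        rw [h, inner_add_right, hu.orthogonal y hy, real_inner_smul_right,
          real_inner_self_eq_norm_sq, hu.norm_eq]
        ring
      rw [h1, inner_neg_right, real_inner_self_eq_norm_sq, hu.norm_eq] at h2
      linarith
  obtain ⟨w, hw, hwG⟩ := exists_unit_orthogonal _ hn
  refine ⟨le_rfl, by linarith, u, w, hu.norm_eq, hw, ?_, ?_, ?_, ?_, Or.inl ?_⟩
  · rw [real_inner_comm]; exact hwG u hu.mem_span
  · exact fun y hy => ⟨hu.orthogonal y (Submodule.subset_span hy.2),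
      hwG y (Submodule.subset_span ((h.EF.trans h.FG) hy.2))⟩
  · exact (same F h.polyF h.EF h.FG h.rankF h.disjEF).locallyWedge hE (ray_eq_wedge_zero _ u w)
  · exact (same F' h.polyF' h.EF' h.FG' h.rankF' h.disjEF').locallyWedge hE
      (ray_eq_wedge_zero _ u w)
  · exact hu.tangent.locallyWedge hE (ray_eq_wedge_zero _ u w)

end Dihedral

/-! ### Area as the Lebesgue measure of a truncated cone -/

section Area

open scoped ENNReal Pointwise

theorem IsPolyCone.isClosed {V : Type*} [NormedAddCommGroup V] [NormedSpace ℝ V] {K : Set V}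
    (h : IsPolyCone K) : IsClosed K := by
  obtain ⟨A, rfl⟩ := h
  have : {x | ∀ a ∈ A, 0 ≤ a x} = ⋂ a ∈ A, {x | 0 ≤ a x} := by ext; simp
  rw [this]
  exact isClosed_biInter fun a _ => isClosed_le continuous_const a.continuous

/-- By definition `toSphere` measures a set by the dimension times the volume of the punctured unit
cone over it. The isometry `φ` transports that cone to coordinates, and since `d` is positive the
missing origin is a null set. -/
theorem toSphere_real_trace {n d : ℕ} (hd : 0 < d) {K : Set (Space n)} (hK : IsPolyCone K)
    (φ : EuclideanSpace ℝ (Fin d) →ₗᵢ[ℝ] Space n) {L : Submodule ℝ (Space n)}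
    (hL : LinearMap.range φ.toLinearMap = L) :
    ((stdOrthonormalBasis ℝ L).toBasis.addHaar).toSphere.real {x | ((x : L) : Space n) ∈ trace K} =
      d * (volume {y | φ y ∈ K ∧ ‖y‖ < 1}).toReal := by
  subst hL
  set e := φ.equivRange with he
  have hfin : Module.finrank ℝ (LinearMap.range φ.toLinearMap) = d := by
    rw [← e.toLinearEquiv.finrank_eq, finrank_euclideanSpace_fin]
  have hne : Nontrivial (LinearMap.range φ.toLinearMap) := by
    apply Module.nontrivial_of_finrank_pos (R := ℝ)
    omega
  have hmeas : MeasurableSet {x : Metric.sphere (0 : LinearMap.range φ.toLinearMap) 1 |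
      ((x : LinearMap.range φ.toLinearMap) : Space n) ∈ trace K} := by
    have hcl : IsClosed (trace K) :=
      (Metric.isClosed_sphere (x := (0 : Space n)) (ε := 1)).inter hK.isClosed
    exact (hcl.preimage (continuous_subtype_val.comp continuous_subtype_val)).measurableSet
  rw [OrthonormalBasis.addHaar_eq_volume, Measure.real, Measure.toSphere_apply' _ hmeas, hfin,
    ENNReal.toReal_mul, ENNReal.toReal_natCast]
  congr 2
  have hset : Ioo (0 : ℝ) 1 • ((↑) '' {x : Metric.sphere (0 : LinearMap.range φ.toLinearMap) 1 |
      ((x : LinearMap.range φ.toLinearMap) : Space n) ∈ trace K} :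
        Set (LinearMap.range φ.toLinearMap)) =
      e '' ({y | φ y ∈ K ∧ ‖y‖ < 1} \ {0}) := by
    ext z
    rw [Set.mem_smul]
    constructor
    · rintro ⟨r, hr, _, ⟨x, hx, rfl⟩, rfl⟩
      obtain ⟨y, hy⟩ := e.surjective (x : LinearMap.range φ.toLinearMap)
      have hx1 : ‖(x : LinearMap.range φ.toLinearMap)‖ = 1 := by simpa using x.2
      have hy1 : ‖y‖ = 1 := by rw [← e.norm_map, hy, hx1]
      have hφy : φ y = ((x : LinearMap.range φ.toLinearMap) : Space n) := by rw [← hy]; rfl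
      refine ⟨r • y, ⟨⟨?_, ?_⟩, ?_⟩, by rw [map_smul, hy]⟩
      · rw [map_smul, hφy]
        exact hK.smul_mem hx.2 hr.1.le
      · rw [norm_smul, hy1, mul_one, Real.norm_eq_abs, abs_of_pos hr.1]
        exact hr.2
      · rw [mem_singleton_iff, smul_eq_zero, not_or]
        exact ⟨hr.1.ne', fun h => by rw [h, norm_zero] at hy1; exact zero_ne_one hy1⟩
    · rintro ⟨y, ⟨⟨hy1, hy2⟩, hy0⟩, rfl⟩
      have hn : 0 < ‖y‖ := norm_pos_iff.2 hy0
      have h1 : ‖e (‖y‖⁻¹ • y)‖ = 1 := by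
        rw [e.norm_map, norm_smul, norm_inv, norm_norm, inv_mul_cancel₀ hn.ne']
      refine ⟨‖y‖, ⟨hn, hy2⟩, e (‖y‖⁻¹ • y), ⟨⟨_, by simpa using h1⟩, ?_, rfl⟩, ?_⟩
      · have h2 : ((e (‖y‖⁻¹ • y) : LinearMap.range φ.toLinearMap) : Space n) = ‖y‖⁻¹ • φ y := by
          rw [map_smul]; rfl
        refine ⟨mem_unitSphere.2 h1, ?_⟩
        change ((e (‖y‖⁻¹ • y) : LinearMap.range φ.toLinearMap) : Space n) ∈ K
        rw [h2]
        exact hK.smul_mem hy1 (by positivity)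
      · change ‖y‖ • e (‖y‖⁻¹ • y) = e y
        rw [← map_smul, smul_smul, mul_inv_cancel₀ hn.ne', one_smul]
  rw [hset]
  have hnull : volume ({y | φ y ∈ K ∧ ‖y‖ < 1} \ {0}) = volume {y | φ y ∈ K ∧ ‖y‖ < 1} := by
    have : Nonempty (Fin d) := ⟨⟨0, hd⟩⟩
    exact measure_sdiff_null (by simp)
  rw [← hnull]
  have hmp := e.measurePreserving
  rw [← hmp.map_eq]
  have : (Measure.map (⇑e) volume) (e '' ({y | φ y ∈ K ∧ ‖y‖ < 1} \ {0})) = _ :=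
    (e.toHomeomorph.toMeasurableEquiv.map_apply _)
  rw [this]
  congr 1
  exact e.toEquiv.preimage_image _

/-- The area of the trace of a cone, in isometric coordinates `φ` on its linear span. -/
theorem area_trace {n d : ℕ} (hd : 0 < d) {K : Set (Space n)} (hK : IsPolyCone K)
    (φ : EuclideanSpace ℝ (Fin d) →ₗᵢ[ℝ] Space n)
    (hφ : LinearMap.range φ.toLinearMap = Submodule.span ℝ K) :
    area (trace K) = d * (volume {y | φ y ∈ K ∧ ‖y‖ < 1}).toReal :=
  toSphere_real_trace hd hK φ (by rw [hφ, span_trace hK])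

/-- Splitting off the first coordinate. -/
def splitEquiv (d : ℕ) : EuclideanSpace ℝ (Fin (d + 1)) ≃L[ℝ] EuclideanSpace ℝ (Fin d) × ℝ :=
  LinearEquiv.toContinuousLinearEquiv
    { toFun := fun x => (WithLp.toLp 2 fun i => x i.succ, x 0)
      invFun := fun p => WithLp.toLp 2 (Fin.cons p.2 p.1)
      map_add' := fun x y => rfl
      map_smul' := fun r x => rfl
      left_inv := fun x => by
        ext i
        refine Fin.cases ?_ (fun j => ?_) i <;> simp
      right_inv := fun p => by
        ext i <;> simp }

theorem splitEquiv_apply {d : ℕ} (x : EuclideanSpace ℝ (Fin (d + 1))) :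
    splitEquiv d x = (WithLp.toLp 2 fun i => x i.succ, x 0) := rfl

theorem norm_sq_eq_split {d : ℕ} (x : EuclideanSpace ℝ (Fin (d + 1))) :
    ‖x‖ ^ 2 = ‖(splitEquiv d x).1‖ ^ 2 + (splitEquiv d x).2 ^ 2 := by
  rw [EuclideanSpace.norm_sq_eq, EuclideanSpace.norm_sq_eq, Fin.sum_univ_succ, add_comm]
  simp [splitEquiv_apply]

theorem volume_preserving_splitEquiv (d : ℕ) :
    MeasurePreserving (splitEquiv d) volume (volume.prod volume) := by
  have h1 := PiLp.volume_preserving_ofLp (Fin (d + 1))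
  have h2 := volume_preserving_piFinSuccAbove (fun _ : Fin (d + 1) => ℝ) 0
  have h3 := (MeasurePreserving.id (volume : Measure ℝ)).prod (PiLp.volume_preserving_toLp (Fin d))
  have h4 := (Measure.measurePreserving_swap (μ := (volume : Measure ℝ))
    (ν := (volume : Measure (EuclideanSpace ℝ (Fin d)))))
  exact h4.comp (h3.comp (h2.comp h1))

end Area

/-! ### Area of a suspension -/

section Lift

open scoped ENNReal Pointwise

/-- The shear `(z, t) ↦ (z, t - g z)`. -/
def shear {V : Type*} [NormedAddCommGroup V] [NormedSpace ℝ V] [FiniteDimensional ℝ V]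
    (g : V →L[ℝ] ℝ) : (V × ℝ) ≃L[ℝ] (V × ℝ) :=
  LinearEquiv.toContinuousLinearEquiv
    { toFun := fun p => (p.1, p.2 - g p.1)
      invFun := fun p => (p.1, p.2 + g p.1)
      map_add' := fun x y => by ext <;> simp; ring
      map_smul' := fun r x => by ext <;> simp; ring
      left_inv := fun x => by ext <;> simp
      right_inv := fun x => by ext <;> simp }

/-- Coordinates of `ℝⁿ⁺²` as `ℝⁿ⁺¹ × ℝ`, sheared along the graph of `g`. -/
def liftEquiv {n : ℕ} (g : Space n →L[ℝ] ℝ) : Space (n + 1) ≃L[ℝ] Space n × ℝ :=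
  (splitEquiv (n + 1)).trans (shear g)

theorem liftEquiv_apply {n : ℕ} (g : Space n →L[ℝ] ℝ) (x : Space (n + 1)) :
    liftEquiv g x = ((splitEquiv (n + 1) x).1, (splitEquiv (n + 1) x).2 - g (splitEquiv (n + 1) x).1) :=
  rfl

/-- Extension of an isometry by the identity in the first coordinate. -/
def extendIsometry {n d : ℕ} (φ : EuclideanSpace ℝ (Fin d) →ₗᵢ[ℝ] Space n) :
    EuclideanSpace ℝ (Fin (d + 1)) →ₗᵢ[ℝ] Space (n + 1) where
  toFun y := (splitEquiv (n + 1)).symm (φ (splitEquiv d y).1, (splitEquiv d y).2)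
  map_add' x y := by rw [← map_add]; simp
  map_smul' r x := by rw [RingHom.id_apply, ← map_smul]; simp
  norm_map' y := by
    refine (sq_eq_sq₀ (norm_nonneg _) (norm_nonneg _)).1 ?_
    rw [norm_sq_eq_split, norm_sq_eq_split y]
    simp

theorem split_extendIsometry {n d : ℕ} (φ : EuclideanSpace ℝ (Fin d) →ₗᵢ[ℝ] Space n)
    (y : EuclideanSpace ℝ (Fin (d + 1))) : splitEquiv (n + 1) (extendIsometry φ y) =
      (φ (splitEquiv d y).1, (splitEquiv d y).2) :=
  (splitEquiv (n + 1)).apply_symm_apply _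

/-- Sheared coordinates describe the cone but are not isometric. The area is computed in the
orthogonal splitting instead, where the shear appears as the condition on `p.2 - g (φ p.1)`. -/
theorem area_lift {n d : ℕ} {K : Set (Space n)} (hK : IsPolyCone K) {J : Set ℝ}
    (hJ : IsPolyCone J) (hJs : Submodule.span ℝ J = ⊤)
    (φ : EuclideanSpace ℝ (Fin d) →ₗᵢ[ℝ] Space n)
    (hφ : LinearMap.range φ.toLinearMap = Submodule.span ℝ K) (g : Space n →L[ℝ] ℝ) :
    area (trace (liftEquiv g ⁻¹' (K ×ˢ J))) = (d + 1 : ℕ) *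
      ((volume.prod volume) {p : EuclideanSpace ℝ (Fin d) × ℝ | φ p.1 ∈ K ∧ p.2 - g (φ p.1) ∈ J ∧
        ‖p.1‖ ^ 2 + p.2 ^ 2 < 1}).toReal := by
  have hpoly : IsPolyCone (liftEquiv g ⁻¹' (K ×ˢ J)) :=
    (hK.prod hJ).preimage (liftEquiv g : Space (n + 1) →L[ℝ] Space n × ℝ)
  rw [area_trace (Nat.succ_pos d) hpoly (extendIsometry φ)]
  · congr 2
    have hme : MeasurableEmbedding (splitEquiv d) :=
      (splitEquiv d).toHomeomorph.measurableEmbedding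
    rw [← (volume_preserving_splitEquiv d).measure_preimage_emb hme]
    congr 1
    ext y
    have h1 : ‖y‖ < 1 ↔ ‖(splitEquiv d y).1‖ ^ 2 + (splitEquiv d y).2 ^ 2 < 1 := by
      rw [← norm_sq_eq_split, sq_lt_one_iff₀ (norm_nonneg y)]
    simp only [mem_ofPred_eq, mem_preimage, h1, liftEquiv_apply, split_extendIsometry, mem_prod]
    tauto
  · rw [span_preimage, span_prod hK.zero_mem hJ.zero_mem, hJs, ← hφ]
    ext x
    constructor
    · rintro ⟨y, rfl⟩
      refine ⟨⟨(splitEquiv d y).1, ?_⟩, Submodule.mem_top⟩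
      change _ = (splitEquiv (n + 1) (extendIsometry φ y)).1
      rw [split_extendIsometry]
      rfl
    · rintro ⟨⟨z, hz⟩, -⟩
      refine ⟨(splitEquiv d).symm (z, (splitEquiv (n + 1) x).2), ?_⟩
      apply (splitEquiv (n + 1)).injective
      change splitEquiv (n + 1) (extendIsometry φ _) = _
      rw [split_extendIsometry, ContinuousLinearEquiv.apply_symm_apply]
      exact Prod.ext hz rfl

/-- The factor by which the volume of the unit ball grows from dimension `d` to `d + 1`. -/
def ballRatio (d : ℕ) : ℝ≥0∞ := ∫⁻ t in Ioo (-1 : ℝ) 1, ENNReal.ofReal (√(1 - t ^ 2)) ^ d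

theorem measurableSet_normSq_lt_one (d : ℕ) :
    MeasurableSet {p : EuclideanSpace ℝ (Fin d) × ℝ | ‖p.1‖ ^ 2 + p.2 ^ 2 < 1} :=
  (isOpen_lt (by fun_prop) continuous_const).measurableSet

/-- Fubini: the slice at height `t` is the part of the cone `A` in the unit ball, scaled by `√(1 - t
^ 2)`. The factor `ballRatio d` does not depend on `A`, which is why suspension rescales all areas
equally. -/
theorem volume_prod_cone {d : ℕ} {A : Set (EuclideanSpace ℝ (Fin d))} (hA : MeasurableSet A)
    (hcone : ∀ r : ℝ, 0 < r → ∀ z, r • z ∈ A ↔ z ∈ A) :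
    (volume.prod volume) {p : EuclideanSpace ℝ (Fin d) × ℝ | p.1 ∈ A ∧ ‖p.1‖ ^ 2 + p.2 ^ 2 < 1} =
      ballRatio d * volume {z | z ∈ A ∧ ‖z‖ < 1} := by
  have hm : MeasurableSet {p : EuclideanSpace ℝ (Fin d) × ℝ | p.1 ∈ A ∧ ‖p.1‖ ^ 2 + p.2 ^ 2 < 1} :=
    (measurable_fst hA).inter (measurableSet_normSq_lt_one d)
  rw [Measure.prod_apply_symm hm]
  have hsec : ∀ t : ℝ, volume ((fun z => (z, t)) ⁻¹'
      {p : EuclideanSpace ℝ (Fin d) × ℝ | p.1 ∈ A ∧ ‖p.1‖ ^ 2 + p.2 ^ 2 < 1}) =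
      (Ioo (-1 : ℝ) 1).indicator (fun t => ENNReal.ofReal (√(1 - t ^ 2)) ^ d *
        volume {z | z ∈ A ∧ ‖z‖ < 1}) t := by
    intro t
    by_cases ht : t ∈ Ioo (-1 : ℝ) 1
    · rw [indicator_of_mem ht]
      have h1 : 0 < 1 - t ^ 2 := by nlinarith [ht.1, ht.2]
      have hs : 0 < √(1 - t ^ 2) := Real.sqrt_pos.2 h1
      have : (fun z => (z, t)) ⁻¹' {p : EuclideanSpace ℝ (Fin d) × ℝ |
          p.1 ∈ A ∧ ‖p.1‖ ^ 2 + p.2 ^ 2 < 1} = √(1 - t ^ 2) • {z | z ∈ A ∧ ‖z‖ < 1} := by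
        ext z
        rw [mem_smul_set_iff_inv_smul_mem₀ hs.ne']
        simp only [mem_preimage, mem_ofPred_eq]
        rw [hcone _ (inv_pos.2 hs), norm_smul, norm_inv, Real.norm_eq_abs, abs_of_pos hs,
          inv_mul_lt_one₀ hs, Real.lt_sqrt (norm_nonneg z)]
        refine and_congr_right fun _ => ⟨fun h => by linarith, fun h => by linarith⟩
      rw [this, Measure.addHaar_smul, finrank_euclideanSpace_fin, abs_of_pos (by positivity),
        ENNReal.ofReal_pow hs.le]
    · rw [indicator_of_notMem ht]
      have : (fun z => (z, t)) ⁻¹' {p : EuclideanSpace ℝ (Fin d) × ℝ |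
          p.1 ∈ A ∧ ‖p.1‖ ^ 2 + p.2 ^ 2 < 1} = ∅ := by
        ext z
        simp only [mem_preimage, mem_ofPred_eq, mem_empty_iff_false, iff_false, not_and, not_lt]
        intro _
        have : 1 ≤ t ^ 2 := by
          rw [mem_Ioo, not_and_or] at ht
          rcases ht with h | h <;> nlinarith
        nlinarith [sq_nonneg ‖z‖]
      rw [this, measure_empty]
  simp_rw [hsec]
  rw [lintegral_indicator measurableSet_Ioo, lintegral_mul_const]
  · rfl
  · fun_prop

theorem volume_ball_split (d : ℕ) :
    volume (Metric.ball (0 : EuclideanSpace ℝ (Fin (d + 1))) 1) =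
      (volume.prod volume) {p : EuclideanSpace ℝ (Fin d) × ℝ | ‖p.1‖ ^ 2 + p.2 ^ 2 < 1} := by
  have hme : MeasurableEmbedding (splitEquiv d) :=
    (splitEquiv d).toHomeomorph.measurableEmbedding
  rw [← (volume_preserving_splitEquiv d).measure_preimage_emb hme]
  congr 1
  ext y
  rw [mem_ball_zero_iff, ← sq_lt_one_iff₀ (norm_nonneg y), norm_sq_eq_split]
  rfl

theorem volume_ball_succ (d : ℕ) :
    volume (Metric.ball (0 : EuclideanSpace ℝ (Fin (d + 1))) 1) =
      ballRatio d * volume (Metric.ball (0 : EuclideanSpace ℝ (Fin d)) 1) := by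
  rw [volume_ball_split]
  have := volume_prod_cone (d := d) MeasurableSet.univ (fun r _ z => by simp)
  simp only [mem_univ, true_and] at this
  rw [this]
  congr 2
  ext z
  simp

theorem sphereVolume_eq (n : ℕ) : sphereVolume n =
    n * (volume (Metric.ball (0 : EuclideanSpace ℝ (Fin n)) 1)).toReal := by
  rw [sphereVolume, Measure.toSphere_real_apply_univ, finrank_euclideanSpace_fin]
  rfl

theorem volume_ball_toReal_pos (n : ℕ) :
    0 < (volume (Metric.ball (0 : EuclideanSpace ℝ (Fin n)) 1)).toReal :=
  ENNReal.toReal_pos (Metric.measure_ball_pos _ _ one_pos).ne' measure_ball_lt_top.ne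

theorem sphereVolume_pos {n : ℕ} (hn : 0 < n) : 0 < sphereVolume n := by
  rw [sphereVolume_eq]
  have := volume_ball_toReal_pos n
  positivity

theorem sphereVolume_two : sphereVolume 2 = 2 * Real.pi := by
  rw [sphereVolume_eq, EuclideanSpace.volume_ball_fin_two]
  simp [Real.pi_pos.le]

theorem exists_isometry_range {n d : ℕ} (L : Submodule ℝ (Space n)) (h : Module.finrank ℝ L = d) :
    ∃ φ : EuclideanSpace ℝ (Fin d) →ₗᵢ[ℝ] Space n, LinearMap.range φ.toLinearMap = L := by
  refine ⟨L.subtypeₗᵢ.comp ((stdOrthonormalBasis ℝ L).reindex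
    (finCongr h)).repr.symm.toLinearIsometry, ?_⟩
  ext x
  constructor
  · rintro ⟨y, rfl⟩
    exact Subtype.coe_prop _
  · intro hx
    exact ⟨((stdOrthonormalBasis ℝ L).reindex (finCongr h)).repr ⟨x, hx⟩, by simp⟩

theorem IsPolyCone.smul_mem_iff {V : Type*} [NormedAddCommGroup V] [NormedSpace ℝ V] {K : Set V}
    (hK : IsPolyCone K) {r : ℝ} (hr : 0 < r) {z : V} : r • z ∈ K ↔ z ∈ K := by
  refine ⟨fun h => ?_, fun h => hK.smul_mem h hr.le⟩
  have := hK.smul_mem h (inv_nonneg.2 hr.le)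
  rwa [smul_smul, inv_mul_cancel₀ hr.ne', one_smul] at this

theorem span_univ_real : Submodule.span ℝ (univ : Set ℝ) = ⊤ := Submodule.span_univ

/-- Suspension multiplies the area of a facet by the ratio of the sphere volumes. -/
theorem area_lift_univ {n : ℕ} (hn : 0 < n) {K : Set (Space n)} (hK : IsPolyCone K)
    (hr : Module.finrank ℝ (Submodule.span ℝ K) = n) (g : Space n →L[ℝ] ℝ) :
    area (trace (liftEquiv g ⁻¹' (K ×ˢ univ))) =
      area (trace K) / sphereVolume n * sphereVolume (n + 1) := by
  obtain ⟨φ, hφ⟩ := exists_isometry_range _ hr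
  rw [area_lift hK IsPolyCone.univ span_univ_real φ hφ, area_trace hn hK φ hφ]
  have hA : MeasurableSet (φ ⁻¹' K) := (hK.isClosed.preimage φ.continuous).measurableSet
  have h1 := volume_prod_cone hA (fun r hr z => by
    rw [mem_preimage, map_smul, hK.smul_mem_iff hr]; rfl)
  have h2 : {p : EuclideanSpace ℝ (Fin n) × ℝ | φ p.1 ∈ K ∧ p.2 - g (φ p.1) ∈ (univ : Set ℝ) ∧
      ‖p.1‖ ^ 2 + p.2 ^ 2 < 1} = {p | p.1 ∈ φ ⁻¹' K ∧ ‖p.1‖ ^ 2 + p.2 ^ 2 < 1} := by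
    ext p; simp
  rw [h2, h1, sphereVolume_eq, sphereVolume_eq, volume_ball_succ, ENNReal.toReal_mul,
    ENNReal.toReal_mul]
  have h3 := volume_ball_toReal_pos n
  have hn' : (n : ℝ) ≠ 0 := by positivity
  have h4 : {z | z ∈ φ ⁻¹' K ∧ ‖z‖ < 1} = {y | φ y ∈ K ∧ ‖y‖ < 1} := rfl
  rw [h4]
  push_cast
  field_simp

end Lift

/-! ### Cutting a suspended facet into pieces of prescribed areas -/

section Split

open scoped ENNReal

variable {d : ℕ}

theorem volume_graph_null {X : Type*} [MeasurableSpace X] {μ : Measure X} [SFinite μ]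
    (f : X → ℝ) (hf : Measurable f) : (μ.prod (volume : Measure ℝ)) {p | p.2 = f p.1} = 0 := by
  have hm : MeasurableSet {p : X × ℝ | p.2 = f p.1} :=
    measurableSet_eq_fun measurable_snd (hf.comp measurable_fst)
  rw [Measure.measure_prod_null hm]
  refine Eventually.of_forall fun x => ?_
  have : Prod.mk x ⁻¹' {p : X × ℝ | p.2 = f p.1} = {f x} := by ext t; simp
  change volume (Prod.mk x ⁻¹' {p : X × ℝ | p.2 = f p.1}) = 0
  rw [this]
  simp

/-- The volume above the graph of `l * f` depends continuously on `l`, because graphs are null sets.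
It tends to zero as `l → ∞` and to the full volume as `l → -∞`, because `f` is positive almost
everywhere on `A`. The intermediate value theorem gives `l`. -/
theorem exists_split_slope {A : Set (EuclideanSpace ℝ (Fin d))} (hA : MeasurableSet A)
    (f : EuclideanSpace ℝ (Fin d) →L[ℝ] ℝ) (hf : ∀ z ∈ A, 0 ≤ f z) (hf0 : ∃ z, f z ≠ 0) {s : ℝ}
    (hs : 0 < s)
    (hs' : s < ((volume.prod volume) {p : EuclideanSpace ℝ (Fin d) × ℝ |
      p.1 ∈ A ∧ ‖p.1‖ ^ 2 + p.2 ^ 2 < 1}).toReal) :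
    ∃ l : ℝ, ((volume.prod volume) {p : EuclideanSpace ℝ (Fin d) × ℝ |
        p.1 ∈ A ∧ p.2 - l * f p.1 ∈ Ici 0 ∧ ‖p.1‖ ^ 2 + p.2 ^ 2 < 1}).toReal = s ∧
      ((volume.prod volume) {p : EuclideanSpace ℝ (Fin d) × ℝ |
        p.1 ∈ A ∧ p.2 - l * f p.1 ∈ Iic 0 ∧ ‖p.1‖ ^ 2 + p.2 ^ 2 < 1}).toReal =
      ((volume.prod volume) {p : EuclideanSpace ℝ (Fin d) × ℝ |
        p.1 ∈ A ∧ ‖p.1‖ ^ 2 + p.2 ^ 2 < 1}).toReal - s := by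
  set μ : Measure (EuclideanSpace ℝ (Fin d) × ℝ) := volume.prod volume with hμ
  set D : Set (EuclideanSpace ℝ (Fin d) × ℝ) := {p | p.1 ∈ A ∧ ‖p.1‖ ^ 2 + p.2 ^ 2 < 1} with hD
  set U : ℝ → Set (EuclideanSpace ℝ (Fin d) × ℝ) := fun l =>
    {p | p.1 ∈ A ∧ p.2 - l * f p.1 ∈ Ici 0 ∧ ‖p.1‖ ^ 2 + p.2 ^ 2 < 1} with hU
  set U' : ℝ → Set (EuclideanSpace ℝ (Fin d) × ℝ) := fun l =>
    {p | p.1 ∈ A ∧ p.2 - l * f p.1 ∈ Iic 0 ∧ ‖p.1‖ ^ 2 + p.2 ^ 2 < 1} with hU'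
  have hball : MeasurableSet {p : EuclideanSpace ℝ (Fin d) × ℝ | ‖p.1‖ ^ 2 + p.2 ^ 2 < 1} :=
    measurableSet_normSq_lt_one d
  have hDm : MeasurableSet D := (measurable_fst hA).inter hball
  have hUm : ∀ l, MeasurableSet (U l) := fun l => (measurable_fst hA).inter
    (MeasurableSet.inter (isClosed_Ici.preimage (by fun_prop :
      Continuous fun p : EuclideanSpace ℝ (Fin d) × ℝ => p.2 - l * f p.1)).measurableSet hball)
  have hUm' : ∀ l, MeasurableSet (U' l) := fun l => (measurable_fst hA).inter
    (MeasurableSet.inter (isClosed_Iic.preimage (by fun_prop :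
      Continuous fun p : EuclideanSpace ℝ (Fin d) × ℝ => p.2 - l * f p.1)).measurableSet hball)
  have hfin : μ D ≠ ∞ := by
    have hsub : D ⊆ {p : EuclideanSpace ℝ (Fin d) × ℝ | ‖p.1‖ ^ 2 + p.2 ^ 2 < 1} :=
      fun p hp => hp.2
    refine ne_top_of_le_ne_top ?_ (measure_mono hsub)
    rw [hμ, ← volume_ball_split]
    exact measure_ball_lt_top.ne
  have hUD : ∀ l, U l ⊆ D := fun l p hp => ⟨hp.1, hp.2.2⟩
  have hgraph : ∀ l : ℝ, ∀ᵐ p ∂μ, p.2 ≠ l * f p.1 := fun l => by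
    rw [ae_iff]
    simpa using volume_graph_null (μ := (volume : Measure (EuclideanSpace ℝ (Fin d))))
      (fun z => l * f z) (by fun_prop)
  have hker : ∀ᵐ p ∂μ, f p.1 ≠ 0 := by
    have : ∀ᵐ z : EuclideanSpace ℝ (Fin d), f z ≠ 0 := by
      rw [ae_iff]
      have := Measure.addHaar_submodule (volume : Measure (EuclideanSpace ℝ (Fin d)))
        (LinearMap.ker (f : EuclideanSpace ℝ (Fin d) →ₗ[ℝ] ℝ)) (by
          intro h
          obtain ⟨z, hz⟩ := hf0
          have : z ∈ LinearMap.ker (f : EuclideanSpace ℝ (Fin d) →ₗ[ℝ] ℝ) := by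
            rw [h]; exact Submodule.mem_top
          exact hz this)
      convert this using 2
      ext z
      simp
    exact Measure.quasiMeasurePreserving_fst.ae this
  -- Dominated convergence of indicators inside `D`, stated for any filter so that it gives both
  -- continuity and the two limits at infinity.
  have htend : ∀ (L : Filter ℝ) [IsCountablyGenerated L] (B : Set (EuclideanSpace ℝ (Fin d) × ℝ)),
      MeasurableSet B → (∀ᵐ p ∂μ, ∀ᶠ l in L, p ∈ U l ↔ p ∈ B) →
      Tendsto (fun l => (μ (U l)).toReal) L (𝓝 (μ B).toReal) ∨ μ B = ∞ := by
    intro L _ B hB h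
    by_cases hBt : μ B = ∞
    · exact Or.inr hBt
    · exact Or.inl ((ENNReal.tendsto_toReal hBt).comp (tendsto_measure_of_ae_tendsto_indicator L hB
        hUm hDm hfin (Eventually.of_forall hUD) h))
  have hcont : Continuous fun l => (μ (U l)).toReal := by
    rw [continuous_iff_continuousAt]
    intro l₀
    refine (htend (𝓝 l₀) (U l₀) (hUm l₀) ?_).resolve_right
      (ne_top_of_le_ne_top hfin (measure_mono (hUD l₀)))
    filter_upwards [hgraph l₀] with p hp
    have hc : Continuous fun l : ℝ => p.2 - l * f p.1 := by fun_prop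
    have : ∀ᶠ l in 𝓝 l₀, 0 ≤ p.2 - l * f p.1 ↔ 0 ≤ p.2 - l₀ * f p.1 := by
      rcases lt_or_gt_of_ne hp with h | h
      · filter_upwards [hc.continuousAt.eventually (gt_mem_nhds (sub_neg.2 h))] with l hl
        constructor <;> intro h' <;> linarith
      · filter_upwards [hc.continuousAt.eventually (lt_mem_nhds (sub_pos.2 h))] with l hl
        constructor <;> intro h' <;> linarith
    filter_upwards [this] with l hl
    simp only [hU, mem_ofPred_eq, mem_Ici, hl]
  have htop : Tendsto (fun l => (μ (U l)).toReal) atTop (𝓝 0) := by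
    have := (htend atTop ∅ MeasurableSet.empty ?_).resolve_right (by simp)
    · simpa using this
    filter_upwards [hker] with p hp
    by_cases hpA : p.1 ∈ A
    · have hpos : 0 < f p.1 := lt_of_le_of_ne (hf _ hpA) hp.symm
      filter_upwards [eventually_gt_atTop (p.2 / f p.1)] with l hl
      rw [div_lt_iff₀ hpos] at hl
      simp only [hU, mem_ofPred_eq, mem_Ici, mem_empty_iff_false, iff_false]
      rintro ⟨-, h, -⟩
      linarith
    · exact Eventually.of_forall fun l => by simp [hU, hpA]
  have hbot : Tendsto (fun l => (μ (U l)).toReal) atBot (𝓝 (μ D).toReal) := by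
    refine (htend atBot D hDm ?_).resolve_right hfin
    filter_upwards [hker] with p hp
    by_cases hpA : p.1 ∈ A
    · have hpos : 0 < f p.1 := lt_of_le_of_ne (hf _ hpA) hp.symm
      filter_upwards [eventually_lt_atBot (p.2 / f p.1)] with l hl
      rw [lt_div_iff₀ hpos] at hl
      have : 0 ≤ p.2 - l * f p.1 := by linarith
      simp [hU, hD, hpA]
      intro _
      linarith
    · exact Eventually.of_forall fun l => by simp [hU, hD, hpA]
  obtain ⟨l, hl⟩ : s ∈ range fun l => (μ (U l)).toReal :=
    mem_range_of_exists_le_of_exists_ge hcont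
      ((htop.eventually (gt_mem_nhds hs)).exists.imp fun _ h => le_of_lt h)
      ((hbot.eventually (lt_mem_nhds hs')).exists.imp fun _ h => le_of_lt h)
  refine ⟨l, hl, ?_⟩
  have hun : U l ∪ U' l = D := by
    ext p
    simp only [hU, hU', hD, mem_union, mem_ofPred_eq, mem_Ici, mem_Iic]
    constructor
    · rintro (h | h) <;> exact ⟨h.1, h.2.2⟩
    · intro h
      exact (le_total 0 (p.2 - l * f p.1)).imp (fun h' => ⟨h.1, h', h.2⟩) fun h' => ⟨h.1, h', h.2⟩
  have hdis : AEDisjoint μ (U l) (U' l) := by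
    refine measure_mono_null (fun p hp => ?_) (volume_graph_null
      (μ := (volume : Measure (EuclideanSpace ℝ (Fin d)))) (fun z => l * f z) (by fun_prop))
    have h1 : 0 ≤ p.2 - l * f p.1 := hp.1.2.1
    have h2 : p.2 - l * f p.1 ≤ 0 := hp.2.2.1
    change p.2 = l * f p.1
    linarith
  have hsum : μ D = μ (U l) + μ (U' l) := by
    rw [← hun, measure_union₀ (hUm' l).nullMeasurableSet hdis]
  have hl' : (μ (U l)).toReal = s := hl
  rw [hsum, ENNReal.toReal_add, hl']
  · ring
  · exact ne_top_of_le_ne_top hfin (measure_mono (hUD l))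
  · exact ne_top_of_le_ne_top hfin (measure_mono fun p hp => ⟨hp.1, hp.2.2⟩)

/-- The suspension of a facet can be cut by the graph of a linear functional into two cells of
prescribed areas. -/
theorem exists_lift_area {n : ℕ} {K : Set (Space n)} {k : ℕ} (hK : IsConeCell k K) (hk : k + 1 = n)
    {s s' : ℝ} (hs : 0 < s) (hs' : 0 < s')
    (h : area (trace K) / sphereVolume n * sphereVolume (n + 1) = s + s') :
    ∃ g : Space n →L[ℝ] ℝ, area (trace (liftEquiv g ⁻¹' (K ×ˢ Ici 0))) = s ∧
      area (trace (liftEquiv g ⁻¹' (K ×ˢ Iic 0))) = s' := by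
  have hr : Module.finrank ℝ (Submodule.span ℝ K) = n := by rw [hK.finrank_span, hk]
  have hspan : ∀ J : Set ℝ, (∃ x ∈ J, x ≠ 0) → Submodule.span ℝ J = ⊤ := by
    rintro J ⟨x, hx, hx0⟩
    refine eq_top_iff.2 fun y _ => ?_
    have := Submodule.smul_mem (Submodule.span ℝ J) (y / x) (Submodule.subset_span hx)
    rwa [smul_eq_mul, div_mul_cancel₀ _ hx0] at this
  obtain ⟨A, hA⟩ := id hK.poly
  obtain ⟨x, hx, hx'⟩ := hK.pointed
  -- Pointedness provides a functional that is nonnegative and not identically zero on `K`. Its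
  -- multiples are the slopes among which the cut is sought.
  obtain ⟨a, haA, hax⟩ : ∃ a ∈ A, a x ≠ 0 := by
    by_contra! h0
    refine hx' ?_
    rw [hA]
    intro a ha
    rw [map_neg, h0 a ha, neg_zero]
  have haK : ∀ z ∈ K, 0 ≤ a z := fun z hz => by rw [hA] at hz; exact hz a haA
  obtain ⟨φ, hφ⟩ := exists_isometry_range _ hr
  have hm : MeasurableSet (φ ⁻¹' K) := (hK.poly.isClosed.preimage φ.continuous).measurableSet
  -- The total area does not depend on the shear, so it may be computed without one. Areas are `n +
  -- 1` times solid volumes, hence the division of `s` below.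
  have htot := area_lift_univ (by omega) hK.poly hr 0
  rw [h, area_lift hK.poly IsPolyCone.univ span_univ_real φ hφ] at htot
  have hD : {p : EuclideanSpace ℝ (Fin n) × ℝ | φ p.1 ∈ K ∧
      p.2 - (0 : Space n →L[ℝ] ℝ) (φ p.1) ∈ (univ : Set ℝ) ∧
      ‖p.1‖ ^ 2 + p.2 ^ 2 < 1} = {p | p.1 ∈ φ ⁻¹' K ∧ ‖p.1‖ ^ 2 + p.2 ^ 2 < 1} := by
    ext p; simp
  rw [hD] at htot
  have hn : (0 : ℝ) < (n + 1 : ℕ) := by positivity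
  obtain ⟨l, h1, h2⟩ := exists_split_slope hm (a.comp φ.toContinuousLinearMap)
    (fun z hz => haK _ hz) (by
      have : x ∈ LinearMap.range φ.toLinearMap := by rw [hφ]; exact Submodule.subset_span hx
      obtain ⟨z, rfl⟩ := this
      exact ⟨z, hax⟩) (s := s / (n + 1 : ℕ)) (by positivity) (by
      rw [div_lt_iff₀ hn, mul_comm, htot]; linarith)
  refine ⟨l • a, ?_, ?_⟩
  · rw [area_lift hK.poly isPolyCone_Ici (hspan _ ⟨1, by simp, one_ne_zero⟩) φ hφ]
    refine Eq.trans ?_ (mul_div_cancel₀ s hn.ne')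
    rw [← h1]
    rfl
  · rw [area_lift hK.poly isPolyCone_Iic (hspan _ ⟨-1, by simp, by simp⟩) φ hφ]
    have h3 : ((n + 1 : ℕ) : ℝ) * (((volume.prod volume) {p : EuclideanSpace ℝ (Fin n) × ℝ |
        p.1 ∈ φ ⁻¹' K ∧ ‖p.1‖ ^ 2 + p.2 ^ 2 < 1}).toReal - s / (n + 1 : ℕ)) = s' := by
      rw [mul_sub, htot, mul_div_cancel₀ _ hn.ne']
      ring
    rw [← h3, ← h2]
    rfl

end Split

/-! ### Lengths of arcs -/

section Arc

open scoped ENNReal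

/-- In polar coordinates the integral factors into that of `r` over the unit interval and the length
of the interval of angles. -/
theorem volume_complex_sector {s : ℝ} (hs0 : 0 ≤ s) (hs : s ≤ Real.pi) :
    volume {z : ℂ | 0 ≤ z.arg ∧ z.arg ≤ s ∧ ‖z‖ < 1} = ENNReal.ofReal (s / 2) := by
  set S : Set ℂ := {z : ℂ | 0 ≤ z.arg ∧ z.arg ≤ s ∧ ‖z‖ < 1} with hS
  have hSm : MeasurableSet S := by
    have h1 : MeasurableSet {z : ℂ | 0 ≤ z.arg} := measurableSet_le measurable_const Complex.measurable_arg
    have h2 : MeasurableSet {z : ℂ | z.arg ≤ s} := measurableSet_le Complex.measurable_arg measurable_const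
    exact h1.inter (h2.inter (isOpen_lt continuous_norm continuous_const).measurableSet)
  rw [← lintegral_indicator_one hSm, ← Complex.lintegral_comp_polarCoord_symm]
  have h1 : ∫⁻ p in polarCoord.target, ENNReal.ofReal p.1 •
      S.indicator (1 : ℂ → ℝ≥0∞) (Complex.polarCoord.symm p) =
      ∫⁻ p in polarCoord.target, (Ioo (0 : ℝ) 1).indicator (fun r => ENNReal.ofReal r) p.1 *
        (Icc 0 s).indicator 1 p.2 := by
    refine setLIntegral_congr_fun polarCoord.open_target.measurableSet fun p hp => ?_
    obtain ⟨h0, hpi⟩ : 0 < p.1 ∧ p.2 ∈ Ioo (-Real.pi) Real.pi := hp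
    have harg : (Complex.polarCoord.symm p).arg = p.2 := by
      rw [Complex.polarCoord_symm_apply]
      exact_mod_cast Complex.arg_mul_cos_add_sin_mul_I h0 ⟨hpi.1, hpi.2.le⟩
    have hn : ‖Complex.polarCoord.symm p‖ = p.1 := by
      rw [Complex.norm_polarCoord_symm, abs_of_pos h0]
    simp only [hS, indicator_apply, mem_ofPred_eq, harg, hn, smul_eq_mul, mem_Ioo, mem_Icc, h0,
      true_and, Pi.one_apply]
    by_cases h1 : p.1 < 1 <;> by_cases h2 : 0 ≤ p.2 <;> by_cases h3 : p.2 ≤ s <;>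
      simp [h1, h2, h3]
  rw [h1, show (polarCoord.target : Set (ℝ × ℝ)) = Ioi (0 : ℝ) ×ˢ Ioo (-Real.pi) Real.pi from rfl,
    Measure.volume_eq_prod, ← Measure.prod_restrict, lintegral_prod_mul]
  · have h2 : ∫⁻ r in Ioi (0 : ℝ), (Ioo (0 : ℝ) 1).indicator (fun r => ENNReal.ofReal r) r =
        ENNReal.ofReal (1 / 2) := by
      rw [lintegral_indicator measurableSet_Ioo, Measure.restrict_restrict measurableSet_Ioo,
        inter_eq_left.2 (fun x hx => hx.1), ← ofReal_integral_eq_lintegral_ofReal]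
      · congr 1
        rw [← integral_Ioc_eq_integral_Ioo, ← intervalIntegral.integral_of_le zero_le_one,
          integral_id]
        norm_num
      · exact (continuous_id.integrableOn_Icc (a := 0) (b := 1)).mono_set Ioo_subset_Icc_self
      · filter_upwards [ae_restrict_mem measurableSet_Ioo] with x hx using hx.1.le
    have h3 : ∫⁻ t in Ioo (-Real.pi) Real.pi, (Icc 0 s).indicator 1 t = ENNReal.ofReal s := by
      rw [lintegral_indicator_one measurableSet_Icc, Measure.restrict_apply measurableSet_Icc]
      refine le_antisymm ((measure_mono inter_subset_left).trans (by simp)) ?_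
      -- The open interval is used because for `s = π` the endpoint is outside the polar chart.
      have : Ioo 0 s ⊆ Icc 0 s ∩ Ioo (-Real.pi) Real.pi := fun x hx =>
        ⟨⟨hx.1.le, hx.2.le⟩, by linarith [hx.1, Real.pi_pos], by linarith [hx.2]⟩
      refine le_trans ?_ (measure_mono this)
      simp
    rw [h2, h3, ← ENNReal.ofReal_mul (by norm_num)]
    congr 1
    ring
  · exact (Measurable.indicator (by fun_prop) measurableSet_Ioo).aemeasurable
  · exact (Measurable.indicator measurable_const measurableSet_Icc).aemeasurable

variable {n : ℕ}

/-- The isometry of the plane with orthonormal frame `u`, `w`. -/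
def planeIsometry {u w : Space n} (hu : ‖u‖ = 1) (hw : ‖w‖ = 1) (huw : inner ℝ u w = 0) :
    EuclideanSpace ℝ (Fin 2) →ₗᵢ[ℝ] Space n where
  toFun y := y 0 • u + y 1 • w
  map_add' x y := by simp only [PiLp.add_apply]; module
  map_smul' r x := by simp only [PiLp.smul_apply, smul_eq_mul, RingHom.id_apply]; module
  norm_map' y := by
    change ‖y 0 • u + y 1 • w‖ = ‖y‖
    refine (sq_eq_sq₀ (norm_nonneg _) (norm_nonneg _)).1 ?_
    rw [norm_add_sq_real, norm_smul, norm_smul, hu, hw, real_inner_smul_left,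
      real_inner_smul_right, huw, EuclideanSpace.norm_sq_eq y, Fin.sum_univ_two]
    ring

theorem planeIsometry_apply {u w : Space n} (hu : ‖u‖ = 1) (hw : ‖w‖ = 1)
    (huw : inner ℝ u w = 0) (y : EuclideanSpace ℝ (Fin 2)) :
    planeIsometry hu hw huw y = y 0 • u + y 1 • w := rfl

theorem span_arc {u w : Space n} {s : ℝ} (hs0 : 0 < s) (hs : s ≤ Real.pi) :
    Submodule.span ℝ (wedge ⊥ u w 0 s) = Submodule.span ℝ {u, w} := by
  refine le_antisymm (Submodule.span_le.2 ?_) (Submodule.span_le.2 ?_)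
  · rintro z ⟨y, hy, r, φ, -, -, -, rfl⟩
    rw [(Submodule.mem_bot ℝ).1 hy, zero_add]
    refine Submodule.smul_mem _ _ (Submodule.add_mem _ (Submodule.smul_mem _ _ ?_)
      (Submodule.smul_mem _ _ ?_)) <;> exact Submodule.subset_span (by simp)
  · have h1 : u ∈ Submodule.span ℝ (wedge ⊥ u w 0 s) :=
      Submodule.subset_span ⟨0, Submodule.zero_mem _, 1, 0, zero_le_one, le_rfl, hs0.le, by simp⟩
    -- The midpoint of the arc is used since the end of an arc of length `π` is `-u` and would not
    -- give a second dimension.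
    have h2 : Real.cos (s / 2) • u + Real.sin (s / 2) • w ∈ Submodule.span ℝ (wedge ⊥ u w 0 s) :=
      Submodule.subset_span ⟨0, Submodule.zero_mem _, 1, s / 2, zero_le_one, by linarith,
        by linarith, by simp⟩
    have h3 : 0 < Real.sin (s / 2) :=
      Real.sin_pos_of_pos_of_lt_pi (by linarith) (by linarith [Real.pi_pos])
    have h4 := Submodule.sub_mem _ h2 (Submodule.smul_mem _ (Real.cos (s / 2)) h1)
    rw [add_sub_cancel_left] at h4
    rintro z (rfl | rfl)
    · exact h1
    · exact (Submodule.smul_mem_iff _ h3.ne').1 h4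

/-- The length of an arc. -/
theorem area_arc {u w : Space n} (hu : ‖u‖ = 1) (hw : ‖w‖ = 1) (huw : inner ℝ u w = 0) {s : ℝ}
    (hs0 : 0 < s) (hs : s ≤ Real.pi) (hpoly : IsPolyCone (wedge ⊥ u w 0 s)) :
    area (trace (wedge ⊥ u w 0 s)) = s := by
  have hr : LinearMap.range (planeIsometry hu hw huw).toLinearMap =
      Submodule.span ℝ (wedge ⊥ u w 0 s) := by
    rw [span_arc hs0 hs]
    ext x
    rw [Submodule.mem_span_pair]
    constructor
    · rintro ⟨y, rfl⟩
      exact ⟨y 0, y 1, rfl⟩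
    · rintro ⟨a, b, rfl⟩
      exact ⟨!₂[a, b], by simp [planeIsometry_apply]⟩
  rw [area_trace two_pos hpoly _ hr]
  have hmp := Complex.orthonormalBasisOneI.measurePreserving_repr_symm
  have hset : {y | planeIsometry hu hw huw y ∈ wedge ⊥ u w 0 s ∧ ‖y‖ < 1} =
      Complex.orthonormalBasisOneI.repr.symm ⁻¹' {z : ℂ | 0 ≤ z.arg ∧ z.arg ≤ s ∧ ‖z‖ < 1} := by
    ext y
    simp only [mem_preimage, mem_ofPred_eq, LinearIsometryEquiv.norm_map]
    rw [← and_assoc, and_congr_left_iff]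
    intro _
    set z := Complex.orthonormalBasisOneI.repr.symm y with hz
    have hzre : z.re = y 0 := by simp [hz]
    have hzim : z.im = y 1 := by simp [hz]
    constructor
    · rintro ⟨v, hv, r, φ, hr, h1, h2, h⟩
      rw [(Submodule.mem_bot ℝ).1 hv, zero_add] at h
      have hy : y = !₂[r * Real.cos φ, r * Real.sin φ] := by
        apply (planeIsometry hu hw huw).injective
        rw [h, planeIsometry_apply]
        simp [smul_smul]
      have hzr : z = r * (Complex.cos φ + Complex.sin φ * Complex.I) := by
        apply Complex.ext
        · rw [hzre, hy]; simp [Complex.cos_ofReal_re, Complex.sin_ofReal_im]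
        · rw [hzim, hy]; simp [Complex.sin_ofReal_re, Complex.cos_ofReal_im]
      rcases hr.eq_or_lt with h0 | h0
      · rw [hzr, ← h0]
        simp [hs0.le]
      · rw [hzr, Complex.arg_mul_cos_add_sin_mul_I h0 ⟨by linarith [Real.pi_pos], by linarith⟩]
        exact ⟨h1, h2⟩
    · rintro ⟨h1, h2⟩
      refine ⟨0, Submodule.zero_mem _, ‖z‖, z.arg, norm_nonneg _, h1, h2, ?_⟩
      rw [planeIsometry_apply, ← hzre, ← hzim, zero_add, smul_add, smul_smul, smul_smul,
        Complex.norm_mul_cos_arg, Complex.norm_mul_sin_arg]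
  rw [hset, hmp.measure_preimage_emb
    Complex.orthonormalBasisOneI.repr.symm.toHomeomorph.measurableEmbedding,
    volume_complex_sector hs0.le hs, ENNReal.toReal_ofReal (by linarith)]
  push_cast
  ring

/-- The cone generated by two vectors. -/
def cone2 {V : Type*} [AddCommGroup V] [Module ℝ V] (p q : V) : Set V :=
  {z | ∃ a b : ℝ, 0 ≤ a ∧ 0 ≤ b ∧ z = a • p + b • q}

theorem wedge_bot_eq_cone2 {V : Type*} [AddCommGroup V] [Module ℝ V] (u w : V) {θ : ℝ} (h0 : 0 < θ)
    (hpi : θ < Real.pi) : wedge ⊥ u w 0 θ = cone2 u (Real.cos θ • u + Real.sin θ • w) := by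
  rw [wedge_eq _ _ _ h0 hpi]
  ext z
  constructor
  · rintro ⟨y, hy, a, b, ha, hb, rfl⟩
    rw [(Submodule.mem_bot ℝ).1 hy, zero_add]
    exact ⟨a, b, ha, hb, rfl⟩
  · rintro ⟨a, b, ha, hb, rfl⟩
    exact ⟨0, Submodule.zero_mem _, a, b, ha, hb, by rw [zero_add]⟩

theorem area_cone2 {p q : Space n} (hp : ‖p‖ = 1) (hq : ‖q‖ = 1) {s : ℝ} (hs0 : 0 < s)
    (hs : s < Real.pi) (hpq : inner ℝ p q = Real.cos s) (hpoly : IsPolyCone (cone2 p q)) :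
    area (trace (cone2 p q)) = s := by
  have hlt : Real.cos s < 1 := by
    rw [← Real.cos_zero]
    exact Real.cos_lt_cos_of_nonneg_of_le_pi le_rfl hs.le hs0
  have hgt : -1 < Real.cos s := by
    rw [← Real.cos_pi]
    exact Real.cos_lt_cos_of_nonneg_of_le_pi hs0.le le_rfl hs
  obtain ⟨θ, w, h1, h2, h3, h4, h5, h6, -⟩ := exists_angle hp hq
    (by rintro rfl; rw [real_inner_self_eq_norm_sq, hp] at hpq; linarith)
    (by rintro rfl; rw [inner_neg_right, real_inner_self_eq_norm_sq, hp] at hpq; linarith)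
  have hθ : θ = s := Real.injOn_cos ⟨h1.le, h2.le⟩ ⟨hs0.le, hs.le⟩ (by rw [h3, hpq])
  subst hθ
  have h7 : cone2 p q = wedge ⊥ p w 0 θ := by rw [wedge_bot_eq_cone2 _ _ h1 h2, ← h6]
  rw [h7] at hpoly ⊢
  exact area_arc hp h4 h5 h1 h2.le hpoly

end Arc

/-! ### Simplicial cones and their faces -/

section SimplexCone

variable {V : Type*} [NormedAddCommGroup V] [NormedSpace ℝ V] [FiniteDimensional ℝ V]
  {ι : Type*} [Fintype ι]

/-- The cone generated by the vectors `v i`, `i ∈ A`. -/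
def simplexCone (v : ι → V) (A : Finset ι) : Set V :=
  {x | ∃ t : ι → ℝ, (∀ i, 0 ≤ t i) ∧ (∀ i ∉ A, t i = 0) ∧ x = ∑ i, t i • v i}

theorem simplexCone_mono (v : ι → V) {A B : Finset ι} (h : A ⊆ B) :
    simplexCone v A ⊆ simplexCone v B := by
  rintro x ⟨t, h0, hA, hx⟩
  exact ⟨t, h0, fun i hi => hA i fun h' => hi (h h'), hx⟩

theorem simplexCone_empty (v : ι → V) : simplexCone v ∅ = {0} := by
  ext x
  constructor
  · rintro ⟨t, -, hA, rfl⟩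
    exact Finset.sum_eq_zero fun i _ => by rw [hA i (by simp), zero_smul]
  · rintro rfl
    exact ⟨0, by simp, by simp, by simp⟩

theorem mem_simplexCone_self [DecidableEq ι] (v : ι → V) {A : Finset ι} {i : ι} (hi : i ∈ A) :
    v i ∈ simplexCone v A := by
  refine ⟨Pi.single i 1, fun j => ?_, fun j hj => ?_, ?_⟩
  · by_cases h : j = i
    · subst h; simp
    · simp [h]
  · rw [Pi.single_eq_of_ne]
    rintro rfl
    exact hj hi
  · rw [Finset.sum_eq_single i] <;> simp +contextual

theorem simplexCone_subset (v : ι → V) (A : Finset ι) {K : Set V} (hK : IsPolyCone K)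
    (h : ∀ i ∈ A, v i ∈ K) : simplexCone v A ⊆ K := by
  rintro x ⟨t, h0, hA, rfl⟩
  refine Finset.sum_induction (fun i => t i • v i) (· ∈ K) (fun _ _ => hK.add_mem) hK.zero_mem
    fun i _ => ?_
  by_cases hi : i ∈ A
  · exact hK.smul_mem (h i hi) (h0 i)
  · rw [hA i hi, zero_smul]
    exact hK.zero_mem

theorem simplexCone_singleton [DecidableEq ι] (v : ι → V) (i : ι) :
    simplexCone v {i} = {x | ∃ r : ℝ, 0 ≤ r ∧ x = r • v i} := by
  ext x
  constructor
  · rintro ⟨t, h0, hA, rfl⟩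
    refine ⟨t i, h0 i, Finset.sum_eq_single i (fun j _ hj => ?_) (by simp)⟩
    rw [hA j (by simpa using hj), zero_smul]
  · rintro ⟨r, hr, rfl⟩
    refine ⟨Pi.single i r, fun j => ?_, fun j hj => ?_, ?_⟩
    · by_cases h : j = i
      · subst h; simpa
      · simp [h]
    · rw [Pi.single_eq_of_ne]
      simpa using hj
    · rw [Finset.sum_eq_single i] <;> simp +contextual

theorem simplexCone_pair [DecidableEq ι] (v : ι → V) {i j : ι} (hij : i ≠ j) :
    simplexCone v {i, j} = cone2 (v i) (v j) := by
  ext x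
  constructor
  · rintro ⟨t, h0, hA, rfl⟩
    refine ⟨t i, t j, h0 i, h0 j, ?_⟩
    rw [← Finset.sum_pair (f := fun k => t k • v k) hij]
    refine (Finset.sum_subset (Finset.subset_univ _) fun k _ hk => ?_).symm
    rw [hA k hk, zero_smul]
  · rintro ⟨a, b, ha, hb, rfl⟩
    refine ⟨Pi.single i a + Pi.single j b, fun k => ?_, fun k hk => ?_, ?_⟩
    · refine add_nonneg ?_ ?_ <;> rw [Pi.single_apply] <;> split_ifs <;> simp [ha, hb]
    · simp only [Finset.mem_insert, Finset.mem_singleton, not_or] at hk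
      simp [hk.1, hk.2]
    · simp only [Pi.add_apply, add_smul, Finset.sum_add_distrib]
      congr 1
      · rw [Finset.sum_eq_single i] <;> simp +contextual
      · rw [Finset.sum_eq_single j] <;> simp +contextual

/-- The combinatorial data of a cone over a simplex at its face `B`, the empty face included. -/
structure IsSimplexFanAt (C : Finset ι → Set V) (B : Finset ι) : Prop where
  poly : IsPolyCone (C B)
  finrank_span : Module.finrank ℝ (Submodule.span ℝ (C B)) = B.card
  pointed : B.Nonempty → ∃ x ∈ C B, -x ∉ C B
  bdry : C B \ rint (C B) = ⋃ F ∈ {F : Finset ι | F ⊂ B}, C F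
  disj : ∀ F F' : Finset ι, F ⊆ B → F' ⊆ B → F ≠ F' → Disjoint (rint (C F)) (rint (C F'))

theorem IsSimplexFanAt.mono {C : Finset ι → Set V} {B F : Finset ι} (h : IsSimplexFanAt C B)
    (hF : F ⊆ B) : C F ⊆ C B := by
  rcases hF.eq_or_ssubset with rfl | hF
  · exact subset_rfl
  · intro x hx
    have : x ∈ C B \ rint (C B) := by
      rw [h.bdry]
      exact mem_biUnion (x := F) hF hx
    exact this.1

theorem exists_coord {v : ι → V} (hv : LinearIndependent ℝ v) :
    ∃ f : ι → V →L[ℝ] ℝ, ∀ (t : ι → ℝ) i, f i (∑ j, t j • v j) = t i := by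
  obtain ⟨g, hg⟩ := (Fintype.linearCombination ℝ v).exists_leftInverse_of_injective
    (LinearMap.ker_eq_bot.2 (linearIndependent_iff_injective_fintypeLinearCombination.1 hv))
  refine ⟨fun i => LinearMap.toContinuousLinearMap (LinearMap.proj i ∘ₗ g), fun t i => ?_⟩
  have h := LinearMap.congr_fun hg t
  rw [LinearMap.comp_apply, Fintype.linearCombination_apply] at h
  exact congrFun h i

theorem isPolyCone_submodule (L : Submodule ℝ V) : IsPolyCone (L : Set V) := by
  obtain ⟨M, hM⟩ := L.exists_isCompl
  convert IsPolyCone.singleton_zero.preimage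
    (LinearMap.toContinuousLinearMap (M.projectionOnto L hM.symm)) using 1
  ext x
  simp

variable {v : ι → V}

theorem mem_span_image_iff {A : Finset ι} {x : V} :
    x ∈ Submodule.span ℝ (v '' A) ↔ ∃ t : ι → ℝ, (∀ i ∉ A, t i = 0) ∧ x = ∑ i, t i • v i := by
  classical
  constructor
  · intro hx
    induction hx using Submodule.span_induction with
    | mem x hx =>
      obtain ⟨i, hi, rfl⟩ := hx
      refine ⟨Pi.single i 1, fun j hj => ?_, ?_⟩
      · rw [Pi.single_eq_of_ne]
        rintro rfl
        exact hj hi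
      · rw [Finset.sum_eq_single i] <;> simp +contextual
    | zero => exact ⟨0, by simp, by simp⟩
    | add x y _ _ hx hy =>
      obtain ⟨t, ht, rfl⟩ := hx
      obtain ⟨s, hs, rfl⟩ := hy
      exact ⟨t + s, fun i hi => by simp [ht i hi, hs i hi], by simp [add_smul, Finset.sum_add_distrib]⟩
    | smul r x _ hx =>
      obtain ⟨t, ht, rfl⟩ := hx
      exact ⟨r • t, fun i hi => by simp [ht i hi], by simp [Finset.smul_sum, smul_smul]⟩
  · rintro ⟨t, ht, rfl⟩
    refine Submodule.sum_mem _ fun i _ => ?_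
    by_cases hi : i ∈ A
    · exact Submodule.smul_mem _ _ (Submodule.subset_span ⟨i, hi, rfl⟩)
    · rw [ht i hi, zero_smul]
      exact Submodule.zero_mem _

theorem simplexCone_structure (hv : LinearIndependent ℝ v) (A : Finset ι) :
    IsPolyCone (simplexCone v A) ∧
    Submodule.span ℝ (simplexCone v A) = Submodule.span ℝ (v '' A) ∧
    rint (simplexCone v A) =
      {x | ∃ t : ι → ℝ, (∀ i ∈ A, 0 < t i) ∧ (∀ i ∉ A, t i = 0) ∧ x = ∑ i, t i • v i} := by
  classical
  obtain ⟨f, hf⟩ := exists_coord hv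
  have hK : simplexCone v A = {x | x ∈ Submodule.span ℝ (v '' A) ∧ ∀ i : A, 0 ≤ f i x} := by
    ext x
    constructor
    · rintro ⟨t, h0, hA, rfl⟩
      exact ⟨mem_span_image_iff.2 ⟨t, hA, rfl⟩, fun i => by rw [hf]; exact h0 i⟩
    · rintro ⟨h1, h2⟩
      obtain ⟨t, ht, rfl⟩ := mem_span_image_iff.1 h1
      refine ⟨t, fun i => ?_, ht, rfl⟩
      by_cases hi : i ∈ A
      · have := h2 ⟨i, hi⟩
        rwa [hf] at this
      · exact (ht i hi).ge
  have hmem : ∑ i, (if i ∈ A then (1 : ℝ) else 0) • v i ∈ Submodule.span ℝ (v '' A) :=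
    mem_span_image_iff.2 ⟨_, fun i hi => by simp [hi], rfl⟩
  obtain ⟨h1, h2⟩ := span_and_rint_poly (Submodule.span ℝ (v '' A)) (fun i : A => f i) hmem
    (fun i => by rw [hf]; simp) hK
  refine ⟨?_, h1, ?_⟩
  · rw [hK]
    have h3 : {x | x ∈ Submodule.span ℝ (v '' A) ∧ ∀ i : A, 0 ≤ f i x} =
        (Submodule.span ℝ (v '' A) : Set V) ∩ ⋂ i : A, {x | 0 ≤ f i x} := by
      ext x; simp
    rw [h3]
    exact (isPolyCone_submodule _).inter (IsPolyCone.iInter fun i => IsPolyCone.halfspace _)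
  · rw [h2]
    ext x
    constructor
    · rintro ⟨h1, h2⟩
      obtain ⟨t, ht, rfl⟩ := mem_span_image_iff.1 h1
      refine ⟨t, fun i hi => ?_, ht, rfl⟩
      have := h2 ⟨i, hi⟩
      rwa [hf] at this
    · rintro ⟨t, h0, hA, rfl⟩
      exact ⟨mem_span_image_iff.2 ⟨t, hA, rfl⟩, fun i => by rw [hf]; exact h0 i i.2⟩

theorem isSimplexFanAt_simplexCone (hv : LinearIndependent ℝ v) (A : Finset ι) :
    IsSimplexFanAt (simplexCone v) A := by
  classical
  obtain ⟨f, hf⟩ := exists_coord hv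
  obtain ⟨h1, h2, h3⟩ := simplexCone_structure hv A
  refine ⟨h1, ?_, ?_, ?_, ?_⟩
  · rw [h2, image_eq_range]
    have := finrank_span_eq_card (R := ℝ) (b := fun i : A => v i)
      (hv.comp _ Subtype.val_injective)
    rw [Fintype.card_coe] at this
    exact this
  · rintro ⟨i, hi⟩
    refine ⟨v i, mem_simplexCone_self v hi, ?_⟩
    rintro ⟨t, h0, -, ht⟩
    have h4 := hf t i
    have h5 := hf (Pi.single i 1) i
    have h6 : ∑ j, (Pi.single i 1 : ι → ℝ) j • v j = v i := by
      rw [Finset.sum_eq_single i] <;> simp +contextual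
    rw [← ht, map_neg, ← h6, h5] at h4
    have := h0 i
    simp at h4
    linarith
  · ext x
    simp only [Set.mem_sdiff, mem_iUnion, mem_ofPred_eq, exists_prop]
    constructor
    · rintro ⟨⟨t, h0, hA, rfl⟩, hx⟩
      rw [h3] at hx
      have : ∃ i ∈ A, t i = 0 := by
        by_contra! h
        exact hx ⟨t, fun i hi => lt_of_le_of_ne (h0 i) (h i hi).symm, hA, rfl⟩
      obtain ⟨i, hi, hti⟩ := this
      refine ⟨A.erase i, Finset.erase_ssubset hi, t, h0, fun j hj => ?_, rfl⟩
      by_cases hji : j = i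
      · rw [hji, hti]
      · exact hA j fun h => hj (Finset.mem_erase.2 ⟨hji, h⟩)
    · rintro ⟨B, hB, t, h0, hA, rfl⟩
      refine ⟨simplexCone_mono v hB.1 ⟨t, h0, hA, rfl⟩, fun hx => ?_⟩
      rw [h3] at hx
      obtain ⟨s, hs, -, hst⟩ := hx
      obtain ⟨i, hi, hiB⟩ := Finset.exists_of_ssubset hB
      have h4 := hf t i
      rw [hst, hf, hA i hiB] at h4
      exact (hs i hi).ne' h4
  · intro F F' _ _ hne
    rw [(simplexCone_structure hv F).2.2, (simplexCone_structure hv F').2.2, Set.disjoint_left]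
    rintro x ⟨t, h0, hA, rfl⟩ ⟨s, hs0, hsA, hst⟩
    have heq : t = s := by
      ext i
      rw [← hf t i, hst, hf]
    subst heq
    refine hne (Finset.ext fun i => ⟨fun hi => ?_, fun hi => ?_⟩)
    · by_contra h
      exact (h0 i hi).ne' (hsA i h)
    · by_contra h
      exact (hs0 i hi).ne' (hA i h)

/-- Generators that move little move a salient cone little. -/
theorem coneClose_simplexCone {p p' : ι → V} {A : Finset ι} {c δ ε : ℝ} (hδ : 0 ≤ δ) (hε : 0 ≤ ε)
    (hsal : ∀ t : ι → ℝ, (∀ i, 0 ≤ t i) → (∀ i ∉ A, t i = 0) →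
      c * ∑ i, t i ≤ ‖∑ i, t i • p i‖)
    (hpp : ∀ i ∈ A, ‖p' i - p i‖ ≤ δ) (hδε : δ * (1 + ε) ≤ ε * c) :
    ConeClose ε (simplexCone p' A) (simplexCone p A) := by
  have key : ∀ t : ι → ℝ, (∀ i, 0 ≤ t i) → (∀ i ∉ A, t i = 0) →
      ‖∑ i, t i • p' i - ∑ i, t i • p i‖ ≤ δ * ∑ i, t i := by
    intro t h0 hA
    rw [← Finset.sum_sub_distrib, Finset.mul_sum]
    refine norm_sum_le_of_le _ fun i _ => ?_
    rw [← smul_sub, norm_smul, Real.norm_eq_abs, abs_of_nonneg (h0 i), mul_comm]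
    by_cases hi : i ∈ A
    · exact mul_le_mul_of_nonneg_right (hpp i hi) (h0 i)
    · rw [hA i hi]; simp
  constructor
  · rintro x ⟨t, h0, hA, rfl⟩
    refine ⟨_, ⟨t, h0, hA, rfl⟩, (key t h0 hA).trans ?_⟩
    have h1 := hsal t h0 hA
    have h2 := key t h0 hA
    have h3 : ‖∑ i, t i • p i‖ ≤ ‖∑ i, t i • p' i‖ + ‖∑ i, t i • p' i - ∑ i, t i • p i‖ := by
      have := norm_sub_le (∑ i, t i • p' i) (∑ i, t i • p' i - ∑ i, t i • p i)
      rwa [sub_sub_cancel] at this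
    have h4 : 0 ≤ ∑ i, t i := Finset.sum_nonneg fun i _ => h0 i
    have h5 : (c - δ) * ∑ i, t i ≤ ‖∑ i, t i • p' i‖ := by linarith
    -- The hypothesis `hδε` says that `δ ≤ ε * (c - δ)`, and `c - δ` is the salience constant left
    -- for the perturbed generators.
    nlinarith [mul_le_mul_of_nonneg_left h5 hε]
  · rintro x ⟨t, h0, hA, rfl⟩
    refine ⟨_, ⟨t, h0, hA, rfl⟩, ?_⟩
    rw [norm_sub_rev]
    refine (key t h0 hA).trans ?_
    have h1 := hsal t h0 hA
    have h4 : 0 ≤ ∑ i, t i := Finset.sum_nonneg fun i _ => h0 i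
    have h5 : δ ≤ ε * c := by nlinarith
    nlinarith [mul_le_mul_of_nonneg_left h1 hε, mul_le_mul_of_nonneg_right h5 h4]

end SimplexCone

/-! ### The face poset of a polygon -/

section PolygonPoset

/-- The faces of a polygon: vertices, edges and the polygon itself. The edge `i` joins the vertices
`i` and `i + 1`. -/
inductive PolygonFace (k : ℕ) : Type
  | vertex (i : Fin (k + 3)) : PolygonFace k
  | edge (i : Fin (k + 3)) : PolygonFace k
  | body : PolygonFace k

namespace PolygonFace

variable {k : ℕ}

instance : Finite (PolygonFace k) := by
  let f : PolygonFace k → Fin (k + 3) ⊕ Fin (k + 3) ⊕ Unit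
    | vertex i => Sum.inl i
    | edge i => Sum.inr (Sum.inl i)
    | body => Sum.inr (Sum.inr ())
  refine Finite.of_injective f ?_
  intro F F' h
  cases F <;> cases F' <;> simp_all [f]

/-- Incidence of faces. -/
def le : PolygonFace k → PolygonFace k → Prop
  | vertex i, vertex j => i = j
  | vertex i, edge j => i = j ∨ i = j + 1
  | edge i, edge j => i = j
  | edge _, vertex _ => False
  | body, vertex _ => False
  | body, edge _ => False
  | _, body => True

instance : PartialOrder (PolygonFace k) where
  le := le
  le_refl F := by cases F <;> simp [le]
  le_trans F F' F'' h h' := by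
    cases F <;> cases F' <;> cases F'' <;> simp_all [le]
  le_antisymm F F' h h' := by
    cases F <;> cases F' <;> simp_all [le]

theorem le_body (F : PolygonFace k) : F ≤ body := by
  change le F body
  cases F <;> simp [le]

/-- The dimension of a face. -/
def dim : PolygonFace k → ℕ
  | vertex _ => 0
  | edge _ => 1
  | body => 2

theorem lt_vertex_iff {F : PolygonFace k} {i : Fin (k + 3)} : ¬ F < vertex i := by
  intro h
  have h1 : le F (vertex i) := h.le
  have h2 := h.ne
  cases F <;> simp_all [le]

theorem lt_edge_iff {F : PolygonFace k} {i : Fin (k + 3)} :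
    F < edge i ↔ F = vertex i ∨ F = vertex (i + 1) := by
  rw [lt_iff_le_and_ne]
  change le F (edge i) ∧ F ≠ edge i ↔ _
  cases F <;> simp [le]

theorem lt_body_iff {F : PolygonFace k} :
    F < body ↔ (∃ i, F = vertex i) ∨ ∃ i, F = edge i := by
  rw [lt_iff_le_and_ne]
  change le F body ∧ F ≠ body ↔ _
  cases F <;> simp [le]

theorem dim_strictMono : StrictMono (dim : PolygonFace k → ℕ) := by
  intro F F' h
  cases F' with
  | vertex i => exact absurd h lt_vertex_iff
  | edge i => rcases lt_edge_iff.1 h with rfl | rfl <;> simp [dim]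
  | body => rcases lt_body_iff.1 h with ⟨i, rfl⟩ | ⟨i, rfl⟩ <;> simp [dim]

end PolygonFace

/-- The face poset of a polygon. -/
def polygonPoset (k : ℕ) : FacePoset 2 where
  Face := PolygonFace k
  body := PolygonFace.body
  le_body := PolygonFace.le_body
  dim := PolygonFace.dim
  dim_strictMono := PolygonFace.dim_strictMono
  dim_body := rfl

theorem fin_add_one_ne {k : ℕ} (i : Fin (k + 3)) : i + 1 ≠ i := by
  intro h
  have : (1 : Fin (k + 3)) = 0 := by simpa using h
  simp at this

theorem fin_add_two_ne {k : ℕ} (i : Fin (k + 3)) : i + 1 + 1 ≠ i := by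
  intro h
  have : (1 + 1 : Fin (k + 3)) = 0 := by rwa [add_assoc, add_eq_left] at h
  have h2 := congrArg Fin.val this
  rw [Fin.val_add, Fin.val_one, Nat.mod_eq_of_lt (by omega)] at h2
  simp at h2

end PolygonPoset

/-! ### Strictly convex polygonal cones -/

section StrictConfig

variable {V : Type*} [NormedAddCommGroup V] [InnerProductSpace ℝ V] [FiniteDimensional ℝ V] {k : ℕ}

/-- The cyclically ordered vectors `p i` generate a strictly convex polyhedral cone in
three-dimensional space, with facet functionals `a i`. -/
structure IsStrictConfig (p : Fin (k + 3) → V) (a : Fin (k + 3) → V →L[ℝ] ℝ) : Prop where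
  finrank_eq : Module.finrank ℝ V = 3
  apply_self : ∀ i, a i (p i) = 0
  apply_succ : ∀ i, a i (p (i + 1)) = 0
  pos : ∀ i j, j ≠ i → j ≠ i + 1 → 0 < a i (p j)

/-- The generators of a face of a polygonal cone. -/
def faceVertices : PolygonFace k → Finset (Fin (k + 3))
  | .vertex i => {i}
  | .edge i => {i, i + 1}
  | .body => Finset.univ

/-- The cones over the faces of the polygon with vertex directions `p`. -/
def polygonCone (p : Fin (k + 3) → V) (F : PolygonFace k) : Set V :=
  simplexCone p (faceVertices F)

theorem isFanAt_vertex {K : PolygonFace k → Set V} {i : Fin (k + 3)} {p : V} (hp : p ≠ 0)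
    (hK : K (.vertex i) = {x | ∃ r : ℝ, 0 ≤ r ∧ x = r • p}) :
    IsFanAt PolygonFace.dim K (.vertex i) := by
  have hv : LinearIndependent ℝ ![p] := by simpa using hp
  have h := isSimplexFanAt_simplexCone hv {0}
  have hK' : simplexCone ![p] {0} = K (.vertex i) := by rw [hK, simplexCone_singleton]; simp
  have hb := h.bdry
  rw [hK'] at hb
  refine ⟨⟨hK' ▸ h.poly, ?_, ?_⟩, ?_, ?_⟩
  · have := h.finrank_span
    rw [hK'] at this
    simpa [PolygonFace.dim] using this
  · have := h.pointed (by simp)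
    rwa [hK'] at this
  · rw [hb]
    ext x
    simp [Finset.ssubset_singleton_iff, simplexCone_empty, PolygonFace.lt_vertex_iff]
  · intro F F' hF hF' hne
    have h1 : F = .vertex i := by
      rcases hF.eq_or_lt with h | h
      · exact h
      · exact absurd h PolygonFace.lt_vertex_iff
    have h2 : F' = .vertex i := by
      rcases hF'.eq_or_lt with h | h
      · exact h
      · exact absurd h PolygonFace.lt_vertex_iff
    exact absurd (h1.trans h2.symm) hne

/-- An edge with independent ends is the cone over a simplex with two generators, whose empty face
accounts for the apex. -/
theorem isFanAt_edge {K : PolygonFace k → Set V} {i : Fin (k + 3)} {p q : V}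
    (hpq : LinearIndependent ℝ ![p, q])
    (hKi : K (.vertex i) = {x | ∃ r : ℝ, 0 ≤ r ∧ x = r • p})
    (hKj : K (.vertex (i + 1)) = {x | ∃ r : ℝ, 0 ≤ r ∧ x = r • q})
    (hK : K (.edge i) = cone2 p q) :
    IsFanAt PolygonFace.dim K (.edge i) := by
  have h := isSimplexFanAt_simplexCone hpq Finset.univ
  have h0 : simplexCone ![p, q] {0} = K (.vertex i) := by rw [hKi, simplexCone_singleton]; simp
  have h1 : simplexCone ![p, q] {1} = K (.vertex (i + 1)) := by
    rw [hKj, simplexCone_singleton]; simp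
  have h2 : simplexCone ![p, q] Finset.univ = K (.edge i) := by
    rw [hK, show (Finset.univ : Finset (Fin 2)) = {0, 1} from rfl, simplexCone_pair _ (by decide)]
    simp
  have hss : ∀ F : Finset (Fin 2), F ⊂ Finset.univ ↔ F = ∅ ∨ F = {0} ∨ F = {1} := by decide
  have hb := h.bdry
  rw [h2] at hb
  refine ⟨⟨h2 ▸ h.poly, ?_, ?_⟩, ?_, ?_⟩
  · have := h.finrank_span
    rw [h2] at this
    simpa [PolygonFace.dim] using this
  · have := h.pointed Finset.univ_nonempty
    rwa [h2] at this
  · rw [hb]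
    ext x
    simp only [hss, mem_iUnion, mem_ofPred_eq, exists_prop, mem_union, PolygonFace.lt_edge_iff,
      or_and_right, exists_or, exists_eq_left, simplexCone_empty, h0, h1]
  · have hrep : ∀ F, F ≤ PolygonFace.edge i → ∃ B : Finset (Fin 2), simplexCone ![p, q] B = K F ∧
        (B = Finset.univ ∧ F = .edge i ∨ B = {0} ∧ F = .vertex i ∨ B = {1} ∧ F = .vertex (i + 1)) := by
      intro F hF
      rcases hF.eq_or_lt with rfl | hF
      · exact ⟨_, h2, by simp⟩
      · rcases PolygonFace.lt_edge_iff.1 hF with rfl | rfl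
        · exact ⟨_, h0, by simp⟩
        · exact ⟨_, h1, by simp⟩
    intro F F' hF hF' hne
    obtain ⟨B, hB, hBF⟩ := hrep F hF
    obtain ⟨B', hB', hBF'⟩ := hrep F' hF'
    rw [← hB, ← hB']
    refine h.disj B B' (Finset.subset_univ _) (Finset.subset_univ _) ?_
    rintro rfl
    apply hne
    rcases hBF with ⟨h3, h4⟩ | ⟨h3, h4⟩ | ⟨h3, h4⟩ <;>
    rcases hBF' with ⟨h5, h6⟩ | ⟨h5, h6⟩ | ⟨h5, h6⟩ <;> rw [h4, h6] <;> exfalso <;>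
    · rw [h3] at h5
      revert h5
      decide

namespace IsStrictConfig

variable {p : Fin (k + 3) → V} {a : Fin (k + 3) → V →L[ℝ] ℝ}

theorem nonneg (h : IsStrictConfig p a) (i j : Fin (k + 3)) : 0 ≤ a i (p j) := by
  by_cases h1 : j = i
  · rw [h1, h.apply_self]
  · by_cases h2 : j = i + 1
    · rw [h2, h.apply_succ]
    · exact (h.pos i j h1 h2).le

theorem pos_succ (h : IsStrictConfig p a) (i : Fin (k + 3)) : 0 < a (i + 1) (p i) :=
  h.pos _ _ (fin_add_one_ne i).symm (fin_add_two_ne i).symm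

theorem pos_pred (h : IsStrictConfig p a) (i : Fin (k + 3)) : 0 < a (i - 1) (p (i + 1)) := by
  refine h.pos _ _ ?_ ?_
  · intro h'
    have := fin_add_two_ne (i - 1)
    rw [sub_add_cancel] at this
    exact this h'
  · rw [sub_add_cancel]
    exact fin_add_one_ne i

theorem pred_self (h : IsStrictConfig p a) (i : Fin (k + 3)) : a (i - 1) (p i) = 0 := by
  have := h.apply_succ (i - 1)
  rwa [sub_add_cancel] at this

/-- The functionals of the two neighbouring edges act as dual coordinates: `a (i + 1)` kills `p (i +
1)` but not `p i`, and `a (i - 1)` kills `p i` but not `p (i + 1)`. -/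
theorem linearIndependent (h : IsStrictConfig p a) (i : Fin (k + 3)) :
    LinearIndependent ℝ ![p i, p (i + 1)] := by
  rw [LinearIndependent.pair_iff]
  intro s t hst
  have h1 := congrArg (a (i + 1)) hst
  have h2 := congrArg (a (i - 1)) hst
  rw [map_add, map_smul, map_smul, h.apply_self, map_zero, smul_zero, add_zero, smul_eq_mul] at h1
  rw [map_add, map_smul, map_smul, h.pred_self, map_zero, smul_zero, zero_add, smul_eq_mul] at h2
  exact ⟨(mul_eq_zero.1 h1).resolve_right (h.pos_succ i).ne',
    (mul_eq_zero.1 h2).resolve_right (h.pos_pred i).ne'⟩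

theorem ne_zero (h : IsStrictConfig p a) (i : Fin (k + 3)) : p i ≠ 0 :=
  (h.linearIndependent i).ne_zero 0

/-- Dimension count: the kernel of the nonzero functional `a i` is a plane, and it contains the two
independent ends of the edge. -/
theorem mem_span_of_apply_eq_zero (h : IsStrictConfig p a) {i : Fin (k + 3)} {x : V}
    (hx : a i x = 0) : ∃ s t : ℝ, x = s • p i + t • p (i + 1) := by
  have hle : Submodule.span ℝ (range ![p i, p (i + 1)]) ≤ LinearMap.ker (a i : V →ₗ[ℝ] ℝ) := by
    refine Submodule.span_le.2 ?_
    rintro _ ⟨j, rfl⟩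
    fin_cases j
    · exact h.apply_self i
    · exact h.apply_succ i
  have h1 := finrank_span_eq_card (h.linearIndependent i)
  have h2 : Module.finrank ℝ (LinearMap.ker (a i : V →ₗ[ℝ] ℝ)) ≤ 2 := by
    have h3 := LinearMap.finrank_range_add_finrank_ker (a i : V →ₗ[ℝ] ℝ)
    rw [h.finrank_eq] at h3
    have h4 : 0 < Module.finrank ℝ (LinearMap.range (a i : V →ₗ[ℝ] ℝ)) := by
      refine Nat.pos_of_ne_zero fun h5 => ?_
      rw [Submodule.finrank_eq_zero, LinearMap.range_eq_bot] at h5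
      have := h.pos i (i - 1) (fun h' => fin_add_one_ne (i - 1) (by rw [sub_add_cancel]; exact h'.symm))
        (fun h' => fin_add_two_ne (i - 1) (by rw [sub_add_cancel]; exact h'.symm))
      exact this.ne' (LinearMap.congr_fun h5 _)
    omega
  have heq := Submodule.eq_of_le_of_finrank_le hle (by rw [h1, Fintype.card_fin]; exact h2)
  have hx' : x ∈ LinearMap.ker (a i : V →ₗ[ℝ] ℝ) := hx
  rw [← heq, Matrix.range_cons, Matrix.range_cons, Matrix.range_empty, union_empty,
    singleton_union, Submodule.mem_span_pair] at hx'
  obtain ⟨s, t, hst⟩ := hx'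
  exact ⟨s, t, hst.symm⟩

theorem mem_cone2 (h : IsStrictConfig p a) {i : Fin (k + 3)} {x : V} (hx : ∀ j, 0 ≤ a j x)
    (hxi : a i x = 0) : x ∈ cone2 (p i) (p (i + 1)) := by
  obtain ⟨s, t, rfl⟩ := h.mem_span_of_apply_eq_zero hxi
  have h1 := hx (i + 1)
  have h2 := hx (i - 1)
  rw [map_add, map_smul, map_smul, h.apply_self, smul_zero, add_zero, smul_eq_mul] at h1
  rw [map_add, map_smul, map_smul, h.pred_self, smul_zero, zero_add, smul_eq_mul] at h2
  exact ⟨s, t, nonneg_of_mul_nonneg_left h1 (h.pos_succ i),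
    nonneg_of_mul_nonneg_left h2 (h.pos_pred i), rfl⟩

/-- The cone is given by its facet functionals. -/
theorem polygonCone_body (h : IsStrictConfig p a) :
    polygonCone p .body = {x | ∀ j, 0 ≤ a j x} := by
  have hpoly : IsPolyCone {x | ∀ j, 0 ≤ a j x} := by
    have : {x | ∀ j, 0 ≤ a j x} = ⋂ j, {x | 0 ≤ a j x} := by ext; simp
    rw [this]
    exact IsPolyCone.iInter fun j => IsPolyCone.halfspace _
  refine Subset.antisymm (simplexCone_subset _ _ hpoly fun i _ j => h.nonneg j i) fun x hx => ?_
  -- Subtract from `x` the largest multiple of `p 0` that preserves all inequalities. One of them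
  -- becomes an equality, so the remainder lies on an edge, and `x` is a nonnegative combination of
  -- `p 0` and the ends of that edge.
  obtain ⟨i, hi, hmin⟩ := Finset.exists_min_image
    (Finset.univ.filter fun i => 0 < a i (p 0)) (fun i => a i x / a i (p 0))
    ⟨0 + 1, by simpa using h.pos_succ 0⟩
  have hi0 : 0 < a i (p 0) := (Finset.mem_filter.1 hi).2
  set s := a i x / a i (p 0) with hs
  have hs0 : 0 ≤ s := div_nonneg (hx i) hi0.le
  have hy : ∀ j, 0 ≤ a j (x - s • p 0) := by
    intro j
    rw [map_sub, map_smul, smul_eq_mul]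
    rcases (h.nonneg j 0).eq_or_lt with h0 | h0
    · rw [← h0, mul_zero, sub_zero]
      exact hx j
    · have := hmin j (Finset.mem_filter.2 ⟨Finset.mem_univ _, h0⟩)
      rw [le_div_iff₀ h0] at this
      linarith
  have hyi : a i (x - s • p 0) = 0 := by
    rw [map_sub, map_smul, smul_eq_mul, hs, div_mul_cancel₀ _ hi0.ne', sub_self]
  obtain ⟨b, c, hb, hc, hbc⟩ := h.mem_cone2 hy hyi
  have hx' : x = s • p 0 + (b • p i + c • p (i + 1)) := by rw [← hbc]; abel
  refine ⟨Pi.single 0 s + (Pi.single i b + Pi.single (i + 1) c), fun j => ?_, by simp [faceVertices], ?_⟩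
  · refine add_nonneg ?_ (add_nonneg ?_ ?_) <;> rw [Pi.single_apply] <;> split_ifs <;>
      simp [hs0, hb, hc]
  · rw [hx']
    simp only [Pi.add_apply, add_smul, Finset.sum_add_distrib]
    congr 1
    · rw [Finset.sum_eq_single 0] <;> simp +contextual
    · congr 1
      · rw [Finset.sum_eq_single i] <;> simp +contextual
      · rw [Finset.sum_eq_single (i + 1)] <;> simp +contextual

theorem polygonCone_vertex (p : Fin (k + 3) → V) (i : Fin (k + 3)) :
    polygonCone p (.vertex i) = {x | ∃ r : ℝ, 0 ≤ r ∧ x = r • p i} := simplexCone_singleton p i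

theorem polygonCone_edge (p : Fin (k + 3) → V) (i : Fin (k + 3)) :
    polygonCone p (.edge i) = cone2 (p i) (p (i + 1)) :=
  simplexCone_pair p (fin_add_one_ne i).symm

theorem rint_cone2 {q r : V} (h : LinearIndependent ℝ ![q, r]) :
    rint (cone2 q r) = {x | ∃ s t : ℝ, 0 < s ∧ 0 < t ∧ x = s • q + t • r} := by
  have h1 := (simplexCone_structure h Finset.univ).2.2
  rw [show (Finset.univ : Finset (Fin 2)) = {0, 1} from rfl, simplexCone_pair _ (by decide)] at h1
  have h2 : cone2 q r = cone2 (![q, r] 0) (![q, r] 1) := rfl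
  rw [h2, h1]
  ext x
  constructor
  · rintro ⟨t, ht, -, rfl⟩
    exact ⟨t 0, t 1, ht 0 (by simp), ht 1 (by simp), by simp⟩
  · rintro ⟨s, t, hs, ht, rfl⟩
    refine ⟨![s, t], fun i _ => ?_, fun i hi => ?_, by simp⟩
    · fin_cases i <;> simpa
    · fin_cases i <;> simp at hi

theorem rint_ray {q : V} (h : q ≠ 0) :
    rint {x | ∃ r : ℝ, 0 ≤ r ∧ x = r • q} = {x | ∃ r : ℝ, 0 < r ∧ x = r • q} := by
  have hv : LinearIndependent ℝ ![q] := by simpa using h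
  have h1 := (simplexCone_structure hv {0}).2.2
  rw [simplexCone_singleton] at h1
  have h2 : {x | ∃ r : ℝ, 0 ≤ r ∧ x = r • q} = {x | ∃ r : ℝ, 0 ≤ r ∧ x = r • ![q] 0} := rfl
  rw [h2, h1]
  ext x
  constructor
  · rintro ⟨t, ht, -, rfl⟩
    exact ⟨t 0, ht 0 (by simp), by simp⟩
  · rintro ⟨s, hs, rfl⟩
    refine ⟨![s], fun i _ => ?_, fun i hi => ?_, by simp⟩
    · fin_cases i; simpa
    · fin_cases i; simp at hi

/-- The functionals vanishing on the relative interior of a face. -/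
def zeros : PolygonFace k → Set (Fin (k + 3))
  | .vertex i => {j | j = i ∨ j + 1 = i}
  | .edge i => {i}
  | .body => ∅

theorem zeros_injective : Function.Injective (zeros : PolygonFace k → Set (Fin (k + 3))) := by
  have hve : ∀ i j : Fin (k + 3), zeros (.vertex i) ≠ zeros (.edge j) := by
    intro i j h
    have h1 : i ∈ zeros (PolygonFace.edge j) := by rw [← h]; exact Or.inl rfl
    have h2 : i - 1 ∈ zeros (PolygonFace.edge j) := by
      rw [← h]; exact Or.inr (sub_add_cancel i 1)
    have h3 : i = i - 1 := (h1 : i = j).trans (h2 : i - 1 = j).symm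
    exact fin_add_one_ne (i - 1) (by rw [sub_add_cancel]; exact h3)
  have hvv : ∀ i j : Fin (k + 3), zeros (.vertex i) = zeros (.vertex j) → i = j := by
    intro i j h
    have h1 : i ∈ zeros (PolygonFace.vertex j) := by rw [← h]; exact Or.inl rfl
    have h2 : j ∈ zeros (PolygonFace.vertex i) := by rw [h]; exact Or.inl rfl
    rcases h1 with h1 | h1
    · exact h1
    · rcases h2 with h2 | h2
      · exact h2.symm
      · rw [← h1] at h2
        exact absurd h2 (fin_add_two_ne i)
  intro F F' h
  cases F with
  | vertex i => cases F' with
    | vertex j => rw [hvv i j h]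
    | edge j => exact absurd h (hve i j)
    | body => exact absurd (h ▸ Or.inl rfl : i ∈ zeros (PolygonFace.body (k := k))) (by simp [zeros])
  | edge i => cases F' with
    | vertex j => exact absurd h.symm (hve j i)
    | edge j =>
      have : i ∈ zeros (PolygonFace.edge j) := by rw [← h]; exact rfl
      rw [show i = j from this]
    | body => exact absurd (h ▸ rfl : i ∈ zeros (PolygonFace.body (k := k))) (by simp [zeros])
  | body => cases F' with
    | vertex j => exact absurd (h ▸ Or.inl rfl : j ∈ zeros (PolygonFace.body (k := k))) (by simp [zeros])
    | edge j => exact absurd (h ▸ rfl : j ∈ zeros (PolygonFace.body (k := k))) (by simp [zeros])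
    | body => rfl

theorem body_structure (h : IsStrictConfig p a) :
    IsPolyCone (polygonCone p .body) ∧ Submodule.span ℝ (polygonCone p .body) = ⊤ ∧
      rint (polygonCone p .body) = {x | ∀ j, 0 < a j x} := by
  have hpos : ∀ j, 0 < a j (∑ i, p i) := by
    intro j
    rw [map_sum]
    refine Finset.sum_pos' (fun i _ => h.nonneg j i) ⟨j + 1 + 1, Finset.mem_univ _, ?_⟩
    exact h.pos _ _ (fin_add_two_ne j) (fin_add_one_ne _)
  obtain ⟨h1, h2⟩ := span_and_rint_poly (⊤ : Submodule ℝ V) a Submodule.mem_top hpos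
    (K := polygonCone p .body) (by rw [h.polygonCone_body]; simp)
  refine ⟨?_, h1, by rw [h2]; simp⟩
  rw [h.polygonCone_body]
  have : {x | ∀ j, 0 ≤ a j x} = ⋂ j, {x | 0 ≤ a j x} := by ext; simp
  rw [this]
  exact IsPolyCone.iInter fun j => IsPolyCone.halfspace _

/-- A relative interior point of a vertex or edge cone is a positive combination of the generators,
so a nonnegative functional vanishes there only if it vanishes on each of them; on the interior of
the body all are positive. The set of active functionals thus identifies the face. -/
theorem eq_zeros_of_mem_rint (h : IsStrictConfig p a) (F : PolygonFace k) {x : V}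
    (hx : x ∈ rint (polygonCone p F)) : {j | a j x = 0} = zeros F := by
  cases F with
  | vertex i =>
    rw [polygonCone_vertex, rint_ray (h.ne_zero i)] at hx
    obtain ⟨r, hr, rfl⟩ := hx
    ext j
    simp only [mem_ofPred_eq, map_smul, smul_eq_mul, mul_eq_zero, hr.ne', false_or, zeros]
    constructor
    · intro h0
      by_contra hne
      rw [not_or] at hne
      exact (h.pos j i (fun h' => hne.1 h'.symm) (fun h' => hne.2 h'.symm)).ne' h0
    · rintro (rfl | rfl)
      · exact h.apply_self _
      · exact h.apply_succ _
  | edge i =>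
    rw [polygonCone_edge, rint_cone2 (h.linearIndependent i)] at hx
    obtain ⟨s, t, hs, ht, rfl⟩ := hx
    ext j
    simp only [mem_ofPred_eq, map_add, map_smul, smul_eq_mul, zeros, mem_singleton_iff]
    constructor
    · intro h0
      have h1 := h.nonneg j i
      have h2 := h.nonneg j (i + 1)
      have h3 : a j (p i) = 0 := by nlinarith [mul_nonneg hs.le h1, mul_nonneg ht.le h2]
      have h4 : a j (p (i + 1)) = 0 := by nlinarith [mul_nonneg hs.le h1, mul_nonneg ht.le h2]
      by_contra hne
      have h5 : i = j + 1 := by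
        by_contra h6
        exact (h.pos j i (fun h' => hne h'.symm) h6).ne' h3
      rw [h5] at h4
      exact (h.pos j _ (fin_add_two_ne j) (fin_add_one_ne _)).ne' h4
    · rintro rfl
      rw [h.apply_self, h.apply_succ]
      simp
  | body =>
    rw [h.body_structure.2.2] at hx
    ext j
    simp only [mem_ofPred_eq, zeros, mem_empty_iff_false, iff_false]
    exact (hx j).ne'

theorem disjoint_rint (h : IsStrictConfig p a) {F F' : PolygonFace k} (hne : F ≠ F') :
    Disjoint (rint (polygonCone p F)) (rint (polygonCone p F')) := by
  rw [Set.disjoint_left]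
  intro x hx hx'
  exact hne (zeros_injective ((h.eq_zeros_of_mem_rint F hx).symm.trans
    (h.eq_zeros_of_mem_rint F' hx')))

theorem isFanAt (h : IsStrictConfig p a) (F : PolygonFace k) :
    IsFanAt PolygonFace.dim (polygonCone p) F := by
  cases F with
  | vertex i => exact isFanAt_vertex (h.ne_zero i) (polygonCone_vertex p i)
  | edge i =>
    exact isFanAt_edge (h.linearIndependent i) (polygonCone_vertex p i) (polygonCone_vertex p _)
      (polygonCone_edge p i)
  | body =>
    obtain ⟨h1, h2, h3⟩ := h.body_structure
    refine ⟨⟨h1, by rw [h2, finrank_top, h.finrank_eq]; rfl, p 0, ?_, ?_⟩, ?_,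
      fun F F' _ _ hne => h.disjoint_rint hne⟩
    · rw [h.polygonCone_body]
      exact fun j => h.nonneg j 0
    · rw [h.polygonCone_body]
      intro h'
      have := h' (0 + 1)
      rw [map_neg] at this
      linarith [h.pos_succ 0]
    · rw [h3, h.polygonCone_body]
      ext x
      simp only [Set.mem_sdiff, mem_ofPred_eq, mem_union, mem_singleton_iff, mem_iUnion, exists_prop]
      constructor
      · rintro ⟨h4, h5⟩
        push Not at h5
        obtain ⟨j, hj⟩ := h5
        have := h.mem_cone2 h4 (le_antisymm hj (h4 j))
        exact Or.inr ⟨.edge j, PolygonFace.lt_body_iff.2 (Or.inr ⟨j, rfl⟩),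
          by rwa [polygonCone_edge]⟩
      · have hz : ∀ F : PolygonFace k, F < .body → ∀ x ∈ polygonCone p F,
            (∀ j, 0 ≤ a j x) ∧ ¬ ∀ j, 0 < a j x := by
          intro F hF x hx
          refine ⟨?_, ?_⟩
          · have := simplexCone_mono p (Finset.subset_univ _) hx
            change x ∈ polygonCone p .body at this
            rwa [h.polygonCone_body] at this
          · intro hpos
            rcases PolygonFace.lt_body_iff.1 hF with ⟨i, rfl⟩ | ⟨i, rfl⟩
            · rw [polygonCone_vertex] at hx
              obtain ⟨r, hr, rfl⟩ := hx
              have := hpos i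
              rw [map_smul, h.apply_self, smul_zero] at this
              exact this.false
            · rw [polygonCone_edge] at hx
              obtain ⟨r, s, hr, hs, rfl⟩ := hx
              have := hpos i
              rw [map_add, map_smul, map_smul, h.apply_self, h.apply_succ, smul_zero, smul_zero,
                add_zero] at this
              exact this.false
        rintro (rfl | ⟨F, hF, hx⟩)
        · exact ⟨by simp, fun h' => by simpa using h' 0⟩
        · exact hz F hF x hx

end IsStrictConfig

end StrictConfig

/-! ### Cones over arcs of a great circle -/

section PlanarArc

/-- The horizontal unit vector at angle `θ`. -/
def dir (θ : ℝ) : Space 2 := !₂[Real.cos θ, Real.sin θ, 0]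

/-- The vertical unit vector. -/
def vertical : Space 2 := !₂[0, 0, 1]

theorem inner_space_two (x y : Space 2) : inner ℝ x y = x 0 * y 0 + x 1 * y 1 + x 2 * y 2 := by
  rw [PiLp.inner_apply, Fin.sum_univ_three]
  simp only [RCLike.inner_apply, conj_trivial]
  ring

@[simp] theorem dir_zero (θ : ℝ) : dir θ 0 = Real.cos θ := rfl
@[simp] theorem dir_one (θ : ℝ) : dir θ 1 = Real.sin θ := rfl
@[simp] theorem dir_two (θ : ℝ) : dir θ 2 = 0 := rfl
@[simp] theorem vertical_zero : vertical 0 = 0 := rfl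
@[simp] theorem vertical_one : vertical 1 = 0 := rfl
@[simp] theorem vertical_two : vertical 2 = 1 := rfl

theorem inner_dir_dir (α β : ℝ) : inner ℝ (dir α) (dir β) = Real.cos (α - β) := by
  rw [inner_space_two, Real.cos_sub]
  simp

theorem inner_dir_vertical (α : ℝ) : inner ℝ (dir α) vertical = 0 := by
  rw [inner_space_two]
  simp

theorem norm_dir (α : ℝ) : ‖dir α‖ = 1 := by
  rw [← sq_eq_sq₀ (norm_nonneg _) zero_le_one, ← real_inner_self_eq_norm_sq, inner_dir_dir]
  simp

theorem norm_vertical : ‖vertical‖ = 1 := by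
  rw [← sq_eq_sq₀ (norm_nonneg _) zero_le_one, ← real_inner_self_eq_norm_sq, inner_space_two]
  simp

theorem dir_add (α φ : ℝ) :
    dir (α + φ) = Real.cos φ • dir α + Real.sin φ • dir (α + Real.pi / 2) := by
  ext i
  fin_cases i
  · simp [Real.cos_add]; ring
  · simp [Real.sin_add]; ring
  · simp

theorem dir_add_int_mul_two_pi (θ : ℝ) (k : ℤ) : dir (θ + k * (2 * Real.pi)) = dir θ := by
  ext i
  fin_cases i <;> simp

theorem norm_dir_sub_dir_le (α β : ℝ) : ‖dir α - dir β‖ ≤ |α - β| := by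
  rw [← sq_le_sq₀ (norm_nonneg _) (abs_nonneg _), sq_abs, norm_sub_sq_real, norm_dir, norm_dir,
    inner_dir_dir]
  have := Real.one_sub_sq_div_two_le_cos (x := α - β)
  linarith

/-- The horizontal plane. -/
def plane : Submodule ℝ (Space 2) := LinearMap.ker (EuclideanSpace.proj (𝕜 := ℝ) (2 : Fin 3) :
  EuclideanSpace ℝ (Fin 3) →L[ℝ] ℝ).toLinearMap

theorem mem_plane {x : Space 2} : x ∈ plane ↔ x 2 = 0 := Iff.rfl

theorem dir_mem_plane (θ : ℝ) : dir θ ∈ plane := rfl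

theorem finrank_plane : Module.finrank ℝ plane = 2 := by
  have h := LinearMap.finrank_range_add_finrank_ker (EuclideanSpace.proj (𝕜 := ℝ) (2 : Fin 3) :
    EuclideanSpace ℝ (Fin 3) →L[ℝ] ℝ).toLinearMap
  have h1 : LinearMap.range (EuclideanSpace.proj (𝕜 := ℝ) (2 : Fin 3) :
      EuclideanSpace ℝ (Fin 3) →L[ℝ] ℝ).toLinearMap = ⊤ := by
    refine LinearMap.range_eq_top.2 fun y => ⟨y • vertical, ?_⟩
    change (y • vertical) 2 = y
    simp
  rw [h1, finrank_top, Module.finrank_self, finrank_euclideanSpace_fin] at h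
  have h2 : 1 + Module.finrank ℝ plane = 2 + 1 := h
  omega

theorem exists_polar_plane {x : Space 2} (hx : x ∈ plane) (α : ℝ) :
    ∃ r φ : ℝ, 0 ≤ r ∧ α ≤ φ ∧ φ < α + 2 * Real.pi ∧ x = r • dir φ := by
  set z : ℂ := ⟨x 0, x 1⟩
  have h := toIcoMod_mem_Ico Real.two_pi_pos α z.arg
  refine ⟨‖z‖, toIcoMod Real.two_pi_pos α z.arg, norm_nonneg _, h.1, h.2, ?_⟩
  have h1 : dir (toIcoMod Real.two_pi_pos α z.arg) = dir z.arg := by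
    have h2 := toIcoMod_add_toIcoDiv_zsmul Real.two_pi_pos α z.arg
    rw [zsmul_eq_mul] at h2
    conv_rhs => rw [← h2]
    rw [dir_add_int_mul_two_pi]
  rw [h1]
  ext i
  fin_cases i
  · simp [Complex.norm_mul_cos_arg, z]
  · simp [Complex.norm_mul_sin_arg, z]
  · simpa using mem_plane.1 hx

theorem smul_dir_inj {r r' φ φ' : ℝ} (hr : 0 < r) (hr' : 0 < r') (h1 : |φ - φ'| < 2 * Real.pi)
    (h : r • dir φ = r' • dir φ') : φ = φ' := by
  have hn := congrArg norm h
  rw [norm_smul, norm_smul, norm_dir, norm_dir, mul_one, mul_one, Real.norm_eq_abs,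
    Real.norm_eq_abs, abs_of_pos hr, abs_of_pos hr'] at hn
  subst hn
  have h2 := smul_right_injective _ hr.ne' h
  have h3 := inner_dir_dir φ φ'
  rw [h2, real_inner_self_eq_norm_sq, norm_dir, one_pow] at h3
  rw [abs_lt] at h1
  have := (Real.cos_eq_one_iff_of_lt_of_lt h1.1 h1.2).1 h3.symm
  linarith

/-- The cone over the arc of the horizontal directions between the angles `α` and `β`. -/
def arcCone (α β : ℝ) : Set (Space 2) :=
  {z | ∃ r φ : ℝ, 0 ≤ r ∧ α ≤ φ ∧ φ ≤ β ∧ z = r • dir φ}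

theorem dir_mem_arcCone {α β φ : ℝ} (h1 : α ≤ φ) (h2 : φ ≤ β) : dir φ ∈ arcCone α β :=
  ⟨1, φ, zero_le_one, h1, h2, by simp⟩

theorem arcCone_eq_wedge (α β : ℝ) :
    arcCone α β = wedge ⊥ (dir α) (dir (α + Real.pi / 2)) 0 (β - α) := by
  ext z
  constructor
  · rintro ⟨r, φ, hr, h1, h2, rfl⟩
    refine ⟨0, Submodule.zero_mem _, r, φ - α, hr, by linarith, by linarith, ?_⟩
    rw [← dir_add, zero_add, add_sub_cancel]
  · rintro ⟨y, hy, r, φ, hr, h1, h2, rfl⟩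
    refine ⟨r, α + φ, hr, by linarith, by linarith, ?_⟩
    rw [← dir_add, (Submodule.mem_bot ℝ).1 hy, zero_add]

theorem arcCone_eq_cone2 {α β : ℝ} (h : α < β) (h' : β - α < Real.pi) :
    arcCone α β = cone2 (dir α) (dir β) := by
  rw [arcCone_eq_wedge, wedge_bot_eq_cone2 _ _ (by linarith) h', ← dir_add, add_sub_cancel]

/-- The two functionals cutting out the cone over a planar arc. -/
def arcFunctional (α β : ℝ) : Bool → Space 2 →L[ℝ] ℝ
  | true => innerSL ℝ (dir (α + Real.pi / 2))
  | false => innerSL ℝ (dir (β - Real.pi / 2))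

theorem arcFunctional_true (α β φ : ℝ) : arcFunctional α β true (dir φ) = Real.sin (φ - α) := by
  change inner ℝ (dir (α + Real.pi / 2)) (dir φ) = _
  rw [inner_dir_dir, show α + Real.pi / 2 - φ = Real.pi / 2 - (φ - α) by ring,
    Real.cos_pi_div_two_sub]

theorem arcFunctional_false (α β φ : ℝ) : arcFunctional α β false (dir φ) = Real.sin (β - φ) := by
  change inner ℝ (dir (β - Real.pi / 2)) (dir φ) = _
  rw [inner_dir_dir, show β - Real.pi / 2 - φ = (β - φ) - Real.pi / 2 by ring,
    Real.cos_sub_pi_div_two]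

/-- With the polar angle normalised to `[α, α + 2π)`, the first functional excludes angles beyond `α
+ π`, and then the second excludes those beyond `β`. Semicircles are admitted. -/
theorem arcCone_eq {α β : ℝ} (h : α < β) (h' : β - α ≤ Real.pi) :
    arcCone α β = {x | x ∈ plane ∧ ∀ i, 0 ≤ arcFunctional α β i x} := by
  ext x
  constructor
  · rintro ⟨r, φ, hr, h1, h2, rfl⟩
    refine ⟨Submodule.smul_mem _ _ (dir_mem_plane φ), fun i => ?_⟩
    rw [map_smul, smul_eq_mul]
    refine mul_nonneg hr ?_
    cases i
    · rw [arcFunctional_false]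
      exact Real.sin_nonneg_of_nonneg_of_le_pi (by linarith) (by linarith)
    · rw [arcFunctional_true]
      exact Real.sin_nonneg_of_nonneg_of_le_pi (by linarith) (by linarith)
  · rintro ⟨hx, hi⟩
    obtain ⟨r, φ, hr, h1, h2, rfl⟩ := exists_polar_plane hx α
    rcases hr.eq_or_lt with rfl | hr0
    · exact ⟨0, α, le_rfl, le_rfl, h.le, by simp⟩
    have ht := hi true
    have hf := hi false
    rw [map_smul, smul_eq_mul, arcFunctional_true] at ht
    rw [map_smul, smul_eq_mul, arcFunctional_false] at hf
    have ht := nonneg_of_mul_nonneg_right ht hr0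
    have hf := nonneg_of_mul_nonneg_right hf hr0
    have hle : φ - α ≤ Real.pi := by
      by_contra hlt
      have := Real.sin_neg_of_neg_of_neg_pi_lt (x := φ - α - 2 * Real.pi) (by linarith)
        (by linarith)
      rw [Real.sin_sub_two_pi] at this
      linarith
    refine ⟨r, φ, hr, h1, ?_, rfl⟩
    by_contra hlt
    have := Real.sin_neg_of_neg_of_neg_pi_lt (x := β - φ) (by linarith) (by linarith)
    linarith

theorem arcCone_span_rint {α β : ℝ} (h : α < β) (h' : β - α ≤ Real.pi) :
    Submodule.span ℝ (arcCone α β) = plane ∧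
    rint (arcCone α β) = {x | ∃ r φ : ℝ, 0 < r ∧ α < φ ∧ φ < β ∧ x = r • dir φ} := by
  obtain ⟨h1, h2⟩ := span_and_rint_poly plane (arcFunctional α β) (dir_mem_plane ((α + β) / 2))
    (by
      rintro (_ | _)
      · rw [arcFunctional_false]
        exact Real.sin_pos_of_pos_of_lt_pi (by linarith) (by linarith)
      · rw [arcFunctional_true]
        exact Real.sin_pos_of_pos_of_lt_pi (by linarith) (by linarith)) (arcCone_eq h h')
  refine ⟨h1, ?_⟩
  rw [h2]
  ext x
  constructor
  · rintro ⟨hx, hi⟩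
    have hx' : x ∈ arcCone α β := by rw [arcCone_eq h h']; exact ⟨hx, fun i => (hi i).le⟩
    obtain ⟨r, φ, hr, h3, h4, rfl⟩ := hx'
    have ht := hi true
    have hf := hi false
    rw [map_smul, smul_eq_mul, arcFunctional_true] at ht
    rw [map_smul, smul_eq_mul, arcFunctional_false] at hf
    refine ⟨r, φ, ?_, ?_, ?_, rfl⟩
    · refine lt_of_le_of_ne hr ?_
      rintro rfl
      simp at ht
    · refine lt_of_le_of_ne h3 ?_
      rintro rfl
      simp at ht
    · refine lt_of_le_of_ne h4 ?_
      rintro rfl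
      simp at hf
  · rintro ⟨r, φ, hr, h3, h4, rfl⟩
    refine ⟨Submodule.smul_mem _ _ (dir_mem_plane φ), fun i => ?_⟩
    rw [map_smul, smul_eq_mul]
    refine mul_pos hr ?_
    cases i
    · rw [arcFunctional_false]
      exact Real.sin_pos_of_pos_of_lt_pi (by linarith) (by linarith)
    · rw [arcFunctional_true]
      exact Real.sin_pos_of_pos_of_lt_pi (by linarith) (by linarith)

theorem isConeCell_arcCone {α β : ℝ} (h : α < β) (h' : β - α ≤ Real.pi) :
    IsConeCell 1 (arcCone α β) := by
  refine ⟨?_, by rw [(arcCone_span_rint h h').1, finrank_plane], dir ((α + β) / 2),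
    dir_mem_arcCone (by linarith) (by linarith), ?_⟩
  · have h1 : {x | x ∈ plane ∧ ∀ i, 0 ≤ arcFunctional α β i x} =
        {x | EuclideanSpace.proj (𝕜 := ℝ) (2 : Fin 3) x = 0} ∩
          ⋂ i, {x | 0 ≤ arcFunctional α β i x} := by
      ext x
      simp [mem_plane]
    rw [arcCone_eq h h', h1]
    exact (IsPolyCone.ker _).inter (IsPolyCone.iInter fun i => IsPolyCone.halfspace _)
  · rw [arcCone_eq h h']
    rintro ⟨-, hi⟩
    have := hi true
    rw [map_neg, arcFunctional_true] at this
    linarith [Real.sin_pos_of_pos_of_lt_pi (x := (α + β) / 2 - α) (by linarith) (by linarith)]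

theorem area_arcCone {α β : ℝ} (h : α < β) (h' : β - α ≤ Real.pi) :
    area (trace (arcCone α β)) = β - α := by
  have hp := (isConeCell_arcCone h h').poly
  rw [arcCone_eq_wedge] at hp ⊢
  refine area_arc (norm_dir _) (norm_dir _) ?_ (by linarith) h' hp
  rw [inner_dir_dir, sub_add_cancel_left, Real.cos_neg, Real.cos_pi_div_two]

theorem dir_ne_zero (α : ℝ) : dir α ≠ 0 := by
  intro h
  have := norm_dir α
  rw [h, norm_zero] at this
  exact zero_ne_one this

/-- A semicircle has antipodal ends, which do not generate its cone, so `isFanAt_edge` is not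
available and faces are separated by polar angles. The ends may be interchanged because the closing
edge of a flat polygon runs against the orientation. -/
theorem isFanAt_edge_of_arcCone {k : ℕ} {K : PolygonFace k → Set (Space 2)} {i j l : Fin (k + 3)}
    {α β : ℝ} (h : α < β) (h' : β - α ≤ Real.pi)
    (hjl : j = i ∧ l = i + 1 ∨ j = i + 1 ∧ l = i)
    (hKi : K (.vertex j) = {x | ∃ r : ℝ, 0 ≤ r ∧ x = r • dir α})
    (hKj : K (.vertex l) = {x | ∃ r : ℝ, 0 ≤ r ∧ x = r • dir β})
    (hK : K (.edge i) = arcCone α β) : IsFanAt PolygonFace.dim K (.edge i) := by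
  have hpi := Real.pi_pos
  have hlt : ∀ F, F < PolygonFace.edge i ↔ F = .vertex j ∨ F = .vertex l := by
    intro F
    rw [PolygonFace.lt_edge_iff]
    rcases hjl with ⟨rfl, rfl⟩ | ⟨rfl, rfl⟩
    · rfl
    · exact or_comm
  have hr := (arcCone_span_rint h h').2
  have hri : rint (K (.vertex j)) = {x | ∃ r φ : ℝ, 0 < r ∧ φ = α ∧ x = r • dir φ} := by
    rw [hKi, IsStrictConfig.rint_ray (dir_ne_zero α)]
    simp
  have hrj : rint (K (.vertex l)) = {x | ∃ r φ : ℝ, 0 < r ∧ φ = β ∧ x = r • dir φ} := by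
    rw [hKj, IsStrictConfig.rint_ray (dir_ne_zero β)]
    simp
  have hdis : ∀ P Q : ℝ → Prop, (∀ φ, P φ → ¬ Q φ) → (∀ φ, P φ → α ≤ φ ∧ φ ≤ β) →
      (∀ φ, Q φ → α ≤ φ ∧ φ ≤ β) → Disjoint {x | ∃ r φ : ℝ, 0 < r ∧ P φ ∧ x = r • dir φ}
        {x | ∃ r φ : ℝ, 0 < r ∧ Q φ ∧ x = r • dir φ} := by
    intro P Q hPQ hP hQ
    rw [Set.disjoint_left]
    rintro x ⟨r, φ, hr, h1, rfl⟩ ⟨r', φ', hr', h2, h3⟩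
    have := smul_dir_inj hr hr' (by
      rw [abs_lt]
      constructor <;> linarith [(hP φ h1).1, (hP φ h1).2, (hQ φ' h2).1, (hQ φ' h2).2]) h3
    subst this
    exact hPQ _ h1 h2
  have hr' : rint (K (.edge i)) = {x | ∃ r φ : ℝ, 0 < r ∧ (α < φ ∧ φ < β) ∧ x = r • dir φ} := by
    rw [hK, hr]
    simp only [and_assoc]
  have d1 : Disjoint (rint (K (.vertex j))) (rint (K (.edge i))) := by
    rw [hri, hr']
    exact hdis _ _ (by rintro φ rfl ⟨h1, -⟩; exact h1.false) (by rintro φ rfl; constructor <;> linarith)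
      (by rintro φ ⟨h1, h2⟩; constructor <;> linarith)
  have d2 : Disjoint (rint (K (.vertex l))) (rint (K (.edge i))) := by
    rw [hrj, hr']
    exact hdis _ _ (by rintro φ rfl ⟨-, h1⟩; exact h1.false) (by rintro φ rfl; constructor <;> linarith)
      (by rintro φ ⟨h1, h2⟩; constructor <;> linarith)
  have d3 : Disjoint (rint (K (.vertex j))) (rint (K (.vertex l))) := by
    rw [hri, hrj]
    exact hdis _ _ (by rintro φ rfl h1; linarith) (by rintro φ rfl; constructor <;> linarith)
      (by rintro φ rfl; constructor <;> linarith)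
  refine ⟨hK ▸ isConeCell_arcCone h h', ?_, ?_⟩
  · simp only [hlt, mem_ofPred_eq, iUnion_iUnion_eq_or_left,
      iUnion_iUnion_eq_left, hKi, hKj]
    rw [hK, hr]
    ext x
    simp only [Set.mem_sdiff, mem_ofPred_eq, mem_union, mem_singleton_iff]
    constructor
    · rintro ⟨⟨r, φ, h0, h1, h2, rfl⟩, h3⟩
      by_contra hne
      rw [not_or, not_or] at hne
      refine h3 ⟨r, φ, lt_of_le_of_ne h0 ?_, lt_of_le_of_ne h1 ?_, lt_of_le_of_ne h2 ?_, rfl⟩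
      · rintro rfl; exact hne.1 (zero_smul _ _)
      · rintro rfl; exact hne.2.1 ⟨r, h0, rfl⟩
      · rintro rfl; exact hne.2.2 ⟨r, h0, rfl⟩
    · have hend : ∀ r γ : ℝ, 0 ≤ r → γ = α ∨ γ = β → (∃ s φ : ℝ, 0 ≤ s ∧ α ≤ φ ∧ φ ≤ β ∧
          r • dir γ = s • dir φ) ∧ ¬ ∃ s φ : ℝ, 0 < s ∧ α < φ ∧ φ < β ∧ r • dir γ = s • dir φ := by
        intro r γ h0 hγ
        refine ⟨⟨r, γ, h0, ?_, ?_, rfl⟩, ?_⟩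
        · rcases hγ with rfl | rfl <;> linarith
        · rcases hγ with rfl | rfl <;> linarith
        · rintro ⟨s, φ, hs, h1, h2, h3⟩
          rcases h0.eq_or_lt with rfl | h0
          · rw [zero_smul, eq_comm, smul_eq_zero] at h3
            exact h3.elim hs.ne' (dir_ne_zero φ)
          · have := smul_dir_inj h0 hs (by
              rw [abs_lt]
              rcases hγ with rfl | rfl <;> constructor <;> linarith) h3
            rcases hγ with rfl | rfl <;> linarith
      rintro (rfl | ⟨r, h0, rfl⟩ | ⟨r, h0, rfl⟩)
      · have := hend 0 α le_rfl (Or.inl rfl)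
        rwa [zero_smul] at this
      · exact hend r α h0 (Or.inl rfl)
      · exact hend r β h0 (Or.inr rfl)
  · intro F F' hF hF' hne
    have hrep : ∀ F, F ≤ PolygonFace.edge i →
        F = .edge i ∨ F = .vertex j ∨ F = .vertex l := fun F hF =>
      hF.eq_or_lt.imp_right (hlt F).1
    rcases hrep F hF with rfl | rfl | rfl <;> rcases hrep F' hF' with rfl | rfl | rfl
    exacts [absurd rfl hne, d1.symm, d2.symm, d1, absurd rfl hne, d3, d2, d3.symm, absurd rfl hne]

end PlanarArc

/-! ### Partial sums of edge lengths -/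

section PartialSums

variable {k : ℕ} {δ : Fin (k + 3) → ℝ}

/-- The sum of the entries before the index `j`. -/
def partialSum (δ : Fin (k + 3) → ℝ) (j : Fin (k + 3)) : ℝ := ∑ l ∈ Finset.Iio j, δ l

theorem fin_add_one_of_lt_last {i : Fin (k + 3)} (h : i ≠ Fin.last _) :
    (i + 1).val = i.val + 1 :=
  Fin.val_add_one_of_lt (lt_of_le_of_ne (Fin.le_last i) h)

theorem fin_last_add_one : (Fin.last (k + 2) + 1 : Fin (k + 3)) = 0 := Fin.last_add_one _

theorem partialSum_zero : partialSum δ 0 = 0 := by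
  rw [partialSum, Finset.sum_eq_zero]
  intro l hl
  exact absurd (Finset.mem_Iio.1 hl) (Fin.not_lt_zero l)

theorem partialSum_add_eq_sum_Iic (δ : Fin (k + 3) → ℝ) (i : Fin (k + 3)) :
    partialSum δ i + δ i = ∑ l ∈ Finset.Iic i, δ l := by
  rw [← Finset.Iio_insert, Finset.sum_insert (by simp), partialSum, add_comm]

theorem partialSum_succ (δ : Fin (k + 3) → ℝ) {i : Fin (k + 3)} (h : i ≠ Fin.last _) :
    partialSum δ (i + 1) = partialSum δ i + δ i := by
  rw [partialSum_add_eq_sum_Iic, partialSum]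
  congr 1
  ext l
  have := fin_add_one_of_lt_last h
  rw [Finset.mem_Iio, Finset.mem_Iic, Fin.lt_def, Fin.le_def]
  omega

theorem partialSum_last_add (δ : Fin (k + 3) → ℝ) :
    partialSum δ (Fin.last _) + δ (Fin.last _) = ∑ l, δ l := by
  rw [partialSum_add_eq_sum_Iic]
  congr 1
  ext l
  simp [Fin.le_last]

theorem partialSum_add_le (hδ : ∀ i, 0 < δ i) {i j : Fin (k + 3)} (h : i < j) :
    partialSum δ i + δ i ≤ partialSum δ j := by
  rw [partialSum_add_eq_sum_Iic]
  refine Finset.sum_le_sum_of_subset_of_nonneg (fun l hl => ?_) fun l _ _ => (hδ l).le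
  rw [Finset.mem_Iic] at hl
  exact Finset.mem_Iio.2 (hl.trans_lt h)

theorem partialSum_nonneg (hδ : ∀ i, 0 < δ i) (i : Fin (k + 3)) : 0 ≤ partialSum δ i :=
  Finset.sum_nonneg fun l _ => (hδ l).le

theorem partialSum_pos (hδ : ∀ i, 0 < δ i) {i : Fin (k + 3)} (h : i ≠ 0) : 0 < partialSum δ i := by
  have := partialSum_add_le hδ (Fin.pos_of_ne_zero h)
  rw [partialSum_zero] at this
  linarith [hδ 0]

theorem partialSum_add_le_sum (hδ : ∀ i, 0 < δ i) (i : Fin (k + 3)) :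
    partialSum δ i + δ i ≤ ∑ l, δ l := by
  rw [partialSum_add_eq_sum_Iic]
  exact Finset.sum_le_sum_of_subset_of_nonneg (Finset.subset_univ _) fun l _ _ => (hδ l).le

theorem partialSum_add_lt_sum (hδ : ∀ i, 0 < δ i) {i : Fin (k + 3)} (h : i ≠ Fin.last _) :
    partialSum δ i + δ i < ∑ l, δ l := by
  rw [← partialSum_succ δ h]
  linarith [partialSum_add_le_sum hδ (i + 1), hδ (i + 1)]

theorem partialSum_smul (c : ℝ) (δ : Fin (k + 3) → ℝ) (i : Fin (k + 3)) :
    partialSum (fun j => c * δ j) i = c * partialSum δ i := by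
  rw [partialSum, partialSum, Finset.mul_sum]

/-- The last entry enters no partial sum, since the index itself is left out. -/
theorem partialSum_congr {δ' : Fin (k + 3) → ℝ} (h : ∀ i ≠ Fin.last _, δ i = δ' i)
    (i : Fin (k + 3)) : partialSum δ i = partialSum δ' i :=
  Finset.sum_congr rfl fun l hl => h l ((Finset.mem_Iio.1 hl).trans_le (Fin.le_last i)).ne

end PartialSums

/-! ### Polygons inscribed in a circle -/

section Inscribed

variable {k : ℕ} {δ : Fin (k + 3) → ℝ}

theorem cos_lt_cos_half {x δ : ℝ} (hδ : 0 < δ) (h1 : δ / 2 < |x|)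
    (h2 : |x| < 2 * Real.pi - δ / 2) : Real.cos x < Real.cos (δ / 2) := by
  rw [← Real.cos_abs x]
  rcases le_total |x| Real.pi with h | h
  · exact Real.cos_lt_cos_of_nonneg_of_le_pi (by linarith) h h1
  · rw [← Real.cos_two_pi_sub]
    exact Real.cos_lt_cos_of_nonneg_of_le_pi (by linarith) (by linarith) (by linarith)

/-- The vertices of a polygon inscribed in a horizontal circle. -/
def inscribedVertex (δ : Fin (k + 3) → ℝ) (ρ h : ℝ) (i : Fin (k + 3)) : Space 2 :=
  ρ • dir (partialSum δ i) + h • vertical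

/-- The facet functionals of an inscribed polygon. -/
def inscribedFunctional (δ : Fin (k + 3) → ℝ) (ρ h : ℝ) (i : Fin (k + 3)) : Space 2 →L[ℝ] ℝ :=
  innerSL ℝ ((ρ * Real.cos (δ i / 2)) • vertical - h • dir (partialSum δ i + δ i / 2))

theorem inscribedFunctional_apply (δ : Fin (k + 3) → ℝ) (ρ h : ℝ) (i : Fin (k + 3))
    (x : Space 2) : inscribedFunctional δ ρ h i x =
      ρ * Real.cos (δ i / 2) * x 2 - h * inner ℝ (dir (partialSum δ i + δ i / 2)) x := by
  change inner ℝ _ x = _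
  rw [inner_sub_left, real_inner_smul_left, real_inner_smul_left, inner_space_two vertical]
  simp

/-- The value compares the vertex `j` with the ends of the arc `i`, all seen from the midpoint of
that arc. -/
theorem inscribedFunctional_vertex (δ : Fin (k + 3) → ℝ) (ρ h : ℝ) (i j : Fin (k + 3)) :
    inscribedFunctional δ ρ h i (inscribedVertex δ ρ h j) = ρ * h *
      (Real.cos (δ i / 2) - Real.cos (partialSum δ j - partialSum δ i - δ i / 2)) := by
  rw [inscribedFunctional_apply, inscribedVertex, inner_add_right, real_inner_smul_right,
    real_inner_smul_right, inner_dir_dir, inner_dir_vertical,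
    ← Real.cos_neg (partialSum δ j - _ - _)]
  simp only [PiLp.add_apply, PiLp.smul_apply, dir_two, vertical_two, smul_eq_mul]
  ring_nf

theorem cos_partialSum_succ (hsum : ∑ i, δ i = 2 * Real.pi) (i : Fin (k + 3)) (x : ℝ) :
    Real.cos (partialSum δ (i + 1) - x) = Real.cos (partialSum δ i + δ i - x) := by
  by_cases h : i = Fin.last _
  · subst h
    rw [fin_last_add_one, partialSum_zero, partialSum_last_add, hsum,
      show 2 * Real.pi - x = (0 - x) + 2 * Real.pi by ring, Real.cos_add_two_pi]
  · rw [partialSum_succ δ h]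

/-- Modulo `2π`, a vertex that is not an end of the arc `i` is farther than `δ i / 2` from its
midpoint, where the cosine is smaller (`cos_lt_cos_half`). The four cases below are the two bounds
for `j` before and after `i`. -/
theorem isStrictConfig_inscribed (hδ : ∀ i, 0 < δ i) (hsum : ∑ i, δ i = 2 * Real.pi) {ρ h : ℝ}
    (hρ : 0 < ρ) (hh : 0 < h) :
    IsStrictConfig (inscribedVertex δ ρ h) (inscribedFunctional δ ρ h) where
  finrank_eq := finrank_euclideanSpace_fin
  apply_self i := by
    rw [inscribedFunctional_vertex, sub_self, zero_sub, Real.cos_neg, sub_self, mul_zero]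
  apply_succ i := by
    rw [inscribedFunctional_vertex, sub_sub, cos_partialSum_succ hsum]
    ring_nf
  pos i j hji hji' := by
    rw [inscribedFunctional_vertex]
    refine mul_pos (mul_pos hρ hh) (sub_pos.2 (cos_lt_cos_half (hδ i) ?_ ?_))
    all_goals rcases lt_or_gt_of_ne hji with hlt | hlt
    · have := partialSum_add_le hδ hlt
      rw [abs_of_neg (by linarith [hδ i, hδ j])]
      linarith [hδ j]
    · have hi : i ≠ Fin.last _ := (hlt.trans_le (Fin.le_last j)).ne
      have h1 : i + 1 < j := by
        refine lt_of_le_of_ne ?_ hji'.symm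
        rw [Fin.le_def, fin_add_one_of_lt_last hi]
        exact hlt
      have := partialSum_add_le hδ h1
      rw [partialSum_succ δ hi] at this
      rw [abs_of_pos (by linarith [hδ i, hδ (i + 1)])]
      linarith [hδ (i + 1)]
    · have := partialSum_add_le hδ hlt
      rw [abs_of_neg (by linarith [hδ i, hδ j])]
      have h1 := partialSum_nonneg hδ j
      -- The upper bound is strict because some arc lies outside the stretch from `j` to the end of
      -- the arc `i`: an arc after `i`, or, if `i` is the last index, an arc before `j`, which
      -- exists since `j ≠ i + 1 = 0`.
      by_cases hi : i = Fin.last _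
      · have hj : j ≠ 0 := by
          rintro rfl
          rw [hi, fin_last_add_one] at hji'
          exact hji' rfl
        linarith [partialSum_pos hδ hj, partialSum_add_le_sum hδ i]
      · linarith [partialSum_add_lt_sum hδ hi]
    · have := partialSum_add_le hδ hlt
      rw [abs_of_pos (by linarith [hδ i])]
      linarith [partialSum_add_le_sum hδ j, hδ j, hδ i, partialSum_nonneg hδ i]

/-- If two edges had the same span, the functional of the first would kill both ends of the second;
but it is positive on all vertices except its own two. -/
theorem IsStrictConfig.span_edge_ne {V : Type*} [NormedAddCommGroup V] [InnerProductSpace ℝ V]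
    [FiniteDimensional ℝ V] {p : Fin (k + 3) → V} {a : Fin (k + 3) → V →L[ℝ] ℝ}
    (h : IsStrictConfig p a) {i j : Fin (k + 3)} (hij : i ≠ j) :
    Submodule.span ℝ (polygonCone p (.edge i)) ≠ Submodule.span ℝ (polygonCone p (.edge j)) := by
  intro heq
  have hle : Submodule.span ℝ (polygonCone p (.edge i)) ≤ LinearMap.ker (a i : V →ₗ[ℝ] ℝ) := by
    refine Submodule.span_le.2 ?_
    rw [polygonCone_edge]
    rintro x ⟨s, t, -, -, rfl⟩
    change a i _ = 0
    rw [map_add, map_smul, map_smul, h.apply_self, h.apply_succ]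
    simp
  rw [heq] at hle
  have h1 : a i (p j) = 0 := hle (Submodule.subset_span (by
    rw [polygonCone_edge]; exact ⟨1, 0, zero_le_one, le_rfl, by simp⟩))
  have h2 : a i (p (j + 1)) = 0 := hle (Submodule.subset_span (by
    rw [polygonCone_edge]; exact ⟨0, 1, le_rfl, zero_le_one, by simp⟩))
  have h3 : j = i + 1 := by
    by_contra hne
    exact (h.pos i j hij.symm hne).ne' h1
  subst h3
  exact (h.pos i _ (fin_add_two_ne i) (fin_add_one_ne _)).ne' h2

/-- A polygon with prescribed edge lengths has an inscribed realisation. -/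
theorem exists_inscribed_angles {S : Fin (k + 3) → ℝ} (hS : ∀ i, 0 < S i)
    (hmax : ∀ i, S i ≤ S (Fin.last _)) (h1 : 2 * S (Fin.last _) < ∑ i, S i)
    (h2 : ∑ i, S i < 2 * Real.pi) :
    ∃ (ρ : ℝ) (δ : Fin (k + 3) → ℝ), 0 < ρ ∧ ρ < 1 ∧ (∀ i, 0 < δ i) ∧
      ∑ i, δ i = 2 * Real.pi ∧ ∀ i, ρ * Real.sin (δ i / 2) = Real.sin (S i / 2) := by
  set M := Fin.last (k + 2) with hM
  -- An edge of length `S i` has half-chord `d i`, and in a circle of radius `ρ` that chord subtends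
  -- the angle `2 * arcsin (d i / ρ)`.
  set d : Fin (k + 3) → ℝ := fun i => Real.sin (S i / 2) with hd
  have hpi := Real.pi_pos
  have hSpi : ∀ i, S i < Real.pi := fun i => by linarith [hmax i]
  have hd0 : ∀ i, 0 < d i := fun i =>
    Real.sin_pos_of_pos_of_lt_pi (by linarith [hS i]) (by linarith [hSpi i])
  have hdM : ∀ i, d i ≤ d M := fun i =>
    Real.sin_le_sin_of_le_of_le_pi_div_two (by linarith [hS i]) (by linarith [hSpi M])
      (by linarith [hmax i])
  have hdM1 : d M < 1 := by
    have := Real.sin_lt_sin_of_lt_of_le_pi_div_two (x := S M / 2) (y := Real.pi / 2)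
      (by linarith [hS M]) le_rfl (by linarith [hSpi M])
    rwa [Real.sin_pi_div_two] at this
  have harc1 : ∀ i, Real.arcsin (d i / 1) = S i / 2 := fun i => by
    rw [div_one]
    exact Real.arcsin_sin (by linarith [hS i]) (by linarith [hSpi i])
  have hcont : ∀ i, ContinuousOn (fun ρ : ℝ => Real.arcsin (d i / ρ)) (Icc (d M) 1) := fun i =>
    Real.continuous_arcsin.comp_continuousOn (continuousOn_const.div continuousOn_id
      fun x hx => ((hd0 M).trans_le hx.1).ne')
  have hpos : ∀ ρ, 0 < ρ → ∀ i, 0 < Real.arcsin (d i / ρ) := fun ρ hρ i =>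
    Real.arcsin_pos.2 (div_pos (hd0 i) hρ)
  have hsin : ∀ ρ, d M ≤ ρ → ∀ i, ρ * Real.sin (Real.arcsin (d i / ρ)) = d i := by
    intro ρ hρ i
    have hρ0 := (hd0 M).trans_le hρ
    rw [Real.sin_arcsin (by have := div_pos (hd0 i) hρ0; linarith)
      ((div_le_one hρ0).2 ((hdM i).trans hρ))]
    field_simp
  have hsplit : ∀ f : Fin (k + 3) → ℝ, ∑ i, f i = ∑ i ∈ Finset.univ.erase M, f i + f M := fun f =>
    (Finset.sum_erase_add _ _ (Finset.mem_univ M)).symm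
  -- The radius runs from one, a great circle, where the half-angles add up to less than `π`, down
  -- to `d M`, where the longest chord is a diameter. If their sum has reached `π` by then, some
  -- radius closes the polygon. Otherwise the centre lies beyond the longest chord, whose arc has to
  -- be replaced by its complement.
  by_cases hcase : Real.pi ≤ ∑ i, Real.arcsin (d i / d M)
  · have hf1 : ∑ i, Real.arcsin (d i / 1) < Real.pi := by
      simp_rw [harc1]
      rw [← Finset.sum_div]
      linarith
    obtain ⟨ρ, hρ, hρe⟩ := intermediate_value_Icc' hdM1.le
      (continuousOn_finsetSum (Finset.univ : Finset (Fin (k + 3))) fun i _ => hcont i)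
      (show Real.pi ∈ Icc _ _ from ⟨hf1.le, hcase⟩)
    have hρe : ∑ i, Real.arcsin (d i / ρ) = Real.pi := hρe
    have hρ0 := (hd0 M).trans_le hρ.1
    refine ⟨ρ, fun i => 2 * Real.arcsin (d i / ρ), hρ0, lt_of_le_of_ne hρ.2 ?_, fun i => ?_, ?_,
      fun i => ?_⟩
    · rintro rfl
      linarith
    · linarith [hpos ρ hρ0 i]
    · rw [← Finset.mul_sum, hρe]
    · rw [mul_div_cancel_left₀ _ two_ne_zero]
      exact hsin ρ hρ.1 i
  · push Not at hcase
    -- When the longest chord is a diameter its half-angle is `π / 2`, and the other half-angles add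
    -- up to less. At radius one the strict polygon inequality reverses the comparison.
    have hg0 : ∑ i ∈ Finset.univ.erase M, Real.arcsin (d i / d M) - Real.arcsin (d M / d M) ≤ 0 := by
      rw [hsplit, div_self (hd0 M).ne', Real.arcsin_one] at hcase
      rw [div_self (hd0 M).ne', Real.arcsin_one]
      linarith
    have hg1 : 0 < ∑ i ∈ Finset.univ.erase M, Real.arcsin (d i / 1) - Real.arcsin (d M / 1) := by
      simp_rw [harc1]
      rw [hsplit] at h1
      rw [← Finset.sum_div]
      linarith
    obtain ⟨ρ, hρ, hρe⟩ := intermediate_value_Icc hdM1.le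
      ((continuousOn_finsetSum (Finset.univ.erase M) fun i _ => hcont i).sub (hcont M))
      (show (0 : ℝ) ∈ Icc _ _ from ⟨hg0, hg1.le⟩)
    have hρe : ∑ i ∈ Finset.univ.erase M, Real.arcsin (d i / ρ) - Real.arcsin (d M / ρ) = 0 := hρe
    have hρ0 := (hd0 M).trans_le hρ.1
    refine ⟨ρ, fun i => if i = M then 2 * Real.pi - 2 * Real.arcsin (d i / ρ) else
      2 * Real.arcsin (d i / ρ), hρ0, lt_of_le_of_ne hρ.2 ?_, fun i => ?_, ?_, fun i => ?_⟩
    · rintro rfl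
      linarith
    · dsimp only
      split_ifs
      · linarith [Real.arcsin_le_pi_div_two (d i / ρ)]
      · linarith [hpos ρ hρ0 i]
    · rw [hsplit, if_pos rfl, Finset.sum_congr rfl fun i hi => if_neg (Finset.ne_of_mem_erase hi),
        ← Finset.mul_sum]
      linarith
    · dsimp only
      split_ifs
      · rw [show (2 * Real.pi - 2 * Real.arcsin (d i / ρ)) / 2 = Real.pi - Real.arcsin (d i / ρ)
          by ring, Real.sin_pi_sub]
        exact hsin ρ hρ.1 i
      · rw [mul_div_cancel_left₀ _ two_ne_zero]
        exact hsin ρ hρ.1 i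

theorem area_inscribed_edge {S : Fin (k + 3) → ℝ} {ρ : ℝ} (hS : ∀ i, 0 < S i)
    (hSpi : ∀ i, S i < Real.pi) (hρ : 0 < ρ) (hρ1 : ρ < 1) (hδ : ∀ i, 0 < δ i)
    (hsum : ∑ i, δ i = 2 * Real.pi) (h : ∀ i, ρ * Real.sin (δ i / 2) = Real.sin (S i / 2))
    (i : Fin (k + 3)) :
    area (trace (polygonCone (inscribedVertex δ ρ √(1 - ρ ^ 2)) (.edge i))) = S i := by
  have hlt : 0 < 1 - ρ ^ 2 := by nlinarith
  have hsq := Real.sq_sqrt hlt.le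
  set η := √(1 - ρ ^ 2) with hη
  have hη0 : 0 < η := Real.sqrt_pos.2 hlt
  have hinner : ∀ i j, inner ℝ (inscribedVertex δ ρ η i) (inscribedVertex δ ρ η j) =
      ρ ^ 2 * Real.cos (partialSum δ i - partialSum δ j) + η ^ 2 := by
    intro i j
    rw [inscribedVertex, inscribedVertex, inner_add_left, inner_add_right, inner_add_right]
    have hvv : inner ℝ vertical vertical = (1 : ℝ) := by
      rw [real_inner_self_eq_norm_sq, norm_vertical, one_pow]
    simp only [real_inner_smul_left, real_inner_smul_right, inner_dir_dir, inner_dir_vertical,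
      real_inner_comm (dir _) vertical, hvv]
    ring
  have hnorm : ∀ i, ‖inscribedVertex δ ρ η i‖ = 1 := by
    intro i
    rw [← sq_eq_sq₀ (norm_nonneg _) zero_le_one, ← real_inner_self_eq_norm_sq, hinner, sub_self,
      Real.cos_zero, hsq]
    ring
  have hc := (isStrictConfig_inscribed hδ hsum hρ hη0).isFanAt (.edge i)
  have hpoly := hc.cell.poly
  rw [IsStrictConfig.polygonCone_edge] at hpoly ⊢
  refine area_cone2 (hnorm _) (hnorm _) (hS i) (hSpi i) ?_ hpoly
  rw [hinner, ← Real.cos_neg, neg_sub, cos_partialSum_succ hsum, add_sub_cancel_left, hsq]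
  -- In terms of half-angles the two cosines agree precisely because the chords do.
  have e : ∀ x : ℝ, Real.cos x = 1 - 2 * Real.sin (x / 2) ^ 2 := fun x => by
    rw [Real.sin_sq, show Real.cos x = Real.cos (2 * (x / 2)) by ring_nf, Real.cos_two_mul]
    ring
  rw [e (δ i), e (S i), ← h]
  ring

end Inscribed

/-! ### Hemispheres and flat polygons as limits -/

section PolygonLimits

variable {k : ℕ} {S : Fin (k + 3) → ℝ}

/-- Pairing with a unit vector `e` that makes inner product at least `c` with all generators gives
the salience constant needed in `coneClose_simplexCone`. -/
theorem mul_sum_le_norm_of_inner {V ι : Type*} [NormedAddCommGroup V] [InnerProductSpace ℝ V]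
    [Fintype ι] {p : ι → V} {A : Finset ι} {c : ℝ} {e : V} (he : ‖e‖ = 1)
    (h : ∀ i ∈ A, c ≤ inner ℝ e (p i)) (t : ι → ℝ) (h0 : ∀ i, 0 ≤ t i) (hA : ∀ i ∉ A, t i = 0) :
    c * ∑ i, t i ≤ ‖∑ i, t i • p i‖ := by
  have h1 : inner ℝ e (∑ i, t i • p i) ≤ ‖e‖ * ‖∑ i, t i • p i‖ := real_inner_le_norm _ _
  rw [he, one_mul, inner_sum] at h1
  refine le_trans ?_ h1
  rw [Finset.mul_sum]
  refine Finset.sum_le_sum fun i _ => ?_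
  rw [real_inner_smul_right, mul_comm]
  by_cases hi : i ∈ A
  · exact mul_le_mul_of_nonneg_left (h i hi) (h0 i)
  · rw [hA i hi, zero_mul, zero_mul]

theorem dir_partialSum_succ (hsum : ∑ i, S i = 2 * Real.pi) (i : Fin (k + 3)) :
    dir (partialSum S (i + 1)) = dir (partialSum S i + S i) := by
  by_cases h : i = Fin.last _
  · subst h
    rw [fin_last_add_one, partialSum_zero, partialSum_last_add, hsum]
    have := dir_add_int_mul_two_pi 0 1
    rw [Int.cast_one, one_mul, zero_add] at this
    exact this.symm
  · rw [partialSum_succ S h]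

theorem norm_inscribedVertex_sub (S : Fin (k + 3) → ℝ) {h : ℝ} (hh : 0 < h) (i : Fin (k + 3)) :
    ‖inscribedVertex S 1 h i - dir (partialSum S i)‖ = h := by
  rw [inscribedVertex, one_smul, add_sub_cancel_left, norm_smul, norm_vertical, mul_one,
    Real.norm_eq_abs, abs_of_pos hh]

/-- The cones over the faces of a hemisphere whose boundary is subdivided into arcs. -/
def hemisphereCone (S : Fin (k + 3) → ℝ) : PolygonFace k → Set (Space 2)
  | .vertex i => {x | ∃ r : ℝ, 0 ≤ r ∧ x = r • dir (partialSum S i)}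
  | .edge i => arcCone (partialSum S i) (partialSum S i + S i)
  | .body => {x | 0 ≤ x 2}

theorem isFanAt_hemisphereCone_of_ne (hS : ∀ i, 0 < S i) (hpi : ∀ i, S i ≤ Real.pi)
    (hsum : ∑ i, S i = 2 * Real.pi) {F : PolygonFace k} (hF : F ≠ .body) :
    IsFanAt PolygonFace.dim (hemisphereCone S) F := by
  cases F with
  | vertex i => exact isFanAt_vertex (dir_ne_zero _) rfl
  | edge i =>
    refine isFanAt_edge_of_arcCone (j := i) (l := i + 1) (lt_add_of_pos_right _ (hS i))
      (by linarith [hpi i]) (Or.inl ⟨rfl, rfl⟩) rfl ?_ rfl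
    rw [← dir_partialSum_succ hsum]
    rfl
  | body => exact absurd rfl hF

/-- The angles of the relative interior of a face. -/
def faceAngles (S : Fin (k + 3) → ℝ) : PolygonFace k → Set ℝ
  | .vertex i => {partialSum S i}
  | .edge i => Ioo (partialSum S i) (partialSum S i + S i)
  | .body => ∅

theorem faceAngles_disjoint (hS : ∀ i, 0 < S i) {F F' : PolygonFace k} (hne : F ≠ F') :
    Disjoint (faceAngles S F) (faceAngles S F') := by
  have key : ∀ i j, i < j → partialSum S i < partialSum S j := fun i j h => by
    linarith [partialSum_add_le hS h, hS i]
  have hve : ∀ i j, partialSum S i ∉ Ioo (partialSum S j) (partialSum S j + S j) := by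
    rintro i j ⟨h1, h2⟩
    rcases lt_trichotomy i j with h | rfl | h
    · linarith [key i j h]
    · exact h1.false
    · linarith [partialSum_add_le hS h]
  rw [Set.disjoint_left]
  cases F with
  | vertex i => cases F' with
    | vertex j =>
      rintro _ rfl h2
      have h2 : partialSum S i = partialSum S j := h2
      rcases lt_trichotomy i j with h | rfl | h
      · exact (key i j h).ne h2
      · exact hne rfl
      · exact (key j i h).ne h2.symm
    | edge j =>
      rintro _ rfl
      exact hve i j
    | body => simp [faceAngles]
  | edge i => cases F' with
    | vertex j =>
      rintro _ h rfl
      exact hve j i h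
    | edge j =>
      rintro φ ⟨h1, h2⟩ ⟨h3, h4⟩
      rcases lt_trichotomy i j with h | rfl | h
      · linarith [partialSum_add_le hS h]
      · exact hne rfl
      · linarith [partialSum_add_le hS h]
    | body => simp [faceAngles]
  | body => simp [faceAngles]

theorem rint_hemisphereCone (hS : ∀ i, 0 < S i) (hpi : ∀ i, S i ≤ Real.pi)
    {F : PolygonFace k} (hF : F ≠ .body) :
    rint (hemisphereCone S F) = {x | ∃ r φ : ℝ, 0 < r ∧ φ ∈ faceAngles S F ∧ x = r • dir φ} := by
  cases F with
  | vertex i =>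
    refine (IsStrictConfig.rint_ray (dir_ne_zero _)).trans ?_
    simp [faceAngles]
  | edge i =>
    refine (arcCone_span_rint (lt_add_of_pos_right _ (hS i)) (by linarith [hpi i])).2.trans ?_
    simp [faceAngles, and_assoc]
  | body => exact absurd rfl hF

theorem rint_halfspace_two :
    Submodule.span ℝ {x : Space 2 | 0 ≤ x 2} = ⊤ ∧
      rint {x : Space 2 | 0 ≤ x 2} = {x | 0 < x 2} := by
  obtain ⟨h1, h2⟩ := span_and_rint_poly (⊤ : Submodule ℝ (Space 2))
    (fun _ : Unit => (EuclideanSpace.proj (𝕜 := ℝ) (2 : Fin 3) :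
      EuclideanSpace ℝ (Fin 3) →L[ℝ] ℝ)) (y := vertical) Submodule.mem_top (by simp)
    (K := {x : Space 2 | 0 ≤ x 2}) (by ext; simp)
  exact ⟨h1, h2.trans (by ext; simp)⟩

theorem exists_partialSum_le {φ : ℝ} (h0 : 0 ≤ φ) (h1 : φ < ∑ i, S i) :
    ∃ i, partialSum S i ≤ φ ∧ φ ≤ partialSum S i + S i := by
  obtain ⟨i, hi, hmax⟩ := Finset.exists_max_image (Finset.univ.filter fun i => partialSum S i ≤ φ) id
    ⟨0, by simpa [partialSum_zero] using h0⟩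
  refine ⟨i, (Finset.mem_filter.1 hi).2, ?_⟩
  by_contra! hlt
  by_cases hl : i = Fin.last _
  · subst hl
    linarith [partialSum_last_add S]
  · rw [← partialSum_succ S hl] at hlt
    have := hmax (i + 1) (by simpa using hlt.le)
    have h2 := fin_add_one_of_lt_last hl
    simp only [id, Fin.le_def] at this
    omega

theorem isFanAt_hemisphereCone_body (hS : ∀ i, 0 < S i) (hpi : ∀ i, S i ≤ Real.pi)
    (hsum : ∑ i, S i = 2 * Real.pi) : IsFanAt PolygonFace.dim (hemisphereCone S) .body := by
  obtain ⟨h1, h2⟩ := rint_halfspace_two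
  have hb : hemisphereCone S .body = {x | 0 ≤ x 2} := rfl
  have hplane : ∀ F : PolygonFace k, F ≠ .body → ∀ x ∈ hemisphereCone S F, x 2 = 0 := by
    intro F hF x hx
    cases F with
    | vertex i =>
      obtain ⟨r, -, rfl⟩ := hx
      simp
    | edge i =>
      obtain ⟨r, φ, -, -, -, rfl⟩ := hx
      simp
    | body => exact absurd rfl hF
  have hdis : ∀ F F' : PolygonFace k, F ≠ F' → F ≠ .body →
      Disjoint (rint (hemisphereCone S F)) (rint (hemisphereCone S F')) := by
    intro F F' hne hF
    rw [Set.disjoint_left]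
    by_cases hF' : F' = .body
    · subst hF'
      intro x hx hx'
      rw [hb, h2] at hx'
      exact hx'.ne' (hplane F hF x (rint_subset _ hx))
    · rw [rint_hemisphereCone hS hpi hF, rint_hemisphereCone hS hpi hF']
      rintro x ⟨r, φ, hr, hφ, rfl⟩ ⟨r', φ', hr', hφ', h⟩
      have hrange : ∀ (F : PolygonFace k) (φ : ℝ), φ ∈ faceAngles S F →
          0 ≤ φ ∧ φ < 2 * Real.pi := by
        intro F φ hφ
        cases F with
        | vertex i =>
          obtain rfl : φ = partialSum S i := hφ
          exact ⟨partialSum_nonneg hS i, by linarith [partialSum_add_le_sum hS i, hS i]⟩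
        | edge i =>
          exact ⟨by linarith [partialSum_nonneg hS i, hφ.1],
            by linarith [partialSum_add_le_sum hS i, hφ.2]⟩
        | body => exact absurd hφ (by simp [faceAngles])
      have h3 := hrange F φ hφ
      have h4 := hrange F' φ' hφ'
      have := smul_dir_inj hr hr' (by rw [abs_lt]; constructor <;> linarith) h
      subst this
      exact Set.disjoint_left.1 (faceAngles_disjoint hS hne) hφ hφ'
  refine ⟨⟨?_, ?_, vertical, ?_, ?_⟩, ?_, fun F F' _ _ hne => ?_⟩
  · exact IsPolyCone.halfspace (EuclideanSpace.proj (𝕜 := ℝ) (2 : Fin 3))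
  · rw [hb, h1, finrank_top, finrank_euclideanSpace_fin]
    rfl
  · simp [hb]
  · simp [hb]
  · rw [hb, h2]
    ext x
    simp only [Set.mem_sdiff, mem_ofPred_eq, mem_union, mem_singleton_iff, mem_iUnion, exists_prop]
    constructor
    · rintro ⟨h3, h4⟩
      obtain ⟨r, φ, hr, h5, h6, rfl⟩ := exists_polar_plane (mem_plane.2 (le_antisymm (not_lt.1 h4) h3)) 0
      obtain ⟨i, h7, h8⟩ := exists_partialSum_le h5 (by linarith)
      exact Or.inr ⟨.edge i, PolygonFace.lt_body_iff.2 (Or.inr ⟨i, rfl⟩), r, φ, hr, h7, h8, rfl⟩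
    · rintro (rfl | ⟨F, hF, hx⟩)
      · simp
      · have := hplane F hF.ne x hx
        rw [this]
        simp
  · by_cases hF : F = .body
    · exact (hdis F' F hne.symm (by rintro rfl; exact hne hF)).symm
    · exact hdis F F' hne hF

/-- The vertices are lifted from the equator to a small height `h`. Edges are uniformly salient with
constant `c`, which is positive as no edge reaches `π`. The half-space is not salient and is
compared by hand. -/
theorem exists_coneClose_hemisphereCone (hS : ∀ i, 0 < S i) (hmax : ∀ i, S i ≤ S (Fin.last _))
    (hpi : S (Fin.last _) < Real.pi) (hsum : ∑ i, S i = 2 * Real.pi) {ε : ℝ} (hε : 0 < ε) :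
    ∃ (p : Fin (k + 3) → Space 2) (a : Fin (k + 3) → Space 2 →L[ℝ] ℝ), IsStrictConfig p a ∧
      ∀ F, ConeClose ε (polygonCone p F) (hemisphereCone S F) := by
  set c := Real.cos (S (Fin.last _) / 2) with hc
  have hci : ∀ i, c ≤ Real.cos (S i / 2) := fun i =>
    Real.cos_le_cos_of_nonneg_of_le_pi (by linarith [hS i]) (by linarith [hS (Fin.last (k + 2))])
      (by linarith [hmax i])
  have hc0 : 0 < c := Real.cos_pos_of_mem_Ioo ⟨by linarith [hS (Fin.last (k + 2)), Real.pi_pos],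
    by linarith⟩
  -- The solution of `h * (1 + ε) = ε * c`, the condition in `coneClose_simplexCone`.
  set h := ε * c / (1 + ε) with hh
  have hh0 : 0 < h := by positivity
  have hhε : h * (1 + ε) ≤ ε * c := by
    rw [hh, div_mul_cancel₀]
    positivity
  have hcfg := isStrictConfig_inscribed hS hsum one_pos hh0
  refine ⟨_, _, hcfg, ?_⟩
  have hA : ∀ i (A : Finset (Fin (k + 3))), A ⊆ {i, i + 1} →
      ConeClose ε (simplexCone (inscribedVertex S 1 h) A)
        (simplexCone (fun i => dir (partialSum S i)) A) := by
    intro i A hAi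
    refine coneClose_simplexCone hh0.le hε.le (mul_sum_le_norm_of_inner
      (norm_dir (partialSum S i + S i / 2)) ?_) (fun j _ => (norm_inscribedVertex_sub S hh0 j).le) hhε
    intro j hj
    rw [inner_dir_dir, ← Real.cos_neg, neg_sub]
    have := hAi hj
    rw [Finset.mem_insert, Finset.mem_singleton] at this
    rcases this with rfl | rfl
    · rw [sub_add_cancel_left, Real.cos_neg]
      exact hci j
    · rw [cos_partialSum_succ hsum, show partialSum S i + S i - (partialSum S i + S i / 2) = S i / 2
        by ring]
      exact hci i
  intro F
  cases F with
  | vertex i =>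
    have := hA i {i} (by simp)
    rwa [simplexCone_singleton (fun i => dir (partialSum S i))] at this
  | edge i =>
    have := hA i {i, i + 1} subset_rfl
    rw [simplexCone_pair (fun i => dir (partialSum S i)) (fin_add_one_ne i).symm] at this
    have he : hemisphereCone S (.edge i) =
        cone2 (dir (partialSum S i)) (dir (partialSum S (i + 1))) := by
      rw [dir_partialSum_succ hsum, ← arcCone_eq_cone2 (lt_add_of_pos_right _ (hS i))
        (by linarith [hmax i])]
      rfl
    rw [he]
    exact this
  | body =>
    constructor
    · intro x hx
      refine ⟨x, ?_, by simp; positivity⟩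
      refine simplexCone_subset _ _ (IsPolyCone.halfspace
        (EuclideanSpace.proj (𝕜 := ℝ) (2 : Fin 3))) (fun i _ => ?_) hx
      simp [inscribedVertex, hh0.le]
    · intro y hy
      have hy : 0 ≤ y 2 := hy
      -- A facet functional can be as low as `-h * ‖y‖` on the half-space. Raising `y` by `h / c *
      -- ‖y‖` compensates, as its vertical coefficient is at least `c`; and `h / c ≤ ε`.
      refine ⟨y + (h / c * ‖y‖) • vertical, ?_, ?_⟩
      · rw [hcfg.polygonCone_body]
        intro j
        rw [inscribedFunctional_apply, inner_add_right, real_inner_smul_right, inner_dir_vertical,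
          mul_zero, add_zero, one_mul]
        simp only [PiLp.add_apply, PiLp.smul_apply, vertical_two, smul_eq_mul, mul_one]
        have h1 : inner ℝ (dir (partialSum S j + S j / 2)) y ≤ ‖y‖ := by
          have := real_inner_le_norm (dir (partialSum S j + S j / 2)) y
          rwa [norm_dir, one_mul] at this
        have h2 : c * (h / c * ‖y‖) ≤ Real.cos (S j / 2) * (y 2 + h / c * ‖y‖) := by
          refine mul_le_mul (hci j) (by linarith) (by positivity) (hc0.le.trans (hci j))
        have h3 : c * (h / c * ‖y‖) = h * ‖y‖ := by field_simp
        nlinarith [mul_le_mul_of_nonneg_left h1 hh0.le]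
      · rw [sub_add_cancel_left, norm_neg, norm_smul, norm_vertical, mul_one, Real.norm_eq_abs,
          abs_of_nonneg (by positivity)]
        refine mul_le_mul_of_nonneg_right ?_ (norm_nonneg _)
        rw [div_le_iff₀ hc0]
        nlinarith

/-- The cones over the faces of a flat polygon, whose last edge covers the others. -/
def flatPolygonCone (S : Fin (k + 3) → ℝ) : PolygonFace k → Set (Space 2)
  | .vertex i => {x | ∃ r : ℝ, 0 ≤ r ∧ x = r • dir (partialSum S i)}
  | .edge i => if i = Fin.last _ then arcCone 0 (S (Fin.last _)) else
      arcCone (partialSum S i) (partialSum S i + S i)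
  | .body => arcCone 0 (S (Fin.last _))

theorem flatPolygonCone_last (S : Fin (k + 3) → ℝ) :
    flatPolygonCone S (.edge (Fin.last _)) = arcCone 0 (S (Fin.last _)) := if_pos rfl

theorem flatPolygonCone_edge (S : Fin (k + 3) → ℝ) {i : Fin (k + 3)} (h : i ≠ Fin.last _) :
    flatPolygonCone S (.edge i) = arcCone (partialSum S i) (partialSum S i + S i) := if_neg h

theorem flatPolygonCone_subset (hS : ∀ i, 0 < S i)
    (hsum : partialSum S (Fin.last _) = S (Fin.last _)) (i : Fin (k + 3)) :
    flatPolygonCone S (.edge i) ⊆ flatPolygonCone S .body := by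
  by_cases hi : i = Fin.last _
  · subst hi
    rw [flatPolygonCone_last]
    rfl
  · rw [flatPolygonCone_edge S hi]
    rintro x ⟨r, φ, hr, h1, h2, rfl⟩
    refine ⟨r, φ, hr, (partialSum_nonneg hS i).trans h1, h2.trans ?_, rfl⟩
    rw [← hsum]
    exact partialSum_add_le hS (lt_of_le_of_ne (Fin.le_last i) hi)

theorem isFanAt_flatPolygonCone (hS : ∀ i, 0 < S i) (hmax : ∀ i, S i ≤ S (Fin.last _))
    (hpi : S (Fin.last _) ≤ Real.pi) (hsum : partialSum S (Fin.last _) = S (Fin.last _))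
    {F : PolygonFace k} (hF : F ≠ .body) :
    IsFanAt PolygonFace.dim (flatPolygonCone S) F := by
  cases F with
  | vertex i => exact isFanAt_vertex (dir_ne_zero _) rfl
  | edge i =>
    by_cases hi : i = Fin.last _
    · subst hi
      refine isFanAt_edge_of_arcCone (j := Fin.last _ + 1) (l := Fin.last _) (hS _)
        (by linarith) (Or.inr ⟨rfl, rfl⟩) ?_ ?_ (flatPolygonCone_last S)
      · rw [fin_last_add_one, ← partialSum_zero (δ := S)]
        rfl
      · rw [← hsum]
        rfl
    · refine isFanAt_edge_of_arcCone (j := i) (l := i + 1) (lt_add_of_pos_right _ (hS i))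
        (by linarith [hmax i]) (Or.inl ⟨rfl, rfl⟩) rfl ?_ (flatPolygonCone_edge S hi)
      rw [← partialSum_succ S hi]
      rfl
  | body => exact absurd rfl hF

theorem disjoint_rint_flatPolygonCone (hS : ∀ i, 0 < S i) (hmax : ∀ i, S i ≤ S (Fin.last _))
    (hpi : S (Fin.last _) ≤ Real.pi) (hsum : partialSum S (Fin.last _) = S (Fin.last _))
    {i j : Fin (k + 3)} (hij : i ≠ j) (hi : i ≠ Fin.last _) (hj : j ≠ Fin.last _) :
    Disjoint (rint (flatPolygonCone S (.edge i))) (rint (flatPolygonCone S (.edge j))) := by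
  have hle : ∀ i : Fin (k + 3), i ≠ Fin.last _ → partialSum S i + S i ≤ Real.pi := by
    intro i hi
    have := partialSum_add_le hS (lt_of_le_of_ne (Fin.le_last i) hi)
    linarith
  rw [Set.disjoint_left, flatPolygonCone_edge S hi, flatPolygonCone_edge S hj,
    (arcCone_span_rint (lt_add_of_pos_right _ (hS i)) (by linarith [hmax i])).2,
    (arcCone_span_rint (lt_add_of_pos_right _ (hS j)) (by linarith [hmax j])).2]
  rintro x ⟨r, φ, hr, h1, h2, rfl⟩ ⟨r', φ', hr', h3, h4, h⟩
  have := smul_dir_inj hr hr' (by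
    rw [abs_lt]
    constructor <;> linarith [hle i hi, hle j hj, partialSum_nonneg hS i, partialSum_nonneg hS j,
      Real.pi_pos]) h
  subst this
  exact Set.disjoint_left.1 (faceAngles_disjoint hS (F := .edge i) (F' := .edge j) (by simpa))
    ⟨h1, h2⟩ ⟨h3, h4⟩

theorem coneClose_of_angles {η : ℝ} (hη : 0 ≤ η) {I : Set ℝ} (hI : I ⊆ Icc 0 Real.pi) :
    ConeClose (η * Real.pi) {x | ∃ r φ : ℝ, 0 ≤ r ∧ φ ∈ I ∧ x = r • dir ((1 - η) * φ)}
      {x | ∃ r φ : ℝ, 0 ≤ r ∧ φ ∈ I ∧ x = r • dir φ} := by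
  have key : ∀ φ ∈ I, ‖dir ((1 - η) * φ) - dir φ‖ ≤ η * Real.pi := by
    intro φ hφ
    refine (norm_dir_sub_dir_le _ _).trans ?_
    rw [show (1 - η) * φ - φ = -(η * φ) by ring, abs_neg, abs_of_nonneg (mul_nonneg hη (hI hφ).1)]
    exact mul_le_mul_of_nonneg_left (hI hφ).2 hη
  constructor
  · rintro x ⟨r, φ, hr, hφ, rfl⟩
    refine ⟨r • dir φ, ⟨r, φ, hr, hφ, rfl⟩, ?_⟩
    rw [← smul_sub, norm_smul, norm_smul, norm_dir, mul_one, mul_comm]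
    exact mul_le_mul_of_nonneg_right (key φ hφ) (norm_nonneg _)
  · rintro x ⟨r, φ, hr, hφ, rfl⟩
    refine ⟨r • dir ((1 - η) * φ), ⟨r, φ, hr, hφ, rfl⟩, ?_⟩
    rw [← smul_sub, norm_smul, norm_smul, norm_dir, mul_one, mul_comm, norm_sub_rev]
    exact mul_le_mul_of_nonneg_right (key φ hφ) (norm_nonneg _)

theorem arcCone_mul {c : ℝ} (hc : 0 < c) (α β : ℝ) :
    arcCone (c * α) (c * β) = {x | ∃ r φ : ℝ, 0 ≤ r ∧ φ ∈ Icc α β ∧ x = r • dir (c * φ)} := by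
  ext x
  constructor
  · rintro ⟨r, φ, hr, h1, h2, rfl⟩
    refine ⟨r, φ / c, hr, ⟨?_, ?_⟩, by rw [mul_div_cancel₀ _ hc.ne']⟩
    · rwa [le_div_iff₀ hc, mul_comm]
    · rwa [div_le_iff₀ hc, mul_comm]
  · rintro ⟨r, φ, hr, ⟨h1, h2⟩, rfl⟩
    exact ⟨r, c * φ, hr, mul_le_mul_of_nonneg_left h1 hc.le, mul_le_mul_of_nonneg_left h2 hc.le, rfl⟩

theorem cone2_comm {V : Type*} [AddCommGroup V] [Module ℝ V] (p q : V) : cone2 p q = cone2 q p := by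
  ext x
  constructor <;> rintro ⟨a, b, ha, hb, rfl⟩ <;> exact ⟨b, a, hb, ha, add_comm _ _⟩

/-- Multiplying all angles by `1 - η` makes the covering arc shorter than `π`, hence generated by
its ends, even if it was a semicircle. A direction moves no more than its angle, thus at most `η *
π`. -/
theorem coneClose_flatPolygonCone (hS : ∀ i, 0 < S i) (hmax : ∀ i, S i ≤ S (Fin.last _))
    (hpi : S (Fin.last _) ≤ Real.pi) (hsum : partialSum S (Fin.last _) = S (Fin.last _))
    {η : ℝ} (hη : 0 < η) (hη1 : η < 1) (F : PolygonFace k) :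
    ConeClose (η * Real.pi) (polygonCone (fun i => dir ((1 - η) * partialSum S i)) F)
      (flatPolygonCone S F) := by
  have hpos := Real.pi_pos
  have h1η : 0 < 1 - η := by linarith
  set q : Fin (k + 3) → Space 2 := fun i => dir ((1 - η) * partialSum S i) with hq
  have hle : ∀ i : Fin (k + 3), partialSum S i ≤ S (Fin.last _) := by
    intro i
    rcases (Fin.le_last i).eq_or_lt with rfl | h
    · exact hsum.le
    · linarith [partialSum_add_le hS h, hS i]
  have hlast : polygonCone q (.edge (Fin.last _)) =
      arcCone ((1 - η) * 0) ((1 - η) * S (Fin.last _)) := by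
    rw [IsStrictConfig.polygonCone_edge, cone2_comm, arcCone_eq_cone2
      (mul_lt_mul_of_pos_left (hS _) h1η) (by nlinarith [hS (Fin.last (k + 2))]), fin_last_add_one]
    simp only [hq, partialSum_zero, hsum]
  have hcl : ∀ α β : ℝ, 0 ≤ α → β ≤ Real.pi →
      ConeClose (η * Real.pi) (arcCone ((1 - η) * α) ((1 - η) * β)) (arcCone α β) := by
    intro α β hα hβ
    have h1 := arcCone_mul one_pos α β
    simp only [one_mul] at h1
    rw [arcCone_mul h1η, h1]
    exact coneClose_of_angles hη.le (Icc_subset_Icc hα hβ)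
  cases F with
  | vertex i =>
    have := coneClose_of_angles hη.le (I := {partialSum S i}) (by
      rw [singleton_subset_iff]
      exact ⟨partialSum_nonneg hS i, (hle i).trans hpi⟩)
    simp only [mem_singleton_iff, exists_eq_left, exists_and_left] at this
    rw [IsStrictConfig.polygonCone_vertex]
    exact this
  | edge i =>
    by_cases hi : i = Fin.last _
    · subst hi
      rw [hlast, flatPolygonCone_last]
      exact hcl _ _ le_rfl hpi
    · have h2 : partialSum S i + S i ≤ Real.pi :=
        (partialSum_add_le hS (lt_of_le_of_ne (Fin.le_last i) hi)).trans (hsum.le.trans hpi)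
      have h3 : polygonCone q (.edge i) =
          arcCone ((1 - η) * partialSum S i) ((1 - η) * (partialSum S i + S i)) := by
        rw [IsStrictConfig.polygonCone_edge, arcCone_eq_cone2
          (mul_lt_mul_of_pos_left (lt_add_of_pos_right _ (hS i)) h1η)
          (by nlinarith [hmax i, hS i])]
        simp only [hq, partialSum_succ S hi]
      rw [h3, flatPolygonCone_edge S hi]
      exact hcl _ _ (partialSum_nonneg hS i) h2
  | body =>
    have h2 : polygonCone q .body = arcCone ((1 - η) * 0) ((1 - η) * S (Fin.last _)) := by
      refine Subset.antisymm (simplexCone_subset _ _ (isConeCell_arcCone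
        (mul_lt_mul_of_pos_left (hS _) h1η) (by nlinarith [hS (Fin.last (k + 2))])).poly
          fun i _ => ?_) ?_
      · exact dir_mem_arcCone (mul_le_mul_of_nonneg_left (partialSum_nonneg hS i) h1η.le)
          (mul_le_mul_of_nonneg_left (hle i) h1η.le)
      · rw [← hlast]
        exact simplexCone_mono _ (Finset.subset_univ _)
    rw [h2]
    exact hcl _ _ le_rfl hpi

/-- Two perturbations are composed: the angles are shrunk to make the arc salient, and then the
vertices are lifted to a small height, which makes them the vertices of an inscribed polygon. -/
theorem exists_coneClose_flatPolygonCone (hS : ∀ i, 0 < S i) (hmax : ∀ i, S i ≤ S (Fin.last _))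
    (hpi : S (Fin.last _) ≤ Real.pi) (hsum : partialSum S (Fin.last _) = S (Fin.last _))
    {ε : ℝ} (hε : 0 < ε) :
    ∃ (p : Fin (k + 3) → Space 2) (a : Fin (k + 3) → Space 2 →L[ℝ] ℝ), IsStrictConfig p a ∧
      ∀ F, ConeClose ε (polygonCone p F) (flatPolygonCone S F) := by
  have hpos := Real.pi_pos
  -- Each perturbation gets a third of `ε₀`; the bound `ε₀ ≤ 1` absorbs the product term in
  -- `ConeClose.trans`.
  set ε₀ := min ε 1 with hε₀
  have hε₀0 : 0 < ε₀ := lt_min hε one_pos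
  have hε₀1 : ε₀ ≤ 1 := min_le_right _ _
  set η := ε₀ / (3 * Real.pi) with hη
  have hη0 : 0 < η := by positivity
  have hηpi : η * Real.pi = ε₀ / 3 := by rw [hη]; field_simp
  have hη1 : η < 1 := by
    have := Real.pi_gt_three
    nlinarith
  have h1η : 0 < 1 - η := by linarith
  set σ := S (Fin.last (k + 2)) with hσ
  -- The last arc takes the long way round, so that the arcs fill the circle. The positions of the
  -- vertices do not depend on it.
  set δ : Fin (k + 3) → ℝ := fun i => if i = Fin.last _ then 2 * Real.pi - (1 - η) * σ else
    (1 - η) * S i with hδ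
  have hps : ∀ i, partialSum δ i = (1 - η) * partialSum S i := fun i => by
    rw [← partialSum_smul]
    exact partialSum_congr (fun j hj => if_neg hj) i
  have hσ' : (1 - η) * σ < Real.pi := by nlinarith [hS (Fin.last (k + 2))]
  have hδ0 : ∀ i, 0 < δ i := by
    intro i
    simp only [hδ]
    split_ifs
    · linarith
    · exact mul_pos h1η (hS i)
  have hδsum : ∑ i, δ i = 2 * Real.pi := by
    rw [← partialSum_last_add, hps, hsum]
    simp [hδ]
  set c := Real.cos ((1 - η) * σ / 2) with hc
  have hc0 : 0 < c := Real.cos_pos_of_mem_Ioo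
    ⟨by nlinarith [hS (Fin.last (k + 2))], by linarith⟩
  set h := ε₀ / 3 * c / (1 + ε₀ / 3) with hh
  have hh0 : 0 < h := by positivity
  have hhε : h * (1 + ε₀ / 3) ≤ ε₀ / 3 * c := by
    rw [hh, div_mul_cancel₀]
    positivity
  refine ⟨_, _, isStrictConfig_inscribed hδ0 hδsum one_pos hh0, fun F => ?_⟩
  have h1 : ConeClose (ε₀ / 3) (polygonCone (inscribedVertex δ 1 h) F)
      (polygonCone (fun i => dir ((1 - η) * partialSum S i)) F) := by
    refine coneClose_simplexCone hh0.le (by positivity) (mul_sum_le_norm_of_inner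
      (norm_dir ((1 - η) * σ / 2)) ?_) (fun j _ => ?_) hhε
    · intro i _
      rw [inner_dir_dir, ← Real.cos_abs ((1 - η) * σ / 2 - _)]
      have h2 := partialSum_nonneg hS i
      have h3 : partialSum S i ≤ σ := by
        rcases (Fin.le_last i).eq_or_lt with rfl | h
        · exact hsum.le
        · linarith [partialSum_add_le hS h, hS i]
      have h4 := mul_nonneg h1η.le h2
      have h5 := mul_le_mul_of_nonneg_left h3 h1η.le
      refine Real.cos_le_cos_of_nonneg_of_le_pi (abs_nonneg _) (by linarith) ?_
      rw [abs_le]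
      constructor <;> linarith
    · rw [← hps]
      exact (norm_inscribedVertex_sub δ hh0 j).le
  have h2 := coneClose_flatPolygonCone hS hmax hpi hsum hη0 hη1 F
  rw [hηpi] at h2
  refine (h1.trans (by positivity) (by positivity) h2).mono ?_
  have : ε₀ ≤ ε := min_le_left _ _
  nlinarith

/-- Polygons with prescribed edge lengths. -/
theorem exists_polygon (hS : ∀ i, 0 < S i) (hmax : ∀ i, S i ≤ S (Fin.last _))
    (h1 : 2 * S (Fin.last _) ≤ ∑ i, S i) (h2 : ∑ i, S i ≤ 2 * Real.pi) :
    ∃ K : PolygonFace k → Set (Space 2),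
      (∀ F, F ≠ .body → IsFanAt PolygonFace.dim K F) ∧
      (∀ i, area (trace (K (.edge i))) = S i) ∧
      (∀ ε > 0, ∃ (p : Fin (k + 3) → Space 2) (a : Fin (k + 3) → Space 2 →L[ℝ] ℝ),
        IsStrictConfig p a ∧ ∀ F, ConeClose ε (polygonCone p F) (K F)) ∧
      (2 * S (Fin.last _) < ∑ i, S i → IsFanAt PolygonFace.dim K .body) ∧
      (2 * S (Fin.last _) < ∑ i, S i → ∑ i, S i < 2 * Real.pi → ∀ i j, i ≠ j →
        Submodule.span ℝ (K (.edge i)) ≠ Submodule.span ℝ (K (.edge j))) ∧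
      (2 * S (Fin.last _) = ∑ i, S i → K .body = K (.edge (Fin.last _)) ∧
        (∀ i, K (.edge i) ⊆ K .body) ∧ ∀ i j, i ≠ j → i ≠ Fin.last _ → j ≠ Fin.last _ →
          Disjoint (rint (K (.edge i))) (rint (K (.edge j)))) := by
  -- Three shapes: the doubly covered arc for equality in the polygon inequality, the hemisphere for
  -- total length `2π`, and the inscribed polygon if both inequalities are strict.
  rcases h1.eq_or_lt with h1e | h1
  · have hsum : partialSum S (Fin.last _) = S (Fin.last _) := by
      linarith [partialSum_last_add S]
    have hpi : S (Fin.last _) ≤ Real.pi := by linarith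
    refine ⟨flatPolygonCone S, fun F hF => isFanAt_flatPolygonCone hS hmax hpi hsum hF, fun i => ?_,
      fun ε hε => exists_coneClose_flatPolygonCone hS hmax hpi hsum hε, fun h => absurd h1e h.ne,
      fun h => absurd h1e h.ne, fun _ => ⟨(flatPolygonCone_last S).symm,
        flatPolygonCone_subset hS hsum, fun i j hij hi hj =>
          disjoint_rint_flatPolygonCone hS hmax hpi hsum hij hi hj⟩⟩
    by_cases hi : i = Fin.last _
    · subst hi
      rw [flatPolygonCone_last, area_arcCone (hS _) (by linarith), sub_zero]
    · rw [flatPolygonCone_edge S hi, area_arcCone (lt_add_of_pos_right _ (hS i))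
        (by linarith [hmax i]), add_sub_cancel_left]
  have hpi : ∀ i, S i < Real.pi := fun i => by linarith [hmax i]
  rcases h2.eq_or_lt with h2e | h2
  · refine ⟨hemisphereCone S, fun F hF =>
      isFanAt_hemisphereCone_of_ne hS (fun i => (hpi i).le) h2e hF, fun i => ?_,
      fun ε hε => exists_coneClose_hemisphereCone hS hmax (hpi _) h2e hε,
      fun _ => isFanAt_hemisphereCone_body hS (fun i => (hpi i).le) h2e,
      fun _ h => absurd h2e h.ne, fun h => absurd h h1.ne⟩
    refine (area_arcCone (lt_add_of_pos_right _ (hS i)) (by linarith [hpi i])).trans ?_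
    rw [add_sub_cancel_left]
  · obtain ⟨ρ, δ, hρ, hρ1, hδ, hsum, h⟩ := exists_inscribed_angles hS hmax h1 h2
    have hcfg := isStrictConfig_inscribed hδ hsum hρ (Real.sqrt_pos.2 (show 0 < 1 - ρ ^ 2 by nlinarith))
    exact ⟨_, fun F _ => hcfg.isFanAt F, area_inscribed_edge hS hpi hρ hρ1 hδ hsum h,
      fun ε hε => ⟨_, _, hcfg, fun F => ConeClose.refl hε.le _⟩, fun _ => hcfg.isFanAt _,
      fun _ _ i j hij => hcfg.span_edge_ne hij, fun h => absurd h h1.ne⟩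

end PolygonLimits

/-! ### Products of a cone with a cone of heights -/

section LiftedCones

variable {V W : Type*} [NormedAddCommGroup V] [InnerProductSpace ℝ V] [FiniteDimensional ℝ V]
  [NormedAddCommGroup W] [InnerProductSpace ℝ W] [FiniteDimensional ℝ W]

theorem finrank_span_lift (L : W ≃L[ℝ] V × ℝ) {K : Set V} {J : Set ℝ} (hK : (0 : V) ∈ K)
    (hJ : (0 : ℝ) ∈ J) : Module.finrank ℝ (Submodule.span ℝ (L ⁻¹' (K ×ˢ J))) =
      Module.finrank ℝ (Submodule.span ℝ K) + Module.finrank ℝ (Submodule.span ℝ J) := by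
  rw [span_preimage, span_prod hK hJ]
  set M := (Submodule.span ℝ K).prod (Submodule.span ℝ J) with hM
  have h1 : Module.finrank ℝ (M.comap (L : W →ₗ[ℝ] V × ℝ)) = Module.finrank ℝ M := by
    have := Submodule.comap_equiv_eq_map_symm L.toLinearEquiv M
    change Module.finrank ℝ (M.comap (L.toLinearEquiv : W →ₗ[ℝ] V × ℝ)) = _
    rw [this, LinearEquiv.finrank_map_eq]
  rw [h1, hM, ← Module.finrank_prod]
  have h2 : (Submodule.span ℝ K).prod (Submodule.span ℝ J) = LinearMap.range
      ((Submodule.span ℝ K).subtype.prodMap (Submodule.span ℝ J).subtype) := by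
    rw [LinearMap.range_prodMap, Submodule.range_subtype, Submodule.range_subtype]
  rw [h2]
  exact LinearMap.finrank_range_of_inj
    (Function.Injective.prodMap (Submodule.subtype_injective _) (Submodule.subtype_injective _))

theorem rint_lift (L : W ≃L[ℝ] V × ℝ) {K : Set V} {J : Set ℝ} (hK : (0 : V) ∈ K)
    (hJ : (0 : ℝ) ∈ J) : rint (L ⁻¹' (K ×ˢ J)) = L ⁻¹' (rint K ×ˢ rint J) := by
  rw [rint_preimage, rint_prod hK hJ]

theorem isPolyCone_lift (L : W ≃L[ℝ] V × ℝ) {K : Set V} {J : Set ℝ} (hK : IsPolyCone K)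
    (hJ : IsPolyCone J) : IsPolyCone (L ⁻¹' (K ×ˢ J)) :=
  (hK.prod hJ).preimage (L : W →L[ℝ] V × ℝ)

theorem span_Ici : Submodule.span ℝ (Ici (0 : ℝ)) = ⊤ :=
  (span_and_rint_poly (⊤ : Submodule ℝ ℝ) (fun _ : Unit => ContinuousLinearMap.id ℝ ℝ) (y := 1)
    Submodule.mem_top (by simp) (by ext; simp)).1

theorem rint_Ici : rint (Ici (0 : ℝ)) = Ioi 0 :=
  (span_and_rint_poly (⊤ : Submodule ℝ ℝ) (fun _ : Unit => ContinuousLinearMap.id ℝ ℝ) (y := 1)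
    Submodule.mem_top (by simp) (by ext; simp)).2.trans (by ext; simp)

theorem span_Iic : Submodule.span ℝ (Iic (0 : ℝ)) = ⊤ :=
  (span_and_rint_poly (⊤ : Submodule ℝ ℝ) (fun _ : Unit => -ContinuousLinearMap.id ℝ ℝ) (y := -1)
    Submodule.mem_top (by simp) (by ext; simp)).1

theorem rint_Iic : rint (Iic (0 : ℝ)) = Iio 0 :=
  (span_and_rint_poly (⊤ : Submodule ℝ ℝ) (fun _ : Unit => -ContinuousLinearMap.id ℝ ℝ) (y := -1)
    Submodule.mem_top (by simp) (by ext; simp)).2.trans (by ext; simp)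

theorem rint_univ : rint (univ : Set V) = univ := by
  ext x
  simp [rint]

theorem rint_singleton_zero : rint ({0} : Set V) = {0} := by
  ext x
  constructor
  · exact fun h => h.1
  · rintro rfl
    refine ⟨rfl, ?_⟩
    simp

theorem zero_notMem_rint {K : Set V} (hK : ∃ x ∈ K, -x ∉ K) (hp : IsPolyCone K) : (0 : V) ∉ rint K := by
  intro h
  obtain ⟨x, hx, hnx⟩ := hK
  obtain ⟨ε, hε, h1⟩ := rint_sub_smul_mem h (Submodule.subset_span hx)
  have h2 := h1 (-ε) (by rw [abs_neg, abs_of_pos hε])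
  rw [zero_add, neg_smul, ← smul_neg] at h2
  exact hnx ((hp.smul_mem_iff hε).1 h2)

theorem IsConeCell.lift_univ {d : ℕ} {K : Set V} (h : IsConeCell d K) (L : W ≃L[ℝ] V × ℝ) :
    IsConeCell (d + 1) (L ⁻¹' (K ×ˢ univ)) := by
  refine ⟨isPolyCone_lift L h.poly IsPolyCone.univ, ?_, ?_⟩
  · rw [finrank_span_lift L h.poly.zero_mem (mem_univ _), h.finrank_span, span_univ_real,
      finrank_top, Module.finrank_self]
  · obtain ⟨x, hx, hnx⟩ := h.pointed
    refine ⟨L.symm (x, 0), ⟨by simpa, mem_univ _⟩, ?_⟩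
    rintro ⟨h1, -⟩
    exact hnx (by simpa using h1)

theorem ConeClose.prod {ε : ℝ} (hε : 0 ≤ ε) {K K' : Set V} (h : ConeClose ε K K') (J : Set ℝ) :
    ConeClose ε (K ×ˢ J) (K' ×ˢ J) := by
  have aux : ∀ (x y : V) (t : ℝ), ‖x - y‖ ≤ ε * ‖x‖ → ‖(x, t) - (y, t)‖ ≤ ε * ‖(x, t)‖ := by
    intro x y t h
    rw [Prod.mk_sub_mk, sub_self, Prod.norm_mk, norm_zero, max_eq_left (norm_nonneg _)]
    exact h.trans (mul_le_mul_of_nonneg_left (norm_fst_le (x, t)) hε)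
  constructor
  · rintro ⟨x, t⟩ ⟨hx, ht⟩
    obtain ⟨y, hy, hxy⟩ := h.1 x hx
    exact ⟨(y, t), ⟨hy, ht⟩, aux x y t hxy⟩
  · rintro ⟨x, t⟩ ⟨hx, ht⟩
    obtain ⟨y, hy, hxy⟩ := h.2 x hx
    exact ⟨(y, t), ⟨hy, ht⟩, aux x y t hxy⟩

theorem exists_coneClose_preimage (L : W ≃L[ℝ] V × ℝ) {ε : ℝ} (hε : 0 < ε) :
    ∃ ε' > 0, ∀ K K' : Set (V × ℝ), ConeClose ε' K K' → ConeClose ε (L ⁻¹' K) (L ⁻¹' K') := by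
  set a := ‖(L.symm : V × ℝ →L[ℝ] W)‖
  set b := ‖(L : W →L[ℝ] V × ℝ)‖
  have ha : 0 ≤ a := norm_nonneg (L.symm : V × ℝ →L[ℝ] W)
  have hb : 0 ≤ b := norm_nonneg (L : W →L[ℝ] V × ℝ)
  have hab : 0 < a * b + 1 := by positivity
  -- The distortion `a * b` of `L` is uniform in the cones; adding one avoids a division by zero.
  refine ⟨ε / (a * b + 1), by positivity, fun K K' h => (h.preimage L (by positivity)).mono ?_⟩
  rw [show a * (ε / (a * b + 1)) * b = ε * (a * b / (a * b + 1)) by ring]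
  refine mul_le_of_le_one_right hε.le ((div_le_one hab).2 (by linarith))

end LiftedCones

/-! ### Suspension of a fan -/

section Suspension

/-- The faces of a suspension: two poles, and the suspensions of the given faces. -/
inductive SuspensionFace (α : Type) : Type
  | pole (b : Bool) : SuspensionFace α
  | susp (G : α) : SuspensionFace α

namespace SuspensionFace

variable {α : Type}

instance [Finite α] : Finite (SuspensionFace α) := by
  let f : SuspensionFace α → Bool ⊕ α
    | pole b => Sum.inl b
    | susp G => Sum.inr G
  refine Finite.of_injective f ?_
  intro F F' h
  cases F <;> cases F' <;> simp_all [f]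

/-- Incidence of faces. -/
def le [LE α] : SuspensionFace α → SuspensionFace α → Prop
  | pole b, pole b' => b = b'
  | pole _, susp _ => True
  | susp _, pole _ => False
  | susp G, susp G' => G ≤ G'

instance [PartialOrder α] : PartialOrder (SuspensionFace α) where
  le := le
  le_refl F := by cases F <;> simp [le]
  le_trans F F' F'' h h' := by
    cases F <;> cases F' <;> cases F'' <;> simp_all [le]
    exact h.trans h'
  le_antisymm F F' h h' := by
    cases F <;> cases F' <;> simp_all [le]
    exact le_antisymm h h'

variable [PartialOrder α]

theorem susp_injective : Function.Injective (susp : α → SuspensionFace α) := fun _ _ h => by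
  cases h
  rfl

theorem susp_le_susp {G G' : α} : susp G ≤ susp G' ↔ G ≤ G' := Iff.rfl

theorem susp_lt_susp {G G' : α} : susp G < susp G' ↔ G < G' := by
  rw [lt_iff_le_and_ne, lt_iff_le_and_ne, susp_le_susp, susp_injective.ne_iff]

theorem pole_lt_susp (b : Bool) (G : α) : pole b < susp G :=
  lt_of_le_of_ne (show le (pole b) (susp G) from trivial) (fun h => by cases h)

theorem not_lt_pole (F : SuspensionFace α) (b : Bool) : ¬ F < pole b := by
  intro h
  have h1 : le F (pole b) := h.le
  have h2 := h.ne
  cases F <;> simp_all [le]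

theorem lt_susp_iff {F : SuspensionFace α} {G : α} :
    F < susp G ↔ (∃ b, F = pole b) ∨ ∃ G' < G, F = susp G' := by
  cases F with
  | pole b => simp [pole_lt_susp]
  | susp G' => simp [susp_lt_susp]

/-- The dimension of a face. -/
def dim (d : α → ℕ) : SuspensionFace α → ℕ
  | pole _ => 0
  | susp G => d G + 1

theorem dim_strictMono {d : α → ℕ} (hd : StrictMono d) : StrictMono (dim d) := by
  intro F F' h
  cases F' with
  | pole b => exact absurd h (not_lt_pole F b)
  | susp G =>
    rcases lt_susp_iff.1 h with ⟨b, rfl⟩ | ⟨G', hG, rfl⟩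
    · simp [dim]
    · simpa [dim] using hd hG

end SuspensionFace

open SuspensionFace

/-- The face poset of the suspension of a complex. -/
def FacePoset.suspension {n : ℕ} (P : FacePoset n) : FacePoset (n + 1) where
  Face := SuspensionFace P.Face
  body := susp P.body
  le_body F := by
    cases F with
    | pole b => exact (pole_lt_susp b _).le
    | susp G => exact susp_le_susp.2 (P.le_body G)
  dim := SuspensionFace.dim P.dim
  dim_strictMono := SuspensionFace.dim_strictMono P.dim_strictMono
  dim_body := by simp [SuspensionFace.dim, P.dim_body]

variable {V W : Type*} [NormedAddCommGroup V] [InnerProductSpace ℝ V] [FiniteDimensional ℝ V]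
  [NormedAddCommGroup W] [InnerProductSpace ℝ W] [FiniteDimensional ℝ W] {α : Type} [PartialOrder α]

/-- The cones over the faces of a suspension. -/
def suspensionCone (L : W ≃L[ℝ] V × ℝ) (K : α → Set V) : SuspensionFace α → Set W
  | pole true => L ⁻¹' ({0} ×ˢ Ici 0)
  | pole false => L ⁻¹' ({0} ×ˢ Iic 0)
  | susp G => L ⁻¹' (K G ×ˢ univ)

theorem rint_pole (L : W ≃L[ℝ] V × ℝ) (K : α → Set V) (b : Bool) :
    rint (suspensionCone L K (pole b)) =
      L ⁻¹' ({0} ×ˢ (if b then Ioi 0 else Iio 0)) := by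
  cases b
  · exact (rint_lift L (mem_singleton (0 : V)) self_mem_Iic).trans (by rw [rint_singleton_zero, rint_Iic]; rfl)
  · exact (rint_lift L (mem_singleton (0 : V)) self_mem_Ici).trans (by rw [rint_singleton_zero, rint_Ici]; rfl)

theorem isFanAt_pole (L : W ≃L[ℝ] V × ℝ) (K : α → Set V) (d : α → ℕ) (b : Bool) :
    IsFanAt (SuspensionFace.dim d) (suspensionCone L K) (pole b) := by
  have h0 : Module.finrank ℝ (Submodule.span ℝ ({0} : Set V)) = 0 := by
    rw [Submodule.span_zero_singleton, finrank_bot]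
  refine ⟨⟨?_, ?_, ?_⟩, ?_, ?_⟩
  · cases b
    · exact isPolyCone_lift L IsPolyCone.singleton_zero isPolyCone_Iic
    · exact isPolyCone_lift L IsPolyCone.singleton_zero isPolyCone_Ici
  · cases b
    · exact (finrank_span_lift L (mem_singleton (0 : V)) self_mem_Iic).trans (by
        rw [h0, span_Iic, finrank_top, Module.finrank_self]; rfl)
    · exact (finrank_span_lift L (mem_singleton (0 : V)) self_mem_Ici).trans (by
        rw [h0, span_Ici, finrank_top, Module.finrank_self]; rfl)
  · cases b
    · exact ⟨L.symm (0, -1), by simp [suspensionCone], by simp [suspensionCone]⟩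
    · exact ⟨L.symm (0, 1), by simp [suspensionCone], by simp [suspensionCone]⟩
  · rw [rint_pole]
    have h1 : {F : SuspensionFace α | F < pole b} = ∅ := by
      ext F
      simp [not_lt_pole]
    rw [h1]
    ext x
    have h2 : x = 0 ↔ (L x).1 = 0 ∧ (L x).2 = 0 := by
      rw [← L.map_eq_zero_iff, Prod.ext_iff]
      rfl
    cases b
    · simp only [suspensionCone, Set.mem_sdiff, mem_preimage, mem_prod, mem_singleton_iff, mem_Iic,
        Bool.false_eq_true, if_false, mem_Iio, mem_empty_iff_false, iUnion_of_empty, iUnion_empty,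
        union_empty, h2]
      constructor
      · rintro ⟨⟨h3, h4⟩, h5⟩
        exact ⟨h3, le_antisymm h4 (not_lt.1 fun h => h5 ⟨h3, h⟩)⟩
      · rintro ⟨h3, h4⟩
        exact ⟨⟨h3, h4.le⟩, fun h => h.2.ne h4⟩
    · simp only [suspensionCone, Set.mem_sdiff, mem_preimage, mem_prod, mem_singleton_iff, mem_Ici,
        if_true, mem_Ioi, mem_empty_iff_false, iUnion_of_empty, iUnion_empty,
        union_empty, h2]
      constructor
      · rintro ⟨⟨h3, h4⟩, h5⟩
        exact ⟨h3, le_antisymm (not_lt.1 fun h => h5 ⟨h3, h⟩) h4⟩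
      · rintro ⟨h3, h4⟩
        exact ⟨⟨h3, h4.ge⟩, fun h => h.2.ne' h4⟩
  · intro F F' hF hF' hne
    exact absurd ((hF.eq_or_lt.resolve_right (not_lt_pole F b)).trans
      (hF'.eq_or_lt.resolve_right (not_lt_pole F' b)).symm) hne

/-- The boundary of `K G × ℝ` is the product of the boundary of `K G` with the line. Over the apex
this is the vertical line, which the two pole rays cover; over the proper faces it consists of their
suspensions. -/
theorem isFanAt_susp (L : W ≃L[ℝ] V × ℝ) {K : α → Set V} {d : α → ℕ} {G : α}
    (h : ∀ F ≤ G, IsFanAt d K F) :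
    IsFanAt (SuspensionFace.dim d) (suspensionCone L K) (susp G) := by
  have hr : ∀ F ≤ G, rint (suspensionCone L K (susp F)) = L ⁻¹' (rint (K F) ×ˢ univ) := fun F hF =>
    (rint_lift L (h F hF).cell.poly.zero_mem (mem_univ _)).trans (by rw [rint_univ])
  refine ⟨(h G le_rfl).cell.lift_univ L, ?_, ?_⟩
  · rw [hr G le_rfl]
    ext x
    have hb : (L x).1 ∈ K G \ rint (K G) ↔ (L x).1 ∈ {0} ∪ ⋃ F ∈ {F | F < G}, K F := by
      rw [(h G le_rfl).bdry]
    simp only [Set.mem_sdiff, mem_union, mem_singleton_iff, mem_iUnion, mem_ofPred_eq,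
      exists_prop] at hb
    simp only [suspensionCone, Set.mem_sdiff, mem_preimage, mem_prod, mem_univ, and_true, hb,
      mem_union, mem_singleton_iff, mem_iUnion, mem_ofPred_eq, exists_prop]
    constructor
    · rintro (h1 | ⟨F, hF, hx⟩)
      · right
        rcases le_total 0 (L x).2 with h2 | h2
        · exact ⟨pole true, pole_lt_susp _ _, h1, h2⟩
        · exact ⟨pole false, pole_lt_susp _ _, h1, h2⟩
      · exact Or.inr ⟨susp F, susp_lt_susp.2 hF, hx, mem_univ _⟩
    · rintro (rfl | ⟨F, hF, hx⟩)
      · left; simp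
      · rcases lt_susp_iff.1 hF with ⟨b, rfl⟩ | ⟨G', hG, rfl⟩
        · left
          cases b <;> exact hx.1
        · exact Or.inr ⟨G', hG, hx.1⟩
  · have hps : ∀ b, ∀ F ≤ G, Disjoint (rint (suspensionCone L K (pole b)))
        (rint (suspensionCone L K (susp F))) := by
      intro b F hF
      rw [rint_pole, hr F hF, Set.disjoint_left]
      rintro x ⟨h1, -⟩ ⟨h2, -⟩
      rw [mem_singleton_iff] at h1
      rw [h1] at h2
      exact zero_notMem_rint (h F hF).cell.pointed (h F hF).cell.poly h2
    intro F F' hF hF' hne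
    cases F with
    | pole b => cases F' with
      | pole b' =>
        rw [rint_pole, rint_pole, Set.disjoint_left]
        rintro x ⟨-, h1⟩ ⟨-, h2⟩
        cases b <;> cases b' <;> first | exact hne rfl | (simp at h1 h2; linarith)
      | susp G' => exact hps b G' hF'
    | susp G' => cases F' with
      | pole b => exact (hps b G' hF).symm
      | susp G'' =>
        rw [hr G' hF, hr G'' hF', Set.disjoint_left]
        rintro x ⟨h1, -⟩ ⟨h2, -⟩
        exact Set.disjoint_left.1 ((h G le_rfl).disj G' G'' hF hF' fun h => hne (by rw [h])) h1 h2

end Suspension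

/-! ### Complexes with prescribed facet areas by repeated suspension -/

section ComplexModel

/-- A convex polyhedral complex in `𝕊ⁿ` all whose facets are `(n-1)`-cells with two facets, in terms
of the cones over its faces. It is nondegenerate under the condition `A`, and adjacent facets span
different great spheres under the condition `B`. -/
structure ComplexModel (n : ℕ) {m : ℕ} (S : Fin m → ℝ) (A B : Prop) where
  P : FacePoset n
  K : P.Face → Set (Space n)
  e : Fin m ≃ {F : P.Face // P.dim F + 1 = n}
  proper : ∀ G, G ≠ P.body → IsFanAt P.dim K G
  body : ∃ d : ℕ, (d = n ∨ d + 1 = n) ∧ IsConeCell d (K P.body)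
  limit : ∀ ε > 0, ∃ K' : P.Face → Set (Space n), (∀ G, IsFanAt P.dim K' G) ∧
    ∀ F, ConeClose ε (K' F) (K F)
  area_eq : ∀ i, area (trace (K (e i))) = S i
  card : ∀ F : P.Face, P.dim F + 1 = n → {E : P.Face | E < F ∧ P.dim E + 2 = n}.ncard = 2
  nondegenerate : A → IsFanAt P.dim K P.body
  span_ne : B → ∀ E F F', MeetAt P P.body E F F' →
    Submodule.span ℝ (K F) ≠ Submodule.span ℝ (K F')

open SuspensionFace

/-- The suspension of a complex. -/
def ComplexModel.suspend {n m : ℕ} (hn : 2 ≤ n) {S : Fin m → ℝ} {A B : Prop}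
    (M : ComplexModel n S A B) :
    ComplexModel (n + 1) (fun i => S i / sphereVolume n * sphereVolume (n + 1)) A B where
  P := M.P.suspension
  K := suspensionCone (liftEquiv 0) M.K
  e := M.e.trans
    { toFun := fun F => ⟨susp F.1, by
        have := F.2
        change M.P.dim F.1 + 1 + 1 = n + 1
        omega⟩
      invFun := fun F => match F with
        | ⟨pole b, h⟩ => absurd (show 0 + 1 = n + 1 from h) (by omega)
        | ⟨susp G, h⟩ => ⟨G, by
          have : M.P.dim G + 1 + 1 = n + 1 := h
          omega⟩
      left_inv := fun _ => rfl
      right_inv := by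
        rintro ⟨_ | G, h⟩
        · exact absurd (show 0 + 1 = n + 1 from h) (by omega)
        · rfl }
  proper G hG := by
    cases G with
    | pole b => exact isFanAt_pole _ _ _ b
    | susp G =>
      refine isFanAt_susp _ fun F hF => M.proper F ?_
      rintro rfl
      exact hG (congrArg susp (le_antisymm (M.P.le_body G) hF))
  body := by
    obtain ⟨d, hd, h⟩ := M.body
    exact ⟨d + 1, by omega, h.lift_univ _⟩
  limit ε hε := by
    obtain ⟨ε', hε', hL⟩ := exists_coneClose_preimage (liftEquiv (0 : Space n →L[ℝ] ℝ)) hε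
    obtain ⟨K', hK', hc⟩ := M.limit ε' hε'
    refine ⟨suspensionCone (liftEquiv 0) K', fun G => ?_, fun F => ?_⟩
    · cases G with
      | pole b => exact isFanAt_pole _ _ _ b
      | susp G => exact isFanAt_susp _ fun F _ => hK' F
    · cases F with
      | pole b => cases b <;> exact ConeClose.refl hε.le _
      | susp G => exact hL _ _ ((hc G).prod hε'.le univ)
  area_eq i := by
    have hF := (M.e i).2
    have hne : (M.e i).1 ≠ M.P.body := by
      intro h
      rw [h, M.P.dim_body] at hF
      omega
    have hc := (M.proper _ hne).cell
    have h1 := area_lift_univ (by omega) hc.poly (by rw [hc.finrank_span, hF]) 0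
    rw [M.area_eq] at h1
    exact h1
  card F hF := by
    cases F with
    | pole b => exact absurd (show 0 + 1 = n + 1 from hF) (by omega)
    | susp F =>
      have hF : M.P.dim F + 1 + 1 = n + 1 := hF
      refine Eq.trans (congrArg Set.ncard ?_) ((ncard_image_of_injective
        {E | E < F ∧ M.P.dim E + 2 = n} susp_injective).trans (M.card F (by omega)))
      ext E
      constructor
      · rintro ⟨h1, h2⟩
        cases E with
        | pole b => exact absurd (show 0 + 2 = n + 1 from h2) (by omega)
        | susp E =>
          have h2 : M.P.dim E + 1 + 2 = n + 1 := h2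
          exact ⟨E, ⟨susp_lt_susp.1 h1, by omega⟩, rfl⟩
      · rintro ⟨E, ⟨h1, h2⟩, rfl⟩
        refine ⟨susp_lt_susp.2 h1, ?_⟩
        change M.P.dim E + 1 + 2 = n + 1
        omega
  nondegenerate hA := by
    refine isFanAt_susp _ fun F _ => ?_
    by_cases hF : F = M.P.body
    · rw [hF]; exact M.nondegenerate hA
    · exact M.proper F hF
  span_ne hB E F F' h := by
    obtain ⟨h1, h2, h3, h4, h5, h6, h7, h8⟩ := h
    have hb : M.P.suspension.dim M.P.suspension.body = n + 1 := M.P.suspension.dim_body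
    rw [hb] at h1 h2 h3
    cases E with
    | pole b => exact absurd (show 0 + 2 = n + 1 from h1) (by omega)
    | susp E => cases F with
      | pole b => exact absurd (show 0 + 1 = n + 1 from h2) (by omega)
      | susp F => cases F' with
        | pole b => exact absurd (show 0 + 1 = n + 1 from h3) (by omega)
        | susp F' =>
          have h1 : M.P.dim E + 1 + 2 = n + 1 := h1
          have h2 : M.P.dim F + 1 + 1 = n + 1 := h2
          have h3 : M.P.dim F' + 1 + 1 = n + 1 := h3
          have hd := M.P.dim_body
          have h7' : F < M.P.body := susp_lt_susp.1 h7
          have h8' : F' < M.P.body := susp_lt_susp.1 h8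
          have := M.span_ne hB E F F' ⟨by omega, by omega, by omega, fun h => h4 (by rw [h]),
            susp_lt_susp.1 h5, susp_lt_susp.1 h6, h7', h8'⟩
          intro heq
          apply this
          change Submodule.span ℝ (liftEquiv (0 : Space n →L[ℝ] ℝ) ⁻¹' (M.K F ×ˢ univ)) =
            Submodule.span ℝ (liftEquiv (0 : Space n →L[ℝ] ℝ) ⁻¹' (M.K F' ×ˢ univ)) at heq
          rw [span_preimage, span_preimage,
            span_prod (M.proper F h7'.ne).cell.poly.zero_mem (mem_univ _),
            span_prod (M.proper F' h8'.ne).cell.poly.zero_mem (mem_univ _)] at heq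
          ext x
          -- Restricted to height zero, the suspended spans give back the original ones.
          have h9 := SetLike.ext_iff.1 heq ((liftEquiv (0 : Space n →L[ℝ] ℝ)).symm (x, 0))
          simpa [Submodule.mem_prod] using h9

/-- The model of a polygon. -/
theorem nonempty_complexModel_two {k : ℕ} {S : Fin (k + 3) → ℝ} (hS : ∀ i, 0 < S i)
    (hmax : ∀ i, S i ≤ S (Fin.last _)) (h1 : 2 * S (Fin.last _) ≤ ∑ i, S i)
    (h2 : ∑ i, S i ≤ 2 * Real.pi) :
    Nonempty (ComplexModel 2 S (2 * S (Fin.last _) < ∑ i, S i)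
      (2 * S (Fin.last _) < ∑ i, S i ∧ ∑ i, S i < 2 * Real.pi)) := by
  obtain ⟨K, hK1, hK2, hK3, hK4, hK5, hK6⟩ := exists_polygon hS hmax h1 h2
  have hdim : ∀ F : PolygonFace k, PolygonFace.dim F + 1 = 2 → ∃ i, F = .edge i := by
    intro F hF
    cases F with
    | vertex i => exact absurd hF (by simp [PolygonFace.dim])
    | edge i => exact ⟨i, rfl⟩
    | body => exact absurd hF (by simp [PolygonFace.dim])
  refine ⟨{
    P := polygonPoset k
    K := K
    e := Equiv.ofBijective (fun i => ⟨.edge i, rfl⟩) ⟨?_, ?_⟩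
    proper := hK1
    body := ?_
    limit := ?_
    area_eq := hK2
    card := ?_
    nondegenerate := hK4
    span_ne := ?_ }⟩
  · intro i j h
    have h' : PolygonFace.edge i = .edge j := congrArg Subtype.val h
    cases h'
    rfl
  · rintro ⟨F, hF⟩
    obtain ⟨i, rfl⟩ := hdim F hF
    exact ⟨i, rfl⟩
  · rcases h1.eq_or_lt with h | h
    · refine ⟨1, Or.inr rfl, ?_⟩
      have := (hK1 (.edge (Fin.last _)) (by simp)).cell
      rw [← (hK6 h).1] at this
      exact this
    · exact ⟨2, Or.inl rfl, (hK4 h).cell⟩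
  · intro ε hε
    obtain ⟨p, a, hp, hc⟩ := hK3 ε hε
    exact ⟨polygonCone p, hp.isFanAt, hc⟩
  · intro F hF
    obtain ⟨i, rfl⟩ := hdim F hF
    have : {E : PolygonFace k | E < .edge i ∧ E.dim + 2 = 2} = {.vertex i, .vertex (i + 1)} := by
      ext E
      simp only [mem_ofPred_eq, PolygonFace.lt_edge_iff, mem_insert_iff, mem_singleton_iff]
      constructor
      · exact fun h => h.1
      · rintro (rfl | rfl) <;> simp [PolygonFace.dim]
    exact (congrArg Set.ncard this).trans (ncard_pair (by simp [(fin_add_one_ne i).symm]))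
  · rintro ⟨hB1, hB2⟩ E F F' ⟨-, h3, h4, h5, -⟩
    obtain ⟨i, rfl⟩ := hdim F h3
    obtain ⟨j, rfl⟩ := hdim F' h4
    exact hK5 hB1 hB2 i j (by rintro rfl; exact h5 rfl)

/-- Induction on `n` by suspension, starting from polygons. The areas are first divided by the
factor that suspension introduces; all hypotheses and both conditions are invariant under this
rescaling. -/
theorem nonempty_complexModel {k n : ℕ} (hn : 2 ≤ n) {S : Fin (k + 3) → ℝ} (hS : ∀ i, 0 < S i)
    (hmax : ∀ i, S i ≤ S (Fin.last _)) (h1 : 2 * S (Fin.last _) ≤ ∑ i, S i)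
    (h2 : ∑ i, S i ≤ sphereVolume n) :
    Nonempty (ComplexModel n S (2 * S (Fin.last _) < ∑ i, S i)
      (2 * S (Fin.last _) < ∑ i, S i ∧ ∑ i, S i < sphereVolume n)) := by
  induction n, hn using Nat.le_induction generalizing S with
  | base =>
    rw [sphereVolume_two] at h2 ⊢
    exact nonempty_complexModel_two hS hmax h1 h2
  | succ n hn ih =>
    have hv := sphereVolume_pos (show 0 < n by omega)
    have hv' := sphereVolume_pos (show 0 < n + 1 by omega)
    -- The reciprocal of the factor by which suspension multiplies areas.
    set c := sphereVolume n / sphereVolume (n + 1) with hc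
    have hc0 : 0 < c := div_pos hv hv'
    have hsum : ∑ i, c * S i = c * ∑ i, S i := (Finset.mul_sum _ _ _).symm
    have hcv : c * sphereVolume (n + 1) = sphereVolume n := by rw [hc]; field_simp
    obtain ⟨M⟩ := ih (S := fun i => c * S i) (fun i => mul_pos hc0 (hS i))
      (fun i => mul_le_mul_of_nonneg_left (hmax i) hc0.le)
      (by rw [hsum]; nlinarith) (by rw [hsum, ← hcv]; exact mul_le_mul_of_nonneg_left h2 hc0.le)
    have M' := M.suspend hn
    have e1 : (fun i => c * S i / sphereVolume n * sphereVolume (n + 1)) = S := by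
      funext i
      rw [hc]
      field_simp
    have e2 : 2 * (c * S (Fin.last _)) < ∑ i, c * S i ↔ 2 * S (Fin.last _) < ∑ i, S i := by
      rw [hsum, ← mul_assoc, mul_comm 2 c, mul_assoc, mul_lt_mul_iff_right₀ hc0]
    have e3 : ∑ i, c * S i < sphereVolume n ↔ ∑ i, S i < sphereVolume (n + 1) := by
      rw [hsum, ← hcv, mul_lt_mul_iff_right₀ hc0]
    rw [e1] at M'
    simp only [e2, e3] at M'
    exact ⟨M'⟩

end ComplexModel

/-! ### From cones to convex complexes, and part (i) -/

section Realisation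

variable {n : ℕ} {P : FacePoset n} {K : P.Face → Set (Space n)}

theorem IsFanAt.subset {V ι : Type*} [NormedAddCommGroup V] [NormedSpace ℝ V] [PartialOrder ι]
    {dim : ι → ℕ} {K : ι → Set V} {F G : ι} (h : IsFanAt dim K G) (hFG : F ≤ G) : K F ⊆ K G := by
  rcases hFG.eq_or_lt with rfl | hlt
  · exact subset_rfl
  · intro x hx
    have : x ∈ K G \ rint (K G) := by
      rw [h.bdry]
      exact Or.inr (mem_biUnion (x := F) hlt hx)
    exact this.1

theorem isRidge_of_meetAt {k d : ℕ} {G E F F' : P.Face} (hm : MeetAt P G E F F')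
    (hE : IsFanAt P.dim K E) (hF : IsFanAt P.dim K F) (hF' : IsFanAt P.dim K F')
    (hG : IsConeCell d (K G)) (hd : d = P.dim E + k) (hFG : K F ⊆ K G) (hFG' : K F' ⊆ K G) :
    IsRidge k (K E) (K F) (K F') (K G) := by
  obtain ⟨h1, h2, h3, h4, h5, h6, h7, h8⟩ := hm
  refine ⟨hE.cell.poly, hF.cell.poly, hF'.cell.poly, hG.poly, hF.subset h5.le, hF'.subset h6.le,
    hFG, hFG', ?_, ?_, ?_, hF.disj _ _ h5.le le_rfl h5.ne, hF'.disj _ _ h6.le le_rfl h6.ne⟩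
  · rw [hE.cell.finrank_span, hF.cell.finrank_span]
    omega
  · rw [hE.cell.finrank_span, hF'.cell.finrank_span]
    omega
  · rw [hE.cell.finrank_span, hG.finrank_span]
    omega

theorem exists_isDihedralAngle_of_meetAt {G E F F' : P.Face} (hm : MeetAt P G E F F')
    (h : ∀ F ≤ G, IsFanAt P.dim K F) :
    ∃ θ ≤ Real.pi, IsDihedralAngle (trace (K G)) (trace (K E)) (trace (K F)) (trace (K F')) θ ∧
      (Submodule.span ℝ (K F) ≠ Submodule.span ℝ (K F') → θ < Real.pi) ∧
      (Submodule.span ℝ (K F) = Submodule.span ℝ (K F') → θ = Real.pi) := by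
  have hG := h G le_rfl
  have hr := isRidge_of_meetAt (k := 2) hm (h E (hm.2.2.2.2.1.trans hm.2.2.2.2.2.2.1).le)
    (h F hm.2.2.2.2.2.2.1.le) (h F' hm.2.2.2.2.2.2.2.le) hG.cell hm.1.symm
    (hG.subset hm.2.2.2.2.2.2.1.le) (hG.subset hm.2.2.2.2.2.2.2.le)
  obtain ⟨h1, h2, h3, h4, h5, h6, h7, h8⟩ := hm
  exact hr.exists_isDihedralAngle (hG.disj _ _ (h5.trans h7).le le_rfl (h5.trans h7).ne)
    (hG.disj _ _ h7.le le_rfl h7.ne) (hG.disj _ _ h8.le le_rfl h8.ne) (hG.disj _ _ h7.le h8.le h4)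

theorem isNondegenerateComplex_trace (h : ∀ G, IsFanAt P.dim K G) :
    IsNondegenerateComplex P fun F => trace (K F) := fun G =>
  (h G).isSubdividedCell fun F _ => (h F).cell.poly

theorem isConvexComplex_trace (hproper : ∀ G, G ≠ P.body → IsFanAt P.dim K G)
    (hbody : ∃ d : ℕ, (d = n ∨ d + 1 = n) ∧ IsConeCell d (K P.body))
    (hlimit : ∀ ε > 0, ∃ K' : P.Face → Set (Space n), (∀ G, IsFanAt P.dim K' G) ∧
      ∀ F, ConeClose ε (K' F) (K F)) : IsConvexComplex P fun F => trace (K F) := by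
  obtain ⟨d, hd, hb⟩ := hbody
  have hpoly : ∀ F, IsPolyCone (K F) := by
    intro F
    by_cases hF : F = P.body
    · rw [hF]; exact hb.poly
    · exact (hproper F hF).cell.poly
  choose u hu hc using fun k : ℕ => hlimit (1 / ((k : ℝ) + 2)) (by positivity)
  exact ⟨fun G hG => (hproper G hG).isSubdividedCell fun F _ => hpoly F, ⟨d, hd, hb.isCell⟩,
    fun k F => trace (u k F), fun k => isNondegenerateComplex_trace (hu k),
    facesTendsto_of_coneClose (fun k F => (hu k F).cell.poly) hpoly hc⟩

theorem exists_convexComplex {n k : ℕ} (hn : 2 ≤ n) {S : Fin (k + 3) → ℝ} (hmono : Monotone S)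
    (hS : ∀ i, 0 < S i) (h1 : S (Fin.last _) ≤ ∑ i ∈ Finset.univ.erase (Fin.last _), S i)
    (h2 : ∑ i, S i ≤ sphereVolume n) :
    ∃ (P : FacePoset n) (c : P.Face → Set (Space n)), IsConvexComplex P c ∧
      (∀ G, SphConvex (c G)) ∧ InClosedHemisphere (c P.body) ∧ HasFacetAreas P c S ∧
      (∀ F : P.Face, P.dim F + 1 = n → {E : P.Face | E < F ∧ P.dim E + 2 = n}.ncard = 2) ∧
      (S (Fin.last _) < ∑ i ∈ Finset.univ.erase (Fin.last _), S i → IsNondegenerateComplex P c) ∧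
      (S (Fin.last _) < ∑ i ∈ Finset.univ.erase (Fin.last _), S i → ∑ i, S i < sphereVolume n →
        ∀ E F F' : P.Face, MeetAt P P.body E F F' →
          ∃ θ : ℝ, θ < Real.pi ∧ IsDihedralAngle (c P.body) (c E) (c F) (c F') θ) := by
  have hsum := Finset.sum_erase_add Finset.univ S (Finset.mem_univ (Fin.last _))
  obtain ⟨M⟩ := nonempty_complexModel hn hS (fun i => hmono (Fin.le_last i)) (by linarith) h2
  have hall : S (Fin.last _) < ∑ i ∈ Finset.univ.erase (Fin.last _), S i →
      ∀ G, IsFanAt M.P.dim M.K G := by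
    intro h G
    by_cases hG : G = M.P.body
    · rw [hG]; exact M.nondegenerate (by linarith)
    · exact M.proper G hG
  have hpoly : ∀ F, IsPolyCone (M.K F) := by
    intro F
    by_cases hF : F = M.P.body
    · obtain ⟨d, -, hb⟩ := M.body
      rw [hF]; exact hb.poly
    · exact (M.proper F hF).cell.poly
  refine ⟨M.P, fun F => trace (M.K F), isConvexComplex_trace M.proper M.body M.limit,
    fun G => (hpoly G).sphConvex, ?_, ⟨M.e, M.area_eq⟩, M.card,
    fun h => isNondegenerateComplex_trace (hall h), fun h h' E F F' hm => ?_⟩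
  · obtain ⟨d, -, hb⟩ := M.body
    exact hb.inClosedHemisphere
  · obtain ⟨θ, -, hθ, hlt, -⟩ := exists_isDihedralAngle_of_meetAt hm fun F _ => hall h F
    exact ⟨θ, hlt (M.span_ne ⟨by linarith, h'⟩ E F F' hm), hθ⟩

end Realisation

/-! ### Splitting a vertex of a simplicial fan into two poles -/

section SplitVertex

variable {n : ℕ}

/-- The vertices of the projection of the face `A` along the edge joining the vertices `0` and `1`,
which is contracted to the vertex `0`. -/
def contractFace (A : Finset (Fin (n + 2))) : Finset (Fin (n + 1)) :=
  Finset.univ.filter fun i => i.succ ∈ A ∧ (i = 0 → 0 ∈ A)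

theorem mem_contractFace {A : Finset (Fin (n + 2))} {i : Fin (n + 1)} :
    i ∈ contractFace A ↔ i.succ ∈ A ∧ (i = 0 → 0 ∈ A) := by
  simp [contractFace]

theorem zero_mem_contractFace {A : Finset (Fin (n + 2))} :
    0 ∈ contractFace A ↔ 0 ∈ A ∧ 1 ∈ A := by
  rw [mem_contractFace, Fin.succ_zero_eq_one, and_comm]
  simp

theorem mem_contractFace_of_ne {A : Finset (Fin (n + 2))} {i : Fin (n + 1)} (hi : i ≠ 0) :
    i ∈ contractFace A ↔ i.succ ∈ A := by
  simp [mem_contractFace, hi]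

theorem contractFace_mono {A B : Finset (Fin (n + 2))} (h : A ⊆ B) :
    contractFace A ⊆ contractFace B := fun i hi => by
  rw [mem_contractFace] at hi ⊢
  exact ⟨h hi.1, fun hi0 => h (hi.2 hi0)⟩

/-- A face is determined by its poles `0`, `1` and by the nonzero vertices of its contraction;
whether the contraction contains `0` carries no further information. -/
theorem subset_of_contractFace {A B : Finset (Fin (n + 2))} (h0 : 0 ∈ A → 0 ∈ B)
    (h1 : 1 ∈ A → 1 ∈ B) (h : contractFace A \ {0} ⊆ contractFace B) : A ⊆ B := by
  intro j hj
  induction j using Fin.cases with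
  | zero => exact h0 hj
  | succ i =>
    by_cases hi : i = 0
    · subst hi
      exact h1 hj
    · refine (mem_contractFace_of_ne hi).1 (h ?_)
      rw [Finset.mem_sdiff, mem_contractFace_of_ne hi, Finset.mem_singleton]
      exact ⟨hj, hi⟩

/-- A face with prescribed contraction. -/
def expandFace (D : Finset (Fin (n + 1))) (p q : Prop) [Decidable p] [Decidable q] :
    Finset (Fin (n + 2)) :=
  Finset.univ.filter fun j => j = 0 ∧ p ∨ j = 1 ∧ q ∨ ∃ i ∈ D, i ≠ 0 ∧ j = i.succ

theorem zero_mem_expandFace {D : Finset (Fin (n + 1))} {p q : Prop} [Decidable p] [Decidable q] :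
    0 ∈ expandFace D p q ↔ p := by
  simp [expandFace, (Fin.succ_ne_zero _).symm]

theorem one_mem_expandFace {D : Finset (Fin (n + 1))} {p q : Prop} [Decidable p] [Decidable q] :
    1 ∈ expandFace D p q ↔ q := by
  have : ∀ i : Fin (n + 1), i ≠ 0 → (1 : Fin (n + 2)) ≠ i.succ := by
    intro i hi h
    rw [← Fin.succ_zero_eq_one, Fin.succ_inj] at h
    exact hi h.symm
  simp only [expandFace, Finset.mem_filter, Finset.mem_univ, true_and, one_ne_zero, false_and,
    false_or]
  constructor
  · rintro (h | ⟨i, -, hi, h⟩)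
    · exact h
    · exact absurd h (this i hi)
  · exact Or.inl

theorem succ_mem_expandFace {D : Finset (Fin (n + 1))} {p q : Prop} [Decidable p] [Decidable q]
    {i : Fin (n + 1)} (hi : i ≠ 0) : i.succ ∈ expandFace D p q ↔ i ∈ D := by
  have h1 : i.succ ≠ 1 := by
    rw [← Fin.succ_zero_eq_one]
    exact fun h => hi (Fin.succ_injective _ h)
  simp only [expandFace, Finset.mem_filter, Finset.mem_univ, true_and, Fin.succ_ne_zero, false_and,
    false_or, h1, Fin.succ_inj]
  constructor
  · rintro ⟨j, hj, -, rfl⟩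
    exact hj
  · exact fun h => ⟨i, h, hi, rfl⟩

theorem contractFace_expandFace {D : Finset (Fin (n + 1))} {p q : Prop} [Decidable p]
    [Decidable q] (h : 0 ∈ D ↔ p ∧ q) : contractFace (expandFace D p q) = D := by
  ext i
  by_cases hi : i = 0
  · subst hi
    rw [zero_mem_contractFace, zero_mem_expandFace, one_mem_expandFace, h]
  · rw [mem_contractFace_of_ne hi, succ_mem_expandFace hi]

/-- The heights occurring above the contraction of the face `A`. -/
def heightCone (A : Finset (Fin (n + 2))) : Set ℝ :=
  {t | (0 ∉ A → t ≤ 0) ∧ (1 ∉ A → 0 ≤ t)}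

theorem heightCone_cases (A : Finset (Fin (n + 2))) :
    (0 ∈ A ∧ 1 ∈ A ∧ heightCone A = univ) ∨ (0 ∈ A ∧ 1 ∉ A ∧ heightCone A = Ici 0) ∨
      (0 ∉ A ∧ 1 ∈ A ∧ heightCone A = Iic 0) ∨ (0 ∉ A ∧ 1 ∉ A ∧ heightCone A = {0}) := by
  by_cases h0 : 0 ∈ A <;> by_cases h1 : 1 ∈ A
  · refine Or.inl ⟨h0, h1, ?_⟩
    ext t; simp [heightCone, h0, h1]
  · refine Or.inr (Or.inl ⟨h0, h1, ?_⟩)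
    ext t; simp [heightCone, h0, h1]
  · refine Or.inr (Or.inr (Or.inl ⟨h0, h1, ?_⟩))
    ext t; simp [heightCone, h0, h1]
  · refine Or.inr (Or.inr (Or.inr ⟨h0, h1, ?_⟩))
    ext t
    simp only [heightCone, h0, h1, not_false_eq_true, true_implies, mem_ofPred_eq,
      mem_singleton_iff]
    exact le_antisymm_iff.symm

theorem zero_mem_heightCone (A : Finset (Fin (n + 2))) : (0 : ℝ) ∈ heightCone A :=
  ⟨fun _ => le_rfl, fun _ => le_rfl⟩

theorem heightCone_mono {A B : Finset (Fin (n + 2))} (h : A ⊆ B) :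
    heightCone A ⊆ heightCone B := fun _ ht =>
  ⟨fun h0 => ht.1 fun h' => h0 (h h'), fun h1 => ht.2 fun h' => h1 (h h')⟩

theorem isPolyCone_heightCone (A : Finset (Fin (n + 2))) : IsPolyCone (heightCone A) := by
  rcases heightCone_cases A with ⟨-, -, h⟩ | ⟨-, -, h⟩ | ⟨-, -, h⟩ | ⟨-, -, h⟩ <;> rw [h]
  exacts [IsPolyCone.univ, isPolyCone_Ici, isPolyCone_Iic, IsPolyCone.singleton_zero]

theorem mem_rint_heightCone {A : Finset (Fin (n + 2))} {t : ℝ} :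
    t ∈ rint (heightCone A) ↔ (0 ∈ A → 1 ∉ A → 0 < t) ∧ (0 ∉ A → 1 ∈ A → t < 0) ∧
      (0 ∉ A → 1 ∉ A → t = 0) := by
  rcases heightCone_cases A with ⟨h0, h1, h⟩ | ⟨h0, h1, h⟩ | ⟨h0, h1, h⟩ | ⟨h0, h1, h⟩ <;>
    simp [h, h0, h1, rint_univ, rint_Ici, rint_Iic, rint_singleton_zero]

theorem finrank_span_heightCone (A : Finset (Fin (n + 2))) :
    Module.finrank ℝ (Submodule.span ℝ (heightCone A)) = if 0 ∉ A ∧ 1 ∉ A then 0 else 1 := by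
  rcases heightCone_cases A with ⟨h0, h1, h⟩ | ⟨h0, h1, h⟩ | ⟨h0, h1, h⟩ | ⟨h0, h1, h⟩ <;> rw [h]
  · rw [span_univ_real, finrank_top, Module.finrank_self]; simp [h0]
  · rw [span_Ici, finrank_top, Module.finrank_self]; simp [h0]
  · rw [span_Iic, finrank_top, Module.finrank_self]; simp [h1]
  · rw [Submodule.span_zero_singleton, finrank_bot]; simp [h0, h1]

/-- Contraction loses exactly one vertex if `A` has a pole: two poles merge into one vertex, a
single pole disappears. The heights then contribute one dimension. -/
theorem card_contractFace (A : Finset (Fin (n + 2))) :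
    (contractFace A).card + Module.finrank ℝ (Submodule.span ℝ (heightCone A)) = A.card := by
  have key : ∀ {m : ℕ} (B : Finset (Fin m)), B.card = ∑ j, if j ∈ B then 1 else 0 := by
    intro m B
    simp
  have h2 : ∑ i : Fin n, (if i.succ ∈ contractFace A then 1 else 0) =
      ∑ i : Fin n, if i.succ.succ ∈ A then 1 else 0 := by
    simp only [mem_contractFace_of_ne (Fin.succ_ne_zero _)]
  rw [finrank_span_heightCone, key A, key (contractFace A), Fin.sum_univ_succ,
    Fin.sum_univ_succ (n := n + 1), Fin.sum_univ_succ (n := n), h2, Fin.succ_zero_eq_one]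
  simp only [zero_mem_contractFace]
  generalize ∑ i : Fin n, (if i.succ.succ ∈ A then 1 else 0) = N
  by_cases h0 : 0 ∈ A <;> by_cases h1 : 1 ∈ A <;> simp [h0, h1] <;> omega

variable {V W : Type*} [NormedAddCommGroup V] [InnerProductSpace ℝ V] [FiniteDimensional ℝ V]
  [NormedAddCommGroup W] [InnerProductSpace ℝ W] [FiniteDimensional ℝ W]

/-- The cones obtained by splitting the vertex `0` of a simplex into two antipodal vertices. -/
def splitCone (L : W ≃L[ℝ] V × ℝ) (C : Finset (Fin (n + 1)) → Set V) (A : Finset (Fin (n + 2))) :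
    Set W :=
  L ⁻¹' (C (contractFace A) ×ˢ heightCone A)

/-- The boundary of a product of cones consists of the points with a boundary component in one
factor. A boundary point in height is at height zero and belongs to the face without poles. A
boundary point in the base belongs to a face `D` of the contraction, and it remains to choose the
poles that go with `D`. -/
theorem isSimplexFanAt_splitCone (L : W ≃L[ℝ] V × ℝ) {C : Finset (Fin (n + 1)) → Set V}
    {B : Finset (Fin (n + 2))} (h : ∀ D ⊆ contractFace B, IsSimplexFanAt C D) :
    IsSimplexFanAt (splitCone L C) B := by
  have hB := h _ subset_rfl
  have hr : ∀ F ⊆ B, rint (splitCone L C F) =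
      L ⁻¹' (rint (C (contractFace F)) ×ˢ rint (heightCone F)) := fun F hF =>
    rint_lift L (h _ (contractFace_mono hF)).poly.zero_mem (zero_mem_heightCone F)
  refine ⟨isPolyCone_lift L hB.poly (isPolyCone_heightCone B), ?_, fun hne => ?_, ?_, ?_⟩
  · rw [splitCone, finrank_span_lift L hB.poly.zero_mem (zero_mem_heightCone B), hB.finrank_span,
      card_contractFace]
  · by_cases hD : (contractFace B).Nonempty
    · obtain ⟨x, hx, hnx⟩ := hB.pointed hD
      refine ⟨L.symm (x, 0), by simpa [splitCone] using ⟨hx, zero_mem_heightCone B⟩, ?_⟩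
      rintro ⟨h1, -⟩
      exact hnx (by simpa using h1)
    · have h01 : ¬ (0 ∈ B ∧ 1 ∈ B) := fun h' => hD ⟨0, zero_mem_contractFace.2 h'⟩
      have h0 := hB.poly.zero_mem
      rcases heightCone_cases B with ⟨h2, h3, -⟩ | ⟨-, -, h4⟩ | ⟨-, -, h4⟩ | ⟨h2, h3, -⟩
      · exact absurd ⟨h2, h3⟩ h01
      · exact ⟨L.symm (0, 1), by simp [splitCone, h4, h0], by simp [splitCone, h4]⟩
      · exact ⟨L.symm (0, -1), by simp [splitCone, h4, h0], by simp [splitCone, h4]⟩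
      · obtain ⟨j, hj⟩ := hne
        exfalso
        induction j using Fin.cases with
        | zero => exact h2 hj
        | succ i =>
          by_cases hi : i = 0
          · subst hi
            exact h3 hj
          · exact hD ⟨i, (mem_contractFace_of_ne hi).2 hj⟩
  · rw [hr B subset_rfl]
    ext x
    have hb : (L x).1 ∈ C (contractFace B) \ rint (C (contractFace B)) ↔
        (L x).1 ∈ ⋃ F ∈ {F | F ⊂ contractFace B}, C F := by rw [hB.bdry]
    simp only [mem_iUnion, mem_ofPred_eq, exists_prop] at hb
    simp only [mem_iUnion, mem_ofPred_eq, exists_prop]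
    change ((L x).1 ∈ C (contractFace B) ∧ (L x).2 ∈ heightCone B) ∧
      ¬ ((L x).1 ∈ rint (C (contractFace B)) ∧ (L x).2 ∈ rint (heightCone B)) ↔
      ∃ F ⊂ B, (L x).1 ∈ C (contractFace F) ∧ (L x).2 ∈ heightCone F
    generalize (L x).1 = y at hb ⊢
    generalize (L x).2 = t
    have hss : ∀ {F : Finset (Fin (n + 2))}, F ⊆ B → F ≠ B → F ⊂ B := fun h h' =>
      lt_of_le_of_ne h h'
    have hsdiff : ∀ {D : Finset (Fin (n + 1))}, D ⊆ contractFace B →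
        D \ {0} ⊆ contractFace B := fun h => Finset.sdiff_subset.trans h
    constructor
    · rintro ⟨⟨h1, h2⟩, h3⟩
      by_cases hy : y ∈ rint (C (contractFace B))
      · have ht : t ∉ rint (heightCone B) := fun h' => h3 ⟨hy, h'⟩
        rw [mem_rint_heightCone] at ht
        have hne : ¬ (0 ∈ B ∧ 1 ∈ B) := fun h' => ht ⟨fun _ h => absurd h'.2 h,
          fun h => absurd h'.1 h, fun h => absurd h'.1 h⟩
        have ht0 : t = 0 ∧ (0 ∈ B ∨ 1 ∈ B) := by
          obtain ⟨h4, h5⟩ := h2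
          by_cases h0 : 0 ∈ B <;> by_cases h1 : 1 ∈ B <;> simp_all
          · linarith
          · linarith
          · exact absurd (le_antisymm h4 h5) ht
        -- Here `B` has exactly one pole and the height is zero; dropping that pole leaves the
        -- contraction unchanged.
        have hc : contractFace (expandFace (contractFace B) False False) = contractFace B :=
          contractFace_expandFace (by rw [zero_mem_contractFace]; simpa using hne)
        refine ⟨expandFace (contractFace B) False False, hss (subset_of_contractFace
          (by simp [zero_mem_expandFace]) (by simp [one_mem_expandFace])
          (hsdiff hc.le)) ?_, by rw [hc]; exact h1, by rw [ht0.1]; exact zero_mem_heightCone _⟩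
        intro heq
        rcases ht0.2 with h' | h'
        · rw [← heq, zero_mem_expandFace] at h'
          exact h'
        · rw [← heq, one_mem_expandFace] at h'
          exact h'
      · obtain ⟨D, hD, hyD⟩ := hb.1 ⟨h1, hy⟩
        -- If `B` has both poles but `D` lacks the vertex they contract to, only one pole may be
        -- kept, and the sign of the height `t` decides which. Otherwise the poles of `B` fit to
        -- `D`.
        by_cases hcase : 0 ∈ contractFace B ∧ 0 ∉ D
        · have hz := zero_mem_contractFace.1 hcase.1
          have hc : contractFace (expandFace D (0 < t) (¬ 0 < t)) = D :=
            contractFace_expandFace (by simp [hcase.2])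
          refine ⟨expandFace D (0 < t) (¬ 0 < t), hss (subset_of_contractFace (fun _ => hz.1)
            (fun _ => hz.2) (hsdiff (hc.le.trans hD.1))) ?_, by rwa [hc], ?_⟩
          · intro heq
            rw [← heq, zero_mem_expandFace, one_mem_expandFace] at hz
            exact hz.2 hz.1
          · constructor
            · rw [zero_mem_expandFace]
              exact not_lt.1
            · rw [one_mem_expandFace, not_not]
              exact le_of_lt
        · have hc : contractFace (expandFace D (0 ∈ B) (1 ∈ B)) = D := by
            refine contractFace_expandFace ?_
            rw [← zero_mem_contractFace]
            exact ⟨fun h' => hD.1 h', fun h' => by_contra fun h4 => hcase ⟨h', h4⟩⟩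
          refine ⟨expandFace D (0 ∈ B) (1 ∈ B), hss (subset_of_contractFace
            zero_mem_expandFace.1 one_mem_expandFace.1 (hsdiff (hc.le.trans hD.1))) ?_,
            by rwa [hc], ?_⟩
          · intro heq
            rw [heq] at hc
            exact hD.ne hc.symm
          · rw [heightCone, zero_mem_expandFace, one_mem_expandFace]
            exact h2
    · rintro ⟨F, hF, h1, h2⟩
      have hFD := contractFace_mono hF.1
      refine ⟨⟨hB.mono hFD h1, heightCone_mono hF.1 h2⟩, ?_⟩
      rintro ⟨h3, h4⟩
      by_cases heq : contractFace F = contractFace B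
      · have hne : ¬ ((0 ∈ B → 0 ∈ F) ∧ (1 ∈ B → 1 ∈ F)) := fun h' =>
          hF.2 (subset_of_contractFace h'.1 h'.2 (by rw [heq]; exact Finset.sdiff_subset))
        have hz : 0 ∈ F ∧ 1 ∈ F ↔ 0 ∈ B ∧ 1 ∈ B := by
          rw [← zero_mem_contractFace, ← zero_mem_contractFace, heq]
        have h0F : 0 ∈ F → 0 ∈ B := fun h' => hF.1 h'
        have h1F : 1 ∈ F → 1 ∈ B := fun h' => hF.1 h'
        obtain ⟨h5, h6⟩ := h2
        rw [mem_rint_heightCone] at h4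
        obtain ⟨h7, h8, h9⟩ := h4
        by_cases a0 : 0 ∈ B <;> by_cases a1 : 1 ∈ B <;> by_cases b0 : 0 ∈ F <;>
          by_cases b1 : 1 ∈ F <;> simp_all <;> linarith
      · exact (hb.2 ⟨_, lt_of_le_of_ne hFD heq, h1⟩).2 h3
  · intro F F' hF hF' hne
    rw [hr F hF, hr F' hF', Set.disjoint_left]
    rintro x ⟨h1, h2⟩ ⟨h3, h4⟩
    by_cases heq : contractFace F = contractFace F'
    · have hz : 0 ∈ F ∧ 1 ∈ F ↔ 0 ∈ F' ∧ 1 ∈ F' := by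
        rw [← zero_mem_contractFace, ← zero_mem_contractFace, heq]
      have hne' : ¬ ((0 ∈ F ↔ 0 ∈ F') ∧ (1 ∈ F ↔ 1 ∈ F')) := fun h' => hne
        (Finset.Subset.antisymm
          (subset_of_contractFace h'.1.1 h'.2.1 (by rw [heq]; exact Finset.sdiff_subset))
          (subset_of_contractFace h'.1.2 h'.2.2 (by rw [heq]; exact Finset.sdiff_subset)))
      rw [mem_rint_heightCone] at h2 h4
      generalize (L x).2 = t at h2 h4
      obtain ⟨h5, h6, h7⟩ := h2
      obtain ⟨h8, h9, h10⟩ := h4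
      by_cases a0 : 0 ∈ F <;> by_cases a1 : 1 ∈ F <;> by_cases b0 : 0 ∈ F' <;>
        by_cases b1 : 1 ∈ F' <;> simp_all <;> linarith
    · exact Set.disjoint_left.1 (hB.disj _ _ (contractFace_mono hF) (contractFace_mono hF') heq)
        h1 h3

end SplitVertex

/-! ### Approximating a split simplex by nondegenerate ones -/

section SplitApproximation

variable {n : ℕ} {V W : Type*} [NormedAddCommGroup V] [NormedSpace ℝ V]
  [FiniteDimensional ℝ V] [NormedAddCommGroup W] [NormedSpace ℝ W] [FiniteDimensional ℝ W]

theorem simplexCone_comp_equiv {ι ι' : Type*} [Fintype ι] [Fintype ι'] (τ : ι ≃ ι') (v : ι' → V)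
    (A : Finset ι) : simplexCone (v ∘ τ) A = simplexCone v (A.map τ.toEmbedding) := by
  ext x
  constructor
  · rintro ⟨t, h0, hA, rfl⟩
    refine ⟨t ∘ τ.symm, fun i => h0 _, fun i hi => hA _ fun h' => hi ?_, ?_⟩
    · exact Finset.mem_map.2 ⟨_, h', by simp⟩
    · rw [← τ.sum_comp]
      simp
  · rintro ⟨t, h0, hA, rfl⟩
    refine ⟨t ∘ τ, fun i => h0 _, fun i hi => hA _ fun h' => hi ?_, ?_⟩
    · simpa using h'
    · rw [← τ.sum_comp]
      simp

theorem simplexCone_preimage {ι : Type*} [Fintype ι] (L : W ≃L[ℝ] V) (v : ι → V) (A : Finset ι) :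
    simplexCone (fun i => L.symm (v i)) A = L ⁻¹' simplexCone v A := by
  ext x
  constructor
  · rintro ⟨t, h0, hA, rfl⟩
    exact ⟨t, h0, hA, by simp [map_sum]⟩
  · rintro ⟨t, h0, hA, h⟩
    exact ⟨t, h0, hA, by rw [← L.symm_apply_apply x, h]; simp [map_sum]⟩

/-- The vertices obtained by splitting the vertex `v 0` into two nearly antipodal ones. -/
def splitVertices (η : ℝ) (v : Fin (n + 1) → V) : Fin (n + 2) → V × ℝ :=
  Fin.cons (η • v 0, 1) (Fin.cons (η • v 0, -1) fun i => (v i.succ, 0))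

theorem sum_smul_splitVertices (η : ℝ) (v : Fin (n + 1) → V) (t : Fin (n + 2) → ℝ) :
    ∑ j, t j • splitVertices η v j =
      ((η * (t 0 + t 1)) • v 0 + ∑ i : Fin n, t i.succ.succ • v i.succ, t 0 - t 1) := by
  rw [Fin.sum_univ_succ, Fin.sum_univ_succ]
  simp only [splitVertices, Fin.cons_zero, Fin.cons_succ]
  rw [Fin.succ_zero_eq_one]
  refine Prod.ext ?_ ?_
  · simp only [Prod.fst_add, Prod.smul_fst, Prod.fst_sum]
    rw [← add_assoc]
    congr 1
    module
  · simp only [Prod.snd_add, Prod.smul_snd, Prod.snd_sum, smul_eq_mul, mul_zero,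
      Finset.sum_const_zero]
    ring

theorem linearIndependent_splitVertices {η : ℝ} (hη : η ≠ 0) {v : Fin (n + 1) → V}
    (hv : LinearIndependent ℝ v) : LinearIndependent ℝ (splitVertices η v) := by
  rw [Fintype.linearIndependent_iff] at hv ⊢
  intro t ht
  rw [sum_smul_splitVertices] at ht
  obtain ⟨h1, h2⟩ := Prod.ext_iff.1 ht
  have h2 : t 0 - t 1 = 0 := h2
  have h3 := hv (Fin.cons (η * (t 0 + t 1)) fun i => t i.succ.succ) (by
    rw [Fin.sum_univ_succ]
    exact h1)
  have h4 : η * (t 0 + t 1) = 0 := h3 0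
  have h5 := (mul_eq_zero.1 h4).resolve_left hη
  intro j
  induction j using Fin.cases with
  | zero => linarith
  | succ i =>
    induction i using Fin.cases with
    | zero => rw [Fin.succ_zero_eq_one]; linarith
    | succ i => exact h3 i.succ

/-- Corresponding points have the same height `s` and differ only in the coefficient of `v 0`, by at
most `η * |s|`. The error is thus at most `η * ‖v 0‖` times the norm. -/
theorem coneClose_splitVertices {η ε : ℝ} (hη : 0 < η) {v : Fin (n + 1) → V}
    (hε : η * ‖v 0‖ ≤ ε) (A : Finset (Fin (n + 2))) :
    ConeClose ε (simplexCone (splitVertices η v) A)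
      (simplexCone v (contractFace A) ×ˢ heightCone A) := by
  have aux : ∀ (a b s : ℝ) (y : V), |a - b| ≤ η * |s| → ∀ z : V × ℝ, z.2 = s →
      ‖(a • v 0 + y, s) - (b • v 0 + y, s)‖ ≤ ε * ‖z‖ := by
    intro a b s y hab z hz
    have h1 : (a • v 0 + y, s) - (b • v 0 + y, s) = ((a - b) • v 0, 0) := by
      rw [Prod.mk_sub_mk, sub_self, add_sub_add_right_eq_sub, sub_smul]
    rw [h1, Prod.norm_mk, norm_zero, max_eq_left (norm_nonneg _), norm_smul, Real.norm_eq_abs]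
    have h2 : |s| ≤ ‖z‖ := hz ▸ norm_snd_le z
    calc |a - b| * ‖v 0‖ ≤ η * |s| * ‖v 0‖ := mul_le_mul_of_nonneg_right hab (norm_nonneg _)
      _ = η * ‖v 0‖ * |s| := by ring
      _ ≤ ε * ‖z‖ := mul_le_mul hε h2 (abs_nonneg _) (le_trans (by positivity) hε)
  constructor
  · rintro x ⟨t, h0, hA, rfl⟩
    rw [sum_smul_splitVertices]
    -- With both poles in `A` the coefficient of `v 0` can be kept. Otherwise it has to be dropped,
    -- but then one of `t 0`, `t 1` vanishes and their sum is the absolute height.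
    set b := if 0 ∈ A ∧ 1 ∈ A then η * (t 0 + t 1) else 0 with hb
    have hb0 : 0 ≤ b := by
      rw [hb]
      split_ifs
      · exact mul_nonneg hη.le (add_nonneg (h0 0) (h0 1))
      · exact le_rfl
    refine ⟨(b • v 0 + ∑ i : Fin n, t i.succ.succ • v i.succ, t 0 - t 1),
      ⟨⟨Fin.cons b fun i => t i.succ.succ, fun i => ?_, fun i hi => ?_, ?_⟩, fun h => ?_,
        fun h => ?_⟩, aux _ _ _ _ ?_ _ rfl⟩
    · induction i using Fin.cases with
      | zero => exact hb0
      | succ i => exact h0 _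
    · induction i using Fin.cases with
      | zero =>
        rw [zero_mem_contractFace] at hi
        exact if_neg hi
      | succ i =>
        rw [mem_contractFace_of_ne (Fin.succ_ne_zero i)] at hi
        exact hA _ hi
    · rw [Fin.sum_univ_succ]
      rfl
    · rw [hA 0 h]
      linarith [h0 1]
    · rw [hA 1 h]
      linarith [h0 0]
    · rw [hb]
      split_ifs with h
      · rw [sub_self, abs_zero]
        positivity
      · rw [sub_zero, abs_mul, abs_of_pos hη]
        refine mul_le_mul_of_nonneg_left ?_ hη.le
        by_cases h1 : 0 ∈ A
        · rw [hA 1 fun h2 => h ⟨h1, h2⟩, add_zero, sub_zero]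
        · rw [hA 0 h1, zero_add, zero_sub, abs_neg]
  · rintro ⟨x, s⟩ ⟨⟨r, h0, hA, rfl⟩, h1, h2⟩
    -- The sum of the two pole coefficients, whose difference must be `s`. The value `r 0 / η` would
    -- reproduce the coefficient of `v 0` exactly; the bound `|s| ≤ u` keeps both coefficients
    -- nonnegative.
    set u := max (r 0 / η) |s| with hu
    have hus : |s| ≤ u := le_max_right _ _
    have hur : r 0 = 0 → u = |s| := fun h => by
      rw [hu, h, zero_div, max_eq_right (abs_nonneg s)]
    rw [Fin.sum_univ_succ]
    set t : Fin (n + 2) → ℝ := Fin.cons ((u + s) / 2) (Fin.cons ((u - s) / 2) fun i => r i.succ)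
      with ht
    have ht0 : t 0 = (u + s) / 2 := rfl
    have ht1 : t 1 = (u - s) / 2 := rfl
    have hts : ∀ i : Fin n, t i.succ.succ = r i.succ := fun i => rfl
    refine ⟨∑ j, t j • splitVertices η v j, ⟨t, fun j => ?_, fun j hj => ?_, rfl⟩, ?_⟩
    · induction j using Fin.cases with
      | zero =>
        rw [ht0]
        linarith [neg_abs_le s]
      | succ i =>
        induction i using Fin.cases with
        | zero =>
          rw [Fin.succ_zero_eq_one, ht1]
          linarith [le_abs_self s]
        | succ i => exact h0 _
    · induction j using Fin.cases with
      | zero =>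
        rw [ht0, hur (hA 0 fun h => hj (zero_mem_contractFace.1 h).1), abs_of_nonpos (h1 hj)]
        ring
      | succ i =>
        induction i using Fin.cases with
        | zero =>
          rw [Fin.succ_zero_eq_one] at hj ⊢
          rw [ht1, hur (hA 0 fun h => hj (zero_mem_contractFace.1 h).2), abs_of_nonneg (h2 hj)]
          ring
        | succ i =>
          refine hA _ fun h => hj ((mem_contractFace_of_ne (Fin.succ_ne_zero i)).1 h)
    · rw [sum_smul_splitVertices, ht0, ht1, show (u + s) / 2 + (u - s) / 2 = u by ring,
        show (u + s) / 2 - (u - s) / 2 = s by ring]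
      simp only [hts]
      refine aux _ _ _ _ ?_ _ rfl
      rcases le_total (r 0 / η) |s| with h | h
      · have h3 : r 0 ≤ |s| * η := (div_le_iff₀ hη).1 h
        rw [hu, max_eq_right h, abs_of_nonpos (by linarith)]
        linarith [h0 0]
      · rw [hu, max_eq_left h, mul_div_cancel₀ _ hη.ne', sub_self, abs_zero]
        positivity

end SplitApproximation

/-! ### Conical models of simplices and their relabelling -/

section SimplexModel

variable {n : ℕ}

/-- The cones over the faces of a combinatorial simplex in `𝕊ⁿ` with facet areas `S`. The simplex
may be flat; then `χ` tells on which of its two sides a facet lies. -/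
structure IsSimplexModel (n : ℕ) (S : Fin (n + 1) → ℝ)
    (C : Finset (Fin (n + 1)) → Set (Space n)) : Prop where
  proper : ∀ B, B ≠ Finset.univ → IsSimplexFanAt C B
  body : IsSimplexFanAt C Finset.univ ∨ (∃ d, d + 1 = n ∧ IsConeCell d (C Finset.univ)) ∧
    (∀ B, C B ⊆ C Finset.univ) ∧ ∃ χ : Fin (n + 1) → Bool, ∀ i j, i ≠ j →
      (χ i = χ j → Disjoint (rint (C (Finset.univ.erase i))) (rint (C (Finset.univ.erase j)))) ∧
      (χ i ≠ χ j → Disjoint (rint (C ((Finset.univ.erase i).erase j))) (rint (C Finset.univ)))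
  limit : ∀ ε > 0, ∃ v : Fin (n + 1) → Space n, LinearIndependent ℝ v ∧
    ∀ A, ConeClose ε (simplexCone v A) (C A)
  area_eq : ∀ i, area (trace (C (Finset.univ.erase i))) = S i
  flat : 3 ≤ n → ∃ a b c, a ≠ b ∧ a ≠ c ∧ b ≠ c ∧
    Submodule.span ℝ (C {a, c}) = Submodule.span ℝ (C {b, c})

theorem map_univ_equiv {ι : Type*} [Fintype ι] (τ : ι ≃ ι) :
    (Finset.univ : Finset ι).map τ.toEmbedding = Finset.univ := by
  ext; simp

theorem map_erase_equiv {ι : Type*} [DecidableEq ι] (τ : ι ≃ ι) (A : Finset ι) (i : ι) :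
    (A.erase i).map τ.toEmbedding = (A.map τ.toEmbedding).erase (τ i) :=
  Finset.map_erase τ.toEmbedding A i

theorem IsSimplexFanAt.comp_equiv {V ι : Type*} [NormedAddCommGroup V] [NormedSpace ℝ V]
    [FiniteDimensional ℝ V] [Fintype ι] {C : Finset ι → Set V} (τ : ι ≃ ι) {B : Finset ι}
    (h : IsSimplexFanAt C (B.map τ.toEmbedding)) :
    IsSimplexFanAt (fun A => C (A.map τ.toEmbedding)) B where
  poly := h.poly
  finrank_span := by rw [h.finrank_span, Finset.card_map]
  pointed hB := h.pointed (hB.map)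
  bdry := by
    rw [h.bdry]
    ext x
    simp only [mem_iUnion, mem_ofPred_eq, exists_prop]
    constructor
    · rintro ⟨F, hF, hx⟩
      have h1 : (F.map τ.symm.toEmbedding).map τ.toEmbedding = F := by
        ext; simp
      refine ⟨F.map τ.symm.toEmbedding, ?_, by rwa [h1]⟩
      rwa [← Finset.map_ssubset_map (f := τ.toEmbedding), h1]
    · rintro ⟨F, hF, hx⟩
      exact ⟨_, Finset.map_ssubset_map.2 hF, hx⟩
  disj F F' hF hF' hne := h.disj _ _ (Finset.map_subset_map.2 hF) (Finset.map_subset_map.2 hF')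
    fun h' => hne (Finset.map_injective _ h')

theorem IsSimplexModel.comp_equiv {S : Fin (n + 1) → ℝ} {C : Finset (Fin (n + 1)) → Set (Space n)}
    (h : IsSimplexModel n S C) (τ : Fin (n + 1) ≃ Fin (n + 1)) :
    IsSimplexModel n (S ∘ τ) fun A => C (A.map τ.toEmbedding) where
  proper B hB := (h.proper _ fun h' => hB (by
    rw [← map_univ_equiv τ] at h'
    exact Finset.map_injective _ h')).comp_equiv τ
  body := by
    rcases h.body with h1 | ⟨h1, h2, χ, hχ⟩
    · left
      refine IsSimplexFanAt.comp_equiv τ ?_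
      rwa [map_univ_equiv]
    · refine Or.inr ⟨by rwa [map_univ_equiv], fun B => by rw [map_univ_equiv]; exact h2 _,
        χ ∘ τ, fun i j hij => ?_⟩
      simp only [map_erase_equiv, map_univ_equiv]
      exact hχ _ _ (τ.injective.ne hij)
  limit ε hε := by
    obtain ⟨v, hv, hc⟩ := h.limit ε hε
    refine ⟨v ∘ τ, hv.comp _ τ.injective, fun A => ?_⟩
    rw [simplexCone_comp_equiv]
    exact hc _
  area_eq i := by
    simp only [map_erase_equiv, map_univ_equiv]
    exact h.area_eq _
  flat hn := by
    obtain ⟨a, b, c, h1, h2, h3, h4⟩ := h.flat hn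
    refine ⟨τ.symm a, τ.symm b, τ.symm c, by simpa, by simpa, by simpa, ?_⟩
    simpa using h4

end SimplexModel

/-! ### From simplices in `𝕊ⁿ` to simplices in `𝕊ⁿ⁺¹` -/

section SimplexRecursion

variable {n : ℕ}

/-- The vertex to which a vertex is contracted. -/
def contractVertex (j : Fin (n + 2)) : Fin (n + 1) := Fin.cases 0 id j

theorem contractFace_erase {A : Finset (Fin (n + 2))} {j : Fin (n + 2)} :
    contractFace (A.erase j) = (contractFace A).erase (contractVertex j) := by
  ext k
  rw [Finset.mem_erase, mem_contractFace, mem_contractFace, Finset.mem_erase, Finset.mem_erase]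
  induction j using Fin.cases with
  | zero =>
    change _ ↔ k ≠ 0 ∧ _
    constructor
    · rintro ⟨⟨-, h1⟩, h2⟩
      exact ⟨fun hk => (h2 hk).1 rfl, h1, fun hk => (h2 hk).2⟩
    · rintro ⟨hk, h1, h2⟩
      exact ⟨⟨Fin.succ_ne_zero k, h1⟩, fun h => absurd h hk⟩
  | succ i =>
    change _ ↔ k ≠ i ∧ _
    rw [ne_eq, Fin.succ_inj]
    constructor
    · rintro ⟨⟨h1, h2⟩, h3⟩
      exact ⟨h1, h2, fun hk => (h3 hk).2⟩
    · rintro ⟨h1, h2, h3⟩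
      exact ⟨⟨h1, h2⟩, fun hk => ⟨(Fin.succ_ne_zero i).symm, h3 hk⟩⟩

theorem contractFace_univ : contractFace (Finset.univ : Finset (Fin (n + 2))) = Finset.univ := by
  ext k
  simp [mem_contractFace]

theorem contractFace_eq_univ {A : Finset (Fin (n + 2))} (h : contractFace A = Finset.univ) :
    A = Finset.univ := by
  have h0 : (0 : Fin (n + 1)) ∈ contractFace A := h ▸ Finset.mem_univ _
  rw [zero_mem_contractFace] at h0
  refine Finset.Subset.antisymm (Finset.subset_univ _)
    (subset_of_contractFace (fun _ => h0.1) (fun _ => h0.2) ?_)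
  rw [h]
  exact Finset.subset_univ _

theorem eq_of_contractVertex_eq {i j : Fin (n + 2)} (h : contractVertex i = contractVertex j)
    (hij : i ≠ j) : i = 0 ∧ j = 1 ∨ i = 1 ∧ j = 0 := by
  induction i using Fin.cases with
  | zero =>
    induction j using Fin.cases with
    | zero => exact absurd rfl hij
    | succ j =>
      have h : 0 = j := h
      rw [← h]
      exact Or.inl ⟨rfl, rfl⟩
  | succ i =>
    induction j using Fin.cases with
    | zero =>
      have h : i = 0 := h
      rw [h]
      exact Or.inr ⟨rfl, rfl⟩
    | succ j =>
      have h : i = j := h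
      exact absurd (by rw [h]) hij

theorem IsSimplexModel.poly {S : Fin (n + 1) → ℝ} {C : Finset (Fin (n + 1)) → Set (Space n)}
    (h : IsSimplexModel n S C) (A : Finset (Fin (n + 1))) : IsPolyCone (C A) := by
  by_cases hA : A = Finset.univ
  · rw [hA]
    rcases h.body with h1 | ⟨⟨d, -, h1⟩, -⟩
    · exact h1.poly
    · exact h1.poly
  · exact (h.proper A hA).poly

theorem erase_ne_univ {ι : Type*} [Fintype ι] [DecidableEq ι] (A : Finset ι) (i : ι) :
    A.erase i ≠ Finset.univ := fun h => by
  have := Finset.mem_univ i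
  rw [← h] at this
  exact Finset.notMem_erase i _ this

theorem heightCone_erase_zero :
    heightCone (Finset.univ.erase 0 : Finset (Fin (n + 2))) = Iic 0 := by
  ext t
  simp [heightCone]

theorem heightCone_erase_one :
    heightCone (Finset.univ.erase 1 : Finset (Fin (n + 2))) = Ici 0 := by
  ext t
  simp [heightCone]

/-- Splitting a vertex of a simplex in `𝕊ⁿ` gives a simplex in `𝕊ⁿ⁺¹`. -/
theorem IsSimplexModel.exists_split (hn : 2 ≤ n) {S : Fin (n + 2) → ℝ} (hS : ∀ i, 0 < S i)
    {S' : Fin (n + 1) → ℝ} {C : Finset (Fin (n + 1)) → Set (Space n)} (h : IsSimplexModel n S' C)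
    (h0 : S' 0 / sphereVolume n * sphereVolume (n + 1) = S 1 + S 0)
    (hi : ∀ i : Fin n, S' i.succ / sphereVolume n * sphereVolume (n + 1) = S i.succ.succ) :
    ∃ C', IsSimplexModel (n + 1) S C' := by
  have hfacet : ∀ i, IsConeCell (n - 1) (C (Finset.univ.erase i)) := by
    intro i
    have hf := h.proper _ (erase_ne_univ Finset.univ i)
    have hc : (Finset.univ.erase i).card = n - 1 + 1 := by
      rw [Finset.card_erase_of_mem (Finset.mem_univ _), Finset.card_fin]
      omega
    exact ⟨hf.poly, by rw [hf.finrank_span, hc], hf.pointed (Finset.card_pos.1 (by omega))⟩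
  -- The upper half of the cut facet contains the pole `0` and is opposite to the vertex `1`, so it
  -- receives the area `S 1`; the lower half receives `S 0`.
  obtain ⟨g, hg1, hg2⟩ := exists_lift_area (hfacet 0) (by omega) (hS 1) (hS 0)
    (by rw [h.area_eq]; exact h0)
  set L := liftEquiv g with hL
  have hr : ∀ F, rint (splitCone L C F) =
      L ⁻¹' (rint (C (contractFace F)) ×ˢ rint (heightCone F)) := fun F =>
    rint_lift L (h.poly _).zero_mem (zero_mem_heightCone F)
  have hu : splitCone L C Finset.univ = L ⁻¹' (C Finset.univ ×ˢ univ) := by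
    rw [splitCone, contractFace_univ]
    congr 2
    ext t
    simp [heightCone]
  refine ⟨splitCone L C, ?_, ?_, ?_, ?_, ?_⟩
  · refine fun B hB => isSimplexFanAt_splitCone L fun D hD => h.proper D ?_
    rintro rfl
    exact hB (contractFace_eq_univ (Finset.univ_subset_iff.1 hD))
  · rcases h.body with hb | ⟨⟨d, hd, hb⟩, hsub, χ, hχ⟩
    · refine Or.inl (isSimplexFanAt_splitCone L fun D _ => ?_)
      by_cases hD : D = Finset.univ
      · rw [hD]; exact hb
      · exact h.proper D hD
    · refine Or.inr ⟨⟨d + 1, by omega, by rw [hu]; exact hb.lift_univ L⟩, fun B => ?_,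
        χ ∘ contractVertex, fun i j hij => ?_⟩
      · rw [hu]
        exact fun x hx => ⟨hsub _ hx.1, mem_univ _⟩
      · have hdis : ∀ F F', Disjoint (rint (C (contractFace F))) (rint (C (contractFace F'))) →
            Disjoint (rint (splitCone L C F)) (rint (splitCone L C F')) := by
          intro F F' hd
          rw [hr, hr, Set.disjoint_left]
          rintro x ⟨h1, -⟩ ⟨h2, -⟩
          exact Set.disjoint_left.1 hd h1 h2
        -- Facets keep the side of the facets they come from. Distinct indices with equal
        -- contraction belong to the two halves of the cut facet, on the same side and separated by
        -- the sign of the height.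
        by_cases hq : contractVertex i = contractVertex j
        · refine ⟨fun _ => ?_, fun hne => absurd (congrArg χ hq) hne⟩
          have hd01 : Disjoint (rint (splitCone L C (Finset.univ.erase 0)))
              (rint (splitCone L C (Finset.univ.erase 1))) := by
            rw [hr, hr, heightCone_erase_zero, heightCone_erase_one, rint_Iic, rint_Ici,
              Set.disjoint_left]
            rintro x ⟨-, h1⟩ ⟨-, h2⟩
            exact lt_asymm (mem_Iio.1 h1) (mem_Ioi.1 h2)
          rcases eq_of_contractVertex_eq hq hij with ⟨rfl, rfl⟩ | ⟨rfl, rfl⟩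
          exacts [hd01, hd01.symm]
        · obtain ⟨h1, h2⟩ := hχ _ _ hq
          refine ⟨fun hc => hdis _ _ ?_, fun hc => hdis _ _ ?_⟩
          · simp only [contractFace_erase, contractFace_univ]
            exact h1 hc
          · simp only [contractFace_erase, contractFace_univ]
            exact h2 hc
  · intro ε hε
    obtain ⟨ε', hε', hLε⟩ := exists_coneClose_preimage L hε
    -- Two errors `ε₁` are composed; since `ε₁ ≤ 1`, their sum and product together stay within `3 *
    -- ε₁`.
    set ε₁ := min (ε' / 3) 1 with hε₁
    have hε₁0 : 0 < ε₁ := lt_min (by positivity) one_pos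
    have hε₁1 : ε₁ ≤ 1 := min_le_right _ _
    have hε₁' : ε₁ ≤ ε' / 3 := min_le_left _ _
    obtain ⟨v, hv, hc⟩ := h.limit ε₁ hε₁0
    set η := ε₁ / (‖v 0‖ + 1) with hη
    have hη0 : 0 < η := by positivity
    have hηv : η * ‖v 0‖ ≤ ε₁ := by
      rw [hη, div_mul_eq_mul_div, div_le_iff₀ (by positivity)]
      nlinarith [norm_nonneg (v 0)]
    refine ⟨fun i => L.symm (splitVertices η v i), ?_, fun A => ?_⟩
    · exact (linearIndependent_splitVertices hη0.ne' hv).map'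
        (L.symm.toLinearEquiv : Space n × ℝ →ₗ[ℝ] Space (n + 1)) L.symm.toLinearEquiv.ker
    · rw [simplexCone_preimage]
      refine hLε _ _ (((coneClose_splitVertices hη0 hηv A).trans hε₁0.le hε₁0.le
        ((hc (contractFace A)).prod hε₁0.le (heightCone A))).mono ?_)
      nlinarith
  · intro j
    rw [splitCone, contractFace_erase, contractFace_univ]
    induction j using Fin.cases with
    | zero =>
      rw [heightCone_erase_zero]
      exact hg2
    | succ i =>
      induction i using Fin.cases with
      | zero =>
        rw [Fin.succ_zero_eq_one, heightCone_erase_one]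
        exact hg1
      | succ i =>
        have hh : heightCone (Finset.univ.erase i.succ.succ) = univ := by
          ext t
          have h1 : (1 : Fin (n + 2)) ≠ i.succ.succ := by
            rw [← Fin.succ_zero_eq_one]
            exact fun h' => (Fin.succ_ne_zero i) (Fin.succ_injective _ h').symm
          simp [heightCone, (Fin.succ_ne_zero _).symm, h1]
        rw [hh]
        have hf := hfacet i.succ
        rw [← hi, ← h.area_eq]
        exact area_lift_univ (by omega) hf.poly (by rw [hf.finrank_span]; omega) g
  · intro _
    -- The edges from the two poles to the last vertex are the halves of the semicircle over an old
    -- vertex, so they span the same plane. That vertex must not be the split one.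
    have hw : Fin.last n ≠ 0 := fun h' => by
      have := congrArg Fin.val h'
      simp at this
      omega
    have hw1 : (1 : Fin (n + 2)) ≠ (Fin.last n).succ := by
      rw [← Fin.succ_zero_eq_one]
      exact fun h' => hw (Fin.succ_injective _ h').symm
    have hc0 : contractFace {0, (Fin.last n).succ} = {Fin.last n} := by
      ext k
      rw [mem_contractFace]
      simp only [Finset.mem_insert, Finset.mem_singleton, Fin.succ_ne_zero, false_or, Fin.succ_inj,
        true_or, implies_true, and_true]
    have hc1 : contractFace {1, (Fin.last n).succ} = {Fin.last n} := by
      ext k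
      rw [mem_contractFace, ← Fin.succ_zero_eq_one]
      simp only [Finset.mem_insert, Finset.mem_singleton, Fin.succ_inj]
      constructor
      · rintro ⟨h1 | h1, h2⟩
        · rcases h2 h1 with h2 | h2
          · exact absurd h2 (Fin.succ_ne_zero _).symm
          · exact absurd h2 (Fin.succ_ne_zero _).symm
        · exact h1
      · rintro rfl
        exact ⟨Or.inr rfl, fun h' => absurd h' hw⟩
    have hh0 : heightCone {0, (Fin.last n).succ} = Ici 0 := by
      ext t
      have h1 : (1 : Fin (n + 2)) ∉ ({0, (Fin.last n).succ} : Finset _) := by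
        rw [Finset.mem_insert, Finset.mem_singleton, not_or]
        exact ⟨one_ne_zero, hw1⟩
      have h0 : (0 : Fin (n + 2)) ∈ ({0, (Fin.last n).succ} : Finset _) :=
        Finset.mem_insert_self _ _
      simp only [heightCone, h0, h1, not_true_eq_false, not_false_eq_true, mem_ofPred_eq, mem_Ici,
        forall_true_left, false_imp_iff, true_and]
    have hh1 : heightCone {1, (Fin.last n).succ} = Iic 0 := by
      ext t
      have h0 : (0 : Fin (n + 2)) ∉ ({1, (Fin.last n).succ} : Finset _) := by
        rw [Finset.mem_insert, Finset.mem_singleton, not_or]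
        exact ⟨zero_ne_one, (Fin.succ_ne_zero _).symm⟩
      have h1 : (1 : Fin (n + 2)) ∈ ({1, (Fin.last n).succ} : Finset _) :=
        Finset.mem_insert_self _ _
      simp only [heightCone, h0, h1, not_true_eq_false, not_false_eq_true, mem_ofPred_eq, mem_Iic,
        forall_true_left, false_imp_iff, and_true]
    refine ⟨0, 1, (Fin.last n).succ, zero_ne_one, (Fin.succ_ne_zero _).symm, hw1, ?_⟩
    have hz := (h.poly {Fin.last n}).zero_mem
    rw [splitCone, splitCone, hc0, hc1, hh0, hh1, span_preimage, span_preimage,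
      span_prod hz self_mem_Ici, span_prod hz self_mem_Iic, span_Ici, span_Iic]

end SimplexRecursion

/-! ### Triangles, and the induction for simplices -/

section SimplexBase

/-- The vertices, in the simplex numbering in which facets are opposite to vertices, of a face of a
triangle. -/
def triangleVertices (G : PolygonFace 0) : Finset (Fin 3) :=
  (faceVertices G).map (Equiv.addRight (1 : Fin 3)).toEmbedding

theorem triangleVertices_vertex (i : Fin 3) : triangleVertices (.vertex i) = {i + 1} := by
  revert i
  decide

theorem triangleVertices_edge (i : Fin 3) : triangleVertices (.edge i) = Finset.univ.erase i := by
  revert i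
  decide

theorem triangleVertices_body : triangleVertices .body = Finset.univ := by
  decide

theorem triangleVertices_injective : Function.Injective triangleVertices := by
  have h1 : ∀ i j : Fin 3, ({i + 1} : Finset (Fin 3)) = {j + 1} → i = j := by decide
  have h2 : ∀ i j : Fin 3, ({i + 1} : Finset (Fin 3)) ≠ Finset.univ.erase j := by decide
  have h3 : ∀ i : Fin 3, ({i + 1} : Finset (Fin 3)) ≠ Finset.univ := by decide
  have h4 : ∀ i j : Fin 3, (Finset.univ.erase i : Finset (Fin 3)) = Finset.univ.erase j → i = j := by
    decide
  have h5 : ∀ i : Fin 3, (Finset.univ.erase i : Finset (Fin 3)) ≠ Finset.univ := by decide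
  intro G G' h
  cases G with
  | vertex i => cases G' with
    | vertex j => rw [triangleVertices_vertex, triangleVertices_vertex] at h; rw [h1 i j h]
    | edge j => rw [triangleVertices_vertex, triangleVertices_edge] at h; exact absurd h (h2 i j)
    | body => rw [triangleVertices_vertex, triangleVertices_body] at h; exact absurd h (h3 i)
  | edge i => cases G' with
    | vertex j =>
      rw [triangleVertices_vertex, triangleVertices_edge] at h; exact absurd h.symm (h2 j i)
    | edge j => rw [triangleVertices_edge, triangleVertices_edge] at h; rw [h4 i j h]
    | body => rw [triangleVertices_edge, triangleVertices_body] at h; exact absurd h (h5 i)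
  | body => cases G' with
    | vertex j => rw [triangleVertices_vertex, triangleVertices_body] at h; exact absurd h.symm (h3 j)
    | edge j => rw [triangleVertices_edge, triangleVertices_body] at h; exact absurd h.symm (h5 j)
    | body => rfl

theorem exists_triangleVertices_eq {A : Finset (Fin 3)} (hA : A.Nonempty) :
    ∃ G, triangleVertices G = A := by
  have : ∀ A : Finset (Fin 3), A.Nonempty → (∃ i : Fin 3, {i + 1} = A) ∨
      (∃ i : Fin 3, Finset.univ.erase i = A) ∨ Finset.univ = A := by decide
  rcases this A hA with ⟨i, h⟩ | ⟨i, h⟩ | h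
  · exact ⟨.vertex i, (triangleVertices_vertex i).trans h⟩
  · exact ⟨.edge i, (triangleVertices_edge i).trans h⟩
  · exact ⟨.body, triangleVertices_body.trans h⟩

theorem triangleVertices_nonempty (G : PolygonFace 0) : (triangleVertices G).Nonempty := by
  have h : ∀ i : Fin 3, (Finset.univ.erase i : Finset (Fin 3)).Nonempty := by decide
  cases G with
  | vertex i => rw [triangleVertices_vertex]; simp
  | edge i => rw [triangleVertices_edge]; exact h i
  | body => rw [triangleVertices_body]; simp

theorem triangleVertices_ssubset {G G' : PolygonFace 0} :
    triangleVertices G ⊂ triangleVertices G' ↔ G < G' := by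
  have h1 : ∀ i : Fin 3, ∀ A : Finset (Fin 3), A.Nonempty → ¬ A ⊂ {i + 1} := by decide
  have h2 : ∀ i j : Fin 3, ({i + 1} : Finset (Fin 3)) ⊂ Finset.univ.erase j ↔ i = j ∨ i = j + 1 := by
    decide
  have h3 : ∀ i j : Fin 3, ¬ (Finset.univ.erase i : Finset (Fin 3)) ⊂ Finset.univ.erase j := by
    decide
  have h4 : ∀ i : Fin 3, ({i + 1} : Finset (Fin 3)) ⊂ Finset.univ := by decide
  have h5 : ∀ i : Fin 3, (Finset.univ.erase i : Finset (Fin 3)) ⊂ Finset.univ := by decide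
  cases G' with
  | vertex j =>
    rw [triangleVertices_vertex]
    exact iff_of_false (h1 j _ (triangleVertices_nonempty G)) PolygonFace.lt_vertex_iff
  | edge j =>
    rw [triangleVertices_edge, PolygonFace.lt_edge_iff]
    cases G with
    | vertex i =>
      rw [triangleVertices_vertex, h2 i j]
      simp
    | edge i =>
      rw [triangleVertices_edge]
      exact iff_of_false (h3 i j) (by simp)
    | body =>
      rw [triangleVertices_body]
      exact iff_of_false (fun h => h.2 (Finset.subset_univ _)) (by simp)
  | body =>
    rw [triangleVertices_body, PolygonFace.lt_body_iff]
    cases G with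
    | vertex i =>
      rw [triangleVertices_vertex]
      exact iff_of_true (h4 i) (by simp)
    | edge i =>
      rw [triangleVertices_edge]
      exact iff_of_true (h5 i) (by simp)
    | body =>
      rw [triangleVertices_body]
      exact iff_of_false (fun h => h.ne rfl) (by simp)

theorem card_triangleVertices (G : PolygonFace 0) :
    (triangleVertices G).card = G.dim + 1 := by
  have h : ∀ i : Fin 3, (Finset.univ.erase i : Finset (Fin 3)).card = 2 := by decide
  cases G with
  | vertex i => rw [triangleVertices_vertex]; rfl
  | edge i => rw [triangleVertices_edge]; exact h i
  | body => rw [triangleVertices_body]; rfl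

/-- The cones over the faces of a triangle, indexed by sets of vertices. -/
def triangleCone {V : Type*} [Zero V] (K : PolygonFace 0 → Set V) (A : Finset (Fin 3)) : Set V :=
  {x | A = ∅ ∧ x = 0 ∨ ∃ G, triangleVertices G = A ∧ x ∈ K G}

theorem triangleCone_empty {V : Type*} [Zero V] (K : PolygonFace 0 → Set V) :
    triangleCone K ∅ = {0} := by
  ext x
  have : ∀ G, triangleVertices G ≠ ∅ := fun G => (triangleVertices_nonempty G).ne_empty
  simp [triangleCone, this]

theorem triangleCone_triangleVertices {V : Type*} [Zero V] (K : PolygonFace 0 → Set V)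
    (G : PolygonFace 0) : triangleCone K (triangleVertices G) = K G := by
  ext x
  have : triangleVertices G ≠ ∅ := (triangleVertices_nonempty G).ne_empty
  simp [triangleCone, this, triangleVertices_injective.eq_iff]

variable {V : Type*} [NormedAddCommGroup V] [InnerProductSpace ℝ V] [FiniteDimensional ℝ V]

theorem isSimplexFanAt_empty {ι : Type*} [Fintype ι] {C : Finset ι → Set V} (h : C ∅ = {0}) :
    IsSimplexFanAt C ∅ where
  poly := by rw [h]; exact IsPolyCone.singleton_zero
  finrank_span := by rw [h, Submodule.span_zero_singleton, finrank_bot, Finset.card_empty]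
  pointed h := absurd h Finset.not_nonempty_empty
  bdry := by
    rw [h, rint_singleton_zero]
    ext x
    simp
  disj F F' hF hF' hne := absurd ((Finset.subset_empty.1 hF).trans (Finset.subset_empty.1 hF').symm)
    hne

theorem isSimplexFanAt_triangleCone {K : PolygonFace 0 → Set V} {G : PolygonFace 0}
    (h : ∀ F ≤ G, IsFanAt PolygonFace.dim K F) :
    IsSimplexFanAt (triangleCone K) (triangleVertices G) where
  poly := by
    rw [triangleCone_triangleVertices]
    exact (h G le_rfl).cell.poly
  finrank_span := by
    rw [triangleCone_triangleVertices, (h G le_rfl).cell.finrank_span, card_triangleVertices]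
  pointed _ := by
    rw [triangleCone_triangleVertices]
    exact (h G le_rfl).cell.pointed
  bdry := by
    rw [triangleCone_triangleVertices, (h G le_rfl).bdry]
    ext x
    simp only [mem_union, mem_singleton_iff, mem_iUnion, mem_ofPred_eq, exists_prop]
    constructor
    · rintro (rfl | ⟨F, hF, hx⟩)
      · exact ⟨∅, Finset.empty_ssubset.2 (triangleVertices_nonempty G), by
          rw [triangleCone_empty]; rfl⟩
      · exact ⟨triangleVertices F, triangleVertices_ssubset.2 hF, by
          rwa [triangleCone_triangleVertices]⟩
    · rintro ⟨A, hA, hx⟩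
      rcases A.eq_empty_or_nonempty with rfl | hne
      · rw [triangleCone_empty] at hx
        exact Or.inl hx
      · obtain ⟨F, rfl⟩ := exists_triangleVertices_eq hne
        rw [triangleCone_triangleVertices] at hx
        exact Or.inr ⟨F, triangleVertices_ssubset.1 hA, hx⟩
  disj A A' hA hA' hne := by
    have hle : ∀ F, triangleVertices F ⊆ triangleVertices G → F ≤ G := by
      intro F hF
      rcases hF.eq_or_ssubset with h' | h'
      · exact (triangleVertices_injective h').le
      · exact (triangleVertices_ssubset.1 h').le
    have h0 : ∀ F, triangleVertices F ⊆ triangleVertices G →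
        Disjoint (rint (triangleCone K ∅)) (rint (triangleCone K (triangleVertices F))) := by
      intro F hF
      rw [triangleCone_empty, triangleCone_triangleVertices, rint_singleton_zero,
        Set.disjoint_singleton_left]
      exact zero_notMem_rint (h F (hle F hF)).cell.pointed (h F (hle F hF)).cell.poly
    rcases A.eq_empty_or_nonempty with rfl | hA0
    · rcases A'.eq_empty_or_nonempty with rfl | hA0'
      · exact absurd rfl hne
      · obtain ⟨F, rfl⟩ := exists_triangleVertices_eq hA0'
        exact h0 F hA'
    · obtain ⟨F, rfl⟩ := exists_triangleVertices_eq hA0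
      rcases A'.eq_empty_or_nonempty with rfl | hA0'
      · exact (h0 F hA).symm
      · obtain ⟨F', rfl⟩ := exists_triangleVertices_eq hA0'
        rw [triangleCone_triangleVertices, triangleCone_triangleVertices]
        exact (h G le_rfl).disj F F' (hle F hA) (hle F' hA') fun h' => hne (by rw [h'])

theorem simplexCone_triangleVertices (p : Fin 3 → V) (G : PolygonFace 0) :
    simplexCone (p ∘ Equiv.addRight (2 : Fin 3)) (triangleVertices G) = polygonCone p G := by
  rw [simplexCone_comp_equiv, polygonCone]
  congr 1
  rw [triangleVertices, Finset.map_map]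
  -- Shifts by one and by two are inverse to each other on `Fin 3`.
  convert Finset.map_refl
  ext i
  revert i
  decide

theorem IsStrictConfig.linearIndependent_triangle {p : Fin 3 → V} {a : Fin 3 → V →L[ℝ] ℝ}
    (h : IsStrictConfig (k := 0) p a) : LinearIndependent ℝ p := by
  rw [Fintype.linearIndependent_iff]
  intro t ht j
  have h1 := congrArg (a (j + 1)) ht
  have hne : ∀ j : Fin 3, j ≠ j + 1 ∧ j ≠ j + 1 + 1 ∧
      (Finset.univ : Finset (Fin 3)) = {j, j + 1, j + 1 + 1} := by decide
  obtain ⟨h2, h3, h4⟩ := hne j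
  have h5 : j + 1 ≠ j + 1 + 1 := (hne (j + 1)).1
  rw [map_sum, map_zero, h4, Finset.sum_insert (by simp [h2, h3]), Finset.sum_pair h5] at h1
  simp only [map_smul, smul_eq_mul] at h1
  have h6 : a (j + 1) (p (j + 1)) = 0 := h.apply_self (j + 1)
  have h7 : a (j + 1) (p (j + 1 + 1)) = 0 := h.apply_succ (j + 1)
  rw [h6, h7, mul_zero, mul_zero, add_zero, add_zero] at h1
  exact (mul_eq_zero.1 h1).resolve_right (h.pos (j + 1) j h2 h3).ne'

/-- A triangle is a polygon with its faces relabelled by vertex sets. If it is flat, its longest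
edge is one of the two sides and the other two edges together form the opposite side; `χ` singles
out the longest edge. -/
theorem exists_isSimplexModel_two {S : Fin 3 → ℝ} (hS : ∀ i, 0 < S i)
    (hmax : ∀ i, S i ≤ S (Fin.last _)) (h1 : 2 * S (Fin.last _) ≤ ∑ i, S i)
    (h2 : ∑ i, S i ≤ 2 * Real.pi) : ∃ C, IsSimplexModel 2 S C := by
  obtain ⟨K, hK1, hK2, hK3, hK4, -, hK6⟩ := exists_polygon (k := 0) hS hmax h1 h2
  have hproper : ∀ B : Finset (Fin 3), B ≠ Finset.univ → IsSimplexFanAt (triangleCone K) B := by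
    intro B hB
    rcases B.eq_empty_or_nonempty with rfl | hne
    · exact isSimplexFanAt_empty (triangleCone_empty K)
    · obtain ⟨G, rfl⟩ := exists_triangleVertices_eq hne
      refine isSimplexFanAt_triangleCone fun F hF => hK1 F ?_
      rintro rfl
      have : G = .body := le_antisymm (PolygonFace.le_body G) hF
      exact hB (by rw [this, triangleVertices_body])
  have hedge : ∀ i : Fin 3, triangleCone K (Finset.univ.erase i) = K (.edge i) := fun i => by
    rw [← triangleVertices_edge, triangleCone_triangleVertices]
  have hbody : triangleCone K Finset.univ = K .body := by
    rw [← triangleVertices_body, triangleCone_triangleVertices]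
  refine ⟨triangleCone K, hproper, ?_, fun ε hε => ?_, fun i => ?_, fun h => by omega⟩
  · rcases h1.eq_or_lt with h | h
    · obtain ⟨h3, h4, h5⟩ := hK6 h
      have h3' : triangleCone K Finset.univ = triangleCone K (Finset.univ.erase (Fin.last 2)) := by
        rw [hbody, hedge]; exact h3
      refine Or.inr ⟨⟨1, rfl, ?_⟩, fun B => ?_, fun i => decide (i = Fin.last 2), fun i j hij => ?_⟩
      · rw [hbody, h3]
        exact (hK1 (.edge (Fin.last _)) (by simp)).cell
      · by_cases hB : B = Finset.univ
        · rw [hB]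
        · have : ∃ i, B ⊆ Finset.univ.erase i := by
            obtain ⟨i, hi⟩ := not_forall.1 fun h => hB (Finset.eq_univ_iff_forall.2 h)
            exact ⟨i, fun j hj => Finset.mem_erase.2 ⟨by rintro rfl; exact hi hj, Finset.mem_univ _⟩⟩
          obtain ⟨i, hi⟩ := this
          refine ((hproper _ (erase_ne_univ _ i)).mono hi).trans ?_
          rw [hedge, hbody]
          exact h4 i
      · constructor
        · intro hc
          simp only [decide_eq_decide] at hc
          rw [hedge, hedge]
          exact h5 i j hij (fun hi => hij (hi.trans (hc.1 hi).symm))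
            (fun hj => hij ((hc.2 hj).trans hj.symm))
        · intro hc
          rw [h3']
          have hl : i = Fin.last 2 ∨ j = Fin.last 2 := by
            by_contra h'
            rw [not_or] at h'
            exact hc (by rw [decide_eq_decide]; exact iff_of_false h'.1 h'.2)
          refine (hproper _ (erase_ne_univ _ (Fin.last 2))).disj _ _ ?_ subset_rfl ?_
          · rcases hl with rfl | rfl
            · exact Finset.erase_subset _ _
            · rw [Finset.erase_right_comm]
              exact Finset.erase_subset _ _
          · intro heq
            have := congrArg Finset.card heq
            rw [Finset.card_erase_of_mem (Finset.mem_erase.2 ⟨hij.symm, Finset.mem_univ _⟩),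
              Finset.card_erase_of_mem (Finset.mem_univ _),
              Finset.card_erase_of_mem (Finset.mem_univ _)] at this
            simp at this
    · left
      rw [← triangleVertices_body]
      refine isSimplexFanAt_triangleCone fun F _ => ?_
      by_cases hF : F = .body
      · rw [hF]; exact hK4 h
      · exact hK1 F hF
  · obtain ⟨p, a, hp, hc⟩ := hK3 ε hε
    refine ⟨p ∘ Equiv.addRight (2 : Fin 3),
      hp.linearIndependent_triangle.comp _ (Equiv.injective _), fun A => ?_⟩
    rcases A.eq_empty_or_nonempty with rfl | hne
    · rw [simplexCone_empty, triangleCone_empty]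
      exact ConeClose.refl hε.le _
    · obtain ⟨G, rfl⟩ := exists_triangleVertices_eq hne
      rw [simplexCone_triangleVertices, triangleCone_triangleVertices]
      exact hc G
  · rw [hedge]
    exact hK2 i

/-- The two smallest areas are merged, the areas are rescaled, and the facet of the resulting
simplex that has the merged area is split again. Merging destroys the order, so the inequality is
required for every index and the areas are sorted anew at each step. -/
theorem exists_isSimplexModel {n : ℕ} (hn : 2 ≤ n) {S : Fin (n + 1) → ℝ} (hS : ∀ i, 0 < S i)
    (h1 : ∀ i, 2 * S i ≤ ∑ i, S i) (h2 : ∑ i, S i ≤ sphereVolume n) :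
    ∃ C, IsSimplexModel n S C := by
  induction n, hn using Nat.le_induction with
  | base =>
    set σ := Tuple.sort S
    have hmono : Monotone (S ∘ σ) := Tuple.monotone_sort S
    have hsum : ∑ i, (S ∘ σ) i = ∑ i, S i := Equiv.sum_comp σ S
    rw [sphereVolume_two] at h2
    obtain ⟨C, hC⟩ := exists_isSimplexModel_two (S := S ∘ σ) (fun i => hS _)
      (fun i => hmono (Fin.le_last i)) (by rw [hsum]; exact h1 _) (by rwa [hsum])
    have := hC.comp_equiv σ.symm
    rw [Function.comp_assoc, Equiv.self_comp_symm, Function.comp_id] at this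
    exact ⟨_, this⟩
  | succ n hn ih =>
    set σ := Tuple.sort S
    have hmono : Monotone (S ∘ σ) := Tuple.monotone_sort S
    have hsum : ∑ i, (S ∘ σ) i = ∑ i, S i := Equiv.sum_comp σ S
    set T := S ∘ σ with hT
    have hT0 : ∀ i, 0 < T i := fun i => hS _
    have hv := sphereVolume_pos (show 0 < n by omega)
    have hv' := sphereVolume_pos (show 0 < n + 1 by omega)
    set c := sphereVolume n / sphereVolume (n + 1) with hc
    have hc0 : 0 < c := div_pos hv hv'
    have hcv : c * sphereVolume (n + 1) = sphereVolume n := by rw [hc]; field_simp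
    have hTsum : ∑ i, T i = T 0 + T 1 + ∑ i : Fin n, T i.succ.succ := by
      rw [Fin.sum_univ_succ, Fin.sum_univ_succ, ← add_assoc]
      rfl
    -- This is the inequality for the merged facet. There are at least four areas here, and in
    -- increasing order the third and the fourth dominate the first two.
    have h01 : T 0 + T 1 ≤ ∑ i : Fin n, T i.succ.succ := by
      obtain ⟨m, rfl⟩ := Nat.exists_eq_add_of_le' hn
      rw [Fin.sum_univ_succ, Fin.sum_univ_succ]
      have h3 : T 0 ≤ T (Fin.succ (Fin.succ 0)) := hmono (Fin.zero_le _)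
      have h4 : T 1 ≤ T (Fin.succ (Fin.succ (Fin.succ 0))) := hmono (by
        rw [Fin.le_def]
        simp)
      have h5 : 0 ≤ ∑ i : Fin m, T i.succ.succ.succ.succ := Finset.sum_nonneg fun i _ => (hT0 _).le
      linarith
    -- The merged area is assigned to the facet opposite to the vertex `0`, the one that
    -- `IsSimplexModel.exists_split` cuts.
    set S' : Fin (n + 1) → ℝ := Fin.cons (c * (T 0 + T 1)) fun i => c * T i.succ.succ with hS'
    have hS'sum : ∑ i, S' i = c * ∑ i, S i := by
      rw [Fin.sum_univ_succ, ← hsum, hTsum, mul_add, Finset.mul_sum]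
      rfl
    have hS'0 : ∀ i, 0 < S' i := by
      refine Fin.cases ?_ fun i => ?_
      · exact mul_pos hc0 (add_pos (hT0 0) (hT0 1))
      · exact mul_pos hc0 (hT0 _)
    have hS'1 : ∀ i, 2 * S' i ≤ ∑ i, S' i := by
      rw [hS'sum]
      refine Fin.cases ?_ fun i => ?_
      · change 2 * (c * (T 0 + T 1)) ≤ _
        rw [← hsum, hTsum]
        nlinarith
      · change 2 * (c * T i.succ.succ) ≤ _
        nlinarith [h1 (σ i.succ.succ), show T i.succ.succ = S (σ i.succ.succ) from rfl]
    obtain ⟨C, hC⟩ := ih hS'0 hS'1 (by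
      rw [hS'sum, ← hcv]
      exact mul_le_mul_of_nonneg_left h2 hc0.le)
    obtain ⟨C', hC'⟩ := hC.exists_split hn hT0
      (by
        change c * (T 0 + T 1) / _ * _ = _
        rw [hc]; field_simp; ring)
      (fun i => by
        change c * T i.succ.succ / _ * _ = _
        rw [hc]; field_simp)
    have := hC'.comp_equiv σ.symm
    rw [hT, Function.comp_assoc, Equiv.self_comp_symm, Function.comp_id] at this
    exact ⟨_, this⟩

end SimplexBase

/-! ### Realisation of simplices, and part (ii) -/

section SimplexRealisation

variable {n : ℕ} {C : Finset (Fin (n + 1)) → Set (Space n)}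

theorem IsSimplexFanAt.isFanAt {A : (simplexPoset n).Face} (h0 : C ∅ = {0})
    (h : IsSimplexFanAt C A.1) :
    IsFanAt (simplexPoset n).dim (fun F : (simplexPoset n).Face => C F.1) A where
  cell := ⟨h.poly, by
    rw [h.finrank_span]
    have := A.2.card_pos
    change _ = A.1.card - 1 + 1
    omega, h.pointed A.2⟩
  bdry := by
    rw [h.bdry]
    ext x
    simp only [mem_union, mem_singleton_iff, mem_iUnion, mem_ofPred_eq, exists_prop]
    constructor
    · rintro ⟨F, hF, hx⟩
      rcases F.eq_empty_or_nonempty with rfl | hne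
      · rw [h0] at hx
        exact Or.inl hx
      · exact Or.inr ⟨⟨F, hne⟩, hF, hx⟩
    · rintro (rfl | ⟨F, hF, hx⟩)
      · exact ⟨∅, Finset.empty_ssubset.2 A.2, by rw [h0]; rfl⟩
      · exact ⟨F.1, hF, hx⟩
  disj F F' hF hF' hne := h.disj F.1 F'.1 hF hF' fun h' => hne (Subtype.ext h')

theorem IsSimplexFanAt.empty_eq (h : IsSimplexFanAt C ∅) : C ∅ = {0} := by
  have h1 := h.finrank_span
  rw [Finset.card_empty, Submodule.finrank_eq_zero, Submodule.span_eq_bot] at h1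
  exact Subset.antisymm h1 (singleton_subset_iff.2 h.poly.zero_mem)

theorem exists_eq_univ_erase {A : Finset (Fin (n + 1))} (h : A.card = n) :
    ∃ i, A = Finset.univ.erase i := by
  have hcompl : Aᶜ.card = 1 := by
    rw [Finset.card_compl, Fintype.card_fin]
    omega
  obtain ⟨i, hi⟩ := Finset.card_eq_one.1 hcompl
  refine ⟨i, ?_⟩
  rw [← compl_compl A, hi]
  ext j
  simp

theorem exists_eq_univ_erase_of_meetAt {G E F F' : (simplexPoset n).Face}
    (hm : MeetAt (simplexPoset n) G E F F') (hG : G = (simplexPoset n).body) :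
    ∃ i j, i ≠ j ∧ F.1 = Finset.univ.erase i ∧ F'.1 = Finset.univ.erase j ∧
      E.1 = (Finset.univ.erase i).erase j := by
  obtain ⟨h1, h2, h3, hne, hEF, hEF', -, -⟩ := hm
  rw [hG, (simplexPoset n).dim_body] at h1 h2 h3
  have h1 : E.1.card - 1 + 2 = n := h1
  have h2 : F.1.card - 1 + 1 = n := h2
  have h3 : F'.1.card - 1 + 1 = n := h3
  have hE0 := E.2.card_pos
  have hF0 := F.2.card_pos
  have hF0' := F'.2.card_pos
  obtain ⟨i, hi⟩ := exists_eq_univ_erase (A := F.1) (by omega)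
  obtain ⟨j, hj⟩ := exists_eq_univ_erase (A := F'.1) (by omega)
  have hij : i ≠ j := by
    rintro rfl
    exact hne (Subtype.ext (hi.trans hj.symm))
  refine ⟨i, j, hij, hi, hj, Finset.eq_of_subset_of_card_le (fun x hx => ?_) ?_⟩
  · have hxi : x ∈ F.1 := hEF.le hx
    have hxj : x ∈ F'.1 := hEF'.le hx
    rw [hi] at hxi
    rw [hj] at hxj
    exact Finset.mem_erase.2 ⟨(Finset.mem_erase.1 hxj).1, hxi⟩
  · rw [Finset.card_erase_of_mem (Finset.mem_erase.2 ⟨hij.symm, Finset.mem_univ _⟩),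
      Finset.card_erase_of_mem (Finset.mem_univ _), Finset.card_fin]
    omega

/-- Proper faces are always nondegenerate, so their angles come from the planar sector argument;
only the body needs the flat case. The angle `π` is found at a vertex of a triangular face, which is
proper because `n ≥ 3`. -/
theorem exists_convexSimplex (hn : 2 ≤ n) {S : Fin (n + 1) → ℝ} (hmono : Monotone S)
    (hS : ∀ i, 0 < S i) (h1 : S (Fin.last n) ≤ ∑ i ∈ Finset.univ.erase (Fin.last n), S i)
    (h2 : ∑ i, S i ≤ sphereVolume n) :
    ∃ c : (simplexPoset n).Face → Set (Space n),
      IsConvexComplex (simplexPoset n) c ∧ IsSimplex c ∧ (∀ G, SphConvex (c G)) ∧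
      InClosedHemisphere (c (simplexPoset n).body) ∧ HasFacetAreas (simplexPoset n) c S ∧
      (∀ G E F F' : (simplexPoset n).Face, MeetAt (simplexPoset n) G E F F' →
        ∃ θ : ℝ, θ ≤ Real.pi ∧ IsDihedralAngle (c G) (c E) (c F) (c F') θ) ∧
      (3 ≤ n → ∃ G E F F' : (simplexPoset n).Face, MeetAt (simplexPoset n) G E F F' ∧
        IsDihedralAngle (c G) (c E) (c F) (c F') Real.pi) := by
  have hsum := Finset.sum_erase_add Finset.univ S (Finset.mem_univ (Fin.last n))
  obtain ⟨C, hC⟩ := exists_isSimplexModel hn hS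
    (fun i => by linarith [hmono (Fin.le_last i)]) h2
  have h0 : C ∅ = {0} := (hC.proper ∅ (Finset.univ_nonempty.ne_empty).symm).empty_eq
  set K : (simplexPoset n).Face → Set (Space n) := fun F => C F.1 with hK
  have hproper : ∀ G, G ≠ (simplexPoset n).body → IsFanAt (simplexPoset n).dim K G := fun G hG =>
    (hC.proper G.1 fun h => hG (Subtype.ext h)).isFanAt h0
  have hcell : ∃ d : ℕ, (d = n ∨ d + 1 = n) ∧ IsConeCell d (K (simplexPoset n).body) := by
    rcases hC.body with h | ⟨⟨d, hd, h⟩, -⟩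
    · have := (IsSimplexFanAt.isFanAt (A := (simplexPoset n).body) h0 h).cell
      rw [(simplexPoset n).dim_body] at this
      exact ⟨n, Or.inl rfl, this⟩
    · exact ⟨d, Or.inr hd, h⟩
  have hlt : ∀ {G F : (simplexPoset n).Face}, F < G → IsFanAt (simplexPoset n).dim K F :=
    fun {G F} hF => hproper F (fun h => (h ▸ hF).not_ge ((simplexPoset n).le_body G))
  refine ⟨fun F => trace (K F), isConvexComplex_trace hproper hcell fun ε hε => ?_, ?_,
    fun G => (hC.poly G.1).sphConvex, ?_, ?_, ?_, ?_⟩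
  · obtain ⟨v, hv, hc⟩ := hC.limit ε hε
    exact ⟨fun F => simplexCone v F.1, fun G => IsSimplexFanAt.isFanAt (simplexCone_empty v)
      (isSimplexFanAt_simplexCone hv G.1), fun F => hc F.1⟩
  · choose v hv hc using fun k : ℕ => hC.limit (1 / ((k : ℝ) + 2)) (by positivity)
    exact ⟨v, hv, facesTendsto_of_coneClose
      (u := fun k (A : (simplexPoset n).Face) => simplexCone (v k) A.1)
      (fun k F => (simplexCone_structure (hv k) F.1).1) (fun F => hC.poly F.1) fun k F => hc k F.1⟩
  · obtain ⟨d, -, h⟩ := hcell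
    exact h.inClosedHemisphere
  · have hcard : ∀ i : Fin (n + 1), (Finset.univ.erase i).card = n := fun i => by
      rw [Finset.card_erase_of_mem (Finset.mem_univ _), Finset.card_fin, Nat.add_sub_cancel]
    refine ⟨Equiv.ofBijective (fun i => ⟨⟨Finset.univ.erase i,
      Finset.card_pos.1 (by rw [hcard]; omega)⟩, ?_⟩) ⟨?_, ?_⟩, fun i => hC.area_eq i⟩
    · change (Finset.univ.erase i).card - 1 + 1 = n
      rw [hcard]
      omega
    · intro i j h
      have h' : Finset.univ.erase i = Finset.univ.erase j :=
        congrArg (fun F => F.1.1) h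
      by_contra hne
      have := Finset.notMem_erase i Finset.univ
      rw [h'] at this
      exact this (Finset.mem_erase.2 ⟨hne, Finset.mem_univ _⟩)
    · rintro ⟨⟨A, hA⟩, hd⟩
      have hd : A.card - 1 + 1 = n := hd
      have hA' := hA.card_pos
      obtain ⟨i, hi⟩ := exists_eq_univ_erase (A := A) (by omega)
      exact ⟨i, Subtype.ext (Subtype.ext hi.symm)⟩
  · intro G E F F' hm
    by_cases hG : G = (simplexPoset n).body
    · rcases hC.body with h | ⟨⟨d, hd, h⟩, hsub, χ, hχ⟩
      · obtain ⟨θ, h3, h4, -⟩ := exists_isDihedralAngle_of_meetAt (K := K) hm fun F _ => by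
          by_cases hF : F = (simplexPoset n).body
          · rw [hF]
            exact IsSimplexFanAt.isFanAt h0 h
          · exact hproper F hF
        exact ⟨θ, h3, h4⟩
      · have hEF := hm.2.2.2.2.1
        have hEF' := hm.2.2.2.2.2.1
        have hFG := hm.2.2.2.2.2.2.1
        have hFG' := hm.2.2.2.2.2.2.2
        have hr : IsRidge 1 (K E) (K F) (K F') (K G) := by
          refine isRidge_of_meetAt hm (hlt hEF) (hlt hFG) (hlt hFG') (d := d) ?_ ?_ ?_ ?_
          · rw [hG]; exact h
          · have h3 := hm.1
            rw [hG, (simplexPoset n).dim_body] at h3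
            omega
          · rw [hG]; exact hsub _
          · rw [hG]; exact hsub _
        have hfin : Module.finrank ℝ (Submodule.span ℝ (K G)) ≤ n := by
          rw [hG]
          exact (h.finrank_span.trans hd).le
        obtain ⟨i, j, hij, hi, hj, hE⟩ := exists_eq_univ_erase_of_meetAt hm hG
        -- Two facets on the same side of a flat simplex continue each other across the ridge,
        -- giving `π`. For facets on different sides the ridge lies on the boundary of the flat
        -- cell, where the two sides fold onto each other, giving `0`.
        by_cases hχij : χ i = χ j
        · refine ⟨Real.pi, le_rfl, hr.isDihedralAngle_pi_of_flat hfin ?_⟩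
          change Disjoint (rint (C F.1)) (rint (C F'.1))
          rw [hi, hj]
          exact (hχ i j hij).1 hχij
        · refine ⟨0, Real.pi_pos.le, hr.isDihedralAngle_zero_of_flat hfin ?_⟩
          change Disjoint (rint (C E.1)) (rint (C G.1))
          rw [hE, hG]
          exact (hχ i j hij).2 hχij
    · obtain ⟨θ, h3, h4, -⟩ := exists_isDihedralAngle_of_meetAt (K := K) hm fun F hF =>
        hproper F fun h => hG (le_antisymm ((simplexPoset n).le_body G) (h ▸ hF))
      exact ⟨θ, h3, h4⟩
  · intro h3
    -- In the triangle `a`, `b`, `c` the two edges at `c` span the same plane, which forces the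
    -- angle there to be `π`.
    obtain ⟨a, b, c, hab, hac, hbc, hspan⟩ := hC.flat h3
    let mk : (A : Finset (Fin (n + 1))) → A.Nonempty → (simplexPoset n).Face := fun A hA => ⟨A, hA⟩
    let G := mk {a, b, c} (by simp)
    let E := mk {c} (by simp)
    let F := mk {a, c} (by simp)
    let F' := mk {b, c} (by simp)
    have hcG : ({a, b, c} : Finset (Fin (n + 1))).card = 3 := by
      rw [Finset.card_eq_three]
      exact ⟨a, b, c, hab, hac, hbc, rfl⟩
    have hcF : ({a, c} : Finset (Fin (n + 1))).card = 2 := Finset.card_pair hac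
    have hcF' : ({b, c} : Finset (Fin (n + 1))).card = 2 := Finset.card_pair hbc
    have hlt' : ∀ {A B : Finset (Fin (n + 1))} (hA : A.Nonempty) (hB : B.Nonempty), A ⊆ B →
        A.card < B.card → mk A hA < mk B hB := fun {A B} hA hB h h' =>
      lt_of_le_of_ne h fun heq => h'.ne (by
        have : A = B := congrArg Subtype.val heq
        rw [this])
    have hm : MeetAt (simplexPoset n) G E F F' := by
      refine ⟨?_, ?_, ?_, ?_, hlt' _ _ (by simp) (by simp [hcF]), hlt' _ _ (by simp) (by simp [hcF']),
        hlt' _ _ ?_ (by omega), hlt' _ _ ?_ (by omega)⟩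
      · change ({c} : Finset (Fin (n + 1))).card - 1 + 2 = ({a, b, c} : Finset (Fin (n + 1))).card - 1
        rw [hcG, Finset.card_singleton]
      · change ({a, c} : Finset (Fin (n + 1))).card - 1 + 1 = ({a, b, c} : Finset (Fin (n + 1))).card - 1
        rw [hcG, hcF]
      · change ({b, c} : Finset (Fin (n + 1))).card - 1 + 1 = ({a, b, c} : Finset (Fin (n + 1))).card - 1
        rw [hcG, hcF']
      · intro h
        have h' : ({a, c} : Finset (Fin (n + 1))) = {b, c} := congrArg Subtype.val h
        have : a ∈ ({b, c} : Finset (Fin (n + 1))) := by rw [← h']; simp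
        simp [hab, hac] at this
      · intro x hx
        simp only [Finset.mem_insert, Finset.mem_singleton] at hx ⊢
        tauto
      · intro x hx
        simp only [Finset.mem_insert, Finset.mem_singleton] at hx ⊢
        tauto
    refine ⟨G, E, F, F', hm, ?_⟩
    obtain ⟨θ, -, h5, -, h6⟩ := exists_isDihedralAngle_of_meetAt (K := K) hm fun F hF => by
      refine hproper F fun h => ?_
      have h7 : F.1.card ≤ ({a, b, c} : Finset (Fin (n + 1))).card := Finset.card_le_card hF
      rw [h, hcG] at h7
      have h8 : (simplexPoset n).body.1.card = n + 1 := Finset.card_fin _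
      omega
    rw [h6 hspan] at h5
    exact h5

end SimplexRealisation

end SphericalComplex

end

theorem mainTheorem8 :
    (∀ (n m : ℕ) (_ : 2 ≤ n) (hm : 3 ≤ m) (S : Fin m → ℝ), Monotone S → (∀ i, 0 < S i) →
      S ⟨m - 1, by omega⟩ ≤ ∑ i ∈ Finset.univ.erase ⟨m - 1, by omega⟩, S i →
      ∑ i, S i ≤ SphericalComplex.sphereVolume n →
      ∃ (P : SphericalComplex.FacePoset n) (c : P.Face → Set (SphericalComplex.Space n)),
        SphericalComplex.IsConvexComplex P c ∧
        (∀ G, SphericalComplex.SphConvex (c G)) ∧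
        SphericalComplex.InClosedHemisphere (c P.body) ∧
        SphericalComplex.HasFacetAreas P c S ∧
        (∀ F : P.Face, P.dim F + 1 = n → {E : P.Face | E < F ∧ P.dim E + 2 = n}.ncard = 2) ∧
        (S ⟨m - 1, by omega⟩ < ∑ i ∈ Finset.univ.erase ⟨m - 1, by omega⟩, S i →
          SphericalComplex.IsNondegenerateComplex P c) ∧
        (S ⟨m - 1, by omega⟩ < ∑ i ∈ Finset.univ.erase ⟨m - 1, by omega⟩, S i →
          ∑ i, S i < SphericalComplex.sphereVolume n →
          ∀ E F F' : P.Face, SphericalComplex.MeetAt P P.body E F F' →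
            ∃ θ : ℝ, θ < Real.pi ∧
              SphericalComplex.IsDihedralAngle (c P.body) (c E) (c F) (c F') θ)) ∧
    (∀ (n : ℕ) (_ : 2 ≤ n) (S : Fin (n + 1) → ℝ), Monotone S → (∀ i, 0 < S i) →
      S (Fin.last n) ≤ ∑ i ∈ Finset.univ.erase (Fin.last n), S i →
      ∑ i, S i ≤ SphericalComplex.sphereVolume n →
      ∃ c : (SphericalComplex.simplexPoset n).Face → Set (SphericalComplex.Space n),
        SphericalComplex.IsConvexComplex (SphericalComplex.simplexPoset n) c ∧
        SphericalComplex.IsSimplex c ∧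
        (∀ G, SphericalComplex.SphConvex (c G)) ∧
        SphericalComplex.InClosedHemisphere (c (SphericalComplex.simplexPoset n).body) ∧
        SphericalComplex.HasFacetAreas (SphericalComplex.simplexPoset n) c S ∧
        (∀ G E F F' : (SphericalComplex.simplexPoset n).Face,
          SphericalComplex.MeetAt (SphericalComplex.simplexPoset n) G E F F' →
            ∃ θ : ℝ, θ ≤ Real.pi ∧ SphericalComplex.IsDihedralAngle (c G) (c E) (c F) (c F') θ) ∧
        (3 ≤ n → ∃ G E F F' : (SphericalComplex.simplexPoset n).Face,
          SphericalComplex.MeetAt (SphericalComplex.simplexPoset n) G E F F' ∧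
            SphericalComplex.IsDihedralAngle (c G) (c E) (c F) (c F') Real.pi)) := by
  refine ⟨fun n m hn hm S hmono hS h1 h2 => ?_, fun n hn S hmono hS h1 h2 =>
    SphericalComplex.exists_convexSimplex hn hmono hS h1 h2⟩
  obtain ⟨k, rfl⟩ := Nat.exists_eq_add_of_le' hm
  exact SphericalComplex.exists_convexComplex hn hmono hS h1 h2
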